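/- **Setting.** Let $d\ge 1$, write $x=(q,p)\in\mathbb R^{2d}$, and let $\mathcal M$ be $\mathbb R^{2d}$ or $\mathbb T^{2d}=(\mathbb R/\mathbb Z)^{2d}$. Let $\mathcal B(\mathbb R^{2d})$ be the set of smooth complex functions on $\mathbb R^{2d}$ all of whose derivatives (including order $0$) are bounded, and $\mathcal B(\mathbb T^{2d})=C^\infty(\mathbb T^{2d})$, identified with the smooth $\mathbb Z^{2d}$-periodic functions on $\mathbb R^{2d}$. For $f\in\mathcal B(\mathbb R^{2d})$ and $\hbar>0$, $Op^W(f)$ is the operator with kernel $$K_f(q_1,q_2)=(2\pi)^{-d}\int_{\mathbb R^d}e^{i(q_1-q_2)\cdot p}f\big(\tfrac{q_1+q_2}{2},\hbar p\big)\,dp$$ (oscillatory integral); it acts on $\mathcal S(\mathbb R^d)$, extends by continuity to $L^2(\mathbb R^d)$ and by duality to $\mathcal S'(\mathbb R^d)$. If $\mathcal M=\mathbb R^{2d}$, then $\hbar>0$ is arbitrary and $\mathcal H=L^2(\mathbb R^d)$. If $\mathcal M=\mathbb T^{2d}$, then $2\pi\hbar N=1$ for an integer $N\ge1$, $\kappa\in[0,2\pi)^{2d}$,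 and $$\mathcal H=\mathcal H_\hbar(\kappa)=\{u\in\mathcal S'(\mathbb R^d):U_\hbar(n)u=e^{i\omega(\kappa,n)+i n_q\cdot n_p/(2\hbar)}u\ \ \forall n=(n_q,n_p)\in\mathbb Z^{2d}\},$$ where $\omega(\xi,\eta)=\xi_q\cdot\eta_p-\xi_p\cdot\eta_q$ and $U_\hbar(\xi)\psi(q)=\psi(q-\xi_q)\,e^{\frac i\hbar(\xi_p\cdot q-\xi_q\cdot\xi_p/2)}$; this space is finite-dimensional and invariant under $Op^W(f)$ for periodic $f$, and $Op^W(f)$ then denotes the restriction to it. *Moyal product.* $f\# g\in\mathcal B(\mathcal M)$ is the symbol with $Op^W(f)Op^W(g)=Op^W(f\# g)$ (on $\mathcal S(\mathbb R^d)$), and the remainders $r^\hbar_J(f,g)$ are defined by $f\# g=\sum_{j<J}\hbar^j f\#_j g+\hbar^J r_J^\hbar(f,g)$, where $$f\#_j g=\sum_{|\alpha+\beta|=j}\frac{1}{(-1)^{|\alpha|}\alpha!\,\beta!\,(2i)^{j}}\;\partial_q^\alpha\partial_p^\beta f\;\partial_q^\beta\partial_p^\alpha g .$$ *The operators $L_j^s$.*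 Let $g\in\mathcal B(\mathcal M)$ be real valued, let $\phi^s$ be its Hamiltonian flow ($\dot q=\nabla_pg$, $\dot p=-\nabla_qg$), and put $\{g,a\}=\nabla_pg\cdot\nabla_qa-\nabla_qg\cdot\nabla_pa$ and $$M^{\alpha,\beta}=\frac{(-1)^{|\beta|}}{\alpha!\,\beta!}\,\big(\partial_q^\beta\partial_p^\alpha g\big)\,\partial_q^\alpha\partial_p^\beta .$$ Set $L_0^sf=f\circ\phi^s$, $L_j^s=0$ for $j$ odd, and for $j\ge2$ even $$L_j^s=\frac1{(2i)^j}\sum_{k=1}^{j/2}\ \sum_{\substack{m_1+\dots+m_k=j/2\\ m_i\ge1}}\ \sum_{|\alpha_1+\beta_1|=1+2m_1}\!\!\cdots\!\!\sum_{|\alpha_k+\beta_k|=1+2m_k}\int_0^s\!\!\cdots\!\int_0^{s_{k-1}}L_0^{s-s_1}M^{\alpha_1,\beta_1}L_0^{s_1-s_2}\cdots M^{\alpha_k,\beta_k}L_0^{s_k}\,ds_k\cdots ds_1 .$$ **Theorem (Egorov).** Let $f,g\in\mathcal B(\mathcal M)$ with $g$ real valued. 1. For all $j\ge0$ and $s\in\mathbb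 R$, the function $f_j(s)=L_j^sf$ belongs to $\mathcal B(\mathcal M)$, and the $f_j$ satisfy $$\partial_sf_j-\{g,f_j\}=2i\sum_{\substack{l+k=j+1\\ k\ge3\ \mathrm{odd}}}g\#_kf_l,\qquad f_0(0)=f,\quad f_j(0)=0\ (j\ge1).$$ 2. For all integers $J\ge1$ and all $t\in\mathbb R$, $$e^{itOp^W(g)/\hbar}\,Op^W(f)\,e^{-itOp^W(g)/\hbar}=\sum_{j<J}\hbar^j\,Op^W(L_j^tf)+\hbar^J R_J^t(f,\hbar)$$ as operators on $\mathcal H$, where $$R_J^t(f,\hbar)=i\int_0^te^{i(t-s)Op^W(g)/\hbar}\Big(\sum_{l<J}Op^W\big(r^\hbar_{J-l+1}(g,L_l^sf)\big)-Op^W\big(r^\hbar_{J-l+1}(L_l^sf,g)\big)\Big)e^{-i(t-s)Op^W(g)/\hbar}\,ds .$$ -/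

import Mathlib

open MeasureTheory Complex Finset
open scoped SchwartzMap ContDiff InnerProductSpace

noncomputable section

/-! ### Phase space, symbols, partial derivatives -/

/-- Configuration space `ℝ^d` with its Euclidean structure. -/
abbrev Config (d : ℕ) : Type := EuclideanSpace ℝ (Fin d)

/-- Phase space `ℝ^{2d}`, with points `x = (q, p)`. -/
abbrev Phase (d : ℕ) : Type := Config d × Config d

/-- The point of `ℝ^d` with integer coordinates `n`. -/
def intVec {d : ℕ} (n : Fin d → ℤ) : Config d := WithLp.toLp 2 fun i => (n i : ℝ)

/-- `𝓑(ℝ^{2d})`: smooth functions all of whose derivatives (of every order, including zero)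
are bounded. -/
def IsSymbol {d : ℕ} {F : Type*} [NormedAddCommGroup F] [NormedSpace ℝ F]
    (f : Phase d → F) : Prop :=
  ContDiff ℝ ∞ f ∧ ∀ n : ℕ, ∃ C : ℝ, ∀ x, ‖iteratedFDeriv ℝ n f x‖ ≤ C

/-- `𝓑(𝕋^{2d}) = C^∞(𝕋^{2d})`, as the smooth `ℤ^{2d}`-periodic functions on `ℝ^{2d}`. -/
def IsTorusSymbol {d : ℕ} {F : Type*} [NormedAddCommGroup F] [NormedSpace ℝ F]
    (f : Phase d → F) : Prop :=
  ContDiff ℝ ∞ f ∧ ∀ (x : Phase d) (m n : Fin d → ℤ), f (x + (intVec m, intVec n)) = f x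

/-- `∂f/∂q_i`. -/
def dq {d : ℕ} {F : Type*} [NormedAddCommGroup F] [NormedSpace ℝ F]
    (i : Fin d) (f : Phase d → F) : Phase d → F :=
  fun x => fderiv ℝ f x (EuclideanSpace.single i (1 : ℝ), 0)

/-- `∂f/∂p_i`. -/
def dp {d : ℕ} {F : Type*} [NormedAddCommGroup F] [NormedSpace ℝ F]
    (i : Fin d) (f : Phase d → F) : Phase d → F :=
  fun x => fderiv ℝ f x (0, EuclideanSpace.single i (1 : ℝ))

/-- `∂_q^α ∂_p^β f` for multi-indices `α, β`. -/
def dqp {d : ℕ} (α β : Fin d → ℕ) (f : Phase d → ℂ) : Phase d → ℂ :=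
  (List.finRange d).foldr (fun i h => (dq i)^[α i] h)
    ((List.finRange d).foldr (fun i h => (dp i)^[β i] h) f)

/-- `α! = ∏ α_i!`. -/
def multiFactorial {d : ℕ} (α : Fin d → ℕ) : ℕ := ∏ i, Nat.factorial (α i)

/-- Sum of `F α β` over all pairs of multi-indices with `|α| = a`, `|β| = b`, `a + b = k`,
that is with `|α + β| = k`. -/
def sumMulti {d : ℕ} (k : ℕ) (F : (Fin d → ℕ) → (Fin d → ℕ) → ℂ) : ℂ :=
  ∑ ab ∈ antidiagonal k,
    ∑ α ∈ piAntidiag (univ : Finset (Fin d)) ab.1,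
      ∑ β ∈ piAntidiag (univ : Finset (Fin d)) ab.2, F α β

/-- The Poisson bracket `{g, f} = ∇_p g · ∇_q f - ∇_q g · ∇_p f`. -/
def poisson {d : ℕ} (g f : Phase d → ℂ) : Phase d → ℂ :=
  fun x => ∑ i, (dp i g x * dq i f x - dq i g x * dp i f x)

/-- A real function regarded as a complex one. -/
def toC {d : ℕ} (g : Phase d → ℝ) : Phase d → ℂ := fun x => (g x : ℂ)

/-! ### Hamiltonian flow -/

/-- The Hamiltonian vector field `(∇_p g, -∇_q g)`. -/
def hamField {d : ℕ} (g : Phase d → ℝ) (x : Phase d) : Phase d :=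
  (WithLp.toLp 2 fun i => dp i g x, WithLp.toLp 2 fun i => -dq i g x)

/-- `Φ s x` is the solution at time `s` of Hamilton's equations `q' = ∇_p g`, `p' = -∇_q g`
starting from `x`, for all `s ∈ ℝ` and all `x`. -/
def IsHamFlow {d : ℕ} (g : Phase d → ℝ) (Φ : ℝ → Phase d → Phase d) : Prop :=
  ∀ x, Φ 0 x = x ∧ ∀ s, HasDerivAt (fun s' => Φ s' x) (hamField g (Φ s x)) s

open Classical in
/-- The Hamiltonian flow `φ^s` of `g` (it exists and is unique for `g ∈ 𝓑`, whose Hamiltonian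
field is globally Lipschitz). -/
def hamFlow {d : ℕ} (g : Phase d → ℝ) : ℝ → Phase d → Phase d :=
  if h : ∃ Φ, IsHamFlow g Φ then h.choose else fun _ x => x

/-! ### The operators `L_j^s` -/

/-- The sum over `|α + β| = 1 + 2m` of the differential operators
`M^{α,β} = (-1)^{|β|} / (α! β!) · (∂_q^β ∂_p^α g) ∂_q^α ∂_p^β`. -/
def sumM {d : ℕ} (g : Phase d → ℝ) (m : ℕ) (f : Phase d → ℂ) : Phase d → ℂ :=
  fun x => sumMulti (1 + 2 * m) fun α β =>
    (-1) ^ (∑ i, β i) / ((multiFactorial α : ℂ) * (multiFactorial β : ℂ)) *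
      (dqp β α (toC g) x * dqp α β f x)

/-- For a list `[m_1, …, m_k]`, the iterated integral along the flow, `L_0^s f = f ∘ φ^s`,
`∫_0^s ⋯ ∫_0^{s_{k-1}} L_0^{s-s_1} M_{m_1} L_0^{s_1-s_2} ⋯ M_{m_k} L_0^{s_k} f ds_k ⋯ ds_1`,
where `M_m` is the sum of the `M^{α,β}` over `|α + β| = 1 + 2m`. -/
def iterTerm {d : ℕ} (g : Phase d → ℝ) (f : Phase d → ℂ) : List ℕ → ℝ → Phase d → ℂ
  | [], s => fun x => f (hamFlow g s x)
  | m :: ms, s => fun x =>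
      ∫ s₁ in (0 : ℝ)..s, sumM g m (iterTerm g f ms s₁) (hamFlow g (s - s₁) x)

/-- `L_j^s f`: zero for odd `j`; for even `j` it is `(2i)^{-j}` times the sum of the iterated
integrals over all `k` and all `m_1, …, m_k ≥ 1` with `m_1 + ⋯ + m_k = j/2`, that is over the
compositions of the integer `j/2`. For `j = 0` only the empty composition occurs, and
`L_0^s f = f ∘ φ^s`. -/
def egorovL {d : ℕ} (g : Phase d → ℝ) (j : ℕ) (s : ℝ) (f : Phase d → ℂ) : Phase d → ℂ :=
  fun x => if Even j then
    ((2 * I) ^ j)⁻¹ * ∑ c : Composition (j / 2), iterTerm g f c.blocks s x else 0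

/-! ### Weyl quantization -/

/-- `(Op^W(f) ψ)(q) = ∫ K_f(q, q') ψ(q') dq'` for the Schwartz kernel
`K_f(q, q') = (2π)^{-d} ∫ exp(i (q - q')·p) f((q + q')/2, ħ p) dp`, the oscillatory integral
being read in the usual order (first in `q'`, then in `p`), in which both integrals converge
absolutely for `f ∈ 𝓑(ℝ^{2d})` and `ψ ∈ 𝓢(ℝ^d)`. -/
def weylFun {d : ℕ} (ħ : ℝ) (f : Phase d → ℂ) (ψ : Config d → ℂ) (q : Config d) : ℂ :=
  (((2 * Real.pi) ^ d : ℝ) : ℂ)⁻¹ * ∫ p : Config d, ∫ q' : Config d,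
    Complex.exp (I * ((⟪q - q', p⟫_ℝ : ℝ) : ℂ)) *
      f ((1 / 2 : ℝ) • (q + q'), ħ • p) * ψ q'

open Classical in
/-- `Op^W(f)` as a continuous operator on `𝓢(ℝ^d)`. -/
def weylS {d : ℕ} (ħ : ℝ) (f : Phase d → ℂ) : 𝓢(Config d, ℂ) →L[ℂ] 𝓢(Config d, ℂ) :=
  if h : ∃ T : 𝓢(Config d, ℂ) →L[ℂ] 𝓢(Config d, ℂ), ∀ ψ q, T ψ q = weylFun ħ f ψ q
  then h.choose else 0

/-- The Hilbert space `L²(ℝ^d)`. -/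
abbrev L2 (d : ℕ) : Type := Lp ℂ 2 (volume : Measure (Config d))

open Classical in
/-- `Op^W(f)` as a bounded operator on `L²(ℝ^d)`: the unique bounded extension from `𝓢(ℝ^d)`. -/
def weylL2 {d : ℕ} (ħ : ℝ) (f : Phase d → ℂ) : L2 d →L[ℂ] L2 d :=
  if h : ∃ T : L2 d →L[ℂ] L2 d, ∀ ψ : 𝓢(Config d, ℂ), T (ψ.toLp 2) = (weylS ħ f ψ).toLp 2
  then h.choose else 0

/-- `Op^W(f)` on `𝓢'(ℝ^d)`, by duality: the transposed kernel `K_f(q', q)` is the kernel of the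
Weyl quantization of `(q, p) ↦ f (q, -p)`. -/
def weylS' {d : ℕ} (ħ : ℝ) (f : Phase d → ℂ) : 𝓢'(Config d, ℂ) →L[ℂ] 𝓢'(Config d, ℂ) :=
  PointwiseConvergenceCLM.precomp ℂ (weylS ħ fun x => f (x.1, -x.2))

/-! ### The torus -/

/-- The phase `exp((i/ħ)(ξ_p · q - ξ_q · ξ_p / 2))`. -/
def heisPhase {d : ℕ} (ħ : ℝ) (ξ : Phase d) (q : Config d) : ℂ :=
  Complex.exp (I * (((⟪ξ.2, q⟫_ℝ - ⟪ξ.1, ξ.2⟫_ℝ / 2) / ħ : ℝ) : ℂ))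

/-- The phase space translation `(U_ħ(ξ) ψ)(q) = ψ(q - ξ_q) exp((i/ħ)(ξ_p · q - ξ_q · ξ_p / 2))`
on `𝓢(ℝ^d)`. -/
def heisS {d : ℕ} (ħ : ℝ) (ξ : Phase d) : 𝓢(Config d, ℂ) →L[ℂ] 𝓢(Config d, ℂ) :=
  SchwartzMap.smulLeftCLM ℂ (heisPhase ħ ξ) ∘L SchwartzMap.compSubConstCLM ℂ ξ.1

theorem cexp_I_mul_hasTemperateGrowth :
    (fun x : ℝ => Complex.exp (I * (x : ℂ))).HasTemperateGrowth := by
  have hs : ContDiff ℝ ∞ (fun x : ℝ => Complex.exp (I * (x : ℂ))) :=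
    (contDiff_const.mul Complex.ofRealCLM.contDiff).cexp
  refine ⟨hs, fun n => ⟨0, 1, fun x => ?_⟩⟩
  have key : ∀ n : ℕ, iteratedDeriv n (fun x : ℝ => Complex.exp (I * (x : ℂ))) =
      fun x : ℝ => I ^ n * Complex.exp (I * (x : ℂ)) := by
    intro n
    induction n with
    | zero => ext x; simp
    | succ n ih =>
      ext x
      rw [iteratedDeriv_succ, ih]
      have h1 : HasDerivAt (fun x : ℝ => I * (x : ℂ)) I x := by
        simpa using (Complex.ofRealCLM.hasDerivAt (x := x)).const_mul I
      rw [((h1.cexp).const_mul (I ^ n)).deriv]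
      ring
  rw [norm_iteratedFDeriv_eq_norm_iteratedDeriv, key n]
  simp [mul_comm I, Complex.norm_exp_ofReal_mul_I]

theorem heisPhase_hasTemperateGrowth {d : ℕ} (ħ : ℝ) (ξ : Phase d) :
    (heisPhase ħ ξ).HasTemperateGrowth := by
  have h2 : Function.HasTemperateGrowth
      (fun q : Config d => ħ⁻¹ * (⟪ξ.2, q⟫_ℝ - ⟪ξ.1, ξ.2⟫_ℝ / 2)) :=
    (Function.HasTemperateGrowth.const ħ⁻¹).mul
      ((Function.hasTemperateGrowth_inner_right ξ.2).sub (Function.HasTemperateGrowth.const _))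
  have h3 := cexp_I_mul_hasTemperateGrowth.comp h2
  have h4 : heisPhase ħ ξ = (fun x : ℝ => Complex.exp (I * (x : ℂ))) ∘
      (fun q : Config d => ħ⁻¹ * (⟪ξ.2, q⟫_ℝ - ⟪ξ.1, ξ.2⟫_ℝ / 2)) := by
    ext q
    simp [heisPhase, div_eq_inv_mul]
  rw [h4]
  exact h3

theorem heisS_apply {d : ℕ} (ħ : ℝ) (ξ : Phase d) (ψ : 𝓢(Config d, ℂ)) (q : Config d) :
    heisS ħ ξ ψ q = ψ (q - ξ.1) *
      Complex.exp (I * (((⟪ξ.2, q⟫_ℝ - ⟪ξ.1, ξ.2⟫_ℝ / 2) / ħ : ℝ) : ℂ)) := by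
  simp [heisS, heisPhase_hasTemperateGrowth, heisPhase, mul_comm]

/-- `U_ħ(ξ)` on `𝓢'(ℝ^d)`, by duality: the transpose of `U_ħ(ξ_q, ξ_p)` is `U_ħ(-ξ_q, ξ_p)`. -/
def heisS' {d : ℕ} (ħ : ℝ) (ξ : Phase d) : 𝓢'(Config d, ℂ) →L[ℂ] 𝓢'(Config d, ℂ) :=
  PointwiseConvergenceCLM.precomp ℂ (heisS ħ (-ξ.1, ξ.2))

/-- The symplectic form `ω(ξ, η) = ξ_q · η_p - ξ_p · η_q`. -/
def omega {d : ℕ} (ξ η : Phase d) : ℝ := ⟪ξ.1, η.2⟫_ℝ - ⟪ξ.2, η.1⟫_ℝ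

/-- `𝓗_ħ(κ)`: the tempered distributions `u` with
`U_ħ(n) u = exp(i ω(κ, n) + i n_q · n_p / (2ħ)) u` for all `n ∈ ℤ^{2d}`. -/
def torusSpace {d : ℕ} (ħ : ℝ) (κ : Phase d) : Submodule ℂ 𝓢'(Config d, ℂ) :=
  ⨅ (a : Fin d → ℤ), ⨅ (b : Fin d → ℤ), LinearMap.ker
    ((heisS' ħ (intVec a, intVec b) : 𝓢'(Config d, ℂ) →ₗ[ℂ] 𝓢'(Config d, ℂ)) -
      Complex.exp (I * ((omega κ (intVec a, intVec b) +
        ⟪intVec a, intVec b⟫_ℝ / (2 * ħ) : ℝ) : ℂ)) • LinearMap.id)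

theorem mem_torusSpace {d : ℕ} (ħ : ℝ) (κ : Phase d) (u : 𝓢'(Config d, ℂ)) :
    u ∈ torusSpace ħ κ ↔ ∀ a b : Fin d → ℤ, heisS' ħ (intVec a, intVec b) u =
      Complex.exp (I * ((omega κ (intVec a, intVec b) +
        ⟪intVec a, intVec b⟫_ℝ / (2 * ħ) : ℝ) : ℂ)) • u := by
  simp [torusSpace, Submodule.mem_iInf, sub_eq_zero]

instance {d : ℕ} (ħ : ℝ) (κ : Phase d) : ContinuousConstSMul ℂ (torusSpace ħ κ) :=
  ⟨fun c => (((continuous_const_smul c).comp continuous_subtype_val)).subtype_mk _⟩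

open Classical in
/-- The Weyl quantization on `𝕋^{2d}`: the restriction of `Op^W(f)` to the invariant subspace
`𝓗_ħ(κ)` of `𝓢'(ℝ^d)`. -/
def weylTorus {d : ℕ} (ħ : ℝ) (κ : Phase d) (f : Phase d → ℂ) :
    torusSpace ħ κ →L[ℂ] torusSpace ħ κ :=
  if h : ∀ u : torusSpace ħ κ, weylS' ħ f u ∈ torusSpace ħ κ then
    ((weylS' ħ f).comp (torusSpace ħ κ).subtypeL).codRestrict (torusSpace ħ κ) h
  else 0

/-! ### The Moyal product -/

/-- `f #_j g = ∑_{|α+β|=j} Γ(α,β) (∂_q^α ∂_p^β f) (∂_q^β ∂_p^α g)` with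
`Γ(α,β)⁻¹ = (-1)^{|α|} α! β! (2i)^{|α+β|}`. -/
def moyalTerm {d : ℕ} (j : ℕ) (f g : Phase d → ℂ) : Phase d → ℂ :=
  fun x => sumMulti j fun α β =>
    ((-1) ^ (∑ i, α i) * (multiFactorial α : ℂ) * (multiFactorial β : ℂ) * (2 * I) ^ j)⁻¹ *
      (dqp α β f x * dqp β α g x)

open Classical in
/-- The Moyal product `f # g`: the unique `h ∈ 𝓑(ℝ^{2d})` with
`Op^W(f) Op^W(g) = Op^W(h)`. (For periodic `f`, `g` it is again periodic, and is the product on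
`C^∞(𝕋^{2d})`.) -/
def moyal {d : ℕ} (ħ : ℝ) (f g : Phase d → ℂ) : Phase d → ℂ :=
  if h : ∃ h : Phase d → ℂ, IsSymbol h ∧
      (weylS ħ f).comp (weylS ħ g) = weylS ħ h
  then h.choose else 0

/-- The remainder `r_J^ħ(f, g)`, defined by `f # g = ∑_{j<J} ħ^j f #_j g + ħ^J r_J^ħ(f, g)`. -/
def moyalRem {d : ℕ} (ħ : ℝ) (J : ℕ) (f g : Phase d → ℂ) : Phase d → ℂ :=
  fun x => ((ħ : ℂ) ^ J)⁻¹ *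
    (moyal ħ f g x - ∑ j ∈ range J, (ħ : ℂ) ^ j * moyalTerm j f g x)

/-! ### The pieces of the Egorov expansion -/

/-- The functions `f_j(s) = L_j^s f` belong to the symbol class `B` and solve the triangular
system `∂_s f_j - {g, f_j} = 2i ∑_{l+k=j+1, k≥3 odd} g #_k f_l`, with `f_0(0) = f` and
`f_j(0) = 0` for `j ≥ 1`. -/
def SolvesTransport {d : ℕ} (B : (Phase d → ℂ) → Prop) (g : Phase d → ℝ)
    (f : Phase d → ℂ) : Prop :=
  ∀ j : ℕ, (∀ s : ℝ, B (egorovL g j s f)) ∧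
    egorovL g j 0 f = (if j = 0 then f else 0) ∧
    ∀ (s : ℝ) (x : Phase d), HasDerivAt (fun s' => egorovL g j s' f x)
      (poisson (toC g) (egorovL g j s f) x +
        2 * I * ∑ k ∈ Icc 3 (j + 1) with Odd k,
          moyalTerm k (toC g) (egorovL g (j + 1 - k) s f) x) s

/-- `E(t-s) (∑_{l<J} Op(r_{J-l+1}(g, L_l^s f)) - Op(r_{J-l+1}(L_l^s f, g))) E(-(t-s))`, for a
quantization `Op` with values in the continuous operators on `V`. -/
def duhamelIntegrand {d : ℕ} {V : Type*} [AddCommGroup V] [Module ℂ V] [TopologicalSpace V]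
    [IsTopologicalAddGroup V] (Op : (Phase d → ℂ) → (V →L[ℂ] V)) (E : ℝ → (V →L[ℂ] V))
    (ħ : ℝ) (g : Phase d → ℝ) (f : Phase d → ℂ) (J : ℕ) (t s : ℝ) : V →L[ℂ] V :=
  E (t - s) ∘L
    (∑ l ∈ range J, (Op (moyalRem ħ (J - l + 1) (toC g) (egorovL g l s f)) -
      Op (moyalRem ħ (J - l + 1) (egorovL g l s f) (toC g)))) ∘L
    E (-(t - s))

/-- `E = e^A` in the sense of the exponential series, converging on every vector. -/
def IsOpExp {V : Type*} [AddCommGroup V] [Module ℂ V] [TopologicalSpace V]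
    (A E : V →L[ℂ] V) : Prop :=
  ∀ u : V, HasSum (fun n : ℕ => ((Nat.factorial n : ℕ) : ℂ)⁻¹ • (A ^ n) u) (E u)

/-- `R = ∫_a^b F(s) ds` for a family of operators on `V`, tested against vectors and
continuous linear functionals (on a finite-dimensional space: entry by entry). -/
def IsOpIntegral {V : Type*} [AddCommGroup V] [Module ℂ V] [TopologicalSpace V]
    (F : ℝ → (V →L[ℂ] V)) (a b : ℝ) (R : V →L[ℂ] V) : Prop :=
  ∀ (u : V) (ℓ : V →L[ℂ] ℂ), IntervalIntegrable (fun s => ℓ (F s u)) volume a b ∧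
    ℓ (R u) = ∫ s in a..b, ℓ (F s u)

/-- `e^{i t Op^W(g)/ħ}` on `L²(ℝ^d)`. -/
def propL2 {d : ℕ} (ħ : ℝ) (g : Phase d → ℝ) (t : ℝ) : L2 d →L[ℂ] L2 d :=
  NormedSpace.exp ((I * (t : ℂ) / (ħ : ℂ)) • weylL2 ħ (toC g))

end

/-! Transport equations. The operators `L_j^s` come from Duhamel's principle along the Hamiltonian
flow. Differentiating an iterated integral in its outer time gives the bracket with `g` plus the
outermost operator `M` applied to the remaining integral. Summing over compositions of `j/2`, the
first block `m` of each composition produces the Moyal term of order `1 + 2m`, hence the triangular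
system (`iterTerm_cons_hasDerivAt`, `egorovL_hasDerivAt`). That the solutions stay in the symbol
class rests on the flow having bounded derivatives of all positive orders on bounded time intervals
(`IsFlow.bddD_fderiv_aux`).

Egorov expansion. Let `E(t)` be the propagator and `F(s) = ∑_{l<J} ħ^l Op(L_l^s f)`, and
differentiate `E(t-s) F(s) E(-(t-s))` in `s`. The commutator of `Op(g)` with `F(s)` expands by the
Moyal product; even terms cancel by symmetry, odd terms double, and those of total order at most `J`
are exactly cancelled by `F'(s)` through the triangular system. What is left is the remainder
integrand, and integration over `[0, t]` gives the formula (`IsQuantization.egorov`). The argument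
uses only that `Op` is linear, multiplicative for the Moyal product, and bounded by finitely many
derivatives of the symbol; these axioms form `IsQuantization`.

The axioms on `L²`. Gaussian coherent states `φ_z` resolve the identity (`synth_anal`). An operator
is then described by a kernel `A(w, z)` on pairs of phase space points, and the Weyl quantizations
of symbols are exactly the operators given by kernels with rapid decay off the diagonal: a symbol is
recovered from its kernel by Fourier inversion (`symb_symKer`), and a kernel acts as the Weyl
quantization of a superposition of rank one symbols (`weylFun_symb`). Products of such kernels are
again such kernels, which yields the Moyal product (`moyal_spec`), and Schur's test yields
boundedness (`norm_weylS_toLp_le`).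

The axioms on the torus. Weyl operators of periodic symbols commute with the lattice translations,
so by duality they preserve `𝓗_ħ(κ)`. This space is finite-dimensional: for `u` in it, `|u(φ_z)|` is
periodic in `z`, and the reproducing formula makes `u(φ_z)` so equicontinuous that vanishing at
finitely many `z` forces `u = 0` (`exists_separating_finset`). The abstract argument is then run on
`ℂ^n` and transported back. -/

noncomputable section

/-! ### Calculus of functions with bounded derivatives on a set -/

section BoundedDerivatives

variable {D E F G H : Type*} [NormedAddCommGroup D] [NormedSpace ℝ D]
  [NormedAddCommGroup E] [NormedSpace ℝ E]
  [NormedAddCommGroup F] [NormedSpace ℝ F] [NormedAddCommGroup G] [NormedSpace ℝ G]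
  [NormedAddCommGroup H] [NormedSpace ℝ H]

/-- `f` is of class `C^N` and its derivatives of order at most `N` are bounded on `S`. -/
def BddD (S : Set E) (N : ℕ∞) (f : E → F) : Prop :=
  ContDiff ℝ N f ∧ ∀ k : ℕ, (k : ℕ∞) ≤ N → ∃ C, ∀ x ∈ S, ‖iteratedFDeriv ℝ k f x‖ ≤ C

theorem isSymbol_iff_bddD {d : ℕ} {f : Phase d → F} : IsSymbol f ↔ BddD Set.univ ⊤ f := by
  simp [IsSymbol, BddD]

variable {S : Set E} {N : ℕ∞} {f : E → F}

theorem BddD.mono {M : ℕ∞} (h : BddD S N f) (hM : M ≤ N) : BddD S M f :=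
  ⟨h.1.of_le (by exact_mod_cast hM), fun k hk => h.2 k (hk.trans hM)⟩

theorem bddD_top_iff : BddD S ⊤ f ↔ ∀ n : ℕ, BddD S n f := by
  refine ⟨fun h n => h.mono le_top, fun h => ⟨?_, fun k _ => (h k).2 k le_rfl⟩⟩
  exact contDiff_infty.2 fun n => (h n).1

theorem BddD.exists_nonneg_bound (h : BddD S N f) (n : ℕ) (hn : (n : ℕ∞) ≤ N) :
    ∃ C, 0 ≤ C ∧ ∀ k ≤ n, ∀ x ∈ S, ‖iteratedFDeriv ℝ k f x‖ ≤ C := by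
  have h1 : ∀ k : ℕ, ∃ C, 0 ≤ C ∧ (k ≤ n → ∀ x ∈ S, ‖iteratedFDeriv ℝ k f x‖ ≤ C) := by
    intro k
    by_cases hk : k ≤ n
    · obtain ⟨C, hC⟩ := h.2 k ((by exact_mod_cast hk : (k : ℕ∞) ≤ n).trans hn)
      exact ⟨max C 0, le_max_right _ _, fun _ x hx => (hC x hx).trans (le_max_left _ _)⟩
    · exact ⟨0, le_rfl, fun h => absurd h hk⟩
  choose C hC0 hC using h1
  refine ⟨∑ k ∈ range (n + 1), C k, sum_nonneg fun k _ => hC0 k, fun k hk x hx => ?_⟩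
  exact (hC k hk x hx).trans
    (single_le_sum (f := C) (fun k _ => hC0 k) (mem_range.2 (Nat.lt_succ_of_le hk)))

theorem BddD.bounded (h : BddD S N f) : ∃ C, ∀ x ∈ S, ‖f x‖ ≤ C := by
  obtain ⟨C, hC⟩ := h.2 0 (by simp)
  exact ⟨C, fun x hx => by simpa using hC x hx⟩

theorem BddD.fderiv_succ {n : ℕ∞} (h : BddD S (n + 1) f) : BddD S n (fderiv ℝ f) := by
  refine ⟨h.1.fderiv_right (by simp), fun k hk => ?_⟩
  obtain ⟨C, hC⟩ := h.2 (k + 1) (by push_cast; gcongr)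
  exact ⟨C, fun x hx => by rw [norm_iteratedFDeriv_fderiv]; exact hC x hx⟩

theorem BddD.fderiv_top (h : BddD S ⊤ f) : BddD S ⊤ (fderiv ℝ f) :=
  BddD.fderiv_succ (n := ⊤) (by simpa using h)

theorem BddD.of_fderiv {n : ℕ} (hd : Differentiable ℝ f) (hb : ∃ C, ∀ x ∈ S, ‖f x‖ ≤ C)
    (h : BddD S n (fderiv ℝ f)) : BddD S ((n + 1 : ℕ) : ℕ∞) f := by
  refine ⟨?_, fun k hk => ?_⟩
  · have := contDiff_succ_iff_fderiv (𝕜 := ℝ) (f := f) (n := (n : ℕ∞))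
    push_cast at this ⊢
    exact this.2 ⟨hd, by simp, h.1⟩
  · cases k with
    | zero => obtain ⟨C, hC⟩ := hb; exact ⟨C, fun x hx => by simpa using hC x hx⟩
    | succ k =>
      obtain ⟨C, hC⟩ := h.2 k (by norm_cast at hk ⊢; omega)
      exact ⟨C, fun x hx => by rw [← norm_iteratedFDeriv_fderiv]; exact hC x hx⟩

theorem BddD.bilin (B : F →L[ℝ] G →L[ℝ] H) {g : E → G} (hf : BddD S N f) (hg : BddD S N g) :
    BddD S N (fun x => B (f x) (g x)) := by
  refine ⟨B.isBoundedBilinearMap.contDiff.comp (hf.1.prodMk hg.1), fun k hk => ?_⟩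
  obtain ⟨C, hC0, hC⟩ := hf.exists_nonneg_bound k hk
  obtain ⟨C', hC0', hC'⟩ := hg.exists_nonneg_bound k hk
  refine ⟨‖B‖ * ∑ i ∈ range (k + 1), (k.choose i : ℝ) * C * C', fun x hx => ?_⟩
  refine (B.norm_iteratedFDeriv_le_of_bilinear hf.1 hg.1 x (n := k) (by exact_mod_cast hk)).trans ?_
  gcongr with i hi
  · exact hC i (by simp at hi; omega) x hx
  · exact hC' _ (by omega) x hx

theorem BddD.clm (L : F →L[ℝ] G) (hf : BddD S N f) : BddD S N (fun x => L (f x)) := by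
  refine ⟨L.contDiff.comp hf.1, fun k hk => ?_⟩
  obtain ⟨C, hC⟩ := hf.2 k hk
  refine ⟨‖L‖ * C, fun x hx => ?_⟩
  refine (L.norm_iteratedFDeriv_comp_left (hf.1.contDiffAt) (n := k) (by exact_mod_cast hk)).trans ?_
  gcongr
  exact hC x hx

theorem BddD.clm_comp {f : E → G →L[ℝ] H} {g : E → F →L[ℝ] G} (hf : BddD S N f)
    (hg : BddD S N g) : BddD S N (fun x => (f x).comp (g x)) :=
  hf.bilin (ContinuousLinearMap.compL ℝ F G H) hg

theorem BddD.add {g : E → F} (hf : BddD S N f) (hg : BddD S N g) :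
    BddD S N (fun x => f x + g x) := by
  refine ⟨hf.1.add hg.1, fun k hk => ?_⟩
  obtain ⟨C, hC⟩ := hf.2 k hk
  obtain ⟨C', hC'⟩ := hg.2 k hk
  refine ⟨C + C', fun x hx => ?_⟩
  have : iteratedFDeriv ℝ k (fun x => f x + g x) x = _ :=
    iteratedFDeriv_add_apply (f := f) (g := g)
    ((hf.1.of_le (by exact_mod_cast hk)).contDiffAt) ((hg.1.of_le (by exact_mod_cast hk)).contDiffAt)
  rw [this]
  exact (norm_add_le _ _).trans (add_le_add (hC x hx) (hC' x hx))

theorem BddD.const (S : Set E) (N : ℕ∞) (c : F) : BddD S N (fun _ => c) := by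
  refine ⟨contDiff_const, fun k _ => ?_⟩
  rcases k with _ | k
  · exact ⟨‖c‖, fun x _ => by simp⟩
  · exact ⟨0, fun x _ => by simp [iteratedFDeriv_succ_const]⟩

theorem BddD.sum {ι : Type*} (s : Finset ι) {f : ι → E → F} (h : ∀ i ∈ s, BddD S N (f i)) :
    BddD S N (fun x => ∑ i ∈ s, f i x) := by
  classical
  induction s using Finset.induction with
  | empty => simpa using BddD.const S N (0 : F)
  | insert a s ha ih =>
    simp only [sum_insert ha]
    exact (h a (by simp)).add (ih fun i hi => h i (by simp [hi]))

theorem BddD.mul {A : Type*} [NormedRing A] [NormedAlgebra ℝ A] {f g : E → A}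
    (hf : BddD S N f) (hg : BddD S N g) : BddD S N (fun x => f x * g x) :=
  hf.bilin (ContinuousLinearMap.mul ℝ A) hg

theorem BddD.const_mul {A : Type*} [NormedRing A] [NormedAlgebra ℝ A] {f : E → A} (c : A)
    (hf : BddD S N f) : BddD S N (fun x => c * f x) :=
  (BddD.const S N c).mul hf

theorem BddD.prodMk {g : E → G} (hf : BddD S N f) (hg : BddD S N g) :
    BddD S N (fun x => (f x, g x)) := by
  have := (hf.clm (ContinuousLinearMap.inl ℝ F G)).add (hg.clm (ContinuousLinearMap.inr ℝ F G))
  simpa using this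

/-- A map which need not be bounded, but whose derivatives of positive order are bounded,
preserves bounded derivatives by composition. -/
theorem BddD.comp' {T : Set F} {g : F → G} (hg : BddD T N g) (hf : ContDiff ℝ N f)
    (hf' : ∀ k : ℕ, (k : ℕ∞) ≤ N → 1 ≤ k → ∃ C, ∀ x ∈ S, ‖iteratedFDeriv ℝ k f x‖ ≤ C)
    (hST : ∀ x ∈ S, f x ∈ T) : BddD S N (fun x => g (f x)) := by
  refine ⟨hg.1.comp hf, fun n hn => ?_⟩
  obtain ⟨C, hC0, hC⟩ := hg.exists_nonneg_bound n hn
  have h1 : ∀ k : ℕ, ∃ C : ℝ, 1 ≤ C ∧ (1 ≤ k → k ≤ n → ∀ x ∈ S, ‖iteratedFDeriv ℝ k f x‖ ≤ C) := by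
    intro k
    by_cases hk : 1 ≤ k ∧ k ≤ n
    · obtain ⟨C, hC⟩ := hf' k ((by exact_mod_cast hk.2 : (k : ℕ∞) ≤ n).trans hn) hk.1
      exact ⟨max C 1, le_max_right _ _, fun _ _ x hx => (hC x hx).trans (le_max_left _ _)⟩
    · exact ⟨1, le_rfl, fun h h' => absurd ⟨h, h'⟩ hk⟩
  choose D hD1 hD using h1
  have hDpos : ∀ k, 0 ≤ D k := fun k => zero_le_one.trans (hD1 k)
  set M := ∑ k ∈ range (n + 1), D k with hM
  have hDM : ∀ k ≤ n, D k ≤ M := fun k hk =>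
    single_le_sum (f := D) (fun k _ => hDpos k) (mem_range.2 (Nat.lt_succ_of_le hk))
  have hM1 : 1 ≤ M := (hD1 0).trans (hDM 0 (Nat.zero_le _))
  -- The estimate for derivatives of a composite wants the `i`-th derivative of the inner map
  -- bounded by the `i`-th power of one constant; `1 ≤ M` gives `M ≤ M ^ i`.
  refine ⟨n.factorial * C * M ^ n, fun x hx => ?_⟩
  refine norm_iteratedFDeriv_comp_le hg.1 hf (by exact_mod_cast hn) x
    (fun i hi => hC i hi _ (hST x hx)) fun i hi1 hi2 => ?_
  exact (hD i hi1 hi2 x hx).trans ((hDM i hi2).trans (le_self_pow₀ hM1 (by omega)))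

theorem iteratedFDeriv_affine_bound (L : E →L[ℝ] F) (c : F) (k : ℕ) (hk : 1 ≤ k) (x : E) :
    ‖iteratedFDeriv ℝ k (fun x => L x + c) x‖ ≤ ‖L‖ ^ k := by
  obtain ⟨k, rfl⟩ : ∃ m, k = m + 1 := ⟨k - 1, by omega⟩
  rw [← norm_iteratedFDeriv_fderiv]
  have : fderiv ℝ (fun x => L x + c) = fun _ => L := by
    ext1 x
    exact (L.hasFDerivAt.add_const c).fderiv
  rw [this]
  rcases k with _ | k
  · simp
  · simp [iteratedFDeriv_succ_const]

theorem BddD.comp_affine {T : Set F} {g : F → G} (hg : BddD T N g) (L : E →L[ℝ] F) (c : F)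
    (hST : ∀ x ∈ S, L x + c ∈ T) : BddD S N (fun x => g (L x + c)) :=
  hg.comp' (f := fun x => L x + c) (L.contDiff.add contDiff_const)
    (fun k _ hk => ⟨‖L‖ ^ k, fun x _ => iteratedFDeriv_affine_bound L c k hk x⟩) hST

theorem BddD.of_hasCompactSupport (hf : ContDiff ℝ N f) (hs : HasCompactSupport f) :
    BddD S N f := by
  refine ⟨hf, fun k hk => ?_⟩
  have hc : Continuous (iteratedFDeriv ℝ k f) := hf.continuous_iteratedFDeriv (by exact_mod_cast hk)
  obtain ⟨C, hC⟩ := hc.bounded_above_of_compact_support (hs.iteratedFDeriv k)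
  exact ⟨C, fun x _ => hC x⟩

theorem norm_iteratedFDeriv_comp_clm_le {g : F → G} (hg : ContDiff ℝ ∞ g) (L : E →L[ℝ] F)
    (k : ℕ) (x : E) :
    ‖iteratedFDeriv ℝ k (fun x => g (L x)) x‖ ≤ ‖iteratedFDeriv ℝ k g (L x)‖ * ‖L‖ ^ k := by
  have := L.iteratedFDeriv_comp_right (f := g) hg x (i := k) (by exact_mod_cast le_top)
  have h2 : iteratedFDeriv ℝ k (fun x => g (L x)) x =
    (iteratedFDeriv ℝ k g (L x)).compContinuousLinearMap fun _ => L := this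
  rw [h2]
  refine (ContinuousMultilinearMap.norm_compContinuousLinearMap_le _ _).trans ?_
  simp

/-- A slice is a translate of `u` restricted along the inclusion of the second factor. Its
derivatives are therefore restrictions of the joint ones, and depend continuously on both variables.
-/
theorem iteratedFDeriv_slice {Y : Type*} [NormedAddCommGroup Y] [NormedSpace ℝ Y]
    {u : Y × E → F} (hu : ContDiff ℝ ∞ u) (k : ℕ) (y : Y) (x : E) :
    iteratedFDeriv ℝ k (fun x => u (y, x)) x =
      (iteratedFDeriv ℝ k u (y, x)).compContinuousLinearMap
        fun _ => ContinuousLinearMap.inr ℝ Y E := by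
  have h1 : (fun x => u (y, x)) =
      (fun z => u (z + (y, 0))) ∘ (ContinuousLinearMap.inr ℝ Y E) := by
    ext x; simp
  have h2 : ContDiff ℝ ∞ fun z : Y × E => u (z + (y, 0)) :=
    hu.comp (contDiff_id.add contDiff_const)
  rw [h1, ContinuousLinearMap.iteratedFDeriv_comp_right _ h2 x (i := k) (by exact_mod_cast le_top),
    iteratedFDeriv_comp_add_right]
  simp

theorem continuous_iteratedFDeriv_slice {Y : Type*} [NormedAddCommGroup Y] [NormedSpace ℝ Y]
    {u : Y × E → F} (hu : ContDiff ℝ ∞ u) (k : ℕ) :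
    Continuous fun p : Y × E => iteratedFDeriv ℝ k (fun x => u (p.1, x)) p.2 := by
  simp_rw [iteratedFDeriv_slice hu]
  exact (ContinuousMultilinearMap.compContinuousLinearMapL
    (fun _ : Fin k => ContinuousLinearMap.inr ℝ Y E)).continuous.comp
    (hu.continuous_iteratedFDeriv (by exact_mod_cast le_top))

end BoundedDerivatives

/-! ### Differentiation under the integral sign to all orders -/

section ParametricIntegral

universe u

variable {Y : Type*} [MeasurableSpace Y] {μ : Measure Y}
  {E : Type u} [NormedAddCommGroup E] [NormedSpace ℝ E]

/-- Repeated differentiation under the integral sign. -/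
theorem contDiff_integral_of_dominated_aux (n : ℕ) :
    ∀ {F : Type u} [NormedAddCommGroup F] [NormedSpace ℝ F] {Ψ : Y → E → F},
    (∀ y, ContDiff ℝ ∞ (Ψ y)) →
    (∀ k x, AEStronglyMeasurable (fun y => iteratedFDeriv ℝ k (Ψ y) x) μ) →
    (∀ k x₀, ∃ b : Y → ℝ, Integrable b μ ∧
      ∀ᶠ x in nhds x₀, ∀ y, ‖iteratedFDeriv ℝ k (Ψ y) x‖ ≤ b y) →
    ContDiff ℝ n (fun x => ∫ y, Ψ y x ∂μ) ∧
      ∀ x, ‖iteratedFDeriv ℝ n (fun x => ∫ y, Ψ y x ∂μ) x‖ ≤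
        ∫ y, ‖iteratedFDeriv ℝ n (Ψ y) x‖ ∂μ := by
  induction n with
  | zero =>
    intro F _ _ Ψ hΨ hm hb
    have hm0 : ∀ x, AEStronglyMeasurable (fun y => Ψ y x) μ := fun x => by
      have := (continuousMultilinearCurryFin0 ℝ E F).continuous.comp_aestronglyMeasurable (hm 0 x)
      simpa using this
    refine ⟨?_, fun x => ?_⟩
    · rw [Nat.cast_zero, contDiff_zero, continuous_iff_continuousAt]
      intro x₀
      obtain ⟨b, hbi, hbb⟩ := hb 0 x₀
      refine continuousAt_of_dominated (Filter.Eventually.of_forall hm0) ?_ hbi ?_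
      · filter_upwards [hbb] with x hx
        exact Filter.Eventually.of_forall fun y => by simpa using hx y
      · exact Filter.Eventually.of_forall fun y => (hΨ y).continuous.continuousAt
    · simpa using norm_integral_le_integral_norm (fun y => Ψ y x)
  | succ n ih =>
    intro F _ _ Ψ hΨ hm hb
    have hm0 : ∀ x, AEStronglyMeasurable (fun y => Ψ y x) μ := fun x => by
      have := (continuousMultilinearCurryFin0 ℝ E F).continuous.comp_aestronglyMeasurable (hm 0 x)
      simpa using this
    have hmf : ∀ k x, AEStronglyMeasurable (fun y => iteratedFDeriv ℝ k (fderiv ℝ (Ψ y)) x) μ := by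
      intro k x
      have := (continuousMultilinearCurryRightEquiv' ℝ k E F).continuous.comp_aestronglyMeasurable
        (hm (k + 1) x)
      refine this.congr (Filter.Eventually.of_forall fun y => ?_)
      simp [iteratedFDeriv_succ_eq_comp_right]
    have hbf : ∀ k x₀, ∃ b : Y → ℝ, Integrable b μ ∧
      ∀ᶠ x in nhds x₀, ∀ y, ‖iteratedFDeriv ℝ k (fderiv ℝ (Ψ y)) x‖ ≤ b y := by
      intro k x₀
      simpa [norm_iteratedFDeriv_fderiv] using hb (k + 1) x₀
    have hmf0 : ∀ x, AEStronglyMeasurable (fun y => fderiv ℝ (Ψ y) x) μ := fun x => by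
      have := (continuousMultilinearCurryFin0 ℝ E (E →L[ℝ] F)).continuous.comp_aestronglyMeasurable
        (hmf 0 x)
      simpa using this
    have hder : ∀ x₀, HasFDerivAt (fun x => ∫ y, Ψ y x ∂μ) (∫ y, fderiv ℝ (Ψ y) x₀ ∂μ) x₀ := by
      intro x₀
      obtain ⟨b, hbi, hbb⟩ := hbf 0 x₀
      obtain ⟨b0, hbi0, hbb0⟩ := hb 0 x₀
      refine hasFDerivAt_integral_of_dominated_of_fderiv_le (F' := fun x y => fderiv ℝ (Ψ y) x) hbb
        (Filter.Eventually.of_forall hm0) ?_ (hmf0 x₀)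
        (Filter.Eventually.of_forall fun y x hx => by simpa using hx y) hbi
        (Filter.Eventually.of_forall fun y x _ =>
          ((hΨ y).differentiable (by simp)).differentiableAt.hasFDerivAt)
      refine hbi0.mono' (hm0 x₀) (Filter.Eventually.of_forall fun y => ?_)
      simpa using hbb0.self_of_nhds y
    have hfd : fderiv ℝ (fun x => ∫ y, Ψ y x ∂μ) = fun x => ∫ y, fderiv ℝ (Ψ y) x ∂μ :=
      funext fun x => (hder x).fderiv
    -- The derivative has values in `E →L[ℝ] F`; for this reason the induction quantifies over the
    -- target space, which shares the universe of `E`.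
    obtain ⟨h1, h2⟩ := ih (Ψ := fun y => fderiv ℝ (Ψ y)) (fun y => (contDiff_infty_iff_fderiv.1 (hΨ y)).2) hmf hbf
    refine ⟨?_, fun x => ?_⟩
    · have := contDiff_succ_iff_fderiv (𝕜 := ℝ) (f := fun x => ∫ y, Ψ y x ∂μ) (n := (n : ℕ∞))
      push_cast at this ⊢
      refine this.2 ⟨fun x => (hder x).differentiableAt, by simp, ?_⟩
      rw [hfd]; exact h1
    · rw [← norm_iteratedFDeriv_fderiv, hfd]
      simpa only [norm_iteratedFDeriv_fderiv] using h2 x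

theorem contDiff_integral_of_dominated {F : Type u} [NormedAddCommGroup F] [NormedSpace ℝ F]
    {Ψ : Y → E → F} (hΨ : ∀ y, ContDiff ℝ ∞ (Ψ y))
    (hm : ∀ k x, AEStronglyMeasurable (fun y => iteratedFDeriv ℝ k (Ψ y) x) μ)
    (hb : ∀ k x₀, ∃ b : Y → ℝ, Integrable b μ ∧
      ∀ᶠ x in nhds x₀, ∀ y, ‖iteratedFDeriv ℝ k (Ψ y) x‖ ≤ b y) :
    ContDiff ℝ ∞ (fun x => ∫ y, Ψ y x ∂μ) ∧
      ∀ n x, ‖iteratedFDeriv ℝ n (fun x => ∫ y, Ψ y x ∂μ) x‖ ≤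
        ∫ y, ‖iteratedFDeriv ℝ n (Ψ y) x‖ ∂μ :=
  ⟨contDiff_infty.2 fun n => (contDiff_integral_of_dominated_aux n hΨ hm hb).1,
    fun n => (contDiff_integral_of_dominated_aux n hΨ hm hb).2⟩

/-- The integral of a jointly smooth function against a measurable weight. -/
theorem contDiff_integral_weight {E : Type} [NormedAddCommGroup E]
    [NormedSpace ℝ E] {Y : Type*} [NormedAddCommGroup Y] [NormedSpace ℝ Y] [FiniteDimensional ℝ Y]
    [MeasurableSpace Y] [BorelSpace Y] {μ : Measure Y}
    {ρ : Y → ℂ} {u : Y × E → ℂ} (hu : ContDiff ℝ ∞ u) (hρ : AEStronglyMeasurable ρ μ)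
    (hb : ∀ k x₀, ∃ b : Y → ℝ, Integrable b μ ∧
      ∀ᶠ x in nhds x₀, ∀ y, ‖ρ y‖ * ‖iteratedFDeriv ℝ k (fun x => u (y, x)) x‖ ≤ b y) :
    ContDiff ℝ ∞ (fun x => ∫ y, ρ y * u (y, x) ∂μ) ∧
      ∀ n x, ‖iteratedFDeriv ℝ n (fun x => ∫ y, ρ y * u (y, x) ∂μ) x‖ ≤
        ∫ y, ‖ρ y‖ * ‖iteratedFDeriv ℝ n (fun x => u (y, x)) x‖ ∂μ := by
  have hs : ∀ y, ContDiff ℝ ∞ fun x => u (y, x) := fun y =>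
    hu.comp (contDiff_const.prodMk contDiff_id)
  have key : ∀ k y x, iteratedFDeriv ℝ k (fun x => ρ y * u (y, x)) x =
      ρ y • iteratedFDeriv ℝ k (fun x => u (y, x)) x := fun k y x =>
    iteratedFDeriv_const_smul_apply (a := ρ y) (f := fun x => u (y, x))
      (((hs y).of_le (m := (k : ℕ∞)) (by exact_mod_cast le_top)).contDiffAt)
  have := contDiff_integral_of_dominated (μ := μ) (Ψ := fun y x => ρ y * u (y, x))
    (fun y => contDiff_const.mul (hs y))
    (fun k x => by
      simp only [key]
      refine hρ.smul (Continuous.aestronglyMeasurable ?_)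
      exact (continuous_iteratedFDeriv_slice hu k).comp (by fun_prop : Continuous fun y => (y, x)))
    (fun k x₀ => by simpa only [key, norm_smul] using hb k x₀)
  simpa only [key, norm_smul] using this

end ParametricIntegral

/-! ### Flows of vector fields with bounded derivatives -/

section Flow

/-- `Φ` is the global flow of the vector field `X`. -/
def IsFlow {E : Type*} [NormedAddCommGroup E] [NormedSpace ℝ E] (X : E → E) (Φ : ℝ → E → E) :
    Prop :=
  ∀ x, Φ 0 x = x ∧ ∀ s, HasDerivAt (fun s' => Φ s' x) (X (Φ s x)) s

/-- The points of `ℝ × E` with time coordinate in `(-T, T)`. -/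
def slab (E : Type*) (T : ℝ) : Set (ℝ × E) := {p | |p.1| < T}

theorem isOpen_slab (E : Type*) [NormedAddCommGroup E] (T : ℝ) : IsOpen (slab E T) :=
  isOpen_lt (by fun_prop) continuous_const

/-- A slab is open, so functions that agree on it have the same derivatives there. The derivative of
a flow is identified with a smooth model only on one slab at a time, the model depending on the
slab. -/
theorem BddD.of_slab_cover {E F : Type*} [NormedAddCommGroup E] [NormedSpace ℝ E]
    [NormedAddCommGroup F] [NormedSpace ℝ F] {N : ℕ∞} {u : ℝ × E → F}
    (h : ∀ T, ∃ v, BddD (slab E T) N v ∧ Set.EqOn u v (slab E T)) (T : ℝ) :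
    BddD (slab E T) N u := by
  refine ⟨contDiff_iff_contDiffAt.2 fun p => ?_, fun k hk => ?_⟩
  · obtain ⟨v, hv, huv⟩ := h (|p.1| + 1)
    refine hv.1.contDiffAt.congr_of_eventuallyEq ?_
    exact huv.eventuallyEq_of_mem ((isOpen_slab E _).mem_nhds (by simp [slab]))
  · obtain ⟨v, hv, huv⟩ := h T
    obtain ⟨C, hC⟩ := hv.2 k hk
    refine ⟨C, fun p hp => ?_⟩
    have : u =ᶠ[nhds p] v := huv.eventuallyEq_of_mem ((isOpen_slab E T).mem_nhds hp)
    rw [(this.iteratedFDeriv ℝ k).self_of_nhds]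
    exact hC p hp

variable {E : Type} [NormedAddCommGroup E] [NormedSpace ℝ E]

/-- Grönwall's inequality in both time directions. -/
theorem norm_le_gronwallBound_abs {f f' : ℝ → E} {δ K ε T : ℝ}
    (hf : ∀ s, |s| < T → HasDerivAt f (f' s) s) (h0 : ‖f 0‖ ≤ δ)
    (hb : ∀ s, |s| < T → ‖f' s‖ ≤ K * ‖f s‖ + ε) {s : ℝ} (hs : |s| < T) :
    ‖f s‖ ≤ gronwallBound δ K ε |s| := by
  have key : ∀ (g g' : ℝ → E), (∀ s, |s| < T → HasDerivAt g (g' s) s) → ‖g 0‖ ≤ δ →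
      (∀ s, |s| < T → ‖g' s‖ ≤ K * ‖g s‖ + ε) → ∀ s, 0 ≤ s → s < T →
      ‖g s‖ ≤ gronwallBound δ K ε s := by
    intro g g' hg hg0 hgb s hs0 hsT
    have := norm_le_gronwallBound_of_norm_deriv_right_le (f := g) (f' := g') (δ := δ) (K := K)
      (ε := ε) (a := 0) (b := s)
      (fun x hx => (hg x (by rw [abs_of_nonneg hx.1]; exact hx.2.trans_lt hsT)).continuousAt.continuousWithinAt)
      (fun x hx => (hg x (by rw [abs_of_nonneg hx.1]; exact hx.2.trans hsT)).hasDerivWithinAt)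
      hg0 (fun x hx => hgb x (by rw [abs_of_nonneg hx.1]; exact hx.2.trans hsT)) s ⟨hs0, le_rfl⟩
    simpa using this
  rcases le_total 0 s with h | h
  · rw [abs_of_nonneg h] at hs ⊢
    exact key f f' hf h0 hb s h hs
  · rw [abs_of_nonpos h] at hs ⊢
    have := key (fun s => f (-s)) (fun s => - f' (-s))
      (fun s hs => by
        have := (hf (-s) (by simpa using hs)).scomp s (hasDerivAt_neg s)
        simpa [Function.comp_def] using this) (by simpa using h0)
      (fun s hs => by simpa using hb (-s) (by simpa using hs)) (-s) (by linarith) hs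
    simpa using this

/-- A bounded field cannot leave the ball of radius `M T` within time `T`, so Picard–Lindelöf
applies on every interval `[-T, T]`. Uniqueness glues these solutions; the value at time `s` is read
off from the solution with horizon `|s| + 1`, which leaves room for a neighbourhood of `s`. -/
theorem exists_isFlow [CompleteSpace E] {X : E → E} {K : NNReal} {M : ℝ} (hX : LipschitzWith K X)
    (hM : ∀ x, ‖X x‖ ≤ M) : ∃ Φ, IsFlow X Φ := by
  have h0M : 0 ≤ M := (norm_nonneg _).trans (hM 0)
  have hex : ∀ x : E, ∀ T : ℝ, ∃ α : ℝ → E, 0 ≤ T → (α 0 = x ∧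
      ∀ t ∈ Set.Ioo (-T) T, HasDerivAt α (X (α t)) t) := by
    intro x T
    by_cases hT : 0 ≤ T
    swap
    · exact ⟨fun _ => x, fun h => absurd h hT⟩
    have hpl : IsPicardLindelof (fun _ => X) (tmin := -T) (tmax := T) ⟨0, by simpa using hT⟩ x
        (⟨M * T, by positivity⟩) 0 ⟨M, h0M⟩ K := by
      refine ⟨fun _ _ => hX.lipschitzOnWith, fun _ _ => continuousOn_const, fun _ _ _ _ => hM _, ?_⟩
      simp only [sub_zero, zero_sub, neg_neg, max_self, NNReal.coe_zero]
      exact le_rfl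
    obtain ⟨α, h1, h2⟩ := hpl.exists_eq_forall_mem_Icc_hasDerivWithinAt₀
    exact ⟨α, fun _ => ⟨h1, fun t ht => (h2 t ⟨ht.1.le, ht.2.le⟩).hasDerivAt
      (Icc_mem_nhds ht.1 ht.2)⟩⟩
  choose α hα using hex
  have huniq : ∀ x T T', 0 ≤ T → T ≤ T' → ∀ t ∈ Set.Ioo (-T) T, α x T t = α x T' t := by
    intro x T T' hT hTT' t ht
    have hT0 : 0 < T := by linarith [ht.1, ht.2]
    exact ODE_solution_unique_of_mem_Ioo (v := fun _ => X) (s := fun _ => Set.univ) (K := K)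
      (t₀ := 0) (a := -T) (b := T)
      (fun _ _ => hX.lipschitzOnWith) (by simpa using hT0)
      (fun t ht => ⟨(hα x T hT).2 t ht, trivial⟩)
      (fun t ht => ⟨(hα x T' (hT.trans hTT')).2 t ⟨by linarith [ht.1], by linarith [ht.2]⟩, trivial⟩)
      (by rw [(hα x T hT).1, (hα x T' (hT.trans hTT')).1]) ht
  refine ⟨fun s x => α x (|s| + 1) s, fun x => ⟨(hα x _ (by positivity)).1, fun s => ?_⟩⟩
  have h1 : (fun s' => α x (|s'| + 1) s') =ᶠ[nhds s] α x (|s| + 2) := by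
    have : {s' : ℝ | |s'| < |s| + 1} ∈ nhds s :=
      (isOpen_lt (by fun_prop) continuous_const).mem_nhds (by simp)
    filter_upwards [this] with s' hs'
    exact huniq x _ _ (by positivity) (by linarith) _ (abs_lt.1 (by linarith))
  have h2 : α x (|s| + 1) s = α x (|s| + 2) s := h1.self_of_nhds
  simp only [h2]
  exact ((hα x (|s| + 2) (by positivity)).2 s (abs_lt.1 (by linarith))).congr_of_eventuallyEq h1

namespace IsFlow

variable {X : E → E} {Φ : ℝ → E → E}

theorem eq_of_solution (h : IsFlow X Φ) {K : NNReal} (hX : LipschitzWith K X) {γ : ℝ → E}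
    (hγ : ∀ s, HasDerivAt γ (X (γ s)) s) (s : ℝ) : γ s = Φ s (γ 0) := by
  have := ODE_solution_unique_univ (v := fun _ => X) (s := fun _ => Set.univ) (K := K) (t₀ := 0)
    (f := γ) (g := fun s => Φ s (γ 0)) (fun _ => hX.lipschitzOnWith) (fun t => ⟨hγ t, trivial⟩)
    (fun t => ⟨(h (γ 0)).2 t, trivial⟩) (by simp [(h (γ 0)).1])
  exact congrFun this s

theorem add (h : IsFlow X Φ) {K : NNReal} (hX : LipschitzWith K X) (s t : ℝ) (x : E) :
    Φ (s + t) x = Φ s (Φ t x) := by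
  have := h.eq_of_solution hX (γ := fun s => Φ (s + t) x)
    (fun s => ((h x).2 (s + t)).comp_add_const s t) s
  simpa using this

theorem dist_le (h : IsFlow X Φ) {K : NNReal} (hX : LipschitzWith K X) (s : ℝ) (x y : E) :
    ‖Φ s x - Φ s y‖ ≤ Real.exp (K * |s|) * ‖x - y‖ := by
  have := norm_le_gronwallBound_abs (f := fun s => Φ s x - Φ s y)
    (f' := fun s => X (Φ s x) - X (Φ s y)) (δ := ‖x - y‖) (K := K) (ε := 0) (T := |s| + 1)
    (fun s _ => ((h x).2 s).sub ((h y).2 s)) (by simp [(h x).1, (h y).1])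
    (fun s _ => by simpa using hX.norm_sub_le _ _) (s := s) (by linarith)
  rw [gronwallBound_ε0, mul_comm] at this
  exact this

theorem time_dist_le (h : IsFlow X Φ) {M : ℝ} (hM : ∀ x, ‖X x‖ ≤ M) (s t : ℝ) (x : E) :
    ‖Φ s x - Φ t x‖ ≤ M * |s - t| := by
  have := Convex.norm_image_sub_le_of_norm_hasDerivWithin_le (f := fun s => Φ s x)
    (f' := fun s => X (Φ s x)) (C := M) (s := Set.univ) (x := t) (y := s)
    (fun s _ => ((h x).2 s).hasDerivWithinAt) (fun s _ => hM _) convex_univ trivial trivial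
  simpa using this

theorem continuous_uncurry (h : IsFlow X Φ) {K : NNReal} (hX : LipschitzWith K X) {M : ℝ}
    (hM : ∀ x, ‖X x‖ ≤ M) : Continuous fun p : ℝ × E => Φ p.1 p.2 := by
  rw [continuous_iff_continuousAt]
  rintro ⟨s, x⟩
  rw [ContinuousAt, tendsto_iff_norm_sub_tendsto_zero]
  refine squeeze_zero (fun _ => norm_nonneg _)
    (g := fun p : ℝ × E => Real.exp (K * |p.1|) * ‖p.2 - x‖ + M * |p.1 - s|) (fun p => ?_) ?_
  · calc ‖Φ p.1 p.2 - Φ s x‖ = ‖(Φ p.1 p.2 - Φ p.1 x) + (Φ p.1 x - Φ s x)‖ := by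
          congr 1; abel
      _ ≤ _ := (norm_add_le _ _).trans (add_le_add (h.dist_le hX _ _ _) (h.time_dist_le hM _ _ _))
  · have : Continuous fun p : ℝ × E => Real.exp (K * |p.1|) * ‖p.2 - x‖ + M * |p.1 - s| := by
      fun_prop
    simpa using this.tendsto (s, x)

end IsFlow

theorem BddD.exists_lipschitz {F : Type*} [NormedAddCommGroup F] [NormedSpace ℝ F] {X : E → F}
    (hX : BddD Set.univ ⊤ X) : ∃ K : NNReal, 1 ≤ K ∧ LipschitzWith K X ∧ ∀ x, ‖fderiv ℝ X x‖ ≤ K := by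
  obtain ⟨C, hC⟩ := hX.fderiv_top.bounded
  refine ⟨⟨max C 1, by positivity⟩, le_max_right (α := ℝ) _ _, ?_, fun x =>
    (hC x trivial).trans (le_max_left _ _)⟩
  exact lipschitzWith_of_nnnorm_fderiv_le (𝕜 := ℝ) (hX.1.differentiable (by simp))
    fun x => (hC x trivial).trans (le_max_left _ _)

theorem BddD.exists_isFlow [CompleteSpace E] {X : E → E} (hX : BddD Set.univ ⊤ X) :
    ∃ Φ, IsFlow X Φ := by
  obtain ⟨K, -, hK, -⟩ := hX.exists_lipschitz
  obtain ⟨M, hM⟩ := hX.bounded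
  exact _root_.exists_isFlow hK fun x => hM x trivial

/-- Mean value inequality for `X - DX(a)` on the ball of radius `‖b - a‖` about `a`, where `DX`
differs from `DX(a)` by at most `C ‖b - a‖`. -/
theorem BddD.taylor_two {F : Type*} [NormedAddCommGroup F] [NormedSpace ℝ F] {X : E → F}
    (hX : BddD Set.univ ⊤ X) : ∃ C : ℝ, 0 ≤ C ∧ ∀ a b,
      ‖X b - X a - fderiv ℝ X a (b - a)‖ ≤ C * ‖b - a‖ ^ 2 := by
  obtain ⟨C, -, hC, -⟩ := hX.fderiv_top.exists_lipschitz
  refine ⟨C, C.2, fun a b => ?_⟩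
  have := (convex_closedBall a ‖b - a‖).norm_image_sub_le_of_norm_fderiv_le' (𝕜 := ℝ) (f := X)
    (φ := fderiv ℝ X a) (C := C * ‖b - a‖) (x := a) (y := b)
    (fun x _ => (hX.1.differentiable (by simp)).differentiableAt)
    (fun x hx => (hC.norm_sub_le x a).trans (by
      gcongr; simpa [dist_eq_norm] using hx)) (by simp) (by simp [dist_eq_norm])
  rw [pow_two, ← mul_assoc]
  exact this

/-- A flow is differentiable in its initial point, the derivative solving the linearised
equation. -/
theorem IsFlow.hasFDerivAt {X : E → E} {Φ : ℝ → E → E} (h : IsFlow X Φ)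
    (hX : BddD Set.univ ⊤ X) {Y : ℝ → E →L[ℝ] E} {T : ℝ} {x : E} (hY0 : Y 0 = 1)
    (hY : ∀ s, |s| < T → HasDerivAt Y ((fderiv ℝ X (Φ s x)).comp (Y s)) s) {s : ℝ} (hs : |s| < T) :
    HasFDerivAt (Φ s) (Y s) x := by
  obtain ⟨K, hK1, hK, hK'⟩ := hX.exists_lipschitz
  obtain ⟨C, hC0, hC⟩ := hX.taylor_two
  have hK0 : (K : ℝ) ≠ 0 := by
    have : (1 : ℝ) ≤ K := by exact_mod_cast hK1
    positivity
  set B := Real.exp (K * T) with hB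
  -- The derivative of this defect is `DX` applied to the defect plus a Taylor error of `X`, which
  -- is at most `C (B ‖y - x‖)²` by the Lipschitz bound for the flow. The defect starts at zero, so
  -- Grönwall keeps it quadratic in `y - x`.
  have key : ∀ y, ‖Φ s y - Φ s x - Y s (y - x)‖ ≤
      (C * B ^ 2 / K * (Real.exp (K * |s|) - 1)) * ‖y - x‖ ^ 2 := by
    intro y
    have := norm_le_gronwallBound_abs (f := fun s => Φ s y - Φ s x - Y s (y - x))
      (f' := fun s => X (Φ s y) - X (Φ s x) - (fderiv ℝ X (Φ s x)).comp (Y s) (y - x))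
      (δ := 0) (K := K) (ε := C * (B * ‖y - x‖) ^ 2) (T := T)
      (fun s hs => (((h y).2 s).sub ((h x).2 s)).sub ((hY s hs).clm_apply (hasDerivAt_const s (y - x))
        |>.congr_deriv (by simp))) (by simp [(h x).1, (h y).1, hY0])
      (fun s hs => by
        have e : X (Φ s y) - X (Φ s x) - (fderiv ℝ X (Φ s x)).comp (Y s) (y - x) =
          fderiv ℝ X (Φ s x) (Φ s y - Φ s x - Y s (y - x)) +
          (X (Φ s y) - X (Φ s x) - fderiv ℝ X (Φ s x) (Φ s y - Φ s x)) := by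
          simp only [map_sub, ContinuousLinearMap.comp_apply]; abel
        rw [e]
        refine (norm_add_le _ _).trans (add_le_add ?_ ((hC _ _).trans ?_))
        · exact (ContinuousLinearMap.le_opNorm _ _).trans (by gcongr; exact hK' _)
        · gcongr
          refine (h.dist_le hK s y x).trans ?_
          gcongr
          exact Real.exp_le_exp.2 (by gcongr)) hs
    rw [gronwallBound_of_K_ne_0 hK0] at this
    refine this.trans (le_of_eq ?_)
    ring
  rw [hasFDerivAt_iff_isLittleO]
  refine Asymptotics.IsBigO.trans_isLittleO (g := fun y => ‖y - x‖ ^ 2)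
    (Asymptotics.IsBigO.of_bound _ (Filter.Eventually.of_forall fun y =>
      (key y).trans (by rw [Real.norm_of_nonneg (by positivity)]))) ?_
  have := (Asymptotics.isLittleO_norm_pow_id (E' := E) (n := 2) (by norm_num))
  exact (this.comp_tendsto (by
    have : Continuous fun y : E => y - x := by fun_prop
    simpa using this.tendsto x))

/-- A smooth bounded truncation of the identity. -/
theorem exists_truncation (F : Type*) [NormedAddCommGroup F] [NormedSpace ℝ F]
    [FiniteDimensional ℝ F] (R : ℝ) :
    ∃ χ : F → F, BddD Set.univ ⊤ χ ∧ (∀ y, ‖χ y‖ ≤ ‖y‖) ∧ ∀ y, ‖y‖ ≤ R → χ y = y := by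
  let ψ : ContDiffBump (0 : F) := ⟨max R 1, max R 1 + 1, by positivity, by linarith⟩
  refine ⟨fun y => ψ y • y, ?_, fun y => ?_, fun y hy => ?_⟩
  · exact BddD.of_hasCompactSupport (ψ.contDiff.smul contDiff_id) ψ.hasCompactSupport.smul_right
  · rw [norm_smul, Real.norm_of_nonneg ψ.nonneg]
    exact mul_le_of_le_one_left (norm_nonneg _) ψ.le_one
  · have : ψ y = 1 := ψ.one_of_mem_closedBall (by
      rw [mem_closedBall_zero_iff]; exact hy.trans (le_max_left _ _))
    simp [this]

section Linearised

variable [FiniteDimensional ℝ E]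

/-- On every slab the derivative of a flow in its initial point is a component of the flow of a
bounded vector field. -/
theorem IsFlow.exists_linearised {X : E → E} {Φ : ℝ → E → E} (h : IsFlow X Φ)
    (hX : BddD Set.univ ⊤ X) (T : ℝ) :
    ∃ (X₁ : E × (E →L[ℝ] E) → E × (E →L[ℝ] E)) (Φ₁ : ℝ → E × (E →L[ℝ] E) → E × (E →L[ℝ] E)),
      BddD Set.univ ⊤ X₁ ∧ IsFlow X₁ Φ₁ ∧ (∃ C, ∀ s x, |s| < T → ‖(Φ₁ s (x, 1)).2‖ ≤ C) ∧
      ∀ s x, |s| < T → HasFDerivAt (Φ s) (Φ₁ s (x, 1)).2 x := by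
  obtain ⟨K, hK1, hK, hK'⟩ := hX.exists_lipschitz
  -- The linearised field is linear in its second component, hence unbounded. It is cut off outside
  -- the Grönwall bound valid for `|s| < T`, so the solutions started at `(x, 1)` do not feel the
  -- truncation on that interval.
  obtain ⟨χ, hχ, hχ1, hχ2⟩ := exists_truncation (E →L[ℝ] E)
    (‖(1 : E →L[ℝ] E)‖ * Real.exp (K * T))
  set X₁ : E × (E →L[ℝ] E) → E × (E →L[ℝ] E) := fun p => (X p.1, (fderiv ℝ X p.1).comp (χ p.2))
    with hX₁
  have hB₁ : BddD Set.univ ⊤ X₁ := by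
    have h1 : BddD Set.univ ⊤ fun p : E × (E →L[ℝ] E) => X p.1 := by
      simpa using hX.comp_affine (S := Set.univ) (ContinuousLinearMap.fst ℝ E (E →L[ℝ] E)) 0
        fun _ _ => trivial
    have h2 : BddD Set.univ ⊤ fun p : E × (E →L[ℝ] E) => fderiv ℝ X p.1 := by
      simpa using hX.fderiv_top.comp_affine (S := Set.univ)
        (ContinuousLinearMap.fst ℝ E (E →L[ℝ] E)) 0 fun _ _ => trivial
    have h3 : BddD Set.univ ⊤ fun p : E × (E →L[ℝ] E) => χ p.2 := by
      simpa using hχ.comp_affine (S := Set.univ) (ContinuousLinearMap.snd ℝ E (E →L[ℝ] E)) 0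
        fun _ _ => trivial
    exact h1.prodMk (h2.bilin (ContinuousLinearMap.compL ℝ E E E) h3)
  have : CompleteSpace (E × (E →L[ℝ] E)) := FiniteDimensional.complete ℝ _
  obtain ⟨Φ₁, hΦ₁⟩ := hB₁.exists_isFlow
  have hfst : ∀ s x, (Φ₁ s (x, 1)).1 = Φ s x := by
    intro s x
    have := h.eq_of_solution hK (γ := fun s => (Φ₁ s (x, 1)).1)
      (fun s => ((hΦ₁ (x, 1)).2 s).fst) s
    simpa [(hΦ₁ (x, 1)).1] using this
  have hsnd : ∀ s x, HasDerivAt (fun s => (Φ₁ s (x, 1)).2)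
      ((fderiv ℝ X (Φ s x)).comp (χ (Φ₁ s (x, 1)).2)) s := by
    intro s x
    have := ((hΦ₁ (x, 1)).2 s).snd
    rw [← hfst]
    exact this
  have hbd : ∀ s x, |s| < T → ‖(Φ₁ s (x, 1)).2‖ ≤ ‖(1 : E →L[ℝ] E)‖ * Real.exp (K * T) := by
    intro s x hs
    have := norm_le_gronwallBound_abs (f := fun s => (Φ₁ s (x, 1)).2) (T := T) (K := K) (ε := 0)
      (δ := ‖(1 : E →L[ℝ] E)‖) (fun s _ => hsnd s x) (by simp [(hΦ₁ (x, 1)).1])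
      (fun s _ => by
        rw [add_zero]
        refine (ContinuousLinearMap.opNorm_comp_le _ _).trans ?_
        gcongr
        · exact hK' _
        · exact hχ1 _) hs
    rw [gronwallBound_ε0] at this
    refine this.trans ?_
    gcongr
  refine ⟨X₁, Φ₁, hB₁, hΦ₁, ⟨_, hbd⟩, fun s x hs => ?_⟩
  refine h.hasFDerivAt hX (Y := fun s => (Φ₁ s (x, 1)).2) (T := T) (by simp [(hΦ₁ (x, 1)).1])
    (fun s hs => ?_) hs
  have := hsnd s x
  rwa [hχ2 _ (hbd s x hs)] at this

end Linearised

/-- The formula for the full derivative of a flow, as a function on a slab. -/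
theorem IsFlow.hasFDerivAt_uncurry [FiniteDimensional ℝ E] {X : E → E} {Φ : ℝ → E → E}
    (h : IsFlow X Φ) (hX : BddD Set.univ ⊤ X) {T : ℝ} {Y : ℝ × E → E →L[ℝ] E}
    (hY : ∀ s x, |s| < T → HasFDerivAt (Φ s) (Y (s, x)) x) (hYc : Continuous Y)
    {p : ℝ × E} (hp : p ∈ slab E T) :
    HasFDerivAt (fun p : ℝ × E => Φ p.1 p.2)
      ((ContinuousLinearMap.toSpanSingleton ℝ (X (Φ p.1 p.2))).coprod (Y p)) p := by
  obtain ⟨K, hK1, hK, hK'⟩ := hX.exists_lipschitz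
  obtain ⟨M, hM⟩ := hX.bounded
  have hc := h.continuous_uncurry hK fun x => hM x trivial
  have hsl : ∀ᶠ v : ℝ × E in nhds p, v ∈ slab E T := (isOpen_slab E T).mem_nhds hp
  have := hasStrictFDerivAt_uncurry_coprod (𝕜 := ℝ) (u := p) (f := Φ)
    (f₁ := fun s x => ContinuousLinearMap.toSpanSingleton ℝ (X (Φ s x)))
    (f₂ := fun s x => Y (s, x))
    (Filter.Eventually.of_forall fun v => ((h v.2).2 v.1).hasFDerivAt)
    (hsl.mono fun v hv => hY v.1 v.2 hv)
    (by
      refine Continuous.continuousAt ?_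
      have : Continuous fun p : ℝ × E => X (Φ p.1 p.2) := hX.1.continuous.comp hc
      exact (ContinuousLinearMap.toSpanSingletonCLE (𝕜 := ℝ) (E := E)).continuous.comp this)
    hYc.continuousAt
  exact this.hasFDerivAt

/-- Induction on the order, over all spaces and fields at once. By the chain rule the full
derivative of `Φ` is assembled from `X ∘ Φ` and the space derivative (`main`). The first has one
more bounded derivative than the induction hypothesis provides for `DΦ`. The second is on each slab
a component of the flow of a bounded field on the larger space `E × (E →L[ℝ] E)`, to which the
induction hypothesis applies as well. -/
theorem IsFlow.bddD_fderiv_aux (n : ℕ) : ∀ {E : Type} [NormedAddCommGroup E] [NormedSpace ℝ E]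
    [FiniteDimensional ℝ E] {X : E → E} {Φ : ℝ → E → E}, IsFlow X Φ → BddD Set.univ ⊤ X → ∀ T,
    BddD (slab E T) n (fderiv ℝ fun p : ℝ × E => Φ p.1 p.2) ∧
      Differentiable ℝ fun p : ℝ × E => Φ p.1 p.2 := by
  have main : ∀ {E : Type} [NormedAddCommGroup E] [NormedSpace ℝ E]
      [FiniteDimensional ℝ E] {X : E → E} {Φ : ℝ → E → E}, IsFlow X Φ → BddD Set.univ ⊤ X →
      ∀ (n : ℕ∞) (T : ℝ),
      BddD (slab E T) n (fun p : ℝ × E => X (Φ p.1 p.2)) →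
      ∀ Y : ℝ × E → E →L[ℝ] E, BddD (slab E T) n Y →
      (∀ s x, |s| < T → HasFDerivAt (Φ s) (Y (s, x)) x) →
      (∃ v, BddD (slab E T) n v ∧ Set.EqOn (fderiv ℝ fun p : ℝ × E => Φ p.1 p.2) v (slab E T)) ∧
      ∀ p ∈ slab E T, DifferentiableAt ℝ (fun p : ℝ × E => Φ p.1 p.2) p := by
    intro E _ _ _ X Φ h hX n T hXΦ Y hYb hY
    refine ⟨⟨_, ?_, fun p hp => (h.hasFDerivAt_uncurry hX hY hYb.1.continuous hp).fderiv⟩,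
      fun p hp => (h.hasFDerivAt_uncurry hX hY hYb.1.continuous hp).differentiableAt⟩
    have h1 := hXΦ.clm ((ContinuousLinearMap.compL ℝ (ℝ × E) ℝ E).flip
      (ContinuousLinearMap.fst ℝ ℝ E) ∘L
      (ContinuousLinearMap.toSpanSingletonCLE (𝕜 := ℝ) (E := E)).toContinuousLinearMap)
    have h2 := hYb.clm ((ContinuousLinearMap.compL ℝ (ℝ × E) E E).flip
      (ContinuousLinearMap.snd ℝ ℝ E))
    convert h1.add h2 using 2 with p
    ext v <;> simp
  induction n with
  | zero =>
    intro E _ _ _ X Φ h hX T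
    obtain ⟨K, hK1, hK, hK'⟩ := hX.exists_lipschitz
    obtain ⟨M, hM⟩ := hX.bounded
    have hc := h.continuous_uncurry hK fun x => hM x trivial
    have hstep : ∀ T, _ := fun T => main h hX 0 T
      ⟨contDiff_zero.2 (hX.1.continuous.comp hc), fun k hk => ⟨M, fun p _ => by
        obtain rfl : k = 0 := by simpa using hk
        simpa using hM _ trivial⟩⟩
    have hfull : ∀ T, (∃ v, BddD (slab E T) 0 v ∧
        Set.EqOn (fderiv ℝ fun p : ℝ × E => Φ p.1 p.2) v (slab E T)) ∧
        ∀ p ∈ slab E T, DifferentiableAt ℝ (fun p : ℝ × E => Φ p.1 p.2) p := fun T => by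
      obtain ⟨X₁, Φ₁, hX₁, hΦ₁, ⟨C, hC⟩, hd⟩ := h.exists_linearised hX T
      obtain ⟨K₁, -, hK₁, -⟩ := hX₁.exists_lipschitz
      obtain ⟨M₁, hM₁⟩ := hX₁.bounded
      have hc₁ := hΦ₁.continuous_uncurry hK₁ fun x => hM₁ x trivial
      exact hstep T (fun p => (Φ₁ p.1 (p.2, 1)).2)
        ⟨by
          have : Continuous fun p : ℝ × E => (Φ₁ p.1 (p.2, 1)).2 :=
            continuous_snd.comp (hc₁.comp (by fun_prop : Continuous fun p : ℝ × E => (p.1, (p.2, (1 : E →L[ℝ] E)))))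
          exact contDiff_zero.2 this, fun k hk => ⟨C, fun p hp => by
          obtain rfl : k = 0 := by simpa using hk
          simpa using hC _ _ hp⟩⟩ hd
    refine ⟨BddD.of_slab_cover (fun T => ?_) T, fun p => (hfull (|p.1| + 1)).2 p (by simp [slab])⟩
    exact_mod_cast (hfull T).1
  | succ n ih =>
    intro E _ _ _ X Φ h hX T
    have hd := (ih h hX T).2
    have hXΦ : ∀ T, BddD (slab E T) (n + 1 : ℕ) fun p : ℝ × E => X (Φ p.1 p.2) := by
      intro T
      have h1 := (ih h hX T).1
      refine BddD.comp' (hX.mono le_top) ?_ ?_ (T := Set.univ) (f := fun p : ℝ × E => Φ p.1 p.2)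
        fun _ _ => trivial
      · have := contDiff_succ_iff_fderiv (𝕜 := ℝ) (f := fun p : ℝ × E => Φ p.1 p.2) (n := (n : ℕ∞))
        push_cast at this ⊢
        exact this.2 ⟨hd, by simp, h1.1⟩
      · intro k hk hk1
        obtain ⟨k, rfl⟩ : ∃ m, k = m + 1 := ⟨k - 1, by omega⟩
        obtain ⟨C, hC⟩ := h1.2 k (by norm_cast at hk ⊢; omega)
        exact ⟨C, fun x hx => by rw [← norm_iteratedFDeriv_fderiv]; exact hC x hx⟩
    refine ⟨BddD.of_slab_cover (fun T => ?_) T, hd⟩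
    obtain ⟨X₁, Φ₁, hX₁, hΦ₁, ⟨C, hC⟩, hdT⟩ := h.exists_linearised hX T
    have ih₁ := ih hΦ₁ hX₁ T
    refine (main h hX _ T (hXΦ T) (fun p => (Φ₁ p.1 (p.2, 1)).2) ?_ hdT).1
    set L : ℝ × E →L[ℝ] ℝ × (E × (E →L[ℝ] E)) := (ContinuousLinearMap.fst ℝ ℝ E).prod
      ((ContinuousLinearMap.snd ℝ ℝ E).prod 0) with hL
    set c : ℝ × (E × (E →L[ℝ] E)) := (0, (0, 1)) with hc
    have hY : (fun p : ℝ × E => (Φ₁ p.1 (p.2, 1)).2) =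
        fun p => ((fun p : ℝ × (E × (E →L[ℝ] E)) => Φ₁ p.1 p.2) (L p + c)).2 := by
      ext1 p; simp [hL, hc]
    have hdY : ∀ p, HasFDerivAt (fun p : ℝ × E => (Φ₁ p.1 (p.2, 1)).2)
        ((ContinuousLinearMap.snd ℝ E (E →L[ℝ] E)).comp
          ((fderiv ℝ (fun p : ℝ × (E × (E →L[ℝ] E)) => Φ₁ p.1 p.2) (L p + c)).comp L)) p := by
      intro p
      rw [hY]
      exact (HasFDerivAt.comp (g := fun p : ℝ × (E × (E →L[ℝ] E)) => Φ₁ p.1 p.2) p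
        (ih₁.2 (L p + c)).hasFDerivAt (L.hasFDerivAt.add_const c)).snd
    refine BddD.of_fderiv (fun p => (hdY p).differentiableAt) ⟨C, fun p hp => hC _ _ hp⟩ ?_
    rw [funext fun p => (hdY p).fderiv]
    have h1 := ih₁.1.comp_affine (S := slab E T) L c (fun p hp => by simpa [slab, hL, hc] using hp)
    exact (BddD.const _ _ (ContinuousLinearMap.snd ℝ E (E →L[ℝ] E))).clm_comp
      (h1.clm_comp (BddD.const _ _ L))

/-- The flow of a vector field with bounded derivatives is smooth, and on bounded time intervals
its derivatives of positive order are bounded. -/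
theorem IsFlow.bddD_fderiv [FiniteDimensional ℝ E] {X : E → E} {Φ : ℝ → E → E} (h : IsFlow X Φ)
    (hX : BddD Set.univ ⊤ X) (T : ℝ) :
    BddD (slab E T) ⊤ (fderiv ℝ fun p : ℝ × E => Φ p.1 p.2) :=
  bddD_top_iff.2 fun n => (IsFlow.bddD_fderiv_aux n h hX T).1

theorem IsFlow.contDiff [FiniteDimensional ℝ E] {X : E → E} {Φ : ℝ → E → E} (h : IsFlow X Φ)
    (hX : BddD Set.univ ⊤ X) : ContDiff ℝ ∞ fun p : ℝ × E => Φ p.1 p.2 :=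
  contDiff_infty_iff_fderiv.2 ⟨(IsFlow.bddD_fderiv_aux 0 h hX 0).2, (h.bddD_fderiv hX 0).1⟩

end Flow

/-! ### Partial derivatives, Moyal terms and the Hamiltonian field -/

section PartialDerivatives

variable {d : ℕ}

theorem foldr_iterate_induction {ι X : Type*} (P : (ι → X) → Prop) {n : ℕ} (D : Fin n → X → X)
    (hD : ∀ i u, P u → P fun s => D i (u s)) (α : Fin n → ℕ) (l : List (Fin n)) {u : ι → X}
    (hu : P u) : P fun s => l.foldr (fun i h => (D i)^[α i] h) (u s) := by
  have hit : ∀ i k u, P u → P fun s => (D i)^[k] (u s) := by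
    intro i k
    induction k with
    | zero => intro u hu; simpa using hu
    | succ k ih =>
      intro u hu
      simp only [Function.iterate_succ, Function.comp_apply]
      exact ih _ (hD i u hu)
  induction l with
  | nil => simpa using hu
  | cons i l ih => simpa using hit i (α i) _ ih

/-- A property of families of functions that is stable under first order partial derivatives is
stable under all partial derivatives. -/
theorem dqp_induction {ι : Type*} (P : (ι → Phase d → ℂ) → Prop)
    (hq : ∀ i u, P u → P fun s => dq i (u s)) (hp : ∀ i u, P u → P fun s => dp i (u s))
    (α β : Fin d → ℕ) {u : ι → Phase d → ℂ} (hu : P u) : P fun s => dqp α β (u s) :=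
  foldr_iterate_induction P dq hq α _ (foldr_iterate_induction P dp hp β _ hu)

theorem BddD.dqp {f : Phase d → ℂ} (hf : BddD Set.univ ⊤ f) (α β : Fin d → ℕ) :
    BddD Set.univ ⊤ (dqp α β f) :=
  dqp_induction (ι := Unit) (fun u => BddD Set.univ ⊤ (u ()))
    (fun _ _ hu => hu.fderiv_top.clm (ContinuousLinearMap.apply ℝ ℂ _))
    (fun _ _ hu => hu.fderiv_top.clm (ContinuousLinearMap.apply ℝ ℂ _)) α β (u := fun _ => f) hf

theorem contDiff_fderiv_apply {E F : Type*} [NormedAddCommGroup E] [NormedSpace ℝ E]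
    [NormedAddCommGroup F] [NormedSpace ℝ F] {f : E → F} (hf : ContDiff ℝ ∞ f) (v : E) :
    ContDiff ℝ ∞ fun x => fderiv ℝ f x v :=
  (contDiff_infty_iff_fderiv.1 hf).2.clm_apply contDiff_const

theorem dqp_sum {κ : Type*} (s : Finset κ) {u : κ → Phase d → ℂ} (c : κ → ℂ)
    (hu : ∀ k ∈ s, ContDiff ℝ ∞ (u k)) (α β : Fin d → ℕ) :
    dqp α β (fun x => ∑ k ∈ s, c k * u k x) = fun x => ∑ k ∈ s, c k * dqp α β (u k) x := by
  have key : ∀ v : Phase d, ∀ w : Option κ → Phase d → ℂ, (∀ k ∈ s, ContDiff ℝ ∞ (w (some k))) →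
      (w none = fun x => ∑ k ∈ s, c k * w (some k) x) →
      ((fun x => fderiv ℝ (w none) x v) = fun x => ∑ k ∈ s, c k * fderiv ℝ (w (some k)) x v) := by
    intro v w hw h
    ext x
    have h1 : HasFDerivAt (w none) (∑ k ∈ s, c k • fderiv ℝ (w (some k)) x) x := by
      rw [h]
      exact HasFDerivAt.fun_sum fun k hk =>
        (((hw k hk).differentiable (by simp)).differentiableAt.hasFDerivAt).const_mul (c k)
    rw [h1.fderiv]
    simp
  -- The family indexed by `Option κ` carries the sum at `none` and its terms at `some k`; the
  -- linear relation between them survives each first order derivative.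
  have := dqp_induction (ι := Option κ) (fun w => (∀ k ∈ s, ContDiff ℝ ∞ (w (some k))) ∧
      (w none = fun x => ∑ k ∈ s, c k * w (some k) x))
    (fun i w hw => ⟨fun k hk => contDiff_fderiv_apply (hw.1 k hk) _, key _ w hw.1 hw.2⟩)
    (fun i w hw => ⟨fun k hk => contDiff_fderiv_apply (hw.1 k hk) _, key _ w hw.1 hw.2⟩)
    α β (u := fun o => o.elim (fun x => ∑ k ∈ s, c k * u k x) u) ⟨hu, rfl⟩
  exact this.2

theorem dqp_zero (α β : Fin d → ℕ) : dqp α β (fun _ : Phase d => (0 : ℂ)) = fun _ => 0 := by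
  simpa using dqp_sum (∅ : Finset Unit) (u := fun _ _ => (0 : ℂ)) (fun _ => 0) (by simp) α β

/-- Invariance under translation by `v` is inherited by partial derivatives. -/
theorem dqp_add_const {f : Phase d → ℂ} {v : Phase d} (hf : ∀ x, f (x + v) = f x)
    (α β : Fin d → ℕ) (x : Phase d) : dqp α β f (x + v) = dqp α β f x := by
  have key : ∀ w (u : Phase d → ℂ), (∀ x, u (x + v) = u x) →
      ∀ x, fderiv ℝ u (x + v) w = fderiv ℝ u x w := by
    intro w u hu x
    rw [← fderiv_comp_add_right v, funext hu]
  exact dqp_induction (ι := Unit) (fun u => ∀ x, u () (x + v) = u () x)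
    (fun i u hu => key _ _ hu) (fun i u hu => key _ _ hu) α β
    (u := fun _ => f) hf x

theorem sumMulti_swap (k : ℕ) (F : (Fin d → ℕ) → (Fin d → ℕ) → ℂ) :
    sumMulti k F = sumMulti k fun α β => F β α := by
  unfold sumMulti
  rw [← Finset.Nat.sum_antidiagonal_swap]
  exact sum_congr rfl fun ab _ => sum_comm

theorem sumMulti_const_mul (k : ℕ) (c : ℂ) (F : (Fin d → ℕ) → (Fin d → ℕ) → ℂ) :
    sumMulti k (fun α β => c * F α β) = c * sumMulti k F := by
  simp only [sumMulti, mul_sum]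

theorem sumMulti_sum {κ : Type*} (s : Finset κ) (k : ℕ) (F : κ → (Fin d → ℕ) → (Fin d → ℕ) → ℂ) :
    sumMulti k (fun α β => ∑ i ∈ s, F i α β) = ∑ i ∈ s, sumMulti k (F i) := by
  simp only [sumMulti]
  symm
  rw [sum_comm]
  refine sum_congr rfl fun _ _ => ?_
  rw [sum_comm]
  refine sum_congr rfl fun _ _ => ?_
  rw [sum_comm]

theorem BddD.sumMulti {E : Type*} [NormedAddCommGroup E] [NormedSpace ℝ E] {S : Set E} {N : ℕ∞}
    (k : ℕ) {F : (Fin d → ℕ) → (Fin d → ℕ) → E → ℂ} (hF : ∀ α β, BddD S N (F α β)) :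
    BddD S N fun x => sumMulti k fun α β => F α β x := by
  simp only [_root_.sumMulti]
  exact BddD.sum _ fun _ _ => BddD.sum _ fun _ _ => BddD.sum _ fun _ _ => hF _ _

theorem BddD.moyalTerm {f g : Phase d → ℂ} (hf : BddD Set.univ ⊤ f) (hg : BddD Set.univ ⊤ g)
    (j : ℕ) : BddD Set.univ ⊤ (moyalTerm j f g) :=
  BddD.sumMulti j fun α β => ((hf.dqp α β).mul (hg.dqp β α)).const_mul _

theorem BddD.toC {E : Type*} [NormedAddCommGroup E] [NormedSpace ℝ E] {S : Set E} {N : ℕ∞}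
    {g : E → ℝ} (hg : BddD S N g) : BddD S N fun x => (g x : ℂ) :=
  hg.clm Complex.ofRealCLM

/-- The odd Moyal terms are, up to a power of `2i`, the differential operators of the transport
equations. -/
theorem moyalTerm_odd (g : Phase d → ℝ) (m : ℕ) (h : Phase d → ℂ) (x : Phase d) :
    2 * I * moyalTerm (1 + 2 * m) (toC g) h x = ((2 * I) ^ (2 * m))⁻¹ * sumM g m h x := by
  unfold moyalTerm sumM
  rw [sumMulti_swap, ← sumMulti_const_mul, ← sumMulti_const_mul]
  congr 1
  ext α β
  have h1 : ((-1 : ℂ) ^ (∑ i, β i))⁻¹ = (-1) ^ (∑ i, β i) := by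
    rw [← inv_pow]; norm_num
  have h2 : (2 * I : ℂ) ≠ 0 := by simp
  simp only [mul_inv, h1, pow_add, pow_one, div_eq_mul_inv]
  have h3 : (2 * I) * (2 * I)⁻¹ = (1 : ℂ) := mul_inv_cancel₀ h2
  have h4 : (2 * I : ℂ)⁻¹ = 2⁻¹ * I⁻¹ := mul_inv _ _
  rw [h4] at h3
  linear_combination ((-1 : ℂ) ^ (∑ i, β i) * (multiFactorial β : ℂ)⁻¹ * (multiFactorial α : ℂ)⁻¹ *
    ((2 * I) ^ (2 * m))⁻¹ * (dqp β α (toC g) x * dqp α β h x)) * h3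

/-- `f #_j g` and `g #_j f` agree for even `j` and are opposite for odd `j`. -/
theorem moyalTerm_comm (j : ℕ) (f g : Phase d → ℂ) (x : Phase d) :
    moyalTerm j g f x = (-1) ^ j * moyalTerm j f g x := by
  unfold moyalTerm
  rw [sumMulti_swap, ← sumMulti_const_mul]
  unfold sumMulti
  refine sum_congr rfl fun ab hab => sum_congr rfl fun α hα => sum_congr rfl fun β hβ => ?_
  have hα' : ∑ i, α i = ab.1 := (mem_piAntidiag.1 hα).1
  have hβ' : ∑ i, β i = ab.2 := (mem_piAntidiag.1 hβ).1
  have hj : j = ab.1 + ab.2 := (mem_antidiagonal.1 hab).symm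
  have h1 : ∀ n : ℕ, ((-1 : ℂ) ^ n)⁻¹ = (-1) ^ n := fun n => by rw [← inv_pow]; norm_num
  have h2 : ∀ n : ℕ, (-1 : ℂ) ^ n * (-1) ^ n = 1 := fun n => by rw [← mul_pow]; norm_num
  simp only [mul_inv, h1, hα', hβ']
  rw [show ((-1 : ℂ)) ^ j = (-1) ^ ab.1 * (-1) ^ ab.2 by rw [hj, pow_add]]
  linear_combination (-((-1 : ℂ) ^ ab.2 * (multiFactorial β : ℂ)⁻¹ * (multiFactorial α : ℂ)⁻¹ *
    ((2 * I) ^ j)⁻¹ * (dqp β α g x * dqp α β f x))) * h2 ab.1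

theorem hasFDerivAt_toC {g : Phase d → ℝ} (hg : ContDiff ℝ ∞ g) (x v : Phase d) :
    fderiv ℝ (toC g) x v = ((fderiv ℝ g x v : ℝ) : ℂ) := by
  have h := ((hg.differentiable (by simp)).differentiableAt (x := x)).hasFDerivAt
  have : HasFDerivAt (toC g) (Complex.ofRealCLM.comp (fderiv ℝ g x)) x :=
    Complex.ofRealCLM.hasFDerivAt.comp x h
  rw [this.fderiv]
  simp

theorem phase_eq_sum (x : Phase d) :
    x = ∑ i, (x.1 i • ((EuclideanSpace.single i (1 : ℝ), 0) : Phase d) +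
      x.2 i • ((0, EuclideanSpace.single i (1 : ℝ)) : Phase d)) := by
  refine Prod.ext ?_ ?_
  · ext j
    simp [Prod.fst_sum, Pi.single_apply]
  · ext j
    simp [Prod.snd_sum, Pi.single_apply]

/-- The Poisson bracket with `g` is the derivative along the Hamiltonian field. -/
theorem poisson_eq_fderiv {g : Phase d → ℝ} (hg : ContDiff ℝ ∞ g) (f : Phase d → ℂ)
    (x : Phase d) : poisson (toC g) f x = fderiv ℝ f x (hamField g x) := by
  conv_rhs => rw [phase_eq_sum (hamField g x), map_sum]
  refine sum_congr rfl fun i _ => ?_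
  simp only [dp, dq, hasFDerivAt_toC hg, map_add, map_smul, hamField, Complex.real_smul]
  push_cast
  ring

theorem poisson_zero (g : Phase d → ℂ) (x : Phase d) : poisson g (fun _ => 0) x = 0 := by
  simp [poisson, dp, dq]

theorem hamField_eq (g : Phase d → ℝ) : ∃ L : (Phase d →L[ℝ] ℝ) →L[ℝ] Phase d,
    ∀ x, hamField g x = L (fderiv ℝ g x) := by
  let L : (Phase d →L[ℝ] ℝ) →ₗ[ℝ] Phase d :=
    { toFun := fun A => (WithLp.toLp 2 fun i => A (0, EuclideanSpace.single i (1 : ℝ)),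
        WithLp.toLp 2 fun i => - A (EuclideanSpace.single i (1 : ℝ), 0))
      map_add' := fun A B => by
        refine Prod.ext ?_ ?_
        · ext i; simp
        · ext i; simp; ring
      map_smul' := fun c A => by
        refine Prod.ext ?_ ?_ <;> ext i <;> simp }
  exact ⟨LinearMap.toContinuousLinearMap L, fun x => rfl⟩

theorem BddD.hamField {g : Phase d → ℝ} (hg : BddD Set.univ ⊤ g) :
    BddD Set.univ ⊤ (hamField g) := by
  obtain ⟨L, hL⟩ := hamField_eq g
  rw [funext hL]
  exact hg.fderiv_top.clm L

theorem isFlow_hamFlow {g : Phase d → ℝ} (hg : BddD Set.univ ⊤ g) :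
    IsFlow (hamField g) (hamFlow g) := by
  have h : ∃ Φ, IsHamFlow g Φ := hg.hamField.exists_isFlow
  have : IsHamFlow g (hamFlow g) := by
    rw [hamFlow, dif_pos h]
    exact h.choose_spec
  exact this

end PartialDerivatives

/-! ### Periodic symbols -/

section Torus

variable {d : ℕ}

/-- Every point of `ℝ^d` is congruent to a point of the unit cube. -/
theorem exists_intVec_add_mem (x : Config d) :
    ∃ n : Fin d → ℤ, ∀ i, (x + intVec n) i ∈ Set.Icc (0 : ℝ) 1 := by
  refine ⟨fun i => -⌊x i⌋, fun i => ?_⟩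
  simp only [intVec, PiLp.add_apply, Int.cast_neg]
  exact ⟨by linarith [Int.floor_le (x i)], by linarith [Int.lt_floor_add_one (x i)]⟩

theorem isCompact_unitCube (d : ℕ) : IsCompact {x : Config d | ∀ i, x i ∈ Set.Icc (0 : ℝ) 1} := by
  have h : IsCompact (Set.pi Set.univ fun _ : Fin d => Set.Icc (0 : ℝ) 1) :=
    isCompact_univ_pi fun _ => isCompact_Icc
  have := h.image (PiLp.continuous_toLp 2 fun _ : Fin d => ℝ)
  convert this using 1
  ext x
  simp only [Set.mem_ofPred_eq, Set.mem_image, Set.mem_pi, Set.mem_univ, true_imp_iff]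
  exact ⟨fun h => ⟨x.ofLp, h, rfl⟩, fun ⟨y, hy, h⟩ => h ▸ hy⟩

/-- Derivatives inherit periodicity, so their values are already taken on the compact unit cube. -/
theorem IsTorusSymbol.bddD {F : Type*} [NormedAddCommGroup F] [NormedSpace ℝ F] {f : Phase d → F}
    (hf : IsTorusSymbol f) : BddD Set.univ ⊤ f := by
  refine ⟨hf.1, fun k _ => ?_⟩
  obtain ⟨C, hC⟩ := ((isCompact_unitCube d).prod (isCompact_unitCube d)).exists_bound_of_continuousOn
    (hf.1.continuous_iteratedFDeriv (m := k) (by exact_mod_cast le_top)).continuousOn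
  refine ⟨C, fun x _ => ?_⟩
  obtain ⟨m, hm⟩ := exists_intVec_add_mem x.1
  obtain ⟨n, hn⟩ := exists_intVec_add_mem x.2
  have h1 : iteratedFDeriv ℝ k f x = iteratedFDeriv ℝ k f (x + (intVec m, intVec n)) := by
    rw [← iteratedFDeriv_comp_add_right, funext fun x => hf.2 x m n]
  rw [h1]
  exact hC _ ⟨hm, hn⟩

end Torus

/-! ### Time-dependent symbols, bounded on bounded time intervals -/

section SlabBounded

variable {d : ℕ}

/-- Smooth functions of time and phase space point, all of whose derivatives are bounded on bounded
time intervals. -/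
def SlabB (u : ℝ × Phase d → ℂ) : Prop := ∀ T, BddD (slab (Phase d) T) ⊤ u

theorem SlabB.contDiff {u : ℝ × Phase d → ℂ} (hu : SlabB u) : ContDiff ℝ ∞ u := (hu 0).1

theorem SlabB.slice {u : ℝ × Phase d → ℂ} (hu : SlabB u) (s : ℝ) :
    BddD Set.univ ⊤ fun x => u (s, x) := by
  have := (hu (|s| + 1)).comp_affine (S := Set.univ) (ContinuousLinearMap.inr ℝ ℝ (Phase d)) (s, 0)
    fun _ _ => by simp [slab]
  simpa using this

theorem SlabB.of_phase {f : Phase d → ℂ} (hf : BddD Set.univ ⊤ f) : SlabB fun p => f p.2 :=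
  fun T => by
    simpa using hf.comp_affine (S := slab (Phase d) T) (ContinuousLinearMap.snd ℝ ℝ (Phase d)) 0
      fun _ _ => trivial

theorem SlabB.fderiv_apply {u : ℝ × Phase d → ℂ} (hu : SlabB u) (v : ℝ × Phase d) :
    SlabB fun p => fderiv ℝ u p v :=
  fun T => (hu T).fderiv_top.clm (ContinuousLinearMap.apply ℝ ℂ v)

theorem fderiv_slice {u : ℝ × Phase d → ℂ} (hu : ContDiff ℝ ∞ u) (s : ℝ) (x v : Phase d) :
    fderiv ℝ (fun x => u (s, x)) x v = fderiv ℝ u (s, x) (0, v) := by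
  have h1 : HasFDerivAt (fun x : Phase d => (s, x)) (ContinuousLinearMap.inr ℝ ℝ (Phase d)) x :=
    hasFDerivAt_prodMk_right s x
  have h2 := (HasFDerivAt.comp (g := u) x
    (hu.differentiable (by simp)).differentiableAt.hasFDerivAt h1).fderiv
  have h3 : fderiv ℝ (fun x => u (s, x)) x =
    (fderiv ℝ u (s, x)).comp (ContinuousLinearMap.inr ℝ ℝ (Phase d)) := h2
  rw [h3]; simp

theorem SlabB.dqp {u : ℝ × Phase d → ℂ} (hu : SlabB u) (α β : Fin d → ℕ) :
    SlabB fun p => dqp α β (fun x => u (p.1, x)) p.2 := by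
  have key : ∀ v : Phase d, ∀ w : ℝ → Phase d → ℂ, SlabB (fun p : ℝ × Phase d => w p.1 p.2) →
      SlabB fun p : ℝ × Phase d => fderiv ℝ (w p.1) p.2 v := by
    intro v w hw
    convert hw.fderiv_apply (0, v) using 2 with p
    exact fderiv_slice (u := fun p : ℝ × Phase d => w p.1 p.2) hw.contDiff p.1 p.2 v
  exact dqp_induction (ι := ℝ) (fun w => SlabB fun p : ℝ × Phase d => w p.1 p.2)
    (fun i w hw => key _ w hw) (fun i w hw => key _ w hw) α β (u := fun s x => u (s, x)) hu

theorem SlabB.sumM {g : Phase d → ℝ} (hg : BddD Set.univ ⊤ g) {u : ℝ × Phase d → ℂ}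
    (hu : SlabB u) (m : ℕ) : SlabB fun p => sumM g m (fun x => u (p.1, x)) p.2 := fun T =>
  BddD.sumMulti _ fun α β =>
    ((SlabB.of_phase (hg.toC.dqp β α) T).mul (hu.dqp α β T)).const_mul _

theorem SlabB.reflect {u : ℝ × Phase d → ℂ} (hu : SlabB u) : SlabB fun p => u (-p.1, p.2) :=
  fun T => by
    simpa using (hu T).comp_affine (S := slab (Phase d) T)
      ((-ContinuousLinearMap.fst ℝ ℝ (Phase d)).prod (ContinuousLinearMap.snd ℝ ℝ (Phase d))) 0
      fun p hp => by simpa [slab] using hp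

/-- The map `(s, x) ↦ (s, Φ s x)` is unbounded, but its derivatives of positive order are bounded on
slabs, and this is all that composition requires. -/
theorem SlabB.comp_flow {X : Phase d → Phase d} {Φ : ℝ → Phase d → Phase d} (h : IsFlow X Φ)
    (hX : BddD Set.univ ⊤ X) {u : ℝ × Phase d → ℂ} (hu : SlabB u) :
    SlabB fun p => u (p.1, Φ p.1 p.2) := fun T => by
  have hc : ContDiff ℝ ∞ fun p : ℝ × Phase d => Φ p.1 p.2 := h.contDiff hX
  refine (hu T).comp' (f := fun p : ℝ × Phase d => (p.1, Φ p.1 p.2)) (contDiff_fst.prodMk hc)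
    (fun k _ hk => ?_) fun p hp => hp
  obtain ⟨k, rfl⟩ : ∃ m, k = m + 1 := ⟨k - 1, by omega⟩
  have hfd : (fderiv ℝ fun p : ℝ × Phase d => (p.1, Φ p.1 p.2)) = fun p =>
      (ContinuousLinearMap.inl ℝ ℝ (Phase d)).comp (ContinuousLinearMap.fst ℝ ℝ (Phase d)) +
      (ContinuousLinearMap.inr ℝ ℝ (Phase d)).comp
        (fderiv ℝ (fun p : ℝ × Phase d => Φ p.1 p.2) p) := by
    ext1 p
    have h1 : HasFDerivAt (fun p : ℝ × Phase d => (p.1, Φ p.1 p.2)) _ p :=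
      hasFDerivAt_fst.prodMk ((hc.differentiable (by simp)).differentiableAt.hasFDerivAt)
    rw [h1.fderiv]
    refine ContinuousLinearMap.ext fun v => ?_
    simp
  have h2 := ((BddD.const (slab (Phase d) T) ⊤ ((ContinuousLinearMap.inl ℝ ℝ (Phase d)).comp
    (ContinuousLinearMap.fst ℝ ℝ (Phase d)))).add ((BddD.const _ _
      (ContinuousLinearMap.inr ℝ ℝ (Phase d))).clm_comp (h.bddD_fderiv hX T))).2 k le_top
  obtain ⟨C, hC⟩ := h2
  refine ⟨C, fun p hp => ?_⟩
  rw [← norm_iteratedFDeriv_fderiv, hfd]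
  exact hC p hp

/-- The substitution `r = sθ` moves the dependence on the upper limit into the integrand, leaving a
fixed interval `(0, 1]` on which to differentiate under the integral. Since `0 < θ ≤ 1`, the map
`(s, x) ↦ (sθ, x)` preserves the slab and has norm at most one. -/
theorem SlabB.integral {u : ℝ × Phase d → ℂ} (hu : SlabB u) :
    SlabB fun p => ∫ r in (0 : ℝ)..p.1, u (r, p.2) := by
  have hfst : SlabB fun p : ℝ × Phase d => ((p.1 : ℝ) : ℂ) := by
    intro T
    refine ⟨Complex.ofRealCLM.contDiff.comp contDiff_fst, fun k _ => ?_⟩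
    have hl : (fun p : ℝ × Phase d => ((p.1 : ℝ) : ℂ)) = fun p =>
        (Complex.ofRealCLM.comp (ContinuousLinearMap.fst ℝ ℝ (Phase d))) p + 0 := by ext p; simp
    rcases k with _ | k
    · refine ⟨T, fun p hp => ?_⟩
      simpa using le_of_lt (show |p.1| < T from hp)
    · rw [hl]
      exact ⟨_, fun p _ => iteratedFDeriv_affine_bound _ _ _ (by omega) p⟩
  have heq : (fun p : ℝ × Phase d => ∫ r in (0 : ℝ)..p.1, u (r, p.2)) = fun p =>
      (p.1 : ℂ) * ∫ θ : ℝ, (Set.Ioc (0 : ℝ) 1).indicator (fun _ => (1 : ℂ)) θ *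
        u (p.1 * θ, p.2) := by
    ext p
    have h1 := intervalIntegral.smul_integral_comp_mul_left (a := 0) (b := 1)
      (fun r => u (r, p.2)) p.1
    simp only [mul_zero, mul_one] at h1
    rw [← h1, intervalIntegral.integral_of_le zero_le_one, ← integral_indicator measurableSet_Ioc,
      Complex.real_smul]
    congr 2
    ext θ
    by_cases h : θ ∈ Set.Ioc (0 : ℝ) 1 <;> simp [h]
  rw [heq]
  have hL : ∀ θ : ℝ, ∃ L : ℝ × Phase d →L[ℝ] ℝ × Phase d, (∀ p, L p = (p.1 * θ, p.2)) := fun θ =>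
    ⟨(θ • ContinuousLinearMap.fst ℝ ℝ (Phase d)).prod (ContinuousLinearMap.snd ℝ ℝ (Phase d)),
      fun p => by simp [mul_comm]⟩
  have hbd : ∀ k : ℕ, ∀ T, ∃ C, 0 ≤ C ∧ ∀ p ∈ slab (Phase d) T, ∀ θ ∈ Set.Ioc (0 : ℝ) 1,
      ‖iteratedFDeriv ℝ k (fun p : ℝ × Phase d => u (p.1 * θ, p.2)) p‖ ≤ C := by
    intro k T
    obtain ⟨C, hC0, hC⟩ := (hu T).exists_nonneg_bound k le_top
    refine ⟨C, hC0, fun p hp θ hθ => ?_⟩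
    obtain ⟨L, hL⟩ := hL θ
    have hn : ‖L‖ ≤ 1 := L.opNorm_le_bound zero_le_one fun p => by
      rw [hL, one_mul, Prod.norm_def, Prod.norm_def, norm_mul]
      refine max_le_max ?_ le_rfl
      rw [Real.norm_of_nonneg hθ.1.le]
      exact mul_le_of_le_one_right (norm_nonneg _) hθ.2
    have := norm_iteratedFDeriv_comp_clm_le hu.contDiff L k p
    simp only [hL] at this
    refine this.trans ((mul_le_of_le_one_right (norm_nonneg _)
      (pow_le_one₀ (norm_nonneg _) hn)).trans (hC k le_rfl _ ?_))
    simp only [slab, Set.mem_ofPred_eq, abs_mul] at hp ⊢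
    refine lt_of_le_of_lt (mul_le_of_le_one_right (abs_nonneg _) ?_) hp
    rw [abs_of_pos hθ.1]; exact hθ.2
  have hb2 : ∀ k : ℕ, ∀ T, ∃ C, 0 ≤ C ∧ ∀ p ∈ slab (Phase d) T, ∀ θ,
      ‖(Set.Ioc (0 : ℝ) 1).indicator (fun _ => (1 : ℂ)) θ‖ *
        ‖iteratedFDeriv ℝ k (fun p : ℝ × Phase d => u (p.1 * θ, p.2)) p‖ ≤
      (Set.Ioc (0 : ℝ) 1).indicator (fun _ => C) θ := by
    intro k T
    obtain ⟨C, hC0, hC⟩ := hbd k T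
    refine ⟨C, hC0, fun p hp θ => ?_⟩
    by_cases h : θ ∈ Set.Ioc (0 : ℝ) 1
    · simpa [h] using hC p hp θ h
    · simp [h]
  have hint : ∀ C : ℝ, Integrable ((Set.Ioc (0 : ℝ) 1).indicator (fun _ => C)) volume := fun C =>
    (integrable_indicator_iff measurableSet_Ioc).2 (by simp)
  obtain ⟨h1, h2⟩ := contDiff_integral_weight (E := ℝ × Phase d) (Y := ℝ) (μ := volume)
    (ρ := (Set.Ioc (0 : ℝ) 1).indicator (fun _ => (1 : ℂ)))
    (u := fun q => u (q.2.1 * q.1, q.2.2))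
    (hu.contDiff.comp (((contDiff_fst.comp contDiff_snd).mul contDiff_fst).prodMk
      (contDiff_snd.comp contDiff_snd)))
    ((measurable_const.indicator measurableSet_Ioc).aestronglyMeasurable)
    (fun k p₀ => by
      obtain ⟨C, hC0, hC⟩ := hb2 k (|p₀.1| + 1)
      refine ⟨_, hint C, ?_⟩
      filter_upwards [(isOpen_slab (Phase d) (|p₀.1| + 1)).mem_nhds (by simp [slab])] with p hp
      exact hC p hp)
  intro T
  refine (hfst T).mul ⟨h1, fun k _ => ?_⟩
  obtain ⟨C, hC0, hC⟩ := hb2 k T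
  refine ⟨C, fun p hp => (h2 k p).trans ?_⟩
  calc _ ≤ ∫ θ : ℝ, (Set.Ioc (0 : ℝ) 1).indicator (fun _ => C) θ := by
        refine integral_mono_of_nonneg (Filter.Eventually.of_forall fun _ => by positivity) (hint C)
          (Filter.Eventually.of_forall fun θ => hC p hp θ)
    _ = C := by rw [integral_indicator measurableSet_Ioc]; simp

end SlabBounded

/-! ### The transport equations for `L_j^s f` -/

section Transport

variable {d : ℕ} {g : Phase d → ℝ}

/-- The derivative along the flow of a function transported by the flow. -/
theorem hasDerivAt_comp_hamFlow (hg : BddD Set.univ ⊤ g) {J : ℝ × Phase d → ℂ}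
    (hJ : ContDiff ℝ ∞ J) (s : ℝ) (x : Phase d) :
    HasDerivAt (fun s => J (s, hamFlow g s x))
      (fderiv ℝ J (s, hamFlow g s x) (1, 0) +
        poisson (toC g) (fun x => J (s, hamFlow g s x)) x) s := by
  have h := isFlow_hamFlow hg
  have hX := hg.hamField
  obtain ⟨K, -, hK, -⟩ := hX.exists_lipschitz
  have hc : ContDiff ℝ ∞ fun p : ℝ × Phase d => hamFlow g p.1 p.2 := h.contDiff hX
  have hcs : ContDiff ℝ ∞ fun x : Phase d => hamFlow g s x :=
    hc.comp (contDiff_const.prodMk contDiff_id)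
  have hJd : ∀ p, HasFDerivAt J (fderiv ℝ J p) p := fun p =>
    (hJ.differentiable (by simp)).differentiableAt.hasFDerivAt
  have h1 : HasDerivAt (fun s => J (s, hamFlow g s x))
      (fderiv ℝ J (s, hamFlow g s x) (1, hamField g (hamFlow g s x))) s :=
    (hJd (s, hamFlow g s x)).comp_hasDerivAt s ((hasDerivAt_id s).prodMk ((h x).2 s))
  -- The flow carries its own field to itself: differentiate `φ^s ∘ φ^r = φ^r ∘ φ^s` at `r = 0`.
  have h2 : fderiv ℝ (hamFlow g s) x (hamField g x) = hamField g (hamFlow g s x) := by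
    have e1 : HasDerivAt (fun r => hamFlow g s (hamFlow g r x))
        (fderiv ℝ (hamFlow g s) x (hamField g x)) 0 := by
      have := (h x).2 0
      have hd : HasFDerivAt (hamFlow g s) (fderiv ℝ (hamFlow g s) x) (hamFlow g 0 x) := by
        rw [(h x).1]
        exact (hcs.differentiable (by simp)).differentiableAt.hasFDerivAt
      have := hd.comp_hasDerivAt (0 : ℝ) this
      rwa [(h x).1] at this
    have e2 : HasDerivAt (fun r => hamFlow g s (hamFlow g r x))
        (hamField g (hamFlow g s x)) 0 := by
      have : (fun r => hamFlow g s (hamFlow g r x)) = fun r => hamFlow g r (hamFlow g s x) := by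
        ext1 r
        rw [← h.add hK, ← h.add hK, add_comm]
      rw [this]
      simpa [(h (hamFlow g s x)).1] using (h (hamFlow g s x)).2 0
    exact e1.unique e2
  have h3 : fderiv ℝ (fun x => J (s, hamFlow g s x)) x (hamField g x) =
      fderiv ℝ J (s, hamFlow g s x) (0, hamField g (hamFlow g s x)) := by
    have hd : HasFDerivAt (fun x => (s, hamFlow g s x))
        ((0 : Phase d →L[ℝ] ℝ).prod (fderiv ℝ (hamFlow g s) x)) x :=
      (hasFDerivAt_const s x).prodMk (hcs.differentiable (by simp)).differentiableAt.hasFDerivAt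
    have := ((hJd (s, hamFlow g s x)).comp x hd).fderiv
    rw [show (fun x => J (s, hamFlow g s x)) = J ∘ fun x => (s, hamFlow g s x) from rfl, this]
    simp [h2]
  rw [poisson_eq_fderiv hg.1, h3, ← map_add]
  simpa using h1

/-- By the group law, the integral of `u_r ∘ φ^{s-r}` over `[0, s]` is the integral of `u_r ∘
φ^{-r}`, composed with `φ^s`. The backward flow is reached by conjugating composition with the flow
by time reversal. -/
theorem iterTerm_slabB (hg : BddD Set.univ ⊤ g) {f : Phase d → ℂ} (hf : BddD Set.univ ⊤ f)
    (l : List ℕ) : SlabB fun p => iterTerm g f l p.1 p.2 := by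
  have h := isFlow_hamFlow hg
  have hX := hg.hamField
  obtain ⟨K, -, hK, -⟩ := hX.exists_lipschitz
  induction l with
  | nil => exact (SlabB.of_phase hf).comp_flow h hX
  | cons m l ih =>
    have h1 := ((ih.sumM hg m).reflect.comp_flow h hX).reflect.integral.comp_flow h hX
    convert h1 using 2 with p
    simp only [iterTerm, neg_neg]
    refine intervalIntegral.integral_congr fun r _ => ?_
    simp only [← h.add hK]
    rw [neg_add_eq_sub]

theorem iterTerm_nil_hasDerivAt (hg : BddD Set.univ ⊤ g) {f : Phase d → ℂ}
    (hf : BddD Set.univ ⊤ f) (s : ℝ) (x : Phase d) :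
    HasDerivAt (fun s => iterTerm g f [] s x) (poisson (toC g) (iterTerm g f [] s) x) s := by
  have := hasDerivAt_comp_hamFlow hg (SlabB.of_phase hf).contDiff s x
  have h0 : fderiv ℝ (fun p : ℝ × Phase d => f p.2) (s, hamFlow g s x) (1, 0) = 0 := by
    have h1 : HasFDerivAt (fun p : ℝ × Phase d => f p.2)
        ((fderiv ℝ f (hamFlow g s x)).comp (ContinuousLinearMap.snd ℝ ℝ (Phase d)))
        (s, hamFlow g s x) :=
      HasFDerivAt.comp (g := f) (s, hamFlow g s x)
        ((hf.1.differentiable (by simp)).differentiableAt.hasFDerivAt) hasFDerivAt_snd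
    rw [h1.fderiv]; simp
  rw [h0, zero_add] at this
  exact this

/-- The integral is jointly differentiable, so its derivative along the time axis can be computed
with `x` frozen, where it is the fundamental theorem of calculus. -/
theorem SlabB.fderiv_integral {P : ℝ × Phase d → ℂ} (hP : SlabB P) (p : ℝ × Phase d) :
    fderiv ℝ (fun p : ℝ × Phase d => ∫ r in (0 : ℝ)..p.1, P (r, p.2)) p (1, 0) = P p := by
  have hd : DifferentiableAt ℝ (fun p : ℝ × Phase d => ∫ r in (0 : ℝ)..p.1, P (r, p.2)) p :=
    hP.integral.contDiff.differentiable (by simp) p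
  have hl : HasDerivAt (fun s : ℝ => (s, p.2)) ((1 : ℝ), (0 : Phase d)) p.1 :=
    (hasDerivAt_id p.1).prodMk (hasDerivAt_const p.1 p.2)
  have e2 := HasFDerivAt.comp_hasDerivAt (f := fun s : ℝ => (s, p.2)) p.1
    (show HasFDerivAt _ _ (p.1, p.2) from hd.hasFDerivAt) hl
  have hcont : Continuous fun r : ℝ => P (r, p.2) := hP.contDiff.continuous.comp (by fun_prop)
  have e3 := intervalIntegral.integral_hasDerivAt_right
    (hcont.intervalIntegrable 0 p.1) (hcont.stronglyMeasurableAtFilter _ _) hcont.continuousAt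
  exact e2.unique e3

/-- Duhamel's principle. Written as `P` integrated up to time `s` and evaluated at `φ^s x`, the term
has two sources of time dependence: the moving point gives the bracket, and the upper limit gives
`P` on the diagonal, where the backward and forward flows cancel. -/
theorem iterTerm_cons_hasDerivAt (hg : BddD Set.univ ⊤ g) {f : Phase d → ℂ}
    (hf : BddD Set.univ ⊤ f) (m : ℕ) (l : List ℕ) (s : ℝ) (x : Phase d) :
    HasDerivAt (fun s => iterTerm g f (m :: l) s x)
      (poisson (toC g) (iterTerm g f (m :: l) s) x + sumM g m (iterTerm g f l s) x) s := by
  have h := isFlow_hamFlow hg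
  have hX := hg.hamField
  obtain ⟨K, -, hK, -⟩ := hX.exists_lipschitz
  have hP' := (((iterTerm_slabB hg hf l).sumM hg m).reflect.comp_flow h hX).reflect
  obtain ⟨P, hPdef⟩ : ∃ P : ℝ × Phase d → ℂ, P = fun p =>
    sumM g m (iterTerm g f l p.1) (hamFlow g (-p.1) p.2) := ⟨_, rfl⟩
  have hP : SlabB P := by
    rw [hPdef]
    simpa only [neg_neg] using hP'
  have heq : ∀ s x, iterTerm g f (m :: l) s x = ∫ r in (0 : ℝ)..s, P (r, hamFlow g s x) := by
    intro s x
    simp only [iterTerm, hPdef]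
    refine intervalIntegral.integral_congr fun r _ => ?_
    simp only [← h.add hK]
    rw [neg_add_eq_sub]
  have := hasDerivAt_comp_hamFlow hg hP.integral.contDiff s x
  rw [hP.fderiv_integral, add_comm] at this
  have hPs : P (s, hamFlow g s x) = sumM g m (iterTerm g f l s) x := by
    simp only [hPdef]
    rw [← h.add hK, neg_add_cancel, (h x).1]
  rw [hPs] at this
  rw [show iterTerm g f (m :: l) s = _ from funext (heq s), funext fun s => heq s x]
  exact this

theorem iterTerm_zero {f : Phase d → ℂ} (m : ℕ) (l : List ℕ) (x : Phase d) :
    iterTerm g f (m :: l) 0 x = 0 := by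
  simp [iterTerm]

theorem sumM_sum {κ : Type*} (s : Finset κ) {u : κ → Phase d → ℂ} (c : κ → ℂ)
    (hu : ∀ k ∈ s, ContDiff ℝ ∞ (u k)) (m : ℕ) (x : Phase d) :
    sumM g m (fun x => ∑ k ∈ s, c k * u k x) x = ∑ k ∈ s, c k * sumM g m (u k) x := by
  simp only [sumM, ← sumMulti_const_mul, ← sumMulti_sum, dqp_sum s c hu, mul_sum]
  congr 1
  ext α β
  exact sum_congr rfl fun k _ => by ring

theorem sumM_const_mul (c : ℂ) {u : Phase d → ℂ} (hu : ContDiff ℝ ∞ u) (m : ℕ) (x : Phase d) :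
    sumM g m (fun x => c * u x) x = c * sumM g m u x := by
  simpa using sumM_sum (g := g) (univ : Finset Unit) (u := fun _ => u) (fun _ => c)
    (fun _ _ => hu) m x

theorem poisson_sum {κ : Type*} (s : Finset κ) {u : κ → Phase d → ℂ} (c : κ → ℂ)
    (hg : ContDiff ℝ ∞ g) (hu : ∀ k ∈ s, ContDiff ℝ ∞ (u k)) (x : Phase d) :
    poisson (toC g) (fun x => ∑ k ∈ s, c k * u k x) x =
      ∑ k ∈ s, c k * poisson (toC g) (u k) x := by
  have h1 : HasFDerivAt (fun x => ∑ k ∈ s, c k * u k x) (∑ k ∈ s, c k • fderiv ℝ (u k) x) x :=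
    HasFDerivAt.fun_sum fun k hk =>
      (((hu k hk).differentiable (by simp)).differentiableAt.hasFDerivAt).const_mul (c k)
  simp only [poisson_eq_fderiv hg, h1.fderiv]
  simp

theorem poisson_const_mul (c : ℂ) (hg : ContDiff ℝ ∞ g) {u : Phase d → ℂ}
    (hu : ContDiff ℝ ∞ u) (x : Phase d) :
    poisson (toC g) (fun x => c * u x) x = c * poisson (toC g) u x := by
  simpa using poisson_sum (g := g) (univ : Finset Unit) (u := fun _ => u) (fun _ => c) hg
    (fun _ _ => hu) x

theorem sum_composition_zero {M : Type*} [AddCommMonoid M] (F : List ℕ → M) :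
    ∑ c : Composition 0, F c.blocks = F [] := by
  have h : ∀ c : Composition 0, c.blocks = [] := fun c => by
    rcases hb : c.blocks with _ | ⟨m, l⟩
    · rfl
    · have hs := c.blocks_sum
      have hm : 0 < m := c.blocks_pos (by simp [hb])
      simp only [hb, List.sum_cons] at hs
      omega
  have hu : (univ : Finset (Composition 0)) = {⟨[], by simp, by simp⟩} := by
    ext c
    simp only [mem_univ, mem_singleton, true_iff]
    exact Composition.ext (h c)
  rw [hu, sum_singleton]

/-- Splitting off the first block of a composition. -/
theorem sum_composition_succ {M : Type*} [AddCommMonoid M] (n : ℕ) (F : List ℕ → M) :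
    ∑ c : Composition (n + 1), F c.blocks =
      ∑ m ∈ range (n + 1), ∑ c : Composition (n - m), F ((m + 1) :: c.blocks) := by
  rw [sum_sigma']
  symm
  refine sum_bij (fun (p : Σ m : ℕ, Composition (n - m)) hp => (⟨(p.1 + 1) :: p.2.blocks, ?_, ?_⟩ :
    Composition (n + 1))) ?_ ?_ ?_ ?_
  · intro i hi
    rcases List.mem_cons.1 hi with h | h
    · omega
    · exact p.2.blocks_pos h
  · have : p.1 < n + 1 := by simpa using hp
    simp only [List.sum_cons, p.2.blocks_sum]
    omega
  · intro _ _; exact mem_univ _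
  · rintro ⟨m, c⟩ _ ⟨m', c'⟩ _ h
    have h2 := congrArg Composition.blocks h
    simp only [List.cons.injEq, add_left_inj] at h2
    obtain ⟨rfl, h3⟩ := h2
    rw [Composition.ext h3]
  · intro c _
    rcases hb : c.blocks with _ | ⟨m, l⟩
    · have := c.blocks_sum
      simp [hb] at this
    · have hs := c.blocks_sum
      have hm : 0 < m := c.blocks_pos (by simp [hb])
      simp only [hb, List.sum_cons] at hs
      refine ⟨⟨m - 1, ⟨l, fun {i} hi => c.blocks_pos (by simp [hb, hi]), by omega⟩⟩, by
        simp; omega, ?_⟩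
      refine Composition.ext ?_
      simp only [hb]
      congr 1
      omega
  · intro _ _; rfl

/-- The sum of the iterated integrals over all compositions of `n`. -/
def iterSum (g : Phase d → ℝ) (f : Phase d → ℂ) (n : ℕ) (s : ℝ) (x : Phase d) : ℂ :=
  ∑ c : Composition n, iterTerm g f c.blocks s x

theorem egorovL_even (n : ℕ) (s : ℝ) (f : Phase d → ℂ) :
    egorovL g (2 * n) s f = fun x => ((2 * I) ^ (2 * n))⁻¹ * iterSum g f n s x := by
  ext x
  rw [egorovL, if_pos (even_two_mul n)]
  have h : 2 * n / 2 = n := by omega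
  rw [iterSum]
  congr 1
  rw [h]

theorem egorovL_odd {j : ℕ} (hj : Odd j) (s : ℝ) (f : Phase d → ℂ) :
    egorovL g j s f = fun _ => 0 := by
  ext x
  rw [egorovL, if_neg (Nat.not_even_iff_odd.2 hj)]

theorem iterSum_slabB (hg : BddD Set.univ ⊤ g) {f : Phase d → ℂ} (hf : BddD Set.univ ⊤ f) (n : ℕ) :
    SlabB fun p => iterSum g f n p.1 p.2 := fun T =>
  BddD.sum _ fun c _ => iterTerm_slabB hg hf c.blocks T

theorem egorovL_slabB (hg : BddD Set.univ ⊤ g) {f : Phase d → ℂ} (hf : BddD Set.univ ⊤ f) (j : ℕ) :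
    SlabB fun p => egorovL g j p.1 f p.2 := by
  rcases Nat.even_or_odd' j with ⟨n, rfl | rfl⟩
  · simp only [egorovL_even]
    exact fun T => (iterSum_slabB hg hf n T).const_mul _
  · simp only [egorovL_odd (odd_two_mul_add_one n)]
    exact fun T => BddD.const _ _ 0

theorem iterSum_zero_eq (f : Phase d → ℂ) (s : ℝ) (x : Phase d) :
    iterSum g f 0 s x = iterTerm g f [] s x := by
  exact sum_composition_zero fun l => iterTerm g f l s x

/-- Only the outermost operator is released by differentiation, so compositions are grouped by their
first block `m + 1`; what follows it is an arbitrary composition of `n - 1 - m`. -/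
theorem iterSum_hasDerivAt (hg : BddD Set.univ ⊤ g) {f : Phase d → ℂ} (hf : BddD Set.univ ⊤ f)
    (n : ℕ) (s : ℝ) (x : Phase d) :
    HasDerivAt (fun s => iterSum g f n s x) (poisson (toC g) (iterSum g f n s) x +
      ∑ m ∈ range n, sumM g (m + 1) (iterSum g f (n - 1 - m) s) x) s := by
  have hcd : ∀ l, ContDiff ℝ ∞ (iterTerm g f l s) := fun l => ((iterTerm_slabB hg hf l).slice s).1
  have hpo : poisson (toC g) (iterSum g f n s) x =
      ∑ c : Composition n, poisson (toC g) (iterTerm g f c.blocks s) x := by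
    have := poisson_sum (g := g) univ (u := fun c : Composition n => iterTerm g f c.blocks s)
      (fun _ => 1) hg.1 (fun c _ => hcd _) x
    simp only [one_mul] at this
    exact this
  rw [hpo]
  rcases n with _ | n
  · simp only [range_zero, sum_empty, add_zero, iterSum_zero_eq]
    rw [sum_composition_zero fun l => poisson (toC g) (iterTerm g f l s) x]
    exact iterTerm_nil_hasDerivAt hg hf s x
  · have h1 : ∀ m, sumM g (m + 1) (iterSum g f (n - m) s) x =
        ∑ c : Composition (n - m), sumM g (m + 1) (iterTerm g f c.blocks s) x := by
      intro m
      have := sumM_sum (g := g) univ (u := fun c : Composition (n - m) => iterTerm g f c.blocks s)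
        (fun _ => 1) (fun c _ => hcd _) (m + 1) x
      simp only [one_mul] at this
      exact this
    simp only [add_tsub_cancel_right, h1]
    rw [sum_composition_succ n fun l => poisson (toC g) (iterTerm g f l s) x, ← sum_add_distrib]
    simp only [← sum_add_distrib]
    have h2 : (fun s => iterSum g f (n + 1) s x) = fun s => ∑ m ∈ range (n + 1),
        ∑ c : Composition (n - m), iterTerm g f ((m + 1) :: c.blocks) s x :=
      funext fun s => sum_composition_succ n fun l => iterTerm g f l s x
    rw [h2]
    exact HasDerivAt.fun_sum fun m _ => HasDerivAt.fun_sum fun c _ =>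
      iterTerm_cons_hasDerivAt hg hf (m + 1) c.blocks s x

theorem moyalTerm_zero_right (k : ℕ) (f : Phase d → ℂ) (x : Phase d) :
    moyalTerm k f (fun _ => 0) x = 0 := by
  simp [moyalTerm, sumMulti, dqp_zero]

/-- For even `j` the first block `m + 1` corresponds to the Moyal order `k = 1 + 2(m + 1)`, and the
powers of `2i` in `L_j` and in the Moyal term multiply up correctly. For odd `j` and odd `k` the
index `j + 1 - k` is odd, so both sides vanish. -/
theorem egorovL_hasDerivAt (hg : BddD Set.univ ⊤ g) {f : Phase d → ℂ} (hf : BddD Set.univ ⊤ f)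
    (j : ℕ) (s : ℝ) (x : Phase d) :
    HasDerivAt (fun s' => egorovL g j s' f x)
      (poisson (toC g) (egorovL g j s f) x +
        2 * I * ∑ k ∈ Icc 3 (j + 1) with Odd k,
          moyalTerm k (toC g) (egorovL g (j + 1 - k) s f) x) s := by
  rcases Nat.even_or_odd' j with ⟨n, rfl | rfl⟩
  · simp only [egorovL_even]
    have h1 := (iterSum_hasDerivAt hg hf n s x).const_mul ((2 * I) ^ (2 * n) : ℂ)⁻¹
    refine h1.congr_deriv ?_
    have hcd : ∀ n, ContDiff ℝ ∞ (iterSum g f n s) := fun n => ((iterSum_slabB hg hf n).slice s).1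
    rw [mul_add, poisson_const_mul _ hg.1 (hcd n)]
    congr 1
    rw [mul_sum, mul_sum]
    refine sum_bij (fun m _ => 1 + 2 * (m + 1)) ?_ ?_ ?_ ?_
    · intro m hm
      simp only [mem_range, mem_filter, mem_Icc] at hm ⊢
      exact ⟨⟨by omega, by omega⟩, by rw [add_comm]; exact odd_two_mul_add_one _⟩
    · intro a _ b _ h; omega
    · intro k hk
      simp only [mem_filter, mem_Icc] at hk
      obtain ⟨⟨hk1, hk2⟩, r, rfl⟩ := hk
      exact ⟨r - 1, by simp; omega, by omega⟩
    · intro m hm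
      have hm' : m < n := by simpa using hm
      have e : 2 * n + 1 - (1 + 2 * (m + 1)) = 2 * (n - 1 - m) := by omega
      rw [moyalTerm_odd, e, egorovL_even]
      rw [sumM_const_mul _ (hcd _), ← mul_assoc, ← mul_inv, ← pow_add]
      congr 4
      omega
  · have hodd := odd_two_mul_add_one n
    simp only [egorovL_odd hodd]
    have h0 : ∑ k ∈ Icc 3 (2 * n + 1 + 1) with Odd k,
        moyalTerm k (toC g) (egorovL g (2 * n + 1 + 1 - k) s f) x = 0 := by
      refine sum_eq_zero fun k hk => ?_
      simp only [mem_filter, mem_Icc] at hk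
      obtain ⟨⟨hk1, hk2⟩, r, rfl⟩ := hk
      rw [egorovL_odd ⟨n - r, by omega⟩, moyalTerm_zero_right]
    rw [h0, poisson_zero]
    simpa using hasDerivAt_const s (0 : ℂ)

theorem egorovL_zero_time (hg : BddD Set.univ ⊤ g) (j : ℕ) (f : Phase d → ℂ) :
    egorovL g j 0 f = if j = 0 then f else 0 := by
  have h := isFlow_hamFlow hg
  rcases Nat.even_or_odd' j with ⟨n, rfl | rfl⟩
  · rw [egorovL_even]
    rcases n with _ | n
    · ext x
      simp [iterSum_zero_eq, iterTerm, (h x).1]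
    · rw [if_neg (by omega)]
      ext x
      rw [iterSum, sum_composition_succ n fun l => iterTerm g f l 0 x]
      simp [iterTerm_zero]
  · rw [egorovL_odd (odd_two_mul_add_one n), if_neg (by omega)]
    rfl

theorem solvesTransport_of_class (B : (Phase d → ℂ) → Prop) (hg : BddD Set.univ ⊤ g)
    {f : Phase d → ℂ} (hf : BddD Set.univ ⊤ f) (hB : ∀ j s, B (egorovL g j s f)) :
    SolvesTransport B g f := fun j =>
  ⟨hB j, egorovL_zero_time hg j f, egorovL_hasDerivAt hg hf j⟩

end Transport

/-! ### Periodicity of the transported symbols -/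

section Periodic

variable {d : ℕ} {g : Phase d → ℝ}

/-- The Hamiltonian field is invariant under `v`, so a translated trajectory is again a trajectory,
and uniqueness applies. -/
theorem hamFlow_add_const (hg : BddD Set.univ ⊤ g) {v : Phase d} (hv : ∀ x, g (x + v) = g x)
    (s : ℝ) (x : Phase d) : hamFlow g s (x + v) = hamFlow g s x + v := by
  have h := isFlow_hamFlow hg
  obtain ⟨K, -, hK, -⟩ := hg.hamField.exists_lipschitz
  have hX : ∀ y, hamField g (y + v) = hamField g y := by
    intro y
    have e : fderiv ℝ g (y + v) = fderiv ℝ g y := by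
      rw [← fderiv_comp_add_right v, funext hv]
    obtain ⟨L, hL⟩ := hamField_eq g
    rw [hL, hL, e]
  have := h.eq_of_solution hK (γ := fun s => hamFlow g s x + v)
    (fun s => by rw [hX]; exact ((h x).2 s).add_const v) s
  simpa [(h x).1] using this.symm

theorem iterTerm_add_const (hg : BddD Set.univ ⊤ g) {v : Phase d} (hv : ∀ x, g (x + v) = g x)
    {f : Phase d → ℂ} (hf : ∀ x, f (x + v) = f x) (l : List ℕ) (s : ℝ) (x : Phase d) :
    iterTerm g f l s (x + v) = iterTerm g f l s x := by
  induction l generalizing s x with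
  | nil => simp only [iterTerm, hamFlow_add_const hg hv, hf]
  | cons m l ih =>
    have hgC : ∀ x, toC g (x + v) = toC g x := fun x => by simp [toC, hv]
    simp only [iterTerm, hamFlow_add_const hg hv, sumM, dqp_add_const hgC, dqp_add_const (ih _)]

theorem egorovL_isTorusSymbol (hg : IsTorusSymbol g) {f : Phase d → ℂ} (hf : IsTorusSymbol f)
    (j : ℕ) (s : ℝ) : IsTorusSymbol (egorovL g j s f) := by
  refine ⟨((egorovL_slabB hg.bddD hf.bddD j).slice s).1, fun x m n => ?_⟩
  simp only [egorovL, iterTerm_add_const hg.bddD (fun x => hg.2 x m n) (fun x => hf.2 x m n)]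

theorem moyalTerm_isTorusSymbol {f g : Phase d → ℂ} (hf : IsTorusSymbol f) (hg : IsTorusSymbol g)
    (j : ℕ) : IsTorusSymbol (moyalTerm j f g) := by
  refine ⟨(hf.bddD.moyalTerm hg.bddD j).1, fun x m n => ?_⟩
  simp only [moyalTerm, dqp_add_const (fun x => hf.2 x m n), dqp_add_const (fun x => hg.2 x m n)]

end Periodic

/-! ### Polynomial weights and Peetre's inequality -/

section Weights

variable {V : Type*} [NormedAddCommGroup V]

/-- The weight `(1 + ‖x‖)^{-N}`. -/
def jd (N : ℕ) (x : V) : ℝ := ((1 + ‖x‖) ^ N)⁻¹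

theorem jd_pos (N : ℕ) (x : V) : 0 < jd N x := by unfold jd; positivity

theorem jd_nonneg (N : ℕ) (x : V) : 0 ≤ jd N x := (jd_pos N x).le

theorem jd_le_one (N : ℕ) (x : V) : jd N x ≤ 1 :=
  inv_le_one_of_one_le₀ (one_le_pow₀ (by linarith [norm_nonneg x]))

@[simp] theorem jd_neg (N : ℕ) (x : V) : jd N (-x) = jd N x := by simp [jd]

@[simp] theorem jd_zero_exp (x : V) : jd 0 x = 1 := by simp [jd]

theorem jd_sub_comm (N : ℕ) (x y : V) : jd N (x - y) = jd N (y - x) := by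
  rw [← jd_neg, neg_sub]

theorem jd_add_exp (M N : ℕ) (x : V) : jd (M + N) x = jd M x * jd N x := by
  simp [jd, pow_add, mul_comm]

theorem jd_anti {M N : ℕ} (h : M ≤ N) (x : V) : jd N x ≤ jd M x := by
  unfold jd
  gcongr
  linarith [norm_nonneg x]

theorem jd_le_of_norm_le {W : Type*} [NormedAddCommGroup W] (N : ℕ) {x : V} {y : W}
    (h : ‖y‖ ≤ ‖x‖) : jd N x ≤ jd N y := by
  unfold jd
  gcongr

/-- Peetre's inequality, from `1 + ‖z‖ ≤ (1 + ‖x‖)(1 + ‖y‖)`. The three points may live in different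
spaces, so that it also compares components with pairs. -/
theorem jd_mul_le_of {W X : Type*} [NormedAddCommGroup W] [NormedAddCommGroup X] (N : ℕ) {x : V}
    {y : W} {z : X} (h : ‖z‖ ≤ ‖x‖ + ‖y‖) : jd N x * jd N y ≤ jd N z := by
  unfold jd
  rw [← mul_inv, ← mul_pow]
  gcongr
  nlinarith [mul_nonneg (norm_nonneg x) (norm_nonneg y)]

theorem jd_mul_le (N : ℕ) (x y : V) : jd N x * jd N y ≤ jd N (x + y) :=
  jd_mul_le_of N (norm_add_le x y)

theorem jd_mul_le_sub (N : ℕ) (x y : V) : jd N x * jd N y ≤ jd N (x - y) :=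
  jd_mul_le_of N (norm_sub_le x y)

theorem pow_mul_jd (N : ℕ) (x : V) : (1 + ‖x‖) ^ N * jd N x = 1 := by
  unfold jd
  exact mul_inv_cancel₀ (by positivity)

theorem le_jd_iff {a C : ℝ} (N : ℕ) (x : V) : a ≤ C * jd N x ↔ (1 + ‖x‖) ^ N * a ≤ C := by
  unfold jd
  rw [← div_eq_mul_inv, le_div_iff₀ (by positivity), mul_comm]

theorem one_add_pow_mul_jd (k N : ℕ) (x : V) : (1 + ‖x‖) ^ k * jd (N + k) x = jd N x := by
  rw [jd_add_exp, mul_left_comm, pow_mul_jd, mul_one]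

theorem continuous_jd (N : ℕ) : Continuous (jd N : V → ℝ) := by
  unfold jd
  exact Continuous.inv₀ (by fun_prop) fun x => by positivity

theorem jd_mul_le_prod {W : Type*} [NormedAddCommGroup W] (N : ℕ) (x : V) (y : W) :
    jd N x * jd N y ≤ jd N (x, y) :=
  jd_mul_le_of N (by
    rw [Prod.norm_def]
    exact max_le (by simp) (by simp))

variable [MeasurableSpace V]

theorem integral_jd_nonneg (μ : Measure V) (N : ℕ) : 0 ≤ ∫ x, jd N x ∂μ :=
  integral_nonneg fun x => jd_nonneg N x

variable [NormedSpace ℝ V] [FiniteDimensional ℝ V] [BorelSpace V]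

theorem integrable_jd (μ : Measure V) [μ.IsAddHaarMeasure] {N : ℕ}
    (hN : Module.finrank ℝ V < N) : Integrable (jd N : V → ℝ) μ := by
  have := integrable_one_add_norm (μ := μ) (E := V) (r := N) (by exact_mod_cast hN)
  refine this.congr (Filter.Eventually.of_forall fun x => ?_)
  simp only [jd]
  rw [Real.rpow_neg (by positivity), Real.rpow_natCast]

theorem integrable_of_le_jd {F : Type*} [NormedAddCommGroup F] (μ : Measure V)
    [μ.IsAddHaarMeasure] {N : ℕ} (hN : Module.finrank ℝ V < N) {f : V → F}
    (hf : AEStronglyMeasurable f μ) {C : ℝ} (h : ∀ x, ‖f x‖ ≤ C * jd N x) : Integrable f μ :=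
  ((integrable_jd μ hN).const_mul C).mono' hf (Filter.Eventually.of_forall h)

end Weights

/-! ### Characters and modulated translates -/

section Oscillating

variable {V : Type*} [NormedAddCommGroup V] [NormedSpace ℝ V]

/-- The character `x ↦ exp(i ℓ(x))`. -/
def chi (ℓ : V →L[ℝ] ℝ) (x : V) : ℂ := cexp (I * (ℓ x : ℂ))

@[simp] theorem norm_chi (ℓ : V →L[ℝ] ℝ) (x : V) : ‖chi ℓ x‖ = 1 := by
  simp [chi, mul_comm I, Complex.norm_exp_ofReal_mul_I]

theorem contDiff_cexp_I : ContDiff ℝ ∞ fun t : ℝ => cexp (I * (t : ℂ)) :=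
  (contDiff_const.mul Complex.ofRealCLM.contDiff).cexp

theorem norm_iteratedFDeriv_cexp_I (k : ℕ) (t : ℝ) :
    ‖iteratedFDeriv ℝ k (fun t : ℝ => cexp (I * (t : ℂ))) t‖ = 1 := by
  have key : ∀ n : ℕ, iteratedDeriv n (fun x : ℝ => cexp (I * (x : ℂ))) =
      fun x : ℝ => I ^ n * cexp (I * (x : ℂ)) := by
    intro n
    induction n with
    | zero => ext x; simp
    | succ n ih =>
      ext x
      rw [iteratedDeriv_succ, ih]
      have h1 : HasDerivAt (fun x : ℝ => I * (x : ℂ)) I x := by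
        simpa using (Complex.ofRealCLM.hasDerivAt (x := x)).const_mul I
      rw [((h1.cexp).const_mul (I ^ n)).deriv]
      ring
  rw [norm_iteratedFDeriv_eq_norm_iteratedDeriv, key k]
  simp [mul_comm I, Complex.norm_exp_ofReal_mul_I]

theorem contDiff_chi (ℓ : V →L[ℝ] ℝ) : ContDiff ℝ ∞ (chi ℓ) :=
  contDiff_cexp_I.comp ℓ.contDiff

theorem continuous_chi (ℓ : V →L[ℝ] ℝ) : Continuous (chi ℓ) := (contDiff_chi ℓ).continuous

theorem norm_iteratedFDeriv_chi_le (ℓ : V →L[ℝ] ℝ) (k : ℕ) (x : V) :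
    ‖iteratedFDeriv ℝ k (chi ℓ) x‖ ≤ ‖ℓ‖ ^ k := by
  have := norm_iteratedFDeriv_comp_clm_le contDiff_cexp_I ℓ k x
  rwa [norm_iteratedFDeriv_cexp_I, one_mul] at this

theorem chi_hasFDerivAt (ℓ : V →L[ℝ] ℝ) (x : V) :
    HasFDerivAt (chi ℓ) ((I * chi ℓ x) • (Complex.ofRealCLM.comp ℓ)) x := by
  have h1 : HasFDerivAt (fun x => I * (ℓ x : ℂ)) (I • (Complex.ofRealCLM.comp ℓ)) x :=
    ((Complex.ofRealCLM.hasFDerivAt).comp x ℓ.hasFDerivAt).const_mul I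
  have h2 := h1.cexp
  rw [smul_smul, mul_comm] at h2
  exact h2

theorem chi_neg (ℓ : V →L[ℝ] ℝ) (x : V) : chi (-ℓ) x = starRingEnd ℂ (chi ℓ x) := by
  simp [chi, ← Complex.exp_conj]

theorem norm_iteratedFDeriv_mul_le_pow {f g : V → ℂ} (hf : ContDiff ℝ ∞ f) (hg : ContDiff ℝ ∞ g)
    (x : V) (n : ℕ) {A B : ℝ} (hA0 : 0 ≤ A) (hA : ∀ k ≤ n, ‖iteratedFDeriv ℝ k f x‖ ≤ A)
    (hB : ∀ k ≤ n, ‖iteratedFDeriv ℝ k g x‖ ≤ B) :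
    ‖iteratedFDeriv ℝ n (fun x => f x * g x) x‖ ≤ 2 ^ n * (A * B) := by
  have hB0 : 0 ≤ B := (norm_nonneg _).trans (hB 0 (Nat.zero_le _))
  refine (norm_iteratedFDeriv_mul_le (N := ∞) hf hg x (by exact_mod_cast le_top)).trans ?_
  calc ∑ i ∈ range (n + 1), (n.choose i : ℝ) * ‖iteratedFDeriv ℝ i f x‖ *
        ‖iteratedFDeriv ℝ (n - i) g x‖ ≤ ∑ i ∈ range (n + 1), (n.choose i : ℝ) * (A * B) := by
        refine sum_le_sum fun i hi => ?_
        rw [mul_assoc]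
        have := mem_range.1 hi
        gcongr
        · exact hA i (by omega)
        · exact hB (n - i) (by omega)
    _ = 2 ^ n * (A * B) := by
        rw [← sum_mul]
        congr 1
        exact_mod_cast Nat.sum_range_choose n

/-- Derivatives of a modulated translate. -/
theorem norm_iteratedFDeriv_packet_le {g : V → ℂ} (hg : ContDiff ℝ ∞ g) (ℓ : V →L[ℝ] ℝ) (y x : V)
    (n : ℕ) {C : ℝ} (hC : ∀ k ≤ n, ‖iteratedFDeriv ℝ k g (x - y)‖ ≤ C) :
    ‖iteratedFDeriv ℝ n (fun x => g (x - y) * chi ℓ x) x‖ ≤ 2 ^ n * (C * (1 + ‖ℓ‖) ^ n) := by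
  have hC0 : 0 ≤ C := (norm_nonneg _).trans (hC 0 (Nat.zero_le _))
  refine norm_iteratedFDeriv_mul_le_pow (hg.comp (contDiff_id.sub contDiff_const))
    (contDiff_chi ℓ) x n hC0 (fun k hk => ?_) fun k hk => ?_
  · have : iteratedFDeriv ℝ k (g ∘ fun x => id x - y) x = iteratedFDeriv ℝ k g (x - y) :=
      iteratedFDeriv_comp_sub k y x
    rw [this]
    exact hC k hk
  · calc _ ≤ ‖ℓ‖ ^ k := norm_iteratedFDeriv_chi_le ℓ k x
      _ ≤ (1 + ‖ℓ‖) ^ k := by gcongr; linarith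
      _ ≤ (1 + ‖ℓ‖) ^ n := pow_le_pow_right₀ (by linarith [norm_nonneg ℓ]) hk

end Oscillating

/-! ### Decay of oscillatory integrals by integration by parts -/

section NonStationary

variable {V : Type*} [NormedAddCommGroup V] [NormedSpace ℝ V] [FiniteDimensional ℝ V]
  [MeasurableSpace V] [BorelSpace V] (μ : Measure V) [μ.IsAddHaarMeasure]

/-- Each integration by parts in the direction `v` moves one derivative onto `u` and gains one
factor `ℓ v`; the bound on `‖v‖` keeps the dominating function unchanged. -/
theorem pow_mul_norm_integral_chi_le (ℓ : V →L[ℝ] ℝ) {v : V} (hv : ‖v‖ ≤ 1) {m : V → ℝ}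
    (hm : Integrable m μ) (k : ℕ) : ∀ {u : V → ℂ}, ContDiff ℝ ∞ u →
    (∀ j ≤ k, ∀ x, ‖iteratedFDeriv ℝ j u x‖ ≤ m x) →
    |ℓ v| ^ k * ‖∫ x, u x * chi ℓ x ∂μ‖ ≤ ∫ x, m x ∂μ := by
  induction k with
  | zero =>
    intro u hu hb
    rw [pow_zero, one_mul]
    refine norm_integral_le_of_norm_le hm (Filter.Eventually.of_forall fun x => ?_)
    simpa using hb 0 le_rfl x
  | succ k ih =>
    intro u hu hb
    have hu' : ContDiff ℝ ∞ fun x => fderiv ℝ u x v :=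
      (hu.fderiv_right (m := ∞) (by simp)).clm_apply contDiff_const
    have hb' : ∀ j ≤ k, ∀ x, ‖iteratedFDeriv ℝ j (fun x => fderiv ℝ u x v) x‖ ≤ m x := by
      intro j hj x
      have h1 := (ContinuousLinearMap.apply ℝ ℂ v).norm_iteratedFDeriv_comp_left
        (f := fderiv ℝ u) (x := x) (n := j) (N := ∞)
        ((hu.fderiv_right (m := ∞) (by simp)).contDiffAt) (by exact_mod_cast le_top)
      have h2 : ‖ContinuousLinearMap.apply ℝ ℂ v‖ ≤ 1 :=
        ContinuousLinearMap.opNorm_le_bound _ zero_le_one fun f => by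
          simp only [ContinuousLinearMap.apply_apply, one_mul]
          exact (f.le_opNorm v).trans (mul_le_of_le_one_right (norm_nonneg _) hv)
      refine h1.trans ((mul_le_of_le_one_left (norm_nonneg _) h2).trans ?_)
      rw [norm_iteratedFDeriv_fderiv]
      exact hb (j + 1) (by omega) x
    have hint : ∀ {w : V → ℂ}, ContDiff ℝ ∞ w → (∀ x, ‖w x‖ ≤ m x) → ∀ c : V → ℂ, Continuous c →
        (∃ C, ∀ x, ‖c x‖ ≤ C) → Integrable (fun x => w x * c x) μ := by
      rintro w hw hwm c hc ⟨C, hC⟩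
      refine (hm.const_mul C).mono' (hw.continuous.mul hc).aestronglyMeasurable
        (Filter.Eventually.of_forall fun x => ?_)
      rw [norm_mul, mul_comm]
      exact mul_le_mul (hC x) (hwm x) (norm_nonneg _) ((norm_nonneg _).trans (hC x))
    have hder : ∀ x, fderiv ℝ (chi ℓ) x v = I * chi ℓ x * (ℓ v : ℂ) := fun x => by
      rw [(chi_hasFDerivAt ℓ x).fderiv]; simp
    have hu0 : ∀ x, ‖u x‖ ≤ m x := fun x => by simpa using hb 0 (Nat.zero_le _) x
    have hu1 : ∀ x, ‖fderiv ℝ u x v‖ ≤ m x := fun x => by simpa using hb' 0 (Nat.zero_le _) x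
    have key := integral_mul_fderiv_eq_neg_fderiv_mul_of_integrable (μ := μ) (v := v)
      (f := u) (g := chi ℓ)
      (hint hu' hu1 _ (continuous_chi ℓ) ⟨1, fun x => by simp⟩)
      (hint hu hu0 _ (by
        simp only [hder]
        exact (continuous_const.mul (continuous_chi ℓ)).mul continuous_const)
        ⟨‖ℓ v‖, fun x => by simp [hder]⟩)
      (hint hu hu0 _ (continuous_chi ℓ) ⟨1, fun x => by simp⟩)
      (fun x _ => hu.differentiable (by simp) x)
      (fun x _ => (contDiff_chi ℓ).differentiable (by simp) x)
    have e : ∫ x, u x * fderiv ℝ (chi ℓ) x v ∂μ = (I * (ℓ v : ℂ)) * ∫ x, u x * chi ℓ x ∂μ := by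
      rw [← integral_const_mul]
      refine integral_congr_ae (Filter.Eventually.of_forall fun x => ?_)
      simp only [hder]
      ring
    rw [e] at key
    have h3 := ih hu' hb'
    have h4 : |ℓ v| * ‖∫ x, u x * chi ℓ x ∂μ‖ = ‖∫ x, fderiv ℝ u x v * chi ℓ x ∂μ‖ := by
      rw [← norm_neg (∫ x, fderiv ℝ u x v * chi ℓ x ∂μ), ← key]
      simp
    rw [pow_succ, mul_assoc, h4]
    exact h3

/-- For `‖ℓ‖ ≤ 1` no gain is needed. Otherwise some `v` in the unit ball has `|ℓ v| > ‖ℓ‖ / 2`, so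
`1 + ‖ℓ‖ ≤ 4 |ℓ v|`; this is the source of the constant `4 ^ N`. -/
theorem norm_integral_chi_le (ℓ : V →L[ℝ] ℝ) {m : V → ℝ} (hm : Integrable m μ) (N : ℕ) {u : V → ℂ}
    (hu : ContDiff ℝ ∞ u) (hb : ∀ j ≤ N, ∀ x, ‖iteratedFDeriv ℝ j u x‖ ≤ m x) :
    ‖∫ x, u x * chi ℓ x ∂μ‖ ≤ 4 ^ N * (∫ x, m x ∂μ) * jd N ℓ := by
  rw [le_jd_iff]
  set A := ‖∫ x, u x * chi ℓ x ∂μ‖ with hA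
  have hA0 : 0 ≤ A := norm_nonneg _
  have h0 : A ≤ ∫ x, m x ∂μ := by
    have := pow_mul_norm_integral_chi_le μ ℓ (v := 0) (by simp) hm 0 hu
      fun j hj => hb j (by omega)
    simpa using this
  have hI : 0 ≤ ∫ x, m x ∂μ := hA0.trans h0
  rcases le_or_gt ‖ℓ‖ 1 with h1 | h1
  · exact mul_le_mul (pow_le_pow_left₀ (by positivity) (by linarith) N) h0 hA0 (by positivity)
  · obtain ⟨v, hv, hv2⟩ := ℓ.exists_lt_apply_of_lt_opNorm (r := ‖ℓ‖ / 2) (by linarith)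
    have h2 := pow_mul_norm_integral_chi_le μ ℓ (v := v) hv.le hm N hu hb
    rw [Real.norm_eq_abs] at hv2
    calc (1 + ‖ℓ‖) ^ N * A ≤ (4 * |ℓ v|) ^ N * A := by
          gcongr
          linarith
      _ = 4 ^ N * (|ℓ v| ^ N * A) := by rw [mul_pow]; ring
      _ ≤ _ := by gcongr

/-- Decay of windowed Fourier integrals. -/
theorem norm_windowed_integral_le (ℓ : V →L[ℝ] ℝ) (y : V) (N : ℕ) {W f : V → ℂ}
    (hW : ContDiff ℝ ∞ W) (hf : ContDiff ℝ ∞ f) {C : ℝ} {w : V → ℝ} (hw : Integrable w μ)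
    {b₁ b₂ : V → ℝ} (h₁ : ∀ j ≤ N, ∀ x, ‖iteratedFDeriv ℝ j W (x - y)‖ ≤ b₁ x)
    (h₂ : ∀ j ≤ N, ∀ x, ‖iteratedFDeriv ℝ j f x‖ ≤ b₂ x) (hb : ∀ x, b₁ x * b₂ x ≤ C * w x) :
    ‖∫ x, W (x - y) * f x * chi ℓ x ∂μ‖ ≤ 8 ^ N * C * (∫ x, w x ∂μ) * jd N ℓ := by
  have := norm_integral_chi_le μ ℓ (m := fun x => 2 ^ N * (C * w x))
    ((hw.const_mul C).const_mul _) N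
    (u := fun x => W (x - y) * f x) ((hW.comp (contDiff_id.sub contDiff_const)).mul hf)
    fun j hj x => by
      have h0 : 0 ≤ b₁ x := (norm_nonneg _).trans (h₁ 0 (Nat.zero_le _) x)
      have h0' : 0 ≤ b₂ x := (norm_nonneg _).trans (h₂ 0 (Nat.zero_le _) x)
      refine (norm_iteratedFDeriv_mul_le_pow (hW.comp (contDiff_id.sub contDiff_const)) hf x j h0
        (fun k hk => ?_) fun k hk => h₂ k (by omega) x).trans ?_
      · have : iteratedFDeriv ℝ k (W ∘ fun x => id x - y) x = iteratedFDeriv ℝ k W (x - y) :=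
          iteratedFDeriv_comp_sub k y x
        rw [this]
        exact h₁ k (by omega) x
      · exact mul_le_mul (pow_le_pow_right₀ (by norm_num) hj) (hb x) (mul_nonneg h0 h0')
          (by positivity)
  refine this.trans (le_of_eq ?_)
  rw [integral_const_mul, integral_const_mul, show (8 : ℝ) = 4 * 2 by norm_num, mul_pow]
  ring

end NonStationary

/-! ### Gaussians and their derivatives -/

section Gaussian

variable {V : Type*} [NormedAddCommGroup V] [NormedSpace ℝ V]

theorem exp_neg_sq_le_jd {c : ℝ} (hc : 0 < c) (N : ℕ) (r : ℝ) (hr : 0 ≤ r) :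
    Real.exp (-(c * r ^ 2)) ≤ Real.exp (N ^ 2 / (4 * c)) * ((1 + r) ^ N)⁻¹ := by
  rw [← div_eq_mul_inv, le_div_iff₀ (by positivity)]
  have h1 : (1 + r) ^ N ≤ Real.exp (N * r) := by
    rw [Real.exp_nat_mul]
    gcongr
    linarith [Real.add_one_le_exp r]
  calc Real.exp (-(c * r ^ 2)) * (1 + r) ^ N ≤ Real.exp (-(c * r ^ 2)) * Real.exp (N * r) := by
        gcongr
    _ = Real.exp (-(c * r ^ 2) + N * r) := by rw [Real.exp_add]
    _ ≤ _ := by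
        gcongr
        rw [le_div_iff₀ (by positivity)]
        nlinarith [sq_nonneg (2 * c * r - N)]

/-- The Gaussian `exp(-B(x, x))`. -/
def gaussB (B : V →L[ℝ] V →L[ℝ] ℝ) (x : V) : ℂ := ((Real.exp (-(B x x)) : ℝ) : ℂ)

theorem contDiff_gaussB (B : V →L[ℝ] V →L[ℝ] ℝ) : ContDiff ℝ ∞ (gaussB B) := by
  unfold gaussB
  have : ContDiff ℝ ∞ fun x => B x x := B.contDiff.clm_apply contDiff_id
  exact Complex.ofRealCLM.contDiff.comp this.neg.exp

theorem norm_iteratedFDeriv_quadratic_le (B : V →L[ℝ] V →L[ℝ] ℝ) (i : ℕ) (x : V) :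
    ‖iteratedFDeriv ℝ i (fun x => -(B x x)) x‖ ≤ 2 ^ i * ‖B‖ * (1 + ‖x‖) ^ 2 := by
  have hid : ∀ j, ‖iteratedFDeriv ℝ j (fun x : V => x) x‖ ≤ 1 + ‖x‖ := by
    intro j
    rcases j with _ | j
    · simp
    · have := iteratedFDeriv_affine_bound (ContinuousLinearMap.id ℝ V) 0 (j + 1) (by omega) x
      simp only [ContinuousLinearMap.coe_id', id_eq, add_zero] at this
      refine this.trans ((pow_le_one₀ (norm_nonneg _) ContinuousLinearMap.norm_id_le).trans ?_)
      linarith [norm_nonneg x]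
  have h := B.norm_iteratedFDeriv_le_of_bilinear (N := ∞) (f := fun x : V => x) (g := fun x => x)
    contDiff_id contDiff_id x (n := i) (by exact_mod_cast le_top)
  have e : iteratedFDeriv ℝ i (fun x => -(B x x)) x = - iteratedFDeriv ℝ i (fun x => B x x) x :=
    iteratedFDeriv_neg_apply
  rw [e, norm_neg]
  refine h.trans ?_
  calc ‖B‖ * ∑ j ∈ range (i + 1), (i.choose j : ℝ) * ‖iteratedFDeriv ℝ j (fun x : V => x) x‖ *
        ‖iteratedFDeriv ℝ (i - j) (fun x : V => x) x‖
      ≤ ‖B‖ * ∑ j ∈ range (i + 1), (i.choose j : ℝ) * (1 + ‖x‖) ^ 2 := by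
        refine mul_le_mul_of_nonneg_left (sum_le_sum fun j _ => ?_) (norm_nonneg B)
        rw [mul_assoc, pow_two]
        refine mul_le_mul_of_nonneg_left ?_ (by positivity)
        exact mul_le_mul (hid _) (hid _) (norm_nonneg _) (by positivity)
    _ = 2 ^ i * ‖B‖ * (1 + ‖x‖) ^ 2 := by
        rw [← sum_mul]
        have : ∑ j ∈ range (i + 1), (i.choose j : ℝ) = 2 ^ i := by
          exact_mod_cast Nat.sum_range_choose i
        rw [this]; ring

/-- The `n`-th derivative is the Gaussian times a factor of growth at most `(1 + ‖x‖) ^ (2n)`, so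
the Gaussian is estimated by the weight of order `N + 2n`, the surplus absorbing this growth. -/
theorem gaussB_bound (B : V →L[ℝ] V →L[ℝ] ℝ) {c : ℝ} (hc : 0 < c) (hB : ∀ x, c * ‖x‖ ^ 2 ≤ B x x)
    (n N : ℕ) : ∃ C, 0 ≤ C ∧ ∀ x, ‖iteratedFDeriv ℝ n (gaussB B) x‖ ≤ C * jd N x := by
  set K := 2 * (1 + ‖B‖) with hK
  have hK1 : 1 ≤ K := by linarith [norm_nonneg B]
  have hq : ContDiff ℝ ∞ fun x => -(B x x) := (B.contDiff.clm_apply contDiff_id).neg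
  refine ⟨n.factorial * K ^ n * Real.exp (((N + 2 * n : ℕ) : ℝ) ^ 2 / (4 * c)), by positivity,
    fun x => ?_⟩
  have hx : 1 ≤ 1 + ‖x‖ := by linarith [norm_nonneg x]
  have h1 : ‖iteratedFDeriv ℝ n (gaussB B) x‖ ≤
      n.factorial * Real.exp (-(B x x)) * (K * (1 + ‖x‖) ^ 2) ^ n := by
    have hcomp : gaussB B = (fun t : ℝ => ((Real.exp t : ℝ) : ℂ)) ∘ fun x => -(B x x) := rfl
    rw [hcomp]
    refine norm_iteratedFDeriv_comp_le (N := ∞) (Complex.ofRealCLM.contDiff.comp Real.contDiff_exp)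
      hq (by exact_mod_cast le_top) x (fun i _ => ?_) fun i hi _ => ?_
    · have h2 := Complex.ofRealLI.norm_iteratedFDeriv_comp_left (f := Real.exp) (x := -(B x x))
        (i := i) (n := ∞) Real.contDiff_exp.contDiffAt (by exact_mod_cast le_top)
      have h3 : (⇑Complex.ofRealLI ∘ Real.exp) = ⇑ofRealCLM ∘ Real.exp := rfl
      rw [h3] at h2
      rw [h2, norm_iteratedFDeriv_eq_norm_iteratedDeriv, iteratedDeriv_eq_iterate, Real.iter_deriv_exp]
      simp [abs_of_pos (Real.exp_pos _)]
    · refine (norm_iteratedFDeriv_quadratic_le B i x).trans ?_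
      rw [mul_pow, hK, mul_pow]
      gcongr
      · calc ‖B‖ ≤ (1 + ‖B‖) ^ 1 := by simp
          _ ≤ (1 + ‖B‖) ^ i := pow_le_pow_right₀ (by linarith [norm_nonneg B]) hi
      · calc (1 + ‖x‖) ^ 2 = ((1 + ‖x‖) ^ 2) ^ 1 := by simp
          _ ≤ ((1 + ‖x‖) ^ 2) ^ i := pow_le_pow_right₀ (one_le_pow₀ hx) hi
  have h2 : Real.exp (-(B x x)) ≤
      Real.exp (((N + 2 * n : ℕ) : ℝ) ^ 2 / (4 * c)) * jd (N + 2 * n) x :=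
    (Real.exp_le_exp.2 (neg_le_neg (hB x))).trans
      (exp_neg_sq_le_jd hc (N + 2 * n) ‖x‖ (norm_nonneg x))
  calc _ ≤ _ := h1
    _ ≤ n.factorial * (Real.exp (((N + 2 * n : ℕ) : ℝ) ^ 2 / (4 * c)) * jd (N + 2 * n) x) *
        (K * (1 + ‖x‖) ^ 2) ^ n := by gcongr
    _ = n.factorial * K ^ n * Real.exp (((N + 2 * n : ℕ) : ℝ) ^ 2 / (4 * c)) *
        ((1 + ‖x‖) ^ (2 * n) * jd (N + 2 * n) x) := by rw [mul_pow, ← pow_mul]; ring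
    _ = _ := by rw [one_add_pow_mul_jd]

end Gaussian

/-! ### Rapidly decreasing functions -/

section SchwartzLike

variable {V : Type*} [NormedAddCommGroup V] [NormedSpace ℝ V]

/-- Smooth functions all of whose derivatives decay faster than any power. -/
def IsSchw (u : V → ℂ) : Prop :=
  ContDiff ℝ ∞ u ∧ ∀ n N : ℕ, ∃ C, 0 ≤ C ∧ ∀ x, ‖iteratedFDeriv ℝ n u x‖ ≤ C * jd N x

theorem IsSchw.exists_bound {u : V → ℂ} (hu : IsSchw u) (n N : ℕ) :
    ∃ C, 0 ≤ C ∧ ∀ k ≤ n, ∀ x, ‖iteratedFDeriv ℝ k u x‖ ≤ C * jd N x := by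
  choose C h0 hC using fun k => hu.2 k N
  refine ⟨∑ k ∈ range (n + 1), C k, sum_nonneg fun k _ => h0 k, fun k hk x => (hC k x).trans ?_⟩
  gcongr
  · exact jd_nonneg _ _
  · exact single_le_sum (f := C) (fun k _ => h0 k) (mem_range.2 (by omega))

theorem IsSchw.norm_le {u : V → ℂ} (hu : IsSchw u) (N : ℕ) :
    ∃ C, 0 ≤ C ∧ ∀ x, ‖u x‖ ≤ C * jd N x := by
  obtain ⟨C, h0, hC⟩ := hu.2 0 N
  exact ⟨C, h0, fun x => by simpa using hC x⟩

def IsSchw.toSchwartz {u : V → ℂ} (hu : IsSchw u) : 𝓢(V, ℂ) where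
  toFun := u
  smooth' := hu.1
  decay' k n := by
    obtain ⟨C, h0, hC⟩ := hu.2 n k
    refine ⟨C, fun x => ?_⟩
    refine le_trans ?_ ((le_jd_iff k x).1 (hC x))
    gcongr
    linarith

/-- The supremum of the Schwartz seminorms of order at most `n` and weight at most `N`. -/
def schwSup (n N : ℕ) (ψ : 𝓢(V, ℂ)) : ℝ :=
  ((Finset.Iic (N, n)).sup fun m => SchwartzMap.seminorm ℂ m.1 m.2) ψ

theorem schwSup_nonneg (n N : ℕ) (ψ : 𝓢(V, ℂ)) : 0 ≤ schwSup n N ψ := apply_nonneg _ _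

theorem SchwartzMap.norm_iteratedFDeriv_le_jd (ψ : 𝓢(V, ℂ)) {n N k : ℕ} (hk : k ≤ n) (x : V) :
    ‖iteratedFDeriv ℝ k ψ x‖ ≤ 2 ^ N * schwSup n N ψ * jd N x := by
  rw [le_jd_iff]
  exact SchwartzMap.one_add_le_sup_seminorm_apply (𝕜 := ℂ) (m := (N, n)) le_rfl hk ψ x

theorem SchwartzMap.isSchw (ψ : 𝓢(V, ℂ)) : IsSchw ψ :=
  ⟨ψ.smooth _, fun n N => ⟨2 ^ N * schwSup n N ψ,
    mul_nonneg (by positivity) (schwSup_nonneg _ _ _), fun x => ψ.norm_iteratedFDeriv_le_jd le_rfl x⟩⟩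

theorem IsSchw.packet {g : V → ℂ} (hg : IsSchw g) (n N : ℕ) :
    ∃ C, 0 ≤ C ∧ ∀ (ℓ : V →L[ℝ] ℝ) (y x : V), ∀ k ≤ n,
      ‖iteratedFDeriv ℝ k (fun x => g (x - y) * chi ℓ x) x‖ ≤ C * (1 + ‖ℓ‖) ^ n * jd N (x - y) := by
  obtain ⟨C, h0, hC⟩ := hg.exists_bound n N
  refine ⟨2 ^ n * C, by positivity, fun ℓ y x k hk => ?_⟩
  refine (norm_iteratedFDeriv_packet_le hg.1 ℓ y x k fun j hj => hC j (by omega) _).trans ?_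
  have h1 : (2 : ℝ) ^ k ≤ 2 ^ n := pow_le_pow_right₀ (by norm_num) hk
  have h2 : (1 + ‖ℓ‖) ^ k ≤ (1 + ‖ℓ‖) ^ n := pow_le_pow_right₀ (by linarith [norm_nonneg ℓ]) hk
  have h3 := jd_nonneg N (x - y)
  calc (2 : ℝ) ^ k * (C * jd N (x - y) * (1 + ‖ℓ‖) ^ k)
      ≤ 2 ^ n * (C * jd N (x - y) * (1 + ‖ℓ‖) ^ n) := by gcongr
    _ = _ := by ring

theorem IsSchw.mul {u v : V → ℂ} (hu : IsSchw u) (hv : ContDiff ℝ ∞ v)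
    (hb : ∀ n, ∃ C, ∀ x, ‖iteratedFDeriv ℝ n v x‖ ≤ C) : IsSchw fun x => u x * v x := by
  refine ⟨hu.1.mul hv, fun n N => ?_⟩
  obtain ⟨C, h0, hC⟩ := hu.exists_bound n N
  obtain ⟨D, hD0, hD⟩ := (show BddD Set.univ ⊤ v from
    ⟨hv, fun n _ => (hb n).imp fun C hC x _ => hC x⟩).exists_nonneg_bound n le_top
  refine ⟨2 ^ n * (C * D), by positivity, fun x => ?_⟩
  refine (norm_iteratedFDeriv_mul_le_pow hu.1 hv x n (mul_nonneg h0 (jd_nonneg N x))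
    (fun k hk => hC k hk x) fun k hk => hD k hk x trivial).trans (le_of_eq ?_)
  ring

theorem IsSchw.comp_sub {u : V → ℂ} (hu : IsSchw u) (y : V) : IsSchw fun x => u (x - y) := by
  refine ⟨hu.1.comp (contDiff_id.sub contDiff_const), fun n N => ?_⟩
  obtain ⟨C, h0, hC⟩ := hu.2 n N
  refine ⟨C * (jd N y)⁻¹, mul_nonneg h0 (inv_nonneg.2 (jd_nonneg _ _)), fun x => ?_⟩
  rw [iteratedFDeriv_comp_sub, mul_assoc]
  refine (hC _).trans (mul_le_mul_of_nonneg_left ?_ h0)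
  rw [inv_mul_eq_div, le_div_iff₀ (jd_pos _ _)]
  have := jd_mul_le N (x - y) y
  rwa [sub_add_cancel] at this

theorem IsSchw.bounded {u : V → ℂ} (hu : IsSchw u) (n : ℕ) :
    ∃ C, ∀ x, ‖iteratedFDeriv ℝ n u x‖ ≤ C := by
  obtain ⟨C, h0, hC⟩ := hu.2 n 0
  exact ⟨C, fun x => by simpa using hC x⟩

theorem bounded_chi (ℓ : V →L[ℝ] ℝ) (n : ℕ) : ∃ C, ∀ x, ‖iteratedFDeriv ℝ n (chi ℓ) x‖ ≤ C :=
  ⟨_, norm_iteratedFDeriv_chi_le ℓ n⟩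

theorem isSchw_gaussB (B : V →L[ℝ] V →L[ℝ] ℝ) {c : ℝ} (hc : 0 < c)
    (hB : ∀ x, c * ‖x‖ ^ 2 ≤ B x x) : IsSchw (gaussB B) :=
  ⟨contDiff_gaussB B, fun n N => gaussB_bound B hc hB n N⟩

theorem IsSchw.comp_clm {W : Type*} [NormedAddCommGroup W] [NormedSpace ℝ W] {u : V → ℂ}
    (hu : IsSchw u) (L : W →L[ℝ] V) (hL : ∀ x, ‖x‖ ≤ 2 * ‖L x‖) : IsSchw fun x => u (L x) := by
  refine ⟨hu.1.comp L.contDiff, fun n N => ?_⟩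
  obtain ⟨C, h0, hC⟩ := hu.2 n N
  refine ⟨C * 2 ^ N * ‖L‖ ^ n, by positivity, fun x => ?_⟩
  have h1 : jd N (L x) ≤ 2 ^ N * jd N x := by
    unfold jd
    rw [← div_eq_mul_inv, le_div_iff₀ (by positivity), inv_mul_le_iff₀ (by positivity), ← mul_pow]
    gcongr
    linarith [hL x]
  calc _ ≤ ‖iteratedFDeriv ℝ n u (L x)‖ * ‖L‖ ^ n := norm_iteratedFDeriv_comp_clm_le hu.1 L n x
    _ ≤ (C * (2 ^ N * jd N x)) * ‖L‖ ^ n := by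
        gcongr
        exact (hC _).trans (by gcongr)
    _ = _ := by ring

variable [FiniteDimensional ℝ V] [MeasurableSpace V] [BorelSpace V]

theorem IsSchw.integrable {u : V → ℂ} (hu : IsSchw u) (μ : Measure V) [μ.IsAddHaarMeasure] :
    Integrable u μ := by
  obtain ⟨C, -, hC⟩ := hu.norm_le (Module.finrank ℝ V + 1)
  exact integrable_of_le_jd μ (Nat.lt_succ_self _) hu.1.continuous.aestronglyMeasurable hC

end SchwartzLike

/-! ### Fourier inversion without `2π` in the exponent -/

section FourierInversion

theorem fourier_inversion {V : Type*} [NormedAddCommGroup V] [InnerProductSpace ℝ V]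
    [FiniteDimensional ℝ V] [MeasurableSpace V] [BorelSpace V] {u : V → ℂ} (hu : IsSchw u) (x : V) :
    ∫ b : V, (∫ y : V, u y * chi (innerSL ℝ (-b)) y) * chi (innerSL ℝ b) x =
      ((2 * Real.pi) ^ Module.finrank ℝ V : ℝ) * u x := by
  set ψ := hu.toSchwartz with hψ
  have h1 := (ψ.continuous.fourierInv_fourier_eq ψ.integrable (by
    rw [← SchwartzMap.fourier_coe]; exact (FourierTransform.fourier ψ).integrable))
  have h2 := congrFun h1 x
  rw [Real.fourierInv_eq'] at h2
  -- The standard Fourier transform carries `2π` in its exponent; dilating the frequency by `2π`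
  -- removes it and produces the power of `2π` on the right.
  have h3 := Measure.integral_comp_smul (μ := (volume : Measure V))
    (fun b : V => (∫ y : V, u y * chi (innerSL ℝ (-b)) y) * chi (innerSL ℝ b) x) (2 * Real.pi)
  have hpos : (0 : ℝ) < (2 * Real.pi) ^ Module.finrank ℝ V := by positivity
  rw [abs_of_pos (inv_pos.2 hpos), eq_inv_smul_iff₀ hpos.ne'] at h3
  rw [← h3, Complex.real_smul]
  congr 1
  rw [show u x = ψ x from rfl, ← h2]
  refine integral_congr_ae (Filter.Eventually.of_forall fun b => ?_)
  simp only [smul_eq_mul]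
  rw [Real.fourier_eq', mul_comm]
  congr 1
  · simp only [chi, innerSL_apply_apply]
    congr 1
    rw [inner_smul_left]
    simp
    ring
  · refine integral_congr_ae (Filter.Eventually.of_forall fun y => ?_)
    simp only [chi, innerSL_apply_apply, smul_eq_mul]
    rw [mul_comm]
    congr 1
    congr 1
    rw [inner_neg_left, inner_smul_left, real_inner_comm]
    simp
    ring

variable {d : ℕ}

/-- The Euclidean pairing on phase space. -/
def pairL (ζ : Phase d) : Phase d →L[ℝ] ℝ := (innerSL ℝ ζ.1).coprod (innerSL ℝ ζ.2)

theorem pairL_apply (ζ x : Phase d) : pairL ζ x = ⟪ζ.1, x.1⟫_ℝ + ⟪ζ.2, x.2⟫_ℝ := by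
  simp [pairL]

theorem norm_pairL_le (ζ : Phase d) : ‖pairL ζ‖ ≤ 2 * ‖ζ‖ := by
  refine ContinuousLinearMap.opNorm_le_bound _ (by positivity) fun x => ?_
  rw [pairL_apply]
  refine (norm_add_le _ _).trans ?_
  have h1 := norm_inner_le_norm (𝕜 := ℝ) ζ.1 x.1
  have h2 := norm_inner_le_norm (𝕜 := ℝ) ζ.2 x.2
  have h3 : ‖ζ.1‖ * ‖x.1‖ ≤ ‖ζ‖ * ‖x‖ :=
    mul_le_mul (norm_fst_le ζ) (norm_fst_le x) (norm_nonneg _) (norm_nonneg _)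
  have h4 : ‖ζ.2‖ * ‖x.2‖ ≤ ‖ζ‖ * ‖x‖ :=
    mul_le_mul (norm_snd_le ζ) (norm_snd_le x) (norm_nonneg _) (norm_nonneg _)
  linarith

theorem le_norm_pairL (ζ : Phase d) : ‖ζ‖ ≤ ‖pairL ζ‖ := by
  have key : ∀ v : Phase d, ‖v‖ * ‖v‖ ≤ ‖pairL ζ v‖ → ‖v‖ ≤ ‖pairL ζ‖ := by
    intro v hv
    have := hv.trans ((pairL ζ).le_opNorm v)
    rcases (norm_nonneg v).eq_or_lt with h | h
    · rw [← h]; exact norm_nonneg _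
    · exact le_of_mul_le_mul_right this h
  rw [Prod.norm_def]
  refine max_le ?_ ?_
  · have := key (ζ.1, 0) (by
      rw [pairL_apply, Prod.norm_def]
      simp [pow_two])
    simpa [Prod.norm_def] using this
  · have := key (0, ζ.2) (by
      rw [pairL_apply, Prod.norm_def]
      simp [pow_two])
    simpa [Prod.norm_def] using this

/-- The product `Phase d` carries the sup norm, not an inner product. The inversion formula is
applied on its Euclidean version `WithLp 2` and pulled back along the identity, which preserves
volume. -/
theorem fourier_inversion_phase {u : Phase d → ℂ} (hu : IsSchw u) (x : Phase d) :
    ∫ ζ : Phase d, (∫ y : Phase d, u y * chi (pairL (-ζ)) y) * chi (pairL ζ) x =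
      ((2 * Real.pi) ^ (2 * d) : ℝ) * u x := by
  set L : WithLp 2 (Phase d) →L[ℝ] Phase d :=
    (WithLp.prodContinuousLinearEquiv 2 ℝ (Config d) (Config d)).toContinuousLinearMap with hLdef
  have hLa : ∀ v, L v = WithLp.ofLp v := fun v => rfl
  have hL : ∀ v, ‖v‖ ≤ 2 * ‖L v‖ := fun v => by
    refine abs_le_of_sq_le_sq' ?_ (by positivity) |>.2
    rw [WithLp.prod_norm_sq_eq_of_L2, hLa, mul_pow]
    have h1 : ‖v.fst‖ ≤ ‖WithLp.ofLp v‖ := _root_.norm_fst_le (WithLp.ofLp v)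
    have h2 : ‖v.snd‖ ≤ ‖WithLp.ofLp v‖ := _root_.norm_snd_le (WithLp.ofLp v)
    nlinarith [pow_le_pow_left₀ (norm_nonneg _) h1 2, pow_le_pow_left₀ (norm_nonneg _) h2 2]
  have hv := fourier_inversion (hu.comp_clm L hL) (WithLp.toLp 2 x)
  have hfr : Module.finrank ℝ (WithLp 2 (Phase d)) = 2 * d := by
    rw [(WithLp.linearEquiv 2 ℝ (Phase d)).finrank_eq]
    simp [two_mul]
  rw [hfr] at hv
  have hchi : ∀ b v : WithLp 2 (Phase d), chi (innerSL ℝ b) v = chi (pairL (WithLp.ofLp b))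
      (WithLp.ofLp v) := fun b v => by
    simp only [chi, pairL_apply, innerSL_apply_apply, WithLp.prod_inner_apply]
  have hmp := WithLp.volume_preserving_ofLp (Config d) (Config d)
  have hme : MeasurableEmbedding (@WithLp.ofLp 2 (Config d × Config d)) :=
    (MeasurableEquiv.toLp 2 (Config d × Config d)).symm.measurableEmbedding
  have key : ∀ F : Phase d → ℂ, ∫ v : WithLp 2 (Phase d), F (WithLp.ofLp v) = ∫ v, F v := fun F =>
    hmp.integral_comp hme F
  rw [← key]
  simp only [hchi, hLa] at hv
  rw [← hv]
  refine integral_congr_ae (Filter.Eventually.of_forall fun b => ?_)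
  simp only
  congr 1
  rw [← key]
  rfl

/-- The symplectic pairing `x ↦ η_p·x_q - η_q·x_p`. -/
def sympL (η : Phase d) : Phase d →L[ℝ] ℝ := pairL (η.2, -η.1)

theorem sympL_apply (η x : Phase d) : sympL η x = ⟪η.2, x.1⟫_ℝ - ⟪η.1, x.2⟫_ℝ := by
  simp [sympL, pairL_apply, sub_eq_add_neg]

theorem norm_swap_neg (η : Phase d) : ‖((η.2, -η.1) : Phase d)‖ = ‖η‖ := by
  simp [Prod.norm_def, max_comm]

theorem norm_sympL_le (ζ : Phase d) : ‖sympL ζ‖ ≤ 2 * ‖ζ‖ := by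
  have := norm_pairL_le (ζ.2, -ζ.1)
  rwa [norm_swap_neg] at this

theorem le_norm_sympL (ζ : Phase d) : ‖ζ‖ ≤ ‖sympL ζ‖ := by
  have := le_norm_pairL (ζ.2, -ζ.1)
  rwa [norm_swap_neg] at this

theorem integral_swap_neg (F : Phase d → ℂ) : ∫ η : Phase d, F (η.2, -η.1) = ∫ ζ, F ζ := by
  let e : Phase d ≃ᵐ Phase d := (MeasurableEquiv.prodComm).trans
    (MeasurableEquiv.prodCongr (MeasurableEquiv.refl _) (MeasurableEquiv.neg _))
  have he : MeasurePreserving e volume volume := by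
    have h1 : MeasurePreserving (Prod.swap : Phase d → Phase d) volume volume :=
      Measure.measurePreserving_swap
    have h2 : MeasurePreserving (Prod.map id Neg.neg : Phase d → Phase d) volume volume :=
      (MeasurePreserving.id volume).prod (Measure.measurePreserving_neg volume)
    exact h2.comp h1
  exact he.integral_comp e.measurableEmbedding F

/-- The symplectic pairing is the Euclidean one after a rotation of `η`, which preserves volume. -/
theorem fourier_inversion_symp {u : Phase d → ℂ} (hu : IsSchw u) (x : Phase d) :
    ∫ η : Phase d, (∫ y : Phase d, u y * chi (sympL (-η)) y) * chi (sympL η) x =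
      ((2 * Real.pi) ^ (2 * d) : ℝ) * u x := by
  rw [← fourier_inversion_phase hu x]
  exact integral_swap_neg fun ζ =>
    (∫ y : Phase d, u y * chi (pairL (-ζ)) y) * chi (pairL ζ) x

end FourierInversion

/-! ### Coherent states: analysis, synthesis and kernel operators -/

section CoherentStates

variable {d : ℕ}

/-- The Gaussian `exp(-c‖q‖²)` on configuration space. -/
def gE (d : ℕ) (c : ℝ) : Config d → ℂ := gaussB (c • innerSL ℝ)

theorem gE_apply (c : ℝ) (q : Config d) : gE d c q = ((Real.exp (-(c * ‖q‖ ^ 2)) : ℝ) : ℂ) := by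
  have h : (c • innerSL ℝ : Config d →L[ℝ] Config d →L[ℝ] ℝ) q q = c * ‖q‖ ^ 2 := by
    rw [← real_inner_self_eq_norm_sq q]
    rfl
  simp only [gE, gaussB, h]

theorem isSchw_gE {c : ℝ} (hc : 0 < c) : IsSchw (gE d c) :=
  isSchw_gaussB _ hc fun x => by
    rw [← real_inner_self_eq_norm_sq x]
    rfl

/-- The coherent state centred at `z = (a, b)`. -/
def coh (z : Phase d) (q : Config d) : ℂ := gE d (1 / 2) (q - z.1) * chi (innerSL ℝ z.2) q

theorem coh_apply (z : Phase d) (q : Config d) : coh z q =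
    ((Real.exp (-(1 / 2 * ‖q - z.1‖ ^ 2)) : ℝ) : ℂ) * cexp (I * (⟪z.2, q⟫_ℝ : ℂ)) := by
  simp [coh, gE_apply, chi]

theorem contDiff_uncurry_coh : ContDiff ℝ ∞ fun p : Phase d × Config d => coh p.1 p.2 := by
  have h1 : ContDiff ℝ ∞ fun p : Phase d × Config d => gE d (1 / 2) (p.2 - p.1.1) :=
    (isSchw_gE (d := d) (c := 1 / 2) (by norm_num)).1.comp
      (contDiff_snd.sub (contDiff_fst.comp contDiff_fst))
  have h2 : ContDiff ℝ ∞ fun p : Phase d × Config d => chi (innerSL ℝ p.1.2) p.2 := by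
    simp only [chi, innerSL_apply_apply]
    exact contDiff_cexp_I.comp ((contDiff_snd.comp contDiff_fst).inner ℝ contDiff_snd)
  exact h1.mul h2

theorem continuous_uncurry_coh : Continuous fun p : Phase d × Config d => coh p.1 p.2 :=
  contDiff_uncurry_coh.continuous

theorem contDiff_coh (z : Phase d) : ContDiff ℝ ∞ (coh z) :=
  ((isSchw_gE (by norm_num)).1.comp (contDiff_id.sub contDiff_const)).mul (contDiff_chi _)

theorem isSchw_coh (z : Phase d) : IsSchw (coh z) :=
  ((isSchw_gE (by norm_num)).comp_sub z.1).mul (contDiff_chi _) (bounded_chi _)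

theorem norm_coh (z : Phase d) (q : Config d) :
    ‖coh z q‖ = Real.exp (-(1 / 2 * ‖q - z.1‖ ^ 2)) := by
  rw [coh, norm_mul, norm_chi, mul_one, gE_apply, Complex.norm_real, Real.norm_of_nonneg
    (Real.exp_pos _).le]

theorem norm_coh_le_one (z : Phase d) (q : Config d) : ‖coh z q‖ ≤ 1 := by
  rw [norm_coh]
  exact Real.exp_le_one_iff.2 (by have := sq_nonneg ‖q - z.1‖; linarith)

theorem coh_deriv_bound (n N : ℕ) : ∃ C, 0 ≤ C ∧ ∀ (z : Phase d) (q : Config d), ∀ k ≤ n,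
    ‖iteratedFDeriv ℝ k (coh z) q‖ ≤ C * (1 + ‖z‖) ^ n * jd N (q - z.1) := by
  obtain ⟨C, h0, hC⟩ := (isSchw_gE (d := d) (c := 1 / 2) (by norm_num)).packet n N
  refine ⟨C, h0, fun z q k hk => (hC (innerSL ℝ z.2) z.1 q k hk).trans ?_⟩
  have := jd_nonneg N (q - z.1)
  rw [innerSL_apply_norm]
  gcongr
  exact norm_snd_le z

/-- Rapidly decreasing measurable functions on phase space. -/
structure Rapid (F : Phase d → ℂ) : Prop where
  meas : Measurable F
  decay : ∀ N : ℕ, ∃ C, 0 ≤ C ∧ ∀ z, ‖F z‖ ≤ C * jd N z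

/-- Measurable kernels with rapid decay away from the diagonal. -/
structure OffDiag (A : Phase d → Phase d → ℂ) : Prop where
  meas : Measurable fun p : Phase d × Phase d => A p.1 p.2
  decay : ∀ N : ℕ, ∃ C, 0 ≤ C ∧ ∀ w z, ‖A w z‖ ≤ C * jd N (w - z)

/-- A number exceeding the dimension of phase space. -/
abbrev bigN (d : ℕ) : ℕ := 2 * d + 1

theorem finrank_phase_lt : Module.finrank ℝ (Phase d) < bigN d := by
  simp [bigN, two_mul]

theorem finrank_config_lt : Module.finrank ℝ (Config d) < bigN d := by
  simp only [finrank_euclideanSpace_fin, bigN]; omega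

instance : (volume : Measure (Phase d)).IsAddHaarMeasure :=
  inferInstanceAs ((volume : Measure (Config d)).prod volume).IsAddHaarMeasure

theorem integrable_jd_phase : Integrable (jd (bigN d) : Phase d → ℝ) :=
  integrable_jd volume finrank_phase_lt

theorem integrable_jd_config : Integrable (jd (bigN d) : Config d → ℝ) :=
  integrable_jd volume finrank_config_lt

theorem Rapid.integrable {F : Phase d → ℂ} (hF : Rapid F) : Integrable F := by
  obtain ⟨C, -, hC⟩ := hF.decay (bigN d)
  exact integrable_of_le_jd volume finrank_phase_lt hF.meas.aestronglyMeasurable hC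

/-- The integral of the weight over phase space. -/
def jdMass (d : ℕ) : ℝ := ∫ z : Phase d, jd (bigN d) z

theorem jdMass_nonneg (d : ℕ) : 0 ≤ jdMass d := integral_jd_nonneg _ _

/-- Windowed Fourier transforms of Schwartz functions are rapidly decreasing. -/
theorem stft_bound {W : Config d → ℂ} (hW : IsSchw W) (N : ℕ) : ∃ (C : ℝ) (n M : ℕ), 0 ≤ C ∧
    ∀ (ψ : 𝓢(Config d, ℂ)) (a b : Config d),
      ‖∫ q, W (q - a) * ψ q * chi (innerSL ℝ b) q‖ ≤ C * schwSup n M ψ * (jd N a * jd N b) := by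
  obtain ⟨C, h0, hC⟩ := hW.exists_bound N N
  refine ⟨8 ^ N * C * 2 ^ (N + bigN d) * ∫ x : Config d, jd (bigN d) x, N, N + bigN d,
    mul_nonneg (by positivity) (integral_jd_nonneg _ _), fun ψ a b => ?_⟩
  have hs := schwSup_nonneg N (N + bigN d) ψ
  have h := norm_windowed_integral_le volume (innerSL ℝ b) a N hW.1 (ψ.smooth ⊤)
    (C := C * (2 ^ (N + bigN d) * schwSup N (N + bigN d) ψ) * jd N a) (w := jd (bigN d))
    integrable_jd_config
    (b₁ := fun x => C * jd N (x - a))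
    (b₂ := fun x => 2 ^ (N + bigN d) * schwSup N (N + bigN d) ψ * jd (N + bigN d) x)
    (fun j hj x => hC j hj _) (fun j hj x => ψ.norm_iteratedFDeriv_le_jd hj x) fun x => by
      rw [jd_add_exp]
      have h1 : jd N (x - a) * jd N x ≤ jd N a := by
        have := jd_mul_le_sub N x (x - a)
        rwa [sub_sub_cancel, mul_comm] at this
      calc _ = C * (2 ^ (N + bigN d) * schwSup N (N + bigN d) ψ) * jd (bigN d) x *
            (jd N (x - a) * jd N x) := by ring
        _ ≤ C * (2 ^ (N + bigN d) * schwSup N (N + bigN d) ψ) * jd (bigN d) x * jd N a := by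
          have := jd_nonneg (bigN d) x
          gcongr
        _ = _ := by ring
  rw [show jd N (innerSL ℝ b) = jd N b by simp [jd]] at h
  refine h.trans (le_of_eq ?_)
  ring

/-- The coherent state transform. -/
def anal (ψ : Config d → ℂ) (z : Phase d) : ℂ := ∫ q, starRingEnd ℂ (coh z q) * ψ q

/-- The synthesis of a function from coherent states. -/
def synth (F : Phase d → ℂ) (q : Config d) : ℂ := ∫ z, F z * coh z q

/-- The action of a kernel. -/
def act (A : Phase d → Phase d → ℂ) (F : Phase d → ℂ) (w : Phase d) : ℂ := ∫ z, A w z * F z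

theorem anal_eq (ψ : Config d → ℂ) (z : Phase d) :
    anal ψ z = ∫ q, gE d (1 / 2) (q - z.1) * ψ q * chi (innerSL ℝ (-z.2)) q := by
  refine integral_congr_ae (Filter.Eventually.of_forall fun q => ?_)
  have : starRingEnd ℂ (gE d (1 / 2) (q - z.1)) = gE d (1 / 2) (q - z.1) := by
    simp only [gE_apply, Complex.conj_ofReal]
  simp only [coh, map_mul, this]
  rw [map_neg, chi_neg]
  ring

theorem measurable_anal {ψ : Config d → ℂ} (hψ : Continuous ψ) : Measurable (anal ψ) := by
  have h : Continuous fun p : Phase d × Config d => starRingEnd ℂ (coh p.1 p.2) * ψ p.2 :=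
    (Complex.continuous_conj.comp continuous_uncurry_coh).mul (hψ.comp continuous_snd)
  exact (h.stronglyMeasurable.integral_prod_right (ν := volume)).measurable

theorem anal_bound (d N : ℕ) : ∃ (C : ℝ) (n M : ℕ), 0 ≤ C ∧
    ∀ (ψ : 𝓢(Config d, ℂ)) (z : Phase d), ‖anal ψ z‖ ≤ C * schwSup n M ψ * jd N z := by
  obtain ⟨C, n, M, h0, hC⟩ := stft_bound (isSchw_gE (d := d) (c := 1 / 2) (by norm_num)) N
  refine ⟨C, n, M, h0, fun ψ z => ?_⟩
  rw [anal_eq]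
  refine (hC ψ z.1 (-z.2)).trans ?_
  have := schwSup_nonneg n M ψ
  rw [jd_neg]
  gcongr
  exact jd_mul_le_prod N z.1 z.2

theorem rapid_anal (ψ : 𝓢(Config d, ℂ)) : Rapid (anal ψ) where
  meas := measurable_anal ψ.continuous
  decay N := by
    obtain ⟨C, n, M, h0, hC⟩ := anal_bound d N
    exact ⟨C * schwSup n M ψ, mul_nonneg h0 (schwSup_nonneg _ _ _), hC ψ⟩

/-- The exponent `bigN d + N + n` is spent in three ways: `n` powers absorb the growth of the
derivatives in the frequency of the packet, `N` powers move the decay from `q - z.1` to `q`, and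
`bigN d` powers remain to integrate over `z`. -/
theorem synth_bound_aux (n N : ℕ) : ∃ C, 0 ≤ C ∧ ∀ (F : Phase d → ℂ) (B : ℝ), 0 ≤ B →
    (∀ z, ‖F z‖ ≤ B * jd (bigN d + N + n) z) → ∀ z q,
    ‖F z‖ * ‖iteratedFDeriv ℝ n (coh z) q‖ ≤ C * B * jd (bigN d) z * jd N q := by
  obtain ⟨C, h0, hC⟩ := coh_deriv_bound (d := d) n N
  refine ⟨C, h0, fun F B hB hF z q => ?_⟩
  have h1 : jd N z * jd N (q - z.1) ≤ jd N q := by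
    have := jd_mul_le N z.1 (q - z.1)
    rw [add_sub_cancel] at this
    refine le_trans ?_ this
    have h2 := jd_nonneg N (q - z.1)
    have h3 := jd_le_of_norm_le N (norm_fst_le z)
    gcongr
  calc ‖F z‖ * ‖iteratedFDeriv ℝ n (coh z) q‖
      ≤ (B * jd (bigN d + N + n) z) * (C * (1 + ‖z‖) ^ n * jd N (q - z.1)) := by
        gcongr
        · exact mul_nonneg hB (jd_nonneg _ _)
        · exact hF z
        · exact hC z q n le_rfl
    _ = B * C * ((1 + ‖z‖) ^ n * jd (bigN d + N + n) z) * jd N (q - z.1) := by ring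
    _ = B * C * jd (bigN d) z * (jd N z * jd N (q - z.1)) := by
        rw [one_add_pow_mul_jd, jd_add_exp]; ring
    _ ≤ B * C * jd (bigN d) z * jd N q := by
        have := jd_nonneg (bigN d) z
        gcongr
    _ = _ := by ring

theorem synth_contDiff_and_bound {F : Phase d → ℂ} (hF : Rapid F) : ContDiff ℝ ∞ (synth F) ∧
    ∀ n q, ‖iteratedFDeriv ℝ n (synth F) q‖ ≤ ∫ z, ‖F z‖ * ‖iteratedFDeriv ℝ n (coh z) q‖ := by
  refine contDiff_integral_weight (E := Config d) (Y := Phase d) (μ := volume) (ρ := F)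
    (u := fun p => coh p.1 p.2) contDiff_uncurry_coh hF.meas.aestronglyMeasurable fun k x₀ => ?_
  obtain ⟨C, h0, hC⟩ := synth_bound_aux (d := d) k 0
  obtain ⟨B, hB, hFB⟩ := hF.decay (bigN d + 0 + k)
  exact ⟨_, integrable_jd_phase.const_mul (C * B), Filter.Eventually.of_forall fun x z => by
    simpa using hC F B hB hFB z x⟩

theorem synth_bound (d n N : ℕ) : ∃ (C : ℝ) (M : ℕ), 0 ≤ C ∧ ∀ (F : Phase d → ℂ) (B : ℝ), 0 ≤ B →
    Rapid F → (∀ z, ‖F z‖ ≤ B * jd M z) → ∀ q,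
    ‖iteratedFDeriv ℝ n (synth F) q‖ ≤ C * B * jd N q := by
  obtain ⟨C, h0, hC⟩ := synth_bound_aux (d := d) n N
  refine ⟨C * jdMass d, bigN d + N + n, mul_nonneg h0 (jdMass_nonneg d), fun F B hB hF hb q => ?_⟩
  refine ((synth_contDiff_and_bound hF).2 n q).trans ?_
  calc ∫ z, ‖F z‖ * ‖iteratedFDeriv ℝ n (coh z) q‖
      ≤ ∫ z, (C * B * jd N q) * jd (bigN d) z :=
        integral_mono_of_nonneg (Filter.Eventually.of_forall fun z => by positivity)
          (integrable_jd_phase.const_mul _) (Filter.Eventually.of_forall fun z =>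
            (hC F B hB hb z q).trans (le_of_eq (by ring)))
    _ = _ := by rw [integral_const_mul, jdMass]; ring

theorem isSchw_synth {F : Phase d → ℂ} (hF : Rapid F) : IsSchw (synth F) := by
  refine ⟨(synth_contDiff_and_bound hF).1, fun n N => ?_⟩
  obtain ⟨C, M, h0, hC⟩ := synth_bound d n N
  obtain ⟨B, hB, hFB⟩ := hF.decay M
  exact ⟨C * B, mul_nonneg h0 hB, hC F B hB hF hFB⟩

/-- Peetre's inequality turns decay in `w - z` and in `z` into decay in `w`; the extra `bigN d`
powers on `F` make the integral converge. -/
theorem act_bound {A : Phase d → Phase d → ℂ} {F : Phase d → ℂ} {N : ℕ} {C B : ℝ} (hC : 0 ≤ C)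
    (hB : 0 ≤ B) (hA : ∀ w z, ‖A w z‖ ≤ C * jd N (w - z))
    (hF : ∀ z, ‖F z‖ ≤ B * jd (N + bigN d) z) (w : Phase d) :
    ‖act A F w‖ ≤ C * B * jdMass d * jd N w := by
  have h1 : ∀ z, ‖A w z * F z‖ ≤ C * B * jd N w * jd (bigN d) z := fun z => by
    rw [norm_mul]
    calc ‖A w z‖ * ‖F z‖ ≤ (C * jd N (w - z)) * (B * jd (N + bigN d) z) := by
          gcongr
          · exact mul_nonneg hC (jd_nonneg _ _)
          · exact hA w z
          · exact hF z
      _ = C * B * (jd N (w - z) * jd N z) * jd (bigN d) z := by rw [jd_add_exp]; ring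
      _ ≤ _ := by
          have h2 := jd_mul_le N (w - z) z
          rw [sub_add_cancel] at h2
          have := jd_nonneg (bigN d) z
          gcongr
  refine (norm_integral_le_of_norm_le (integrable_jd_phase.const_mul _)
    (Filter.Eventually.of_forall h1)).trans (le_of_eq ?_)
  rw [integral_const_mul, jdMass]
  ring

theorem OffDiag.measurable_mul {A : Phase d → Phase d → ℂ} (hA : OffDiag A) {F : Phase d → ℂ}
    (hF : Measurable F) : Measurable fun p : Phase d × Phase d => A p.1 p.2 * F p.2 :=
  hA.meas.mul (hF.comp measurable_snd)

theorem rapid_act {A : Phase d → Phase d → ℂ} (hA : OffDiag A) {F : Phase d → ℂ} (hF : Rapid F) :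
    Rapid (act A F) where
  meas := ((hA.measurable_mul hF.meas).stronglyMeasurable.integral_prod_right
    (ν := volume)).measurable
  decay N := by
    obtain ⟨C, hC, hAC⟩ := hA.decay N
    obtain ⟨B, hB, hFB⟩ := hF.decay (N + bigN d)
    exact ⟨_, mul_nonneg (mul_nonneg hC hB) (jdMass_nonneg d), act_bound hC hB hAC hFB⟩

/-- The function obtained from `ψ` by analysis, action of a kernel and synthesis. -/
def opFun (A : Phase d → Phase d → ℂ) (ψ : Config d → ℂ) : Config d → ℂ :=
  synth (act A (anal ψ))

/-- One decay constant of the kernel and one Schwartz seminorm of `ψ` suffice. This gives continuity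
on `𝓢`, and the linear dependence on `B` later controls the operator by finitely many derivatives of
its symbol. -/
theorem opFun_bound (d n N : ℕ) : ∃ (C : ℝ) (M n' M' : ℕ), 0 ≤ C ∧
    ∀ (A : Phase d → Phase d → ℂ) (B : ℝ), OffDiag A → 0 ≤ B →
    (∀ w z, ‖A w z‖ ≤ B * jd M (w - z)) → ∀ (ψ : 𝓢(Config d, ℂ)) q,
    ‖iteratedFDeriv ℝ n (opFun A ψ) q‖ ≤ C * B * schwSup n' M' ψ * jd N q := by
  obtain ⟨C, M, h0, hC⟩ := synth_bound d n N
  obtain ⟨C', n', M', h0', hC'⟩ := anal_bound d (M + bigN d)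
  refine ⟨C * (C' * jdMass d), M, n', M', mul_nonneg h0 (mul_nonneg h0' (jdMass_nonneg d)),
    fun A B hA hB hb ψ q => ?_⟩
  have hs := mul_nonneg h0' (schwSup_nonneg n' M' ψ)
  have h1 := hC (act A (anal ψ)) _ (mul_nonneg (mul_nonneg hB hs) (jdMass_nonneg d))
    (rapid_act hA (rapid_anal ψ)) (act_bound hB hs hb (hC' ψ)) q
  refine h1.trans (le_of_eq ?_)
  ring

theorem integrable_conj_coh_mul (z : Phase d) (ψ : 𝓢(Config d, ℂ)) :
    Integrable fun q => starRingEnd ℂ (coh z q) * ψ q := by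
  refine ψ.integrable.bdd_mul (c := 1)
    (Complex.continuous_conj.comp (contDiff_coh z).continuous).aestronglyMeasurable
    (Filter.Eventually.of_forall fun q => ?_)
  simpa using norm_coh_le_one z q

theorem OffDiag.integrable_mul {A : Phase d → Phase d → ℂ} (hA : OffDiag A) {F : Phase d → ℂ}
    (hF : Rapid F) (w : Phase d) : Integrable fun z => A w z * F z := by
  obtain ⟨C, -, hC⟩ := hA.decay 0
  refine hF.integrable.bdd_mul (c := C)
    (hA.meas.comp (measurable_prodMk_left (x := w))).aestronglyMeasurable
    (Filter.Eventually.of_forall fun z => by simpa using hC w z)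

theorem Rapid.integrable_mul_coh {F : Phase d → ℂ} (hF : Rapid F) (q : Config d) :
    Integrable fun z => F z * coh z q :=
  hF.integrable.mul_bdd (c := 1)
    (continuous_uncurry_coh.comp (by fun_prop : Continuous fun z : Phase d => (z, q))).aestronglyMeasurable
    (Filter.Eventually.of_forall fun z => norm_coh_le_one z q)

theorem anal_add (ψ χ : 𝓢(Config d, ℂ)) : anal (ψ + χ : 𝓢(Config d, ℂ)) = anal ψ + anal χ := by
  ext z
  simp only [anal, Pi.add_apply, add_apply, mul_add]
  exact integral_add (integrable_conj_coh_mul z ψ) (integrable_conj_coh_mul z χ)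

theorem anal_smul (c : ℂ) (ψ : 𝓢(Config d, ℂ)) : anal (c • ψ : 𝓢(Config d, ℂ)) = c • anal ψ := by
  ext z
  simp only [anal, Pi.smul_apply, smul_apply, smul_eq_mul, ← integral_const_mul]
  congr 1
  ext q
  ring

theorem act_add {A : Phase d → Phase d → ℂ} (hA : OffDiag A) {F G : Phase d → ℂ} (hF : Rapid F)
    (hG : Rapid G) : act A (F + G) = act A F + act A G := by
  ext z
  simp only [act, Pi.add_apply, mul_add]
  exact integral_add (hA.integrable_mul hF z) (hA.integrable_mul hG z)

theorem act_smul (A : Phase d → Phase d → ℂ) (c : ℂ) (F : Phase d → ℂ) :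
    act A (c • F) = c • act A F := by
  ext z
  simp only [act, Pi.smul_apply, smul_eq_mul, ← integral_const_mul]
  congr 1
  ext q
  ring

theorem synth_add {F G : Phase d → ℂ} (hF : Rapid F) (hG : Rapid G) :
    synth (F + G) = synth F + synth G := by
  ext q
  simp only [synth, Pi.add_apply, add_mul]
  exact integral_add (hF.integrable_mul_coh q) (hG.integrable_mul_coh q)

theorem synth_smul (c : ℂ) (F : Phase d → ℂ) : synth (c • F) = c • synth F := by
  ext q
  simp only [synth, Pi.smul_apply, smul_eq_mul, ← integral_const_mul]
  congr 1
  ext z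
  ring

/-- The continuous operator on Schwartz space with a given kernel in the coherent state
representation. -/
def opS (A : Phase d → Phase d → ℂ) (hA : OffDiag A) : 𝓢(Config d, ℂ) →L[ℂ] 𝓢(Config d, ℂ) :=
  SchwartzMap.mkCLM (fun ψ => opFun A ψ)
    (fun ψ χ q => by
      simp only [opFun, anal_add, act_add hA (rapid_anal ψ) (rapid_anal χ),
        synth_add (rapid_act hA (rapid_anal ψ)) (rapid_act hA (rapid_anal χ)), Pi.add_apply])
    (fun c ψ q => by
      simp only [opFun, anal_smul, act_smul, synth_smul, Pi.smul_apply, RingHom.id_apply])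
    (fun ψ => (isSchw_synth (rapid_act hA (rapid_anal ψ))).1)
    fun ⟨k, n⟩ => by
      obtain ⟨C, M, n', M', h0, hC⟩ := opFun_bound d n k
      obtain ⟨B, hB, hb⟩ := hA.decay M
      refine ⟨Finset.Iic (M', n'), C * B, mul_nonneg h0 hB, fun ψ q => ?_⟩
      have h1 := hC A B hA hB hb ψ q
      rw [le_jd_iff] at h1
      refine le_trans ?_ h1
      gcongr
      linarith

theorem opS_apply (A : Phase d → Phase d → ℂ) (hA : OffDiag A) (ψ : 𝓢(Config d, ℂ)) (q : Config d) :
    opS A hA ψ q = synth (act A (anal ψ)) q := rfl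

end CoherentStates

/-! ### Resolution of the identity -/

section Inversion

variable {d : ℕ}

theorem IsSchw.conj {V : Type*} [NormedAddCommGroup V] [NormedSpace ℝ V] {u : V → ℂ}
    (hu : IsSchw u) : IsSchw fun x => starRingEnd ℂ (u x) := by
  refine ⟨Complex.conjCLE.contDiff.comp hu.1, fun n N => ?_⟩
  obtain ⟨C, h0, hC⟩ := hu.2 n N
  refine ⟨C, h0, fun x => ?_⟩
  have := Complex.conjLIE.norm_iteratedFDeriv_comp_left u x n
  exact this.le.trans (hC x)

@[fun_prop]
theorem continuous_coh {X : Type*} [TopologicalSpace X] {f : X → Phase d} {g : X → Config d}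
    (hf : Continuous f) (hg : Continuous g) : Continuous fun x => coh (f x) (g x) := by
  simp only [coh_apply]
  fun_prop

/-- Fubini for synthesis. -/
theorem integral_mul_synth {χ : Config d → ℂ} (hχ : IsSchw χ) {F : Phase d → ℂ} (hF : Rapid F) :
    ∫ q, χ q * synth F q = ∫ z, F z * ∫ q, χ q * coh z q := by
  have hint : Integrable (Function.uncurry fun (q : Config d) (z : Phase d) =>
      χ q * (F z * coh z q)) (volume.prod volume) := by
    have h1 := (hχ.integrable volume).mul_prod hF.integrable
    have h2 : Continuous fun p : Config d × Phase d => coh p.2 p.1 := by fun_prop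
    have h3 := h1.mul_bdd (c := 1) h2.aestronglyMeasurable
      (Filter.Eventually.of_forall fun p => norm_coh_le_one p.2 p.1)
    refine h3.congr (Filter.Eventually.of_forall fun p => ?_)
    simp only [Function.uncurry]
    ring
  simp only [synth, ← integral_const_mul]
  rw [integral_integral_swap hint]
  congr 1
  ext z
  congr 1
  ext q
  ring

/-- The Gram kernel of the coherent states. -/
def gram (w z : Phase d) : ℂ := ∫ q, starRingEnd ℂ (coh w q) * coh z q

theorem anal_synth {F : Phase d → ℂ} (hF : Rapid F) : anal (synth F) = act gram F := by
  ext w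
  have := integral_mul_synth (isSchw_coh w).conj hF
  simp only [anal, act, gram]
  rw [this]
  simp only [mul_comm]

/-- Centring the integral at `w.1` leaves a windowed Fourier integral of a Gaussian, whose decay in
`z - w` is already known; the phase is harmless. -/
theorem gram_eq (w z : Phase d) : ∃ θ : ℂ, ‖θ‖ = 1 ∧ gram w z = θ *
    ∫ q, gE d (1 / 2) (q - (z.1 - w.1)) * gE d (1 / 2) q * chi (innerSL ℝ (z.2 - w.2)) q := by
  refine ⟨chi (innerSL ℝ (z.2 - w.2)) w.1, norm_chi _ _, ?_⟩
  rw [gram, ← integral_add_right_eq_self _ w.1, ← integral_const_mul]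
  congr 1
  ext q
  have h1 : starRingEnd ℂ (gE d (1 / 2) (q + w.1 - w.1)) = gE d (1 / 2) q := by
    simp only [gE_apply, Complex.conj_ofReal, add_sub_cancel_right]
  have h2 : starRingEnd ℂ (chi (innerSL ℝ w.2) (q + w.1)) * chi (innerSL ℝ z.2) (q + w.1) =
      chi (innerSL ℝ (z.2 - w.2)) w.1 * chi (innerSL ℝ (z.2 - w.2)) q := by
    rw [← chi_neg]
    simp only [chi, ← Complex.exp_add]
    congr 1
    simp only [neg_apply, innerSL_apply_apply, inner_add_right, inner_sub_left]
    push_cast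
    ring
  have h3 : q + w.1 - z.1 = q - (z.1 - w.1) := by abel
  simp only [coh, map_mul, h1, h3]
  linear_combination gE d (1 / 2) q * gE d (1 / 2) (q - (z.1 - w.1)) * h2

theorem offDiag_gram : OffDiag (gram (d := d)) where
  meas := by
    have h : Continuous fun p : (Phase d × Phase d) × Config d =>
        starRingEnd ℂ (coh p.1.1 p.2) * coh p.1.2 p.2 :=
      (Complex.continuous_conj.comp (by fun_prop :
        Continuous fun p : (Phase d × Phase d) × Config d => coh p.1.1 p.2)).mul (by fun_prop)
    exact (h.stronglyMeasurable.integral_prod_right (ν := volume)).measurable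
  decay N := by
    have hg := isSchw_gE (d := d) (c := 1 / 2) (by norm_num)
    obtain ⟨C, n, M, h0, hC⟩ := stft_bound hg N
    have hs := schwSup_nonneg n M hg.toSchwartz
    refine ⟨C * schwSup n M hg.toSchwartz, mul_nonneg h0 hs, fun w z => ?_⟩
    obtain ⟨θ, hθ, he⟩ := gram_eq w z
    rw [he, norm_mul, hθ, one_mul]
    refine (hC hg.toSchwartz (z.1 - w.1) (z.2 - w.2)).trans ?_
    gcongr
    rw [jd_sub_comm N w z]
    exact jd_mul_le_prod N (z.1 - w.1) (z.2 - w.2)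

/-- The constant in the inversion formula for the coherent state transform. -/
def kap (d : ℕ) : ℝ := (2 * Real.pi) ^ d * ∫ a : Config d, Real.exp (-‖a‖ ^ 2)

theorem integrable_exp_neg_sq : Integrable fun a : Config d => Real.exp (-‖a‖ ^ 2) := by
  have := ((isSchw_gE (d := d) (c := 1) one_pos).integrable volume).re
  refine this.congr (Filter.Eventually.of_forall fun a => ?_)
  simp only [gE_apply, one_mul]
  exact Complex.ofReal_re _

theorem kap_pos (d : ℕ) : 0 < kap d := by
  have := integral_exp_pos (μ := (volume : Measure (Config d))) (f := fun a => -‖a‖ ^ 2)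
    integrable_exp_neg_sq
  unfold kap
  positivity

/-- With the centre `a` fixed, the integral over the frequency `b` is Fourier inversion for the
windowed function, evaluated at `q`. The two windows then multiply to `exp(-‖q - a‖²)`, and
integrating over `a` gives the constant `kap d`. -/
theorem synth_anal (ψ : 𝓢(Config d, ℂ)) (q : Config d) :
    synth (anal ψ) q = (kap d : ℂ) * ψ q := by
  have hint := (rapid_anal ψ).integrable_mul_coh q
  have h1 : ∀ a : Config d, ∫ b : Config d, anal ψ (a, b) * coh (a, b) q =
      ((2 * Real.pi) ^ d : ℝ) * ψ q * (Real.exp (-‖q - a‖ ^ 2) : ℝ) := by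
    intro a
    have hu : IsSchw fun y => gE d (1 / 2) (y - a) * ψ y :=
      ((isSchw_gE (by norm_num)).comp_sub a).mul ψ.isSchw.1 ψ.isSchw.bounded
    have h2 := fourier_inversion hu q
    rw [finrank_euclideanSpace_fin] at h2
    have h3 : ∀ b, anal ψ (a, b) * coh (a, b) q = gE d (1 / 2) (q - a) *
        ((∫ y, gE d (1 / 2) (y - a) * ψ y * chi (innerSL ℝ (-b)) y) * chi (innerSL ℝ b) q) := by
      intro b
      rw [anal_eq, coh]
      ring
    simp only [h3]
    rw [integral_const_mul, h2]
    have h4 : gE d (1 / 2) (q - a) * gE d (1 / 2) (q - a) = (Real.exp (-‖q - a‖ ^ 2) : ℝ) := by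
      rw [gE_apply, ← Complex.ofReal_mul, ← Real.exp_add]
      congr 2
      ring
    rw [← h4]
    ring
  rw [synth, Measure.volume_eq_prod, integral_prod _ hint]
  simp only [h1]
  rw [integral_const_mul, integral_complex_ofReal, integral_sub_left_eq_self (fun a => Real.exp (-‖a‖ ^ 2)),
    kap]
  push_cast
  ring

end Inversion

/-! ### Schur's test and bounds on `L²` -/

section Schur

variable {d : ℕ}

/-- Squared `L²` norm. -/
def sqN {X : Type*} [MeasureSpace X] (F : X → ℂ) : ℝ := ∫ z, ‖F z‖ ^ 2

theorem sqN_nonneg {X : Type*} [MeasureSpace X] (F : X → ℂ) : 0 ≤ sqN F :=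
  integral_nonneg fun _ => sq_nonneg _

theorem Rapid.integrable_sq {F : Phase d → ℂ} (hF : Rapid F) : Integrable fun z => ‖F z‖ ^ 2 := by
  obtain ⟨C, -, hC⟩ := hF.decay 0
  have h := hF.integrable.norm.bdd_mul (f := fun z => ‖F z‖) (c := C)
    hF.meas.norm.aestronglyMeasurable (Filter.Eventually.of_forall fun z => by simpa using hC z)
  simpa only [pow_two] using h

theorem integrable_jd_sub_mul {h : Phase d → ℝ} (hh : Integrable h) :
    Integrable (fun p : Phase d × Phase d => jd (bigN d) (p.1 - p.2) * h p.2)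
      (volume.prod volume) := by
  have := Integrable.convolution_integrand (ContinuousLinearMap.mul ℝ ℝ) hh
    (integrable_jd_phase (d := d))
  refine this.congr (Filter.Eventually.of_forall fun p => ?_)
  simp [mul_comm]

theorem integral_jd_sub_mul {h : Phase d → ℝ} (hh : Integrable h) :
    ∫ p : Phase d × Phase d, jd (bigN d) (p.1 - p.2) * h p.2 = jdMass d * ∫ z, h z := by
  rw [Measure.volume_eq_prod, integral_prod_symm _ (integrable_jd_sub_mul hh),
    ← integral_const_mul]
  congr 1
  ext z
  simp only
  rw [integral_mul_const, integral_sub_right_eq_self (fun w => jd (bigN d) w), jdMass]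

/-- Under the double integral `2‖H‖‖F‖ ≤ ‖H‖² + ‖F‖²`, and the weight `jd (bigN d) (w - z)` has the
same finite mass in either variable. -/
theorem schur_bound {A : Phase d → Phase d → ℂ} {B : ℝ} (hB : 0 ≤ B)
    (hA : ∀ w z, ‖A w z‖ ≤ B * jd (bigN d) (w - z)) {F H : Phase d → ℂ} (hF : Rapid F)
    (hH : Rapid H) (hm : OffDiag A) :
    ‖∫ w, H w * act A F w‖ ≤ B * jdMass d * (sqN H + sqN F) / 2 := by
  have hi1 := integrable_jd_sub_mul hF.integrable_sq
  have hi2 : Integrable (fun p : Phase d × Phase d => jd (bigN d) (p.1 - p.2) * ‖H p.1‖ ^ 2)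
      (volume.prod volume) := by
    have := (integrable_jd_sub_mul hH.integrable_sq).swap
    refine this.congr (Filter.Eventually.of_forall fun p => ?_)
    simp only [Function.comp, Prod.swap, jd_sub_comm _ p.1 p.2]
  have he2 : ∫ p : Phase d × Phase d, jd (bigN d) (p.1 - p.2) * ‖H p.1‖ ^ 2 =
      jdMass d * sqN H := by
    rw [sqN, ← integral_jd_sub_mul hH.integrable_sq, Measure.volume_eq_prod,
      ← integral_prod_swap]
    simp only [Prod.swap, jd_sub_comm]
  have hbd : ∀ p : Phase d × Phase d, ‖H p.1 * (A p.1 p.2 * F p.2)‖ ≤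
      B / 2 * (jd (bigN d) (p.1 - p.2) * ‖H p.1‖ ^ 2 + jd (bigN d) (p.1 - p.2) * ‖F p.2‖ ^ 2) := by
    intro p
    rw [norm_mul, norm_mul]
    have h1 := two_mul_le_add_sq ‖H p.1‖ ‖F p.2‖
    have h2 := jd_nonneg (bigN d) (p.1 - p.2)
    calc ‖H p.1‖ * (‖A p.1 p.2‖ * ‖F p.2‖)
        ≤ ‖H p.1‖ * ((B * jd (bigN d) (p.1 - p.2)) * ‖F p.2‖) := by
          gcongr
          exact hA _ _
      _ = B / 2 * jd (bigN d) (p.1 - p.2) * (2 * ‖H p.1‖ * ‖F p.2‖) := by ring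
      _ ≤ B / 2 * jd (bigN d) (p.1 - p.2) * (‖H p.1‖ ^ 2 + ‖F p.2‖ ^ 2) := by gcongr
      _ = _ := by ring
  have hint : Integrable (fun p : Phase d × Phase d => H p.1 * (A p.1 p.2 * F p.2))
      (volume.prod volume) :=
    ((hi2.add hi1).const_mul (B / 2)).mono'
      ((hH.meas.comp measurable_fst).mul (hm.measurable_mul hF.meas)).aestronglyMeasurable
      (Filter.Eventually.of_forall hbd)
  have he : ∫ w, H w * act A F w = ∫ p : Phase d × Phase d, H p.1 * (A p.1 p.2 * F p.2) := by
    rw [Measure.volume_eq_prod (Phase d) (Phase d), integral_prod _ hint]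
    simp only [act, integral_const_mul]
  rw [he]
  refine (norm_integral_le_of_norm_le ((hi2.add hi1).const_mul (B / 2))
    (Filter.Eventually.of_forall hbd)).trans (le_of_eq ?_)
  have he3 : ∫ p : Phase d × Phase d, (jd (bigN d) (p.1 - p.2) * ‖H p.1‖ ^ 2 +
      jd (bigN d) (p.1 - p.2) * ‖F p.2‖ ^ 2) = jdMass d * sqN H + jdMass d * sqN F := by
    rw [← he2, sqN, ← integral_jd_sub_mul hF.integrable_sq]
    exact integral_add hi2 hi1
  rw [integral_const_mul]
  rw [Measure.volume_eq_prod (Phase d) (Phase d)] at he3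
  simp only [Pi.add_apply]
  rw [he3]
  ring

theorem integral_conj_mul_synth (χ : 𝓢(Config d, ℂ)) {F : Phase d → ℂ} (hF : Rapid F) :
    ∫ q, starRingEnd ℂ (χ q) * synth F q = ∫ z, starRingEnd ℂ (anal χ z) * F z := by
  rw [integral_mul_synth χ.isSchw.conj hF]
  congr 1
  ext z
  rw [mul_comm]
  congr 1
  rw [anal, ← integral_conj]
  congr 1
  ext q
  simp [mul_comm]

theorem Rapid.conj {F : Phase d → ℂ} (hF : Rapid F) : Rapid fun z => starRingEnd ℂ (F z) where
  meas := Complex.continuous_conj.measurable.comp hF.meas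
  decay N := by simpa using hF.decay N

theorem integral_conj_mul_self {X : Type*} [MeasureSpace X] (F : X → ℂ) :
    ∫ z, starRingEnd ℂ (F z) * F z = (sqN F : ℂ) := by
  rw [sqN, ← integral_complex_ofReal]
  congr 1
  ext z
  rw [mul_comm, Complex.mul_conj, Complex.normSq_eq_norm_sq]

/-- Analysis is the adjoint of synthesis, so this is the inversion formula paired with `ψ`. -/
theorem sqN_anal (ψ : 𝓢(Config d, ℂ)) : sqN (anal ψ) = kap d * sqN ψ := by
  have h := integral_conj_mul_synth ψ (rapid_anal ψ)
  simp only [synth_anal] at h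
  rw [integral_conj_mul_self] at h
  have h2 : ∫ q, starRingEnd ℂ (ψ q) * ((kap d : ℂ) * ψ q) = (kap d : ℂ) * (sqN ψ : ℂ) := by
    rw [← integral_conj_mul_self, ← integral_const_mul]
    congr 1
    ext q
    ring
  rw [h2] at h
  exact_mod_cast h.symm

/-- Schur's test bounds a pairing by a sum of squares, not by a product. Testing against `c T` and
choosing `c = D⁻¹` balances the two squares; the case `D = 0` is settled with `c = 1`. -/
theorem sqN_opS_le {A : Phase d → Phase d → ℂ} (hA : OffDiag A) {B : ℝ} (hB : 0 ≤ B)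
    (hb : ∀ w z, ‖A w z‖ ≤ B * jd (bigN d) (w - z)) (ψ : 𝓢(Config d, ℂ)) :
    sqN (opS A hA ψ) ≤ (B * jdMass d * kap d) ^ 2 * sqN ψ := by
  set T := opS A hA ψ with hT
  set D := B * jdMass d * kap d with hD
  have hD0 : 0 ≤ D := mul_nonneg (mul_nonneg hB (jdMass_nonneg d)) (kap_pos d).le
  have key : ∀ c : ℝ, 0 ≤ c → c * sqN T ≤ D * (c ^ 2 * sqN T + sqN ψ) / 2 := by
    intro c hc
    have h1 := integral_conj_mul_synth ((c : ℂ) • T) (rapid_act hA (rapid_anal ψ))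
    have h2 := schur_bound hB hb (rapid_anal ψ) (rapid_anal ((c : ℂ) • T)).conj hA
    rw [← h1] at h2
    have h3 : ∫ q, starRingEnd ℂ (((c : ℂ) • T) q) * synth (act A (anal ψ)) q =
        (c : ℂ) * (sqN T : ℂ) := by
      rw [← integral_conj_mul_self, ← integral_const_mul]
      congr 1
      ext q
      rw [← opS_apply A hA, ← hT]
      simp
      ring
    have h4 : sqN (fun z => starRingEnd ℂ (anal ((c : ℂ) • T) z)) = kap d * (c ^ 2 * sqN T) := by
      have : sqN (fun z => starRingEnd ℂ (anal ((c : ℂ) • T) z)) = sqN (anal ((c : ℂ) • T)) := by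
        simp [sqN]
      rw [this, sqN_anal]
      congr 1
      rw [sqN, sqN, ← integral_const_mul]
      congr 1
      ext q
      simp [mul_pow]
    rw [h3, h4, sqN_anal] at h2
    have h5 : ‖(c : ℂ) * (sqN T : ℂ)‖ = c * sqN T := by
      rw [← Complex.ofReal_mul, Complex.norm_real, Real.norm_of_nonneg (mul_nonneg hc (sqN_nonneg _))]
    rw [h5] at h2
    refine h2.trans (le_of_eq ?_)
    rw [hD]
    ring
  rcases hD0.eq_or_lt with h | h
  · have := key 1 zero_le_one
    rw [← h] at this ⊢
    have h0 := sqN_nonneg (T : Config d → ℂ)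
    simp at this ⊢
    linarith
  · have := key D⁻¹ (by positivity)
    have h2 : D⁻¹ * sqN T ≤ (D⁻¹ * sqN T + D * sqN ψ) / 2 := by
      refine this.trans (le_of_eq ?_)
      field_simp
    have h3 : D⁻¹ * sqN T ≤ D * sqN ψ := by linarith
    rw [inv_mul_le_iff₀ h] at h3
    linarith

theorem norm_toLp_sq (ψ : 𝓢(Config d, ℂ)) : ‖ψ.toLp 2‖ ^ 2 = sqN ψ := by
  have h := SchwartzMap.inner_toL2_toL2_eq ψ ψ
  have h2 := inner_self_eq_norm_sq_to_K (𝕜 := ℂ) (ψ.toLp 2)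
  rw [h] at h2
  have h3 : ∫ x, ⟪ψ x, ψ x⟫_ℂ = (sqN ψ : ℂ) := by
    rw [← integral_conj_mul_self]
    congr 1
    ext x
    rw [RCLike.inner_apply, mul_comm]
  rw [h3] at h2
  have h4 : ((‖ψ.toLp 2‖ ^ 2 : ℝ) : ℂ) = (sqN ψ : ℂ) := by
    rw [h2]
    push_cast
    rfl
  exact Complex.ofReal_injective h4

theorem norm_toLp_opS_le {A : Phase d → Phase d → ℂ} (hA : OffDiag A) {B : ℝ} (hB : 0 ≤ B)
    (hb : ∀ w z, ‖A w z‖ ≤ B * jd (bigN d) (w - z)) (ψ : 𝓢(Config d, ℂ)) :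
    ‖(opS A hA ψ).toLp 2‖ ≤ B * (jdMass d * kap d) * ‖ψ.toLp 2‖ := by
  have h := sqN_opS_le hA hB hb ψ
  rw [← norm_toLp_sq, ← norm_toLp_sq, ← mul_pow] at h
  have h0 : 0 ≤ B * (jdMass d * kap d) :=
    mul_nonneg hB (mul_nonneg (jdMass_nonneg d) (kap_pos d).le)
  have := abs_le_of_sq_le_sq' h (by rw [mul_assoc B]; positivity)
  rw [mul_assoc B] at this
  exact this.2

end Schur

/-! ### From kernels to Weyl symbols and back -/

section WeylSymbols

variable {d : ℕ}

/-- The Gaussian `exp(-‖q‖² - ‖p‖²)` on phase space. -/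
def gP (x : Phase d) : ℂ := gE d 1 x.1 * gE d 1 x.2

theorem gP_apply (x : Phase d) : gP x = ((Real.exp (-(‖x.1‖ ^ 2 + ‖x.2‖ ^ 2)) : ℝ) : ℂ) := by
  rw [gP, gE_apply, gE_apply, ← Complex.ofReal_mul, ← Real.exp_add]
  congr 2
  ring

theorem isSchw_gP : IsSchw (gP (d := d)) := by
  set B₀ : Config d →L[ℝ] Config d →L[ℝ] ℝ := innerSL ℝ
  have hB₀ : ∀ x, B₀ x x = ‖x‖ ^ 2 := fun x => real_inner_self_eq_norm_sq x
  set B : Phase d →L[ℝ] Phase d →L[ℝ] ℝ :=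
    B₀.bilinearComp (ContinuousLinearMap.fst ℝ _ _) (ContinuousLinearMap.fst ℝ _ _) +
    B₀.bilinearComp (ContinuousLinearMap.snd ℝ _ _) (ContinuousLinearMap.snd ℝ _ _) with hB
  have hBx : ∀ x : Phase d, B x x = ‖x.1‖ ^ 2 + ‖x.2‖ ^ 2 := fun x => by
    simp only [hB, add_apply, ContinuousLinearMap.bilinearComp_apply, hB₀]
    rfl
  have : gP (d := d) = gaussB B := by
    ext x
    rw [gP_apply, gaussB, hBx]
  rw [this]
  refine isSchw_gaussB B one_pos fun x => ?_
  rw [hBx, Prod.norm_def, one_mul]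
  rcases le_total ‖x.1‖ ‖x.2‖ with h | h
  · rw [max_eq_right h]; nlinarith [sq_nonneg ‖x.1‖]
  · rw [max_eq_left h]; nlinarith [sq_nonneg ‖x.2‖]

/-- Midpoint of two phase space points. -/
def mid (w z : Phase d) : Phase d := (1 / 2 : ℝ) • (w + z)

@[fun_prop]
theorem continuous_mid {X : Type*} [TopologicalSpace X] {f g : X → Phase d} (hf : Continuous f)
    (hg : Continuous g) : Continuous fun x => mid (f x) (g x) := by
  unfold mid; fun_prop

/-- The total mass of the Gaussian `exp(-‖q‖²)`. -/
def gMass (d : ℕ) : ℝ := ∫ a : Config d, Real.exp (-‖a‖ ^ 2)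

theorem gMass_pos (d : ℕ) : 0 < gMass d :=
  integral_exp_pos (μ := (volume : Measure (Config d))) (f := fun a => -‖a‖ ^ 2)
    integrable_exp_neg_sq

/-- The phase `exp(i ⟨β, a' - a⟩)`. -/
def midPhase (w z : Phase d) : ℂ := cexp (I * (⟪(mid w z).2, (w - z).1⟫_ℝ : ℂ))

theorem norm_midPhase (w z : Phase d) : ‖midPhase w z‖ = 1 := by
  simp [midPhase, mul_comm I, Complex.norm_exp_ofReal_mul_I]

/-- The Weyl symbol of the rank one operator `φ_w ⟨φ_z, ·⟩`. -/
def wig (w z x : Phase d) : ℂ :=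
  (((2 * Real.pi) ^ d / gMass d : ℝ) : ℂ) * midPhase w z *
    (gP (x - mid w z) * chi (sympL (w - z)) x)

theorem contDiff_wig : ContDiff ℝ ∞ fun p : (Phase d × Phase d) × Phase d =>
    wig p.1.1 p.1.2 p.2 := by
  have hw : ContDiff ℝ ∞ fun p : (Phase d × Phase d) × Phase d => p.1.1 :=
    contDiff_fst.comp contDiff_fst
  have hz : ContDiff ℝ ∞ fun p : (Phase d × Phase d) × Phase d => p.1.2 :=
    contDiff_snd.comp contDiff_fst
  have hx : ContDiff ℝ ∞ fun p : (Phase d × Phase d) × Phase d => p.2 := contDiff_snd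
  have hm : ContDiff ℝ ∞ fun p : (Phase d × Phase d) × Phase d => mid p.1.1 p.1.2 :=
    (hw.add hz).const_smul (1 / 2 : ℝ)
  have hs := hw.sub hz
  have h1 : ContDiff ℝ ∞ fun p : (Phase d × Phase d) × Phase d => midPhase p.1.1 p.1.2 :=
    contDiff_cexp_I.comp (hm.snd.inner ℝ hs.fst)
  have h2 : ContDiff ℝ ∞ fun p : (Phase d × Phase d) × Phase d => gP (p.2 - mid p.1.1 p.1.2) :=
    isSchw_gP.1.comp (hx.sub hm)
  have h3 : ContDiff ℝ ∞ fun p : (Phase d × Phase d) × Phase d =>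
      chi (sympL (p.1.1 - p.1.2)) p.2 := by
    simp only [chi, sympL_apply]
    exact contDiff_cexp_I.comp ((hs.snd.inner ℝ hx.fst).sub (hs.fst.inner ℝ hx.snd))
  exact (contDiff_const.mul h1).mul (h2.mul h3)

@[fun_prop]
theorem continuous_wig {X : Type*} [TopologicalSpace X] {f g h : X → Phase d} (hf : Continuous f)
    (hg : Continuous g) (hh : Continuous h) : Continuous fun x => wig (f x) (g x) (h x) := by
  have := (contDiff_wig (d := d)).continuous
  exact Continuous.comp (g := fun p : (Phase d × Phase d) × Phase d => wig p.1.1 p.1.2 p.2)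
    (f := fun x => ((f x, g x), h x)) this ((hf.prodMk hg).prodMk hh)

/-- The Gaussian factor is centred at the midpoint and oscillates with frequency of size `‖w - z‖`.
Of the weight `N + n`, the power `n` absorbs the derivatives of the oscillation and `N` pays for
replacing the midpoint by `w`. -/
theorem wig_deriv_bound (d n N : ℕ) : ∃ C, 0 ≤ C ∧ ∀ w z x : Phase d,
    ‖iteratedFDeriv ℝ n (wig w z) x‖ * jd (N + n) (w - z) ≤ C * jd N (x - w) := by
  obtain ⟨C, h0, hC⟩ := (isSchw_gP (d := d)).packet n N
  have hc : 0 < (2 * Real.pi) ^ d / gMass d := div_pos (by positivity) (gMass_pos d)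
  refine ⟨(2 * Real.pi) ^ d / gMass d * (C * 2 ^ n), by positivity, fun w z x => ?_⟩
  have h1 : iteratedFDeriv ℝ n (wig w z) x =
      ((((2 * Real.pi) ^ d / gMass d : ℝ) : ℂ) * midPhase w z) •
        iteratedFDeriv ℝ n (fun x => gP (x - mid w z) * chi (sympL (w - z)) x) x := by
    refine iteratedFDeriv_const_smul_apply (a := (((2 * Real.pi) ^ d / gMass d : ℝ) : ℂ) *
      midPhase w z) (f := fun x => gP (x - mid w z) * chi (sympL (w - z)) x) ?_
    exact (((isSchw_gP.1.comp (contDiff_id.sub contDiff_const)).mul (contDiff_chi _)).of_le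
      (m := (n : ℕ∞)) (by exact_mod_cast le_top)).contDiffAt
  rw [h1, norm_smul, norm_mul, norm_midPhase, mul_one, Complex.norm_real,
    Real.norm_of_nonneg hc.le]
  have h2 := hC (sympL (w - z)) (mid w z) x n le_rfl
  have h3 : 1 + ‖sympL (w - z)‖ ≤ 2 * (1 + ‖w - z‖) := by
    have := norm_sympL_le (w - z)
    linarith
  have h4 : jd N (w - z) * jd N (x - mid w z) ≤ jd N (x - w) := by
    refine jd_mul_le_of N ?_
    have : x - w = (x - mid w z) + (-(1 / 2 : ℝ)) • (w - z) := by
      simp only [mid]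
      module
    rw [this, add_comm]
    refine (norm_add_le _ _).trans ?_
    gcongr
    rw [norm_smul]
    norm_num
    linarith [norm_nonneg (w - z)]
  have h5 := jd_nonneg N (x - mid w z)
  have h6 := jd_nonneg (N + n) (w - z)
  calc _ ≤ (2 * Real.pi) ^ d / gMass d * (C * (1 + ‖sympL (w - z)‖) ^ n * jd N (x - mid w z)) *
        jd (N + n) (w - z) := by gcongr
    _ ≤ (2 * Real.pi) ^ d / gMass d * (C * (2 * (1 + ‖w - z‖)) ^ n * jd N (x - mid w z)) *
        jd (N + n) (w - z) := by gcongr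
    _ = (2 * Real.pi) ^ d / gMass d * (C * 2 ^ n) * (((1 + ‖w - z‖) ^ n * jd (N + n) (w - z)) *
        jd N (x - mid w z)) := by rw [mul_pow 2 (1 + ‖w - z‖) n]; ring
    _ ≤ _ := by
        rw [one_add_pow_mul_jd]
        gcongr

theorem integrable_jd_sub_mul' {h : Phase d → ℝ} (hh : Integrable h) :
    Integrable (fun p : Phase d × Phase d => jd (bigN d) (p.1 - p.2) * h p.1)
      (volume.prod volume) := by
  have := (integrable_jd_sub_mul hh).swap
  refine this.congr (Filter.Eventually.of_forall fun p => ?_)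
  simp only [Function.comp, Prod.swap, jd_sub_comm _ p.1 p.2]

theorem integral_jd_sub_mul' {h : Phase d → ℝ} (hh : Integrable h) :
    ∫ p : Phase d × Phase d, jd (bigN d) (p.1 - p.2) * h p.1 = jdMass d * ∫ z, h z := by
  rw [← integral_jd_sub_mul hh, Measure.volume_eq_prod, ← integral_prod_swap]
  simp only [Prod.swap, jd_sub_comm]

/-- The Weyl symbol of the operator with a given kernel. -/
def symb (A : Phase d → Phase d → ℂ) (x : Phase d) : ℂ :=
  ∫ p : Phase d × Phase d, A p.1 p.2 * wig p.1 p.2 x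

theorem OffDiag.mul_wig_bound {A : Phase d → Phase d → ℂ} (hA : OffDiag A) (n N K : ℕ) :
    ∃ C, 0 ≤ C ∧ ∀ w z x : Phase d, ‖A w z‖ * ‖iteratedFDeriv ℝ n (wig w z) x‖ ≤
      C * (jd K (w - z) * jd N (x - w)) := by
  obtain ⟨C, h0, hC⟩ := wig_deriv_bound d n N
  obtain ⟨D, hD0, hD⟩ := hA.decay (K + (N + n))
  refine ⟨D * C, mul_nonneg hD0 h0, fun w z x => ?_⟩
  calc ‖A w z‖ * ‖iteratedFDeriv ℝ n (wig w z) x‖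
      ≤ D * jd (K + (N + n)) (w - z) * ‖iteratedFDeriv ℝ n (wig w z) x‖ := by
        gcongr
        exact hD w z
    _ = D * jd K (w - z) * (‖iteratedFDeriv ℝ n (wig w z) x‖ * jd (N + n) (w - z)) := by
        rw [jd_add_exp]; ring
    _ ≤ D * jd K (w - z) * (C * jd N (x - w)) := by
        exact mul_le_mul_of_nonneg_left (hC w z x) (mul_nonneg hD0 (jd_nonneg _ _))
    _ = _ := by ring

theorem integrable_jd_const_sub (x : Phase d) : Integrable fun w => jd (bigN d) (x - w) := by
  simpa only [jd_sub_comm _ x] using integrable_jd_phase.comp_sub_right x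

theorem integral_jd_const_sub (x : Phase d) : ∫ w, jd (bigN d) (x - w) = jdMass d := by
  simp only [jd_sub_comm _ x]
  exact integral_sub_right_eq_self (fun w => jd (bigN d) w) x

theorem symb_contDiff_and_bound {A : Phase d → Phase d → ℂ} (hA : OffDiag A) :
    ContDiff ℝ ∞ (symb A) ∧ ∀ n x, ‖iteratedFDeriv ℝ n (symb A) x‖ ≤
      ∫ p : Phase d × Phase d, ‖A p.1 p.2‖ * ‖iteratedFDeriv ℝ n (wig p.1 p.2) x‖ := by
  refine contDiff_integral_weight (E := Phase d) (Y := Phase d × Phase d) (μ := volume)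
    (ρ := fun p => A p.1 p.2) (u := fun p => wig p.1.1 p.1.2 p.2) contDiff_wig
    hA.meas.aestronglyMeasurable fun k x₀ => ?_
  obtain ⟨C, h0, hC⟩ := hA.mul_wig_bound k (bigN d) (bigN d)
  -- The dominating function must not depend on `x`: for `‖x - x₀‖ < 1` the factor `2 ^ bigN d` pays
  -- for replacing `x` by `x₀` in the weight.
  refine ⟨fun p => C * 2 ^ bigN d * (jd (bigN d) (p.1 - p.2) * jd (bigN d) (x₀ - p.1)),
    (integrable_jd_sub_mul' (integrable_jd_const_sub x₀)).const_mul _, ?_⟩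
  filter_upwards [Metric.ball_mem_nhds x₀ one_pos] with x hx p
  refine (hC p.1 p.2 x).trans ?_
  have h1 : jd (bigN d) (x - p.1) ≤ 2 ^ bigN d * jd (bigN d) (x₀ - p.1) := by
    have h2 := jd_mul_le (bigN d) (x₀ - x) (x - p.1)
    rw [sub_add_sub_cancel] at h2
    have h3 : ((2 : ℝ) ^ bigN d)⁻¹ ≤ jd (bigN d) (x₀ - x) := by
      unfold jd
      gcongr
      rw [norm_sub_rev]
      have : ‖x - x₀‖ < 1 := by simpa [dist_eq_norm] using hx
      linarith
    have h4 := jd_nonneg (bigN d) (x - p.1)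
    have h5 := (mul_le_mul_of_nonneg_right h3 h4).trans h2
    rwa [inv_mul_le_iff₀ (by positivity)] at h5
  have h2 := jd_nonneg (bigN d) (p.1 - p.2)
  calc _ ≤ C * (jd (bigN d) (p.1 - p.2) * (2 ^ bigN d * jd (bigN d) (x₀ - p.1))) := by gcongr
    _ = _ := by ring

theorem isSymbol_symb {A : Phase d → Phase d → ℂ} (hA : OffDiag A) : IsSymbol (symb A) := by
  refine ⟨(symb_contDiff_and_bound hA).1, fun n => ?_⟩
  obtain ⟨C, h0, hC⟩ := hA.mul_wig_bound n (bigN d) (bigN d)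
  refine ⟨C * (jdMass d * jdMass d), fun x => ((symb_contDiff_and_bound hA).2 n x).trans ?_⟩
  have hi := integrable_jd_sub_mul' (integrable_jd_const_sub x)
  calc _ ≤ ∫ p : Phase d × Phase d, C * (jd (bigN d) (p.1 - p.2) * jd (bigN d) (x - p.1)) :=
        integral_mono_of_nonneg (Filter.Eventually.of_forall fun p => by positivity)
          (hi.const_mul C) (Filter.Eventually.of_forall fun p => hC p.1 p.2 x)
    _ = _ := by
        rw [integral_const_mul, integral_jd_sub_mul' (integrable_jd_const_sub x),
          integral_jd_const_sub]

theorem OffDiag.integrable_mul_wig {A : Phase d → Phase d → ℂ} (hA : OffDiag A) (x : Phase d) :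
    Integrable (fun p : Phase d × Phase d => A p.1 p.2 * wig p.1 p.2 x)
      (volume.prod volume) := by
  obtain ⟨C, h0, hC⟩ := hA.mul_wig_bound 0 (bigN d) (bigN d)
  refine ((integrable_jd_sub_mul' (integrable_jd_const_sub x)).const_mul C).mono'
    (hA.meas.mul (by fun_prop : Continuous fun p : Phase d × Phase d =>
      wig p.1 p.2 x).measurable).aestronglyMeasurable (Filter.Eventually.of_forall fun p => ?_)
  rw [norm_mul]
  simpa using hC p.1 p.2 x

/-- The normalization of the coherent state kernels. -/
def symConst (d : ℕ) : ℝ := (2 * Real.pi) ^ d / gMass d * (2 * Real.pi) ^ (2 * d) *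
  ∫ x : Phase d, (Real.exp (-(‖x.1‖ ^ 2 + ‖x.2‖ ^ 2))) ^ 2

/-- The windowed symplectic Fourier transform. -/
def stftP (f : Phase d → ℂ) (y η : Phase d) : ℂ :=
  ∫ x, gP (x - y) * f x * chi (sympL (-η)) x

/-- The coherent state kernel of the Weyl quantization of a symbol. -/
def symKer (f : Phase d → ℂ) (w z : Phase d) : ℂ :=
  (symConst d : ℂ)⁻¹ * starRingEnd ℂ (midPhase w z) * stftP f (mid w z) (w - z)

theorem stftP_bound (d N : ℕ) : ∃ C, 0 ≤ C ∧ ∀ (f : Phase d → ℂ) (B : ℝ), ContDiff ℝ ∞ f →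
    (∀ k ≤ N, ∀ x, ‖iteratedFDeriv ℝ k f x‖ ≤ B) → ∀ y η, ‖stftP f y η‖ ≤ C * B * jd N η := by
  obtain ⟨C, h0, hC⟩ := (isSchw_gP (d := d)).exists_bound N (bigN d)
  refine ⟨8 ^ N * C * jdMass d, mul_nonneg (by positivity) (jdMass_nonneg d),
    fun f B hf hB y η => ?_⟩
  have hB0 : 0 ≤ B := (norm_nonneg _).trans (hB 0 (Nat.zero_le _) 0)
  have h := norm_windowed_integral_le volume (sympL (-η)) y N isSchw_gP.1 hf
    (C := C * B) (w := fun x => jd (bigN d) (x - y))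
    (integrable_jd_phase.comp_sub_right _) (b₁ := fun x => C * jd (bigN d) (x - y))
    (b₂ := fun _ => B) (fun j hj x => hC j hj _) hB fun x => le_of_eq (by ring)
  rw [integral_sub_right_eq_self (fun x => jd (bigN d) x)] at h
  have h1 : jd N (sympL (-η)) ≤ jd N η := by
    refine jd_le_of_norm_le N ?_
    have := le_norm_sympL (-η)
    rwa [norm_neg] at this
  have h2 : 0 ≤ 8 ^ N * (C * B) * jdMass d :=
    mul_nonneg (by positivity) (jdMass_nonneg d)
  exact h.trans ((mul_le_mul_of_nonneg_left h1 h2).trans (le_of_eq (by ring)))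

/-- Decay of order `N` off the diagonal costs `N` derivatives of the symbol: `w - z` is the
frequency in the windowed Fourier integral. -/
theorem symKer_bound (d N : ℕ) : ∃ C, 0 ≤ C ∧ ∀ (f : Phase d → ℂ) (B : ℝ), ContDiff ℝ ∞ f →
    (∀ k ≤ N, ∀ x, ‖iteratedFDeriv ℝ k f x‖ ≤ B) → ∀ w z, ‖symKer f w z‖ ≤ C * B * jd N (w - z) := by
  obtain ⟨C, h0, hC⟩ := stftP_bound d N
  refine ⟨|symConst d|⁻¹ * C, by positivity, fun f B hf hB w z => ?_⟩
  rw [symKer, norm_mul, norm_mul, norm_inv, Complex.norm_real, Real.norm_eq_abs,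
    RCLike.norm_conj, norm_midPhase, mul_one, mul_assoc, mul_assoc]
  refine mul_le_mul_of_nonneg_left ?_ (by positivity)
  rw [← mul_assoc]
  exact hC f B hf hB _ _

@[fun_prop]
theorem continuous_chi_sympL {X : Type*} [TopologicalSpace X] {f g : X → Phase d}
    (hf : Continuous f) (hg : Continuous g) : Continuous fun x => chi (sympL (f x)) (g x) := by
  simp only [chi, sympL_apply]
  fun_prop

@[fun_prop]
theorem continuous_gP {X : Type*} [TopologicalSpace X] {f : X → Phase d} (hf : Continuous f) :
    Continuous fun x => gP (f x) :=
  isSchw_gP.1.continuous.comp hf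

theorem measurable_stftP {f : Phase d → ℂ} (hf : Continuous f) :
    Measurable fun p : Phase d × Phase d => stftP f p.1 p.2 := by
  have h : Continuous fun p : (Phase d × Phase d) × Phase d =>
      gP (p.2 - p.1.1) * f p.2 * chi (sympL (-p.1.2)) p.2 := by
    fun_prop
  exact (h.stronglyMeasurable.integral_prod_right' (ν := volume)).measurable

@[fun_prop]
theorem continuous_midPhase {X : Type*} [TopologicalSpace X] {f g : X → Phase d}
    (hf : Continuous f) (hg : Continuous g) : Continuous fun x => midPhase (f x) (g x) := by
  unfold midPhase
  fun_prop

theorem measurable_stftP_mid {f : Phase d → ℂ} (hf : Continuous f) :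
    Measurable fun p : Phase d × Phase d => stftP f (mid p.1 p.2) (p.1 - p.2) := by
  have h3 : Continuous fun p : Phase d × Phase d => (mid p.1 p.2, p.1 - p.2) := by fun_prop
  have := (measurable_stftP hf).comp h3.measurable
  exact this

theorem measurable_symKer {f : Phase d → ℂ} (hf : Continuous f) :
    Measurable fun p : Phase d × Phase d => symKer f p.1 p.2 := by
  have h2 : Continuous fun p : Phase d × Phase d => midPhase p.1 p.2 := by fun_prop
  have h5 : Measurable fun p : Phase d × Phase d => starRingEnd ℂ (midPhase p.1 p.2) :=
    Complex.continuous_conj.measurable.comp h2.measurable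
  simp only [symKer]
  exact (h5.const_mul _).mul (measurable_stftP_mid hf)

theorem offDiag_symKer {f : Phase d → ℂ} (hf : IsSymbol f) : OffDiag (symKer f) := by
  refine ⟨measurable_symKer hf.1.continuous, fun N => ?_⟩
  obtain ⟨C, h0, hC⟩ := symKer_bound d N
  obtain ⟨B, hB0, hB⟩ := (isSymbol_iff_bddD.1 hf).exists_nonneg_bound N le_top
  exact ⟨C * B, mul_nonneg h0 hB0, hC f B hf.1 fun k hk x => hB k hk x trivial⟩

end WeylSymbols

/-! ### Recovering a symbol from its kernel -/

section SymbolReconstruction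

variable {d : ℕ}

theorem gP_neg (x : Phase d) : gP (-x) = gP x := by simp [gP_apply]

theorem jd_half_le (N : ℕ) (x : Phase d) : jd N x ≤ jd N ((1 / 2 : ℝ) • x) := by
  refine jd_le_of_norm_le N ?_
  rw [norm_smul]
  norm_num
  linarith [norm_nonneg x]

theorem midPhase_mul_conj (w z : Phase d) : midPhase w z * starRingEnd ℂ (midPhase w z) = 1 := by
  rw [Complex.mul_conj, Complex.normSq_eq_norm_sq, norm_midPhase]
  simp

theorem symConst_ne_zero (d : ℕ) : symConst d ≠ 0 := by
  have h : Integrable fun x : Phase d => (Real.exp (-(‖x.1‖ ^ 2 + ‖x.2‖ ^ 2))) ^ 2 := by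
    have h1 := ((isSchw_gP (d := d)).mul isSchw_gP.1 isSchw_gP.bounded).integrable volume
    refine h1.re.congr (Filter.Eventually.of_forall fun x => ?_)
    simp only [gP_apply, ← Complex.ofReal_mul]
    rw [pow_two (Real.exp _)]
    exact Complex.ofReal_re _
  have h2 : 0 < ∫ x : Phase d, (Real.exp (-(‖x.1‖ ^ 2 + ‖x.2‖ ^ 2))) ^ 2 := by
    simp only [← Real.exp_nat_mul] at h ⊢
    exact integral_exp_pos h
  have := gMass_pos d
  exact (show 0 < symConst d by unfold symConst; positivity).ne'

/-- The integrand in the reconstruction of a symbol from its windowed Fourier transform. -/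
def recon (f : Phase d → ℂ) (x y η : Phase d) : ℂ :=
  stftP f y η * (gP (x - y) * chi (sympL η) x)

theorem measurable_recon {f : Phase d → ℂ} (hf : Continuous f) (x : Phase d) :
    Measurable fun p : Phase d × Phase d => recon f x p.1 p.2 := by
  have h : Continuous fun p : Phase d × Phase d => gP (x - p.1) * chi (sympL p.2) x := by fun_prop
  exact (measurable_stftP hf).mul h.measurable

theorem recon_bound {f : Phase d → ℂ} (hf : IsSymbol f) : ∃ C, 0 ≤ C ∧ ∀ x y η,
    ‖recon f x y η‖ ≤ C * (jd (bigN d + bigN d) η * jd (bigN d) (x - y)) := by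
  obtain ⟨C, h0, hC⟩ := stftP_bound d (bigN d + bigN d)
  obtain ⟨B, hB0, hB⟩ := (isSymbol_iff_bddD.1 hf).exists_nonneg_bound (bigN d + bigN d) le_top
  obtain ⟨D, hD0, hD⟩ := (isSchw_gP (d := d)).norm_le (bigN d)
  refine ⟨C * B * D, by positivity, fun x y η => ?_⟩
  rw [recon, norm_mul, norm_mul, norm_chi, mul_one]
  calc _ ≤ (C * B * jd (bigN d + bigN d) η) * (D * jd (bigN d) (x - y)) := by
        gcongr
        · exact mul_nonneg (by positivity) (jd_nonneg _ _)
        · exact hC f B hf.1 (fun k hk x => hB k hk x trivial) y η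
        · exact hD _
    _ = _ := by ring

theorem integrable_recon {f : Phase d → ℂ} (hf : IsSymbol f) (x : Phase d) :
    Integrable (fun p : Phase d × Phase d => recon f x p.1 p.2) (volume.prod volume) := by
  obtain ⟨C, h0, hC⟩ := recon_bound hf
  refine (((integrable_jd_const_sub x).mul_prod integrable_jd_phase).const_mul C).mono'
    (measurable_recon hf.1.continuous x).aestronglyMeasurable
    (Filter.Eventually.of_forall fun p => (hC x p.1 p.2).trans ?_)
  rw [mul_comm (jd _ p.2)]
  have h1 := jd_anti (Nat.le_add_left (bigN d) (bigN d)) p.2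
  have h2 := jd_nonneg (bigN d) (x - p.1)
  gcongr

/-- Half of the decay in `η` is used to move from `x - (y + η/2)` to `x - y`; this is why
`recon_bound` supplies twice `bigN d`. -/
theorem integrable_recon_shift {f : Phase d → ℂ} (hf : IsSymbol f) (x : Phase d) :
    Integrable (fun p : Phase d × Phase d => recon f x (p.1 + (1 / 2 : ℝ) • p.2) p.2)
      (volume.prod volume) := by
  obtain ⟨C, h0, hC⟩ := recon_bound hf
  have hm : Continuous fun p : Phase d × Phase d => (p.1 + (1 / 2 : ℝ) • p.2, p.2) := by fun_prop
  have hm2 := (measurable_recon hf.1.continuous x).comp hm.measurable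
  refine (((integrable_jd_const_sub x).mul_prod integrable_jd_phase).const_mul C).mono'
    hm2.aestronglyMeasurable
    (Filter.Eventually.of_forall fun p => (hC x _ p.2).trans ?_)
  have h1 := jd_mul_le (bigN d) (x - (p.1 + (1 / 2 : ℝ) • p.2)) ((1 / 2 : ℝ) • p.2)
  have h2 := jd_half_le (bigN d) p.2
  have h3 := jd_nonneg (bigN d) (x - (p.1 + (1 / 2 : ℝ) • p.2))
  have h4 := jd_nonneg (bigN d) p.2
  rw [show x - (p.1 + (1 / 2 : ℝ) • p.2) + (1 / 2 : ℝ) • p.2 = x - p.1 by abel] at h1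
  refine mul_le_mul_of_nonneg_left ?_ h0
  rw [jd_add_exp]
  calc jd (bigN d) p.2 * jd (bigN d) p.2 * jd (bigN d) (x - (p.1 + (1 / 2 : ℝ) • p.2))
      ≤ jd (bigN d) p.2 * jd (bigN d) ((1 / 2 : ℝ) • p.2) *
        jd (bigN d) (x - (p.1 + (1 / 2 : ℝ) • p.2)) := by gcongr
    _ = jd (bigN d) p.2 * (jd (bigN d) (x - (p.1 + (1 / 2 : ℝ) • p.2)) *
        jd (bigN d) ((1 / 2 : ℝ) • p.2)) := by ring
    _ ≤ jd (bigN d) p.2 * jd (bigN d) (x - p.1) := by gcongr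
    _ = _ := mul_comm _ _

theorem integral_recon {f : Phase d → ℂ} (hf : IsSymbol f) (x y : Phase d) :
    ∫ η, recon f x y η = ((2 * Real.pi) ^ (2 * d) : ℝ) * f x * (gP (y - x) * gP (y - x)) := by
  have hu : IsSchw fun y' => gP (y' - y) * f y' :=
    (isSchw_gP.comp_sub y).mul hf.1 fun n => (hf.2 n)
  have h := fourier_inversion_symp hu x
  have h1 : ∀ η, recon f x y η = gP (x - y) *
      ((∫ y', gP (y' - y) * f y' * chi (sympL (-η)) y') * chi (sympL η) x) := fun η => by
    rw [recon, stftP]; ring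
  simp only [h1]
  rw [integral_const_mul, h, ← gP_neg (y - x), neg_sub]
  ring

/-- The phases of kernel and rank one symbol cancel, and the integrand depends on `(w, z)` only
through the midpoint and `η = w - z`. In these variables the `η` integral is symplectic Fourier
inversion for the windowed symbol, and the remaining integral is the mass of the squared Gaussian,
which `symConst` normalises away. -/
theorem symb_symKer {f : Phase d → ℂ} (hf : IsSymbol f) (x : Phase d) : symb (symKer f) x = f x := by
  have hint := (offDiag_symKer hf).integrable_mul_wig x
  set c : ℂ := (symConst d : ℂ)⁻¹ * (((2 * Real.pi) ^ d / gMass d : ℝ) : ℂ) with hc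
  have h1 : ∀ w z, symKer f w z * wig w z x = c * recon f x (mid w z) (w - z) := fun w z => by
    rw [symKer, wig, recon, hc]
    linear_combination (symConst d : ℂ)⁻¹ * stftP f (mid w z) (w - z) *
      (((2 * Real.pi) ^ d / gMass d : ℝ) : ℂ) * (gP (x - mid w z) * chi (sympL (w - z)) x) *
      midPhase_mul_conj w z
  have h2 : ∀ z η : Phase d, recon f x (mid (η + z) z) (η + z - z) =
      recon f x (z + (1 / 2 : ℝ) • η) η := fun z η => by
    rw [add_sub_cancel_right, show mid (η + z) z = z + (1 / 2 : ℝ) • η by unfold mid; module]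
  rw [symb, Measure.volume_eq_prod, integral_prod_symm _ hint]
  simp only [h1, integral_const_mul]
  have h3 : ∀ z : Phase d, ∫ w, recon f x (mid w z) (w - z) =
      ∫ η, recon f x (z + (1 / 2 : ℝ) • η) η := fun z => by
    rw [← integral_add_right_eq_self (fun w => recon f x (mid w z) (w - z)) z]
    simp only [h2]
  simp only [h3]
  rw [integral_integral_swap (integrable_recon_shift hf x)]
  have h4 : ∀ η : Phase d, ∫ z, recon f x (z + (1 / 2 : ℝ) • η) η = ∫ z, recon f x z η := fun η =>
    integral_add_right_eq_self (fun z => recon f x z η) _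
  simp only [h4]
  rw [← integral_integral_swap (integrable_recon hf x)]
  simp only [integral_recon hf, integral_const_mul]
  rw [integral_sub_right_eq_self (fun y => gP y * gP y) x]
  have h5 : ∫ y : Phase d, gP y * gP y =
      ((∫ x : Phase d, (Real.exp (-(‖x.1‖ ^ 2 + ‖x.2‖ ^ 2))) ^ 2 : ℝ) : ℂ) := by
    rw [← integral_complex_ofReal]
    congr 1
    ext y
    rw [gP_apply, ← Complex.ofReal_mul, pow_two (Real.exp _)]
  have h6 : (symConst d : ℂ) ≠ 0 := by exact_mod_cast symConst_ne_zero d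
  rw [h5, hc]
  have h7 : (symConst d : ℂ) = (((2 * Real.pi) ^ d / gMass d : ℝ) : ℂ) *
      ((2 * Real.pi) ^ (2 * d) : ℝ) *
      ((∫ x : Phase d, (Real.exp (-(‖x.1‖ ^ 2 + ‖x.2‖ ^ 2))) ^ 2 : ℝ) : ℂ) := by
    rw [symConst, Complex.ofReal_mul, Complex.ofReal_mul]
  calc _ = (symConst d : ℂ)⁻¹ * ((((2 * Real.pi) ^ d / gMass d : ℝ) : ℂ) *
      ((2 * Real.pi) ^ (2 * d) : ℝ) *
      ((∫ x : Phase d, (Real.exp (-(‖x.1‖ ^ 2 + ‖x.2‖ ^ 2))) ^ 2 : ℝ) : ℂ)) * f x := by ring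
    _ = f x := by rw [← h7, inv_mul_cancel₀ h6, one_mul]

end SymbolReconstruction

/-! ### The rank one operators between coherent states -/

section WeylKernel

variable {d : ℕ}

theorem integral_gE_mul_cexp (v : Config d) :
    ∫ p : Config d, gE d 1 p * cexp (I * (⟪v, p⟫_ℝ : ℂ)) =
      (gMass d : ℂ) * ((Real.exp (-(‖v‖ ^ 2 / 4)) : ℝ) : ℂ) := by
  have key : ∀ v : Config d, ∫ p : Config d, gE d 1 p * cexp (I * (⟪v, p⟫_ℝ : ℂ)) =
      (Real.pi / 1 : ℂ) ^ (Module.finrank ℝ (Config d) / 2 : ℂ) *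
        cexp (I ^ 2 * ‖v‖ ^ 2 / (4 * 1)) := fun v => by
    rw [← GaussianFourier.integral_cexp_neg_mul_sq_norm_add (b := 1) (by simp) I v]
    congr 1
    ext p
    rw [gE_apply, Complex.ofReal_exp, ← Complex.exp_add]
    congr 1
    push_cast
    ring
  have h0 := key 0
  simp only [inner_zero_left, Complex.ofReal_zero, mul_zero, Complex.exp_zero, mul_one,
    norm_zero] at h0
  rw [key, gMass, ← integral_complex_ofReal]
  have h1 : ∫ p : Config d, ((Real.exp (-‖p‖ ^ 2) : ℝ) : ℂ) = ∫ p : Config d, gE d 1 p := by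
    simp only [gE_apply, one_mul]
  rw [h1, h0]
  simp only [ne_eq, OfNat.ofNat_ne_zero, not_false_eq_true, zero_pow, mul_zero, zero_div,
    Complex.exp_zero, mul_one, I_sq, Complex.ofReal_exp]
  congr 2
  push_cast
  ring

/-- The parallelogram law for `q - a'` and `q' - a`. It splits the Gaussian in midpoint and
difference into the product of the two packets. -/
theorem gauss_kernel_identity (a a' q q' : Config d) :
    ‖(1 / 2 : ℝ) • (q + q') - (1 / 2 : ℝ) • (a' + a)‖ ^ 2 + ‖q - q' - (a' - a)‖ ^ 2 / 4 =
      1 / 2 * ‖q - a'‖ ^ 2 + 1 / 2 * ‖q' - a‖ ^ 2 := by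
  have h1 : (1 / 2 : ℝ) • (q + q') - (1 / 2 : ℝ) • (a' + a) =
      (1 / 2 : ℝ) • ((q - a') + (q' - a)) := by module
  have h2 : q - q' - (a' - a) = (q - a') - (q' - a) := by abel
  have h3 := parallelogram_law_with_norm ℝ (q - a') (q' - a)
  rw [h1, h2, norm_smul, mul_pow]
  norm_num
  nlinarith [h3]

theorem wig_apply (w z : Phase d) (Q p : Config d) : wig w z (Q, p) =
    (((2 * Real.pi) ^ d / gMass d : ℝ) : ℂ) *
      (gE d 1 (Q - (1 / 2 : ℝ) • (w.1 + z.1)) * gE d 1 (p - (1 / 2 : ℝ) • (w.2 + z.2))) *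
      cexp (I * ((⟪(1 / 2 : ℝ) • (w.2 + z.2), w.1 - z.1⟫_ℝ + ⟪w.2 - z.2, Q⟫_ℝ -
        ⟪w.1 - z.1, p⟫_ℝ : ℝ) : ℂ)) := by
  have h : cexp (I * ((⟪(1 / 2 : ℝ) • (w.2 + z.2), w.1 - z.1⟫_ℝ + ⟪w.2 - z.2, Q⟫_ℝ -
        ⟪w.1 - z.1, p⟫_ℝ : ℝ) : ℂ)) = midPhase w z * chi (sympL (w - z)) (Q, p) := by
    rw [midPhase, chi, sympL_apply, ← Complex.exp_add]
    congr 1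
    simp only [mid, Prod.smul_snd, Prod.snd_add, Prod.fst_sub, Prod.snd_sub]
    push_cast
    ring
  rw [h, wig, gP]
  simp only [mid, Prod.fst_sub, Prod.snd_sub, Prod.smul_fst, Prod.smul_snd, Prod.fst_add,
    Prod.snd_add]
  ring

/-- The Weyl kernel of the symbol of a rank one operator. -/
theorem integral_wig (w z : Phase d) (q q' : Config d) :
    ∫ p : Config d, cexp (I * ((⟪q - q', p⟫_ℝ : ℝ) : ℂ)) * wig w z ((1 / 2 : ℝ) • (q + q'), p) =
      (((2 * Real.pi) ^ d : ℝ) : ℂ) * (coh w q * starRingEnd ℂ (coh z q')) := by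
  set m := (1 / 2 : ℝ) • (w.1 + z.1) with hm
  set β := (1 / 2 : ℝ) • (w.2 + z.2) with hβ
  set Q := (1 / 2 : ℝ) • (q + q') with hQ
  rw [← integral_add_right_eq_self _ β]
  have h1 : ∀ p : Config d, cexp (I * ((⟪q - q', p + β⟫_ℝ : ℝ) : ℂ)) * wig w z (Q, p + β) =
      ((((2 * Real.pi) ^ d / gMass d : ℝ) : ℂ) * gE d 1 (Q - m) *
        cexp (I * ((⟪w.2, q⟫_ℝ - ⟪z.2, q'⟫_ℝ : ℝ) : ℂ))) *
        (gE d 1 p * cexp (I * (⟪q - q' - (w.1 - z.1), p⟫_ℝ : ℂ))) := fun p => by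
    rw [wig_apply, ← hm, ← hβ, add_sub_cancel_right]
    have : cexp (I * ((⟪q - q', p + β⟫_ℝ : ℝ) : ℂ)) * cexp (I * ((⟪β, w.1 - z.1⟫_ℝ +
        ⟪w.2 - z.2, Q⟫_ℝ - ⟪w.1 - z.1, p + β⟫_ℝ : ℝ) : ℂ)) =
        cexp (I * ((⟪w.2, q⟫_ℝ - ⟪z.2, q'⟫_ℝ : ℝ) : ℂ)) *
        cexp (I * (⟪q - q' - (w.1 - z.1), p⟫_ℝ : ℂ)) := by
      rw [← Complex.exp_add, ← Complex.exp_add, ← mul_add, ← mul_add, ← Complex.ofReal_add,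
        ← Complex.ofReal_add]
      congr 3
      rw [real_inner_comm (w.1 - z.1) β, hβ, hQ]
      simp only [inner_add_right, inner_sub_left, inner_smul_right]
      rw [real_inner_comm w.2 q, real_inner_comm w.2 q', real_inner_comm z.2 q,
        real_inner_comm z.2 q']
      ring
    linear_combination ((((2 * Real.pi) ^ d / gMass d : ℝ) : ℂ) * gE d 1 (Q - m) * gE d 1 p) * this
  simp only [h1]
  rw [integral_const_mul, integral_gE_mul_cexp]
  have hid := gauss_kernel_identity z.1 w.1 q q'
  rw [← hm, ← hQ] at hid
  have h2 : gE d 1 (Q - m) * ((Real.exp (-(‖q - q' - (w.1 - z.1)‖ ^ 2 / 4)) : ℝ) : ℂ) =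
      ((Real.exp (-(1 / 2 * ‖q - w.1‖ ^ 2)) : ℝ) : ℂ) *
        ((Real.exp (-(1 / 2 * ‖q' - z.1‖ ^ 2)) : ℝ) : ℂ) := by
    rw [gE_apply, ← Complex.ofReal_mul, ← Complex.ofReal_mul, ← Real.exp_add, ← Real.exp_add]
    congr 2
    linarith
  have h3 : coh w q * starRingEnd ℂ (coh z q') =
      ((Real.exp (-(1 / 2 * ‖q - w.1‖ ^ 2)) : ℝ) : ℂ) *
        ((Real.exp (-(1 / 2 * ‖q' - z.1‖ ^ 2)) : ℝ) : ℂ) *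
        cexp (I * ((⟪w.2, q⟫_ℝ - ⟪z.2, q'⟫_ℝ : ℝ) : ℂ)) := by
    have : cexp (I * ((⟪w.2, q⟫_ℝ - ⟪z.2, q'⟫_ℝ : ℝ) : ℂ)) =
        cexp (I * (⟪w.2, q⟫_ℝ : ℂ)) * starRingEnd ℂ (cexp (I * (⟪z.2, q'⟫_ℝ : ℂ))) := by
      rw [← Complex.exp_conj, ← Complex.exp_add]
      congr 1
      simp only [map_mul, conj_I, conj_ofReal]
      push_cast
      ring
    rw [this, coh_apply, coh_apply, map_mul, Complex.conj_ofReal]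
    ring
  have h4 : (((2 * Real.pi) ^ d / gMass d : ℝ) : ℂ) * (gMass d : ℂ) =
      (((2 * Real.pi) ^ d : ℝ) : ℂ) := by
    rw [← Complex.ofReal_mul, div_mul_cancel₀ _ (gMass_pos d).ne']
  rw [h3, ← h2, ← h4]
  ring

end WeylKernel

/-! ### Weyl quantization of a superposition of rank one symbols -/

section WeylOperator

variable {d : ℕ}

/-- The contribution of a rank one symbol at momentum `p` to the Weyl quantization. -/
def wigInt (ψ : Config d → ℂ) (q : Config d) (w z : Phase d) (p : Config d) : ℂ :=
  ∫ q' : Config d, cexp (I * ((⟪q - q', p⟫_ℝ : ℝ) : ℂ)) *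
    wig w z ((1 / 2 : ℝ) • (q + q'), p) * ψ q'

/-- As a function of `q'`, the Gaussian in the midpoint is a window of parameter `1/4` about `w.1 +
z.1 - q`, and all phases are affine in `q'`. The integral is thus a windowed Fourier transform of
`ψ`, whose rapid decay is available. -/
theorem norm_wigInt (ψ : Config d → ℂ) (q : Config d) (w z : Phase d) (p : Config d) :
    ‖wigInt ψ q w z p‖ = (2 * Real.pi) ^ d / gMass d *
      ‖gE d 1 (p - (1 / 2 : ℝ) • (w.2 + z.2))‖ *
      ‖∫ q', gE d (1 / 4) (q' - (w.1 + z.1 - q)) * ψ q' *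
        chi (innerSL ℝ ((1 / 2 : ℝ) • (w.2 - z.2) - p)) q'‖ := by
  have hc : 0 < (2 * Real.pi) ^ d / gMass d := div_pos (by positivity) (gMass_pos d)
  set θ : ℝ := ⟪q, p⟫_ℝ + ⟪(1 / 2 : ℝ) • (w.2 + z.2), w.1 - z.1⟫_ℝ +
    ⟪w.2 - z.2, (1 / 2 : ℝ) • q⟫_ℝ - ⟪w.1 - z.1, p⟫_ℝ with hθ
  have h : wigInt ψ q w z p = ((((2 * Real.pi) ^ d / gMass d : ℝ) : ℂ) * cexp (I * (θ : ℂ)) *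
      gE d 1 (p - (1 / 2 : ℝ) • (w.2 + z.2))) *
      ∫ q', gE d (1 / 4) (q' - (w.1 + z.1 - q)) * ψ q' *
        chi (innerSL ℝ ((1 / 2 : ℝ) • (w.2 - z.2) - p)) q' := by
    rw [wigInt, ← integral_const_mul]
    congr 1
    ext q'
    rw [wig_apply]
    have h1 : gE d 1 ((1 / 2 : ℝ) • (q + q') - (1 / 2 : ℝ) • (w.1 + z.1)) =
        gE d (1 / 4) (q' - (w.1 + z.1 - q)) := by
      rw [gE_apply, gE_apply, show (1 / 2 : ℝ) • (q + q') - (1 / 2 : ℝ) • (w.1 + z.1) =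
        (1 / 2 : ℝ) • (q' - (w.1 + z.1 - q)) by module, norm_smul, mul_pow]
      norm_num
    have h2 : cexp (I * ((⟪q - q', p⟫_ℝ : ℝ) : ℂ)) * cexp (I * ((⟪(1 / 2 : ℝ) • (w.2 + z.2),
        w.1 - z.1⟫_ℝ + ⟪w.2 - z.2, (1 / 2 : ℝ) • (q + q')⟫_ℝ - ⟪w.1 - z.1, p⟫_ℝ : ℝ) : ℂ)) =
        cexp (I * (θ : ℂ)) * chi (innerSL ℝ ((1 / 2 : ℝ) • (w.2 - z.2) - p)) q' := by
      rw [chi, innerSL_apply_apply, ← Complex.exp_add, ← Complex.exp_add, ← mul_add, ← mul_add,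
        ← Complex.ofReal_add, ← Complex.ofReal_add]
      congr 3
      rw [hθ, inner_sub_left ((1 / 2 : ℝ) • (w.2 - z.2)), real_inner_smul_left (w.2 - z.2) q', smul_add (1 / 2 : ℝ) q,
        inner_add_right, inner_sub_left q, real_inner_comm q' p, real_inner_smul_right _ q']
      ring
    rw [h1]
    linear_combination ((((2 * Real.pi) ^ d / gMass d : ℝ) : ℂ) *
      gE d (1 / 4) (q' - (w.1 + z.1 - q)) *
      gE d 1 (p - (1 / 2 : ℝ) • (w.2 + z.2)) * ψ q') * h2
  rw [h, norm_mul, norm_mul, norm_mul, Complex.norm_real, Real.norm_of_nonneg hc.le]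
  have : ‖cexp (I * (θ : ℂ))‖ = 1 := by rw [mul_comm, Complex.norm_exp_ofReal_mul_I]
  rw [this, mul_one]

/-- With `ν = (w.2 - z.2)/2 - p` and `β` the mean momentum, `p - β + ν = -z.2`, so decay in `p - β`
and `ν` gives decay in `z.2`. Decay in `w.1 + z.1 - q` gives decay in `z.1` at the price of powers
of `w - z` and of `q`, which is fixed. -/
theorem wigInt_bound (ψ : 𝓢(Config d, ℂ)) (q : Config d) (N K : ℕ) : ∃ C, 0 ≤ C ∧ ∀ w z p,
    ‖wigInt ψ q w z p‖ * jd N (w - z) ≤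
      C * (jd K (p - (1 / 2 : ℝ) • (w.2 + z.2)) * jd N z) := by
  obtain ⟨C₁, h₁, hC₁⟩ := (isSchw_gE (d := d) (c := 1) one_pos).norm_le (N + K)
  obtain ⟨C₂, n, M, h₂, hC₂⟩ := stft_bound (isSchw_gE (d := d) (c := 1 / 4) (by norm_num)) N
  have hs := schwSup_nonneg n M ψ
  have hc : 0 < (2 * Real.pi) ^ d / gMass d := div_pos (by positivity) (gMass_pos d)
  refine ⟨(2 * Real.pi) ^ d / gMass d * C₁ * (C₂ * schwSup n M ψ) * (jd N q)⁻¹,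
    mul_nonneg (by positivity) (inv_nonneg.2 (jd_nonneg _ _)), fun w z p => ?_⟩
  rw [norm_wigInt]
  set β := (1 / 2 : ℝ) • (w.2 + z.2) with hβ
  set ν := (1 / 2 : ℝ) • (w.2 - z.2) - p with hν
  have hb : jd N (p - β) * jd N ν ≤ jd N z.2 := by
    have := jd_mul_le N (p - β) ν
    rwa [show p - β + ν = -z.2 by rw [hβ, hν]; module, jd_neg] at this
  have ha : jd N (w.1 + z.1 - q) * jd N q * jd N (w - z) ≤ jd N z.1 := by
    have h1 := jd_mul_le N (w.1 + z.1 - q) q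
    rw [sub_add_cancel] at h1
    have h2 : jd N (w.1 + z.1) * jd N (w - z) ≤ jd N z.1 := by
      refine jd_mul_le_of N ?_
      have h3 : ‖(w - z).1‖ ≤ ‖w - z‖ := norm_fst_le _
      have h4 : z.1 = (1 / 2 : ℝ) • ((w.1 + z.1) - (w.1 - z.1)) := by module
      calc ‖z.1‖ = 1 / 2 * ‖(w.1 + z.1) - (w.1 - z.1)‖ := by
            conv_lhs => rw [h4, norm_smul]
            norm_num
        _ ≤ 1 / 2 * (‖w.1 + z.1‖ + ‖w.1 - z.1‖) := by gcongr; exact norm_sub_le _ _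
        _ ≤ ‖w.1 + z.1‖ + ‖w - z‖ := by
            have := norm_nonneg (w.1 + z.1)
            have := norm_nonneg (w.1 - z.1)
            simp only [Prod.fst_sub] at h3
            linarith
    have := jd_nonneg N (w - z)
    exact (mul_le_mul_of_nonneg_right h1 this).trans h2
  have hz := jd_mul_le_prod N z.1 z.2
  have hq := jd_pos N q
  have p1 := jd_nonneg N (p - β)
  have p2 := jd_nonneg N ν
  have p3 := jd_nonneg K (p - β)
  have p4 := jd_nonneg N (w.1 + z.1 - q)
  have p5 := jd_nonneg N (w - z)
  have p6 := jd_nonneg N z.1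
  have p7 := jd_nonneg N z.2
  calc _ ≤ (2 * Real.pi) ^ d / gMass d * (C₁ * jd (N + K) (p - β)) *
        (C₂ * schwSup n M ψ * (jd N (w.1 + z.1 - q) * jd N ν)) * jd N (w - z) := by
        refine mul_le_mul_of_nonneg_right (mul_le_mul (mul_le_mul_of_nonneg_left (hC₁ _) hc.le)
          (hC₂ ψ _ _) (norm_nonneg _) ?_) p5
        exact mul_nonneg hc.le (mul_nonneg h₁ (jd_nonneg _ _))
    _ = (2 * Real.pi) ^ d / gMass d * C₁ * (C₂ * schwSup n M ψ) * (jd N q)⁻¹ * jd K (p - β) *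
        ((jd N (w.1 + z.1 - q) * jd N q * jd N (w - z)) * (jd N (p - β) * jd N ν)) := by
        rw [jd_add_exp]
        field_simp
    _ ≤ (2 * Real.pi) ^ d / gMass d * C₁ * (C₂ * schwSup n M ψ) * (jd N q)⁻¹ * jd K (p - β) *
        (jd N z.1 * jd N z.2) := by
        have := inv_nonneg.2 hq.le
        gcongr
    _ ≤ (2 * Real.pi) ^ d / gMass d * C₁ * (C₂ * schwSup n M ψ) * (jd N q)⁻¹ * jd K (p - β) *
        jd N z := by
        have := inv_nonneg.2 hq.le
        gcongr
    _ = _ := by ring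

theorem measurable_wigInt {ψ : Config d → ℂ} (hψ : Continuous ψ) (q : Config d) :
    Measurable fun x : Config d × (Phase d × Phase d) => wigInt ψ q x.2.1 x.2.2 x.1 := by
  have h : Continuous fun x : (Config d × (Phase d × Phase d)) × Config d =>
      cexp (I * ((⟪q - x.2, x.1.1⟫_ℝ : ℝ) : ℂ)) *
        wig x.1.2.1 x.1.2.2 ((1 / 2 : ℝ) • (q + x.2), x.1.1) * ψ x.2 := by fun_prop
  exact (h.stronglyMeasurable.integral_prod_right' (ν := volume)).measurable

/-- Absolute convergence in `p` jointly with `(w, z)`, available only after the integration in `q'`.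
The decay about the mean momentum is converted into decay in `p`, using up decay in `z` and in `w -
z`. -/
theorem integrable_mul_wigInt {A : Phase d → Phase d → ℂ} (hA : OffDiag A) (ψ : 𝓢(Config d, ℂ))
    (q : Config d) : Integrable (fun x : Config d × (Phase d × Phase d) =>
      A x.2.1 x.2.2 * wigInt ψ q x.2.1 x.2.2 x.1) (volume.prod volume) := by
  set K := bigN d with hK
  obtain ⟨C, h0, hC⟩ := wigInt_bound ψ q (K + K) K
  obtain ⟨D, hD0, hD⟩ := hA.decay (K + K + (K + K))
  have hi := (integrable_jd_config (d := d)).mul_prod (integrable_jd_sub_mul (integrable_jd_phase (d := d)))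
  refine (hi.const_mul (D * C)).mono'
    ((hA.meas.comp measurable_snd).mul (measurable_wigInt ψ.continuous q)).aestronglyMeasurable
    (Filter.Eventually.of_forall fun x => ?_)
  obtain ⟨p, w, z⟩ := x
  simp only [norm_mul]
  set β := (1 / 2 : ℝ) • (w.2 + z.2) with hβ
  have hb : jd K z * jd K (w - z) ≤ jd K β := by
    refine jd_mul_le_of K ?_
    have h1 : β = z.2 + (1 / 2 : ℝ) • (w - z).2 := by rw [hβ, Prod.snd_sub]; module
    rw [h1]
    refine (norm_add_le _ _).trans (add_le_add (norm_snd_le z) ?_)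
    rw [norm_smul]
    have := norm_snd_le (w - z)
    have := norm_nonneg (w - z)
    rw [Real.norm_of_nonneg (by norm_num)]
    linarith
  have hp : jd K (p - β) * jd K β ≤ jd K p := by
    have := jd_mul_le K (p - β) β
    rwa [sub_add_cancel] at this
  have e1 := jd_nonneg (K + K) (w - z)
  have e2 := jd_nonneg K (w - z)
  have e3 := jd_nonneg K z
  have e4 := jd_nonneg K (p - β)
  calc ‖A w z‖ * ‖wigInt ψ q w z p‖
      ≤ (D * jd (K + K + (K + K)) (w - z)) * ‖wigInt ψ q w z p‖ := by
        gcongr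
        exact hD w z
    _ = D * jd (K + K) (w - z) * (‖wigInt ψ q w z p‖ * jd (K + K) (w - z)) := by
        rw [jd_add_exp (K + K)]; ring
    _ ≤ D * jd (K + K) (w - z) * (C * (jd K (p - β) * jd (K + K) z)) :=
        mul_le_mul_of_nonneg_left (hC w z p) (mul_nonneg hD0 e1)
    _ = D * C * (jd K (w - z) * jd K z) * (jd K (p - β) * (jd K z * jd K (w - z))) := by
        rw [jd_add_exp K K (w - z), jd_add_exp K K z]; ring
    _ ≤ D * C * (jd K (w - z) * jd K z) * (jd K (p - β) * jd K β) := by gcongr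
    _ ≤ D * C * (jd K (w - z) * jd K z) * jd K p := by gcongr
    _ = _ := by ring

theorem integrable_wigInt_fubini {A : Phase d → Phase d → ℂ} (hA : OffDiag A)
    (ψ : 𝓢(Config d, ℂ)) (q p : Config d) :
    Integrable (fun x : Config d × (Phase d × Phase d) =>
      A x.2.1 x.2.2 * (cexp (I * ((⟪q - x.1, p⟫_ℝ : ℝ) : ℂ)) *
        wig x.2.1 x.2.2 ((1 / 2 : ℝ) • (q + x.1), p) * ψ x.1)) (volume.prod volume) := by
  set K := bigN d with hK
  obtain ⟨C, h0, hC⟩ := hA.mul_wig_bound 0 K K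
  obtain ⟨D, hD0, hD⟩ := ψ.isSchw.norm_le (K + K)
  have hi := (integrable_jd_config (d := d)).mul_prod
    (integrable_jd_sub_mul' (integrable_jd_const_sub (((1 / 2 : ℝ) • q, p) : Phase d)))
  have hc : Continuous fun x : Config d × (Phase d × Phase d) =>
      cexp (I * ((⟪q - x.1, p⟫_ℝ : ℝ) : ℂ)) *
        wig x.2.1 x.2.2 ((1 / 2 : ℝ) • (q + x.1), p) * ψ x.1 := by
    have := ψ.continuous
    fun_prop
  refine (hi.const_mul (C * D)).mono'
    ((hA.meas.comp measurable_snd).mul hc.measurable).aestronglyMeasurable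
    (Filter.Eventually.of_forall fun x => ?_)
  obtain ⟨q', w, z⟩ := x
  simp only [norm_mul]
  rw [mul_comm I, Complex.norm_exp_ofReal_mul_I, one_mul, ← mul_assoc]
  set x : Phase d := ((1 / 2 : ℝ) • (q + q'), p) with hx
  have h1 : jd K (x - w) * jd K q' ≤ jd K (((1 / 2 : ℝ) • q, p) - w) := by
    refine jd_mul_le_of K ?_
    have h2 : (((1 / 2 : ℝ) • q, p) : Phase d) - w = (x - w) - ((1 / 2 : ℝ) • q', 0) := by
      rw [hx]
      ext1
      · simp only [Prod.fst_sub]; module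
      · simp
    rw [h2]
    refine (norm_sub_le _ _).trans ?_
    gcongr
    rw [Prod.norm_def]
    simp only [norm_zero, norm_smul]
    rw [max_eq_left (by positivity)]
    norm_num
    linarith [norm_nonneg q']
  have e1 := jd_nonneg K (w - z)
  have e2 := jd_nonneg K (x - w)
  have e3 := jd_nonneg K q'
  have hC' := hC w z x
  rw [norm_iteratedFDeriv_zero] at hC'
  calc ‖A w z‖ * ‖wig w z x‖ * ‖ψ q'‖
      ≤ (C * (jd K (w - z) * jd K (x - w))) * (D * jd (K + K) q') := by
        gcongr
        exact hD q'
    _ = C * D * (jd K (w - z) * jd K q') * (jd K (x - w) * jd K q') := by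
        rw [jd_add_exp K K q']; ring
    _ ≤ C * D * (jd K (w - z) * jd K q') * jd K (((1 / 2 : ℝ) • q, p) - w) := by gcongr
    _ = _ := by ring

/-- For a single rank one symbol the Gaussian in `p` makes the double integral absolutely
convergent, so `p` may be integrated first, which produces the kernel of the rank one operator. -/
theorem integral_wigInt (ψ : 𝓢(Config d, ℂ)) (q : Config d) (w z : Phase d) :
    ∫ p, wigInt ψ q w z p = (((2 * Real.pi) ^ d : ℝ) : ℂ) * (coh w q * anal ψ z) := by
  have hint : Integrable (Function.uncurry fun (p q' : Config d) =>
      cexp (I * ((⟪q - q', p⟫_ℝ : ℝ) : ℂ)) * wig w z ((1 / 2 : ℝ) • (q + q'), p) * ψ q')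
      (volume.prod volume) := by
    have hg : Integrable (fun p : Config d => gE d 1 (p - (1 / 2 : ℝ) • (w.2 + z.2))) :=
      ((isSchw_gE one_pos).integrable volume).comp_sub_right _
    have hc : Continuous fun x : Config d × Config d =>
        cexp (I * ((⟪q - x.2, x.1⟫_ℝ : ℝ) : ℂ)) *
          wig w z ((1 / 2 : ℝ) • (q + x.2), x.1) * ψ x.2 := by
      have := ψ.continuous
      fun_prop
    refine ((hg.norm.mul_prod ψ.integrable.norm).const_mul
      ((2 * Real.pi) ^ d / gMass d)).mono' hc.aestronglyMeasurable
      (Filter.Eventually.of_forall fun x => ?_)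
    have hcp : 0 < (2 * Real.pi) ^ d / gMass d := div_pos (by positivity) (gMass_pos d)
    simp only [Function.uncurry, norm_mul]
    rw [mul_comm I, Complex.norm_exp_ofReal_mul_I, one_mul, wig_apply, norm_mul, norm_mul,
      norm_mul, mul_comm I, Complex.norm_exp_ofReal_mul_I, mul_one, Complex.norm_real,
      Real.norm_of_nonneg hcp.le, mul_assoc]
    refine mul_le_mul_of_nonneg_left ?_ hcp.le
    refine mul_le_mul_of_nonneg_right ?_ (norm_nonneg _)
    refine mul_le_of_le_one_left (norm_nonneg _) ?_
    rw [gE_apply, Complex.norm_real, Real.norm_of_nonneg (Real.exp_pos _).le]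
    exact Real.exp_le_one_iff.2 (by rw [one_mul]; exact neg_nonpos.2 (sq_nonneg _))
  simp only [wigInt]
  rw [integral_integral_swap hint]
  simp only [integral_mul_const, integral_wig]
  rw [anal, ← integral_const_mul, ← integral_const_mul]
  congr 1
  ext q'
  ring

/-- The superposition is pulled out in two stages, following the order of the oscillatory integral:
through `q'` at fixed `p`, then through `p`. Each rank one symbol contributes `φ_w ⟨φ_z, ψ⟩`, and
their superposition with weight `A` is the kernel operator. -/
theorem weylFun_symb {A : Phase d → Phase d → ℂ} (hA : OffDiag A) (ψ : 𝓢(Config d, ℂ))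
    (q : Config d) : weylFun 1 (symb A) ψ q = opS A hA ψ q := by
  have h1 : ∀ p : Config d, ∫ q' : Config d, cexp (I * ((⟪q - q', p⟫_ℝ : ℝ) : ℂ)) *
      symb A ((1 / 2 : ℝ) • (q + q'), (1 : ℝ) • p) * ψ q' =
      ∫ y : Phase d × Phase d, A y.1 y.2 * wigInt ψ q y.1 y.2 p := by
    intro p
    have hi := integrable_wigInt_fubini hA ψ q p
    simp only [wigInt, ← integral_const_mul]
    rw [← integral_integral_swap hi]
    congr 1
    ext q'
    rw [symb, one_smul, ← integral_const_mul, ← integral_mul_const]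
    congr 1
    ext y
    ring
  rw [weylFun]
  simp only [h1]
  rw [integral_integral_swap (integrable_mul_wigInt hA ψ q)]
  simp only [integral_const_mul, integral_wigInt]
  have h2 : ∫ y : Phase d × Phase d, A y.1 y.2 * ((((2 * Real.pi) ^ d : ℝ) : ℂ) *
      (coh y.1 q * anal ψ y.2)) = (((2 * Real.pi) ^ d : ℝ) : ℂ) *
      ∫ y : Phase d × Phase d, coh y.1 q * (A y.1 y.2 * anal ψ y.2) := by
    rw [← integral_const_mul]
    congr 1
    ext y
    ring
  have h3 : (((2 * Real.pi) ^ d : ℝ) : ℂ) ≠ 0 := by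
    exact_mod_cast (show (2 * Real.pi) ^ d ≠ 0 by positivity)
  rw [h2, ← mul_assoc, inv_mul_cancel₀ h3, one_mul, opS_apply, synth]
  have hint : Integrable (fun y : Phase d × Phase d => coh y.1 q * (A y.1 y.2 * anal ψ y.2))
      (volume.prod volume) := by
    obtain ⟨C, h0, hC⟩ := hA.decay (bigN d)
    have hm : Continuous fun y : Phase d × Phase d => coh y.1 q := by fun_prop
    refine ((integrable_jd_sub_mul (rapid_anal ψ).integrable.norm).const_mul C).mono'
      (hm.measurable.mul (hA.measurable_mul (rapid_anal ψ).meas)).aestronglyMeasurable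
      (Filter.Eventually.of_forall fun y => ?_)
    rw [norm_mul, norm_mul]
    calc _ ≤ 1 * (C * jd (bigN d) (y.1 - y.2) * ‖anal ψ y.2‖) := by
          gcongr
          · exact norm_coh_le_one _ _
          · exact hC _ _
      _ = _ := by ring
  rw [Measure.volume_eq_prod, integral_prod _ hint]
  congr 1
  ext w
  simp only [act, integral_const_mul]
  ring

end WeylOperator

/-! ### Products, linearity and boundedness of Weyl operators -/

section WeylCalculus

variable {d : ℕ}

/-! ### Composition of kernels -/

/-- The kernel of a product. -/
def compK (A B : Phase d → Phase d → ℂ) (w z : Phase d) : ℂ := ∫ y, A w y * B y z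

theorem OffDiag.compK {A B : Phase d → Phase d → ℂ} (hA : OffDiag A) (hB : OffDiag B) :
    OffDiag (compK A B) where
  meas := by
    have h : Measurable fun p : (Phase d × Phase d) × Phase d =>
        A p.1.1 p.2 * B p.2 p.1.2 := by
      have h1 : Measurable fun p : (Phase d × Phase d) × Phase d => (p.1.1, p.2) := by fun_prop
      have h2 : Measurable fun p : (Phase d × Phase d) × Phase d => (p.2, p.1.2) := by fun_prop
      exact (hA.meas.comp h1).mul (hB.meas.comp h2)
    exact (h.stronglyMeasurable.integral_prod_right' (ν := volume)).measurable
  decay N := by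
    obtain ⟨C, hC0, hC⟩ := hA.decay (bigN d + N)
    obtain ⟨D, hD0, hD⟩ := hB.decay N
    refine ⟨C * D * jdMass d, mul_nonneg (mul_nonneg hC0 hD0) (jdMass_nonneg d), fun w z => ?_⟩
    have hb : ∀ y, ‖A w y * B y z‖ ≤ C * D * jd N (w - z) * jd (bigN d) (w - y) := by
      intro y
      have h1 := jd_mul_le N (w - y) (y - z)
      rw [sub_add_sub_cancel] at h1
      have h2 := jd_nonneg (bigN d) (w - y)
      rw [norm_mul]
      calc ‖A w y‖ * ‖B y z‖ ≤ (C * jd (bigN d + N) (w - y)) * (D * jd N (y - z)) :=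
            mul_le_mul (hC _ _) (hD _ _) (norm_nonneg _) (mul_nonneg hC0 (jd_nonneg _ _))
        _ = C * D * jd (bigN d) (w - y) * (jd N (w - y) * jd N (y - z)) := by
            rw [jd_add_exp]; ring
        _ ≤ C * D * jd (bigN d) (w - y) * jd N (w - z) := by gcongr
        _ = _ := by ring
    refine (norm_integral_le_of_norm_le ((integrable_jd_const_sub w).const_mul _)
      (Filter.Eventually.of_forall hb)).trans (le_of_eq ?_)
    rw [integral_const_mul, integral_jd_const_sub]
    ring

theorem act_compK {A B : Phase d → Phase d → ℂ} (hA : OffDiag A) (hB : OffDiag B)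
    {F : Phase d → ℂ} (hF : Rapid F) : act (compK A B) F = act A (act B F) := by
  ext w
  have hi : Integrable (Function.uncurry fun y z : Phase d => A w y * (B y z * F z))
      (volume.prod volume) := by
    obtain ⟨C, hC0, hC⟩ := hA.decay 0
    obtain ⟨D, hD0, hD⟩ := hB.decay (bigN d)
    have hm : Measurable fun p : Phase d × Phase d => A w p.1 :=
      hA.meas.comp (by fun_prop : Measurable fun p : Phase d × Phase d => (w, p.1))
    refine ((integrable_jd_sub_mul hF.integrable.norm).const_mul (C * D)).mono'
      (hm.mul (hB.measurable_mul hF.meas)).aestronglyMeasurable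
      (Filter.Eventually.of_forall fun p => ?_)
    simp only [Function.uncurry, norm_mul]
    have h1 : ‖A w p.1‖ ≤ C := (hC _ _).trans (by rw [jd_zero_exp, mul_one])
    calc ‖A w p.1‖ * (‖B p.1 p.2‖ * ‖F p.2‖)
        ≤ C * (D * jd (bigN d) (p.1 - p.2) * ‖F p.2‖) :=
          mul_le_mul h1 (mul_le_mul_of_nonneg_right (hD _ _) (norm_nonneg _))
            (by positivity) hC0
      _ = _ := by ring
  simp only [act, compK]
  simp only [← integral_mul_const, ← integral_const_mul]
  rw [integral_integral_swap hi]
  simp only [mul_assoc]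

/-- Between the two kernels, synthesis is followed by analysis, which is the action of the Gram
kernel. -/
theorem opS_comp_opS {A B : Phase d → Phase d → ℂ} (hA : OffDiag A) (hB : OffDiag B) :
    (opS A hA).comp (opS B hB) =
      opS (compK A (compK gram B)) (hA.compK (offDiag_gram.compK hB)) := by
  ext ψ q
  have h1 : (opS B hB ψ : Config d → ℂ) = synth (act B (anal ψ)) := rfl
  have hr := rapid_anal ψ
  rw [ContinuousLinearMap.comp_apply, opS_apply, opS_apply, h1, anal_synth (rapid_act hB hr),
    act_compK hA (offDiag_gram.compK hB) hr, act_compK offDiag_gram hB hr]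

/-! ### Dependence on `ħ` -/

/-- The symbol `(q, p) ↦ f (q, ħ p)`. -/
def dilSym (ħ : ℝ) (f : Phase d → ℂ) : Phase d → ℂ := fun x => f (x.1, ħ • x.2)

/-- The linear map `(q, p) ↦ (q, ħ p)`. -/
def dilCLM (d : ℕ) (ħ : ℝ) : Phase d →L[ℝ] Phase d :=
  (ContinuousLinearMap.fst ℝ _ _).prod (ħ • ContinuousLinearMap.snd ℝ _ _)

theorem dilSym_eq (ħ : ℝ) (f : Phase d → ℂ) : dilSym ħ f = fun x => f (dilCLM d ħ x) := rfl

theorem IsSymbol.dilSym {f : Phase d → ℂ} (hf : IsSymbol f) (ħ : ℝ) : IsSymbol (dilSym ħ f) := by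
  rw [isSymbol_iff_bddD] at hf ⊢
  simpa [dilSym_eq] using hf.comp_affine (S := Set.univ) (dilCLM d ħ) 0 fun _ _ => trivial

theorem weylFun_eq_dilSym (ħ : ℝ) (f : Phase d → ℂ) (ψ : Config d → ℂ) (q : Config d) :
    weylFun ħ f ψ q = weylFun 1 (dilSym ħ f) ψ q := by
  simp [weylFun, dilSym]

theorem dilSym_inv {ħ : ℝ} (hħ : ħ ≠ 0) (f : Phase d → ℂ) : dilSym ħ (dilSym ħ⁻¹ f) = f := by
  ext x
  simp [dilSym, smul_smul, hħ]

theorem weylFun_eq_opS {f : Phase d → ℂ} (hf : IsSymbol f) (ħ : ℝ) (ψ : 𝓢(Config d, ℂ))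
    (q : Config d) :
    weylFun ħ f ψ q = opS (symKer (dilSym ħ f)) (offDiag_symKer (hf.dilSym ħ)) ψ q := by
  rw [weylFun_eq_dilSym, ← weylFun_symb]
  congr 1
  ext x
  exact (symb_symKer (hf.dilSym ħ) x).symm

theorem weylS_of_apply {ħ : ℝ} {f : Phase d → ℂ} {T : 𝓢(Config d, ℂ) →L[ℂ] 𝓢(Config d, ℂ)}
    (hT : ∀ ψ q, T ψ q = weylFun ħ f ψ q) : weylS ħ f = T := by
  have h : ∃ T : 𝓢(Config d, ℂ) →L[ℂ] 𝓢(Config d, ℂ), ∀ ψ q, T ψ q = weylFun ħ f ψ q := ⟨T, hT⟩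
  ext ψ q
  rw [weylS, dif_pos h, h.choose_spec, hT]

theorem weylS_eq_opS {f : Phase d → ℂ} (hf : IsSymbol f) (ħ : ℝ) :
    weylS ħ f = opS (symKer (dilSym ħ f)) (offDiag_symKer (hf.dilSym ħ)) :=
  weylS_of_apply fun ψ q => (weylFun_eq_opS hf ħ ψ q).symm

theorem weylS_apply {f : Phase d → ℂ} (hf : IsSymbol f) (ħ : ℝ) (ψ : 𝓢(Config d, ℂ))
    (q : Config d) : weylS ħ f ψ q = weylFun ħ f ψ q := by
  rw [weylS_eq_opS hf, weylFun_eq_opS hf]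

theorem exists_weylS_eq_opS {ħ : ℝ} (hħ : ħ ≠ 0) {A : Phase d → Phase d → ℂ} (hA : OffDiag A) :
    ∃ f, IsSymbol f ∧ weylS ħ f = opS A hA :=
  ⟨dilSym ħ⁻¹ (symb A), (isSymbol_symb hA).dilSym _, weylS_of_apply fun ψ q => by
    rw [weylFun_eq_dilSym, dilSym_inv hħ, weylFun_symb hA]⟩

/-- The operator product has a kernel with rapid decay off the diagonal, and every such kernel is
the Weyl quantization of a symbol. This existence makes the choice in the definition of the Moyal
product meaningful. -/
theorem moyal_spec {ħ : ℝ} (hħ : ħ ≠ 0) {f g : Phase d → ℂ} (hf : IsSymbol f) (hg : IsSymbol g) :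
    IsSymbol (moyal ħ f g) ∧ (weylS ħ f).comp (weylS ħ g) = weylS ħ (moyal ħ f g) := by
  have h : ∃ h : Phase d → ℂ, IsSymbol h ∧ (weylS ħ f).comp (weylS ħ g) = weylS ħ h := by
    rw [weylS_eq_opS hf, weylS_eq_opS hg, opS_comp_opS]
    obtain ⟨h, h1, h2⟩ := exists_weylS_eq_opS hħ ((offDiag_symKer (hf.dilSym ħ)).compK
      (offDiag_gram.compK (offDiag_symKer (hg.dilSym ħ))))
    exact ⟨h, h1, h2.symm⟩
  rw [moyal, dif_pos h]
  exact h.choose_spec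

/-! ### Linearity -/

theorem IsSymbol.add {f g : Phase d → ℂ} (hf : IsSymbol f) (hg : IsSymbol g) :
    IsSymbol (f + g) := by
  rw [isSymbol_iff_bddD] at *
  exact hf.add hg

theorem IsSymbol.smul {f : Phase d → ℂ} (hf : IsSymbol f) (c : ℂ) : IsSymbol (c • f) := by
  rw [isSymbol_iff_bddD] at *
  exact hf.const_mul c

theorem stftP_add_smul {f g : Phase d → ℂ} (hf : IsSymbol f) (hg : IsSymbol g) (c : ℂ)
    (y η : Phase d) : stftP (f + c • g) y η = stftP f y η + c * stftP g y η := by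
  have key : ∀ {f : Phase d → ℂ}, IsSymbol f →
      Integrable fun x => gP (x - y) * f x * chi (sympL (-η)) x := by
    intro f hf
    obtain ⟨C, hC⟩ := hf.2 0
    refine ((((isSchw_gP (d := d)).comp_sub y).integrable volume).mul_bdd (c := C)
      hf.1.continuous.aestronglyMeasurable (Filter.Eventually.of_forall fun x => by
        simpa using hC x)).mul_bdd (c := 1)
      (by fun_prop : Continuous fun x => chi (sympL (-η)) x).aestronglyMeasurable
      (Filter.Eventually.of_forall fun x => (norm_chi _ _).le)
  simp only [stftP]
  rw [← integral_const_mul, ← integral_add (key hf) ((key hg).const_mul c)]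
  congr 1
  ext x
  simp only [Pi.add_apply, Pi.smul_apply, smul_eq_mul]
  ring

theorem symKer_add_smul {f g : Phase d → ℂ} (hf : IsSymbol f) (hg : IsSymbol g) (c : ℂ)
    (w z : Phase d) : symKer (f + c • g) w z = symKer f w z + c * symKer g w z := by
  simp only [symKer, stftP_add_smul hf hg]
  ring

theorem weylS_add_smul {f g : Phase d → ℂ} (hf : IsSymbol f) (hg : IsSymbol g) (c : ℂ) (ħ : ℝ) :
    weylS ħ (f + c • g) = weylS ħ f + c • weylS ħ g := by
  rw [weylS_eq_opS hf, weylS_eq_opS hg, weylS_eq_opS (hf.add (hg.smul c))]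
  have h : dilSym ħ (f + c • g) = dilSym ħ f + c • dilSym ħ g := rfl
  have hf' := offDiag_symKer (hf.dilSym ħ)
  have hg' := offDiag_symKer (hg.dilSym ħ)
  ext ψ q
  have hr := rapid_anal ψ
  have h2 : act (symKer (dilSym ħ (f + c • g))) (anal ψ) =
      act (symKer (dilSym ħ f)) (anal ψ) + c • act (symKer (dilSym ħ g)) (anal ψ) := by
    ext w
    simp only [act, Pi.add_apply, Pi.smul_apply, smul_eq_mul, h,
      symKer_add_smul (hf.dilSym ħ) (hg.dilSym ħ)]
    rw [← integral_const_mul, ← integral_add (hf'.integrable_mul hr w)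
      ((hg'.integrable_mul hr w).const_mul c)]
    congr 1
    ext z
    ring
  have hc : Rapid (c • act (symKer (dilSym ħ g)) (anal ψ)) := by
    have hb := rapid_act hg' hr
    refine ⟨hb.meas.const_smul c, fun N => ?_⟩
    obtain ⟨C, h0, hC⟩ := hb.decay N
    refine ⟨‖c‖ * C, by positivity, fun z => ?_⟩
    rw [Pi.smul_apply, norm_smul, mul_assoc]
    exact mul_le_mul_of_nonneg_left (hC z) (norm_nonneg c)
  simp only [add_apply, smul_apply, opS_apply, h2, synth_add (rapid_act hf' hr) hc, synth_smul,
    Pi.add_apply, Pi.smul_apply]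

/-! ### Bounds -/

theorem exists_dilSym_bound (d N : ℕ) (ħ : ℝ) : ∃ C, 0 ≤ C ∧ ∀ (f : Phase d → ℂ) (B : ℝ),
    ContDiff ℝ ∞ f → (∀ k ≤ N, ∀ x, ‖iteratedFDeriv ℝ k f x‖ ≤ B) →
    ∀ k ≤ N, ∀ x, ‖iteratedFDeriv ℝ k (dilSym ħ f) x‖ ≤ C * B := by
  refine ⟨max 1 ‖dilCLM d ħ‖ ^ N, by positivity, fun f B hf hB k hk x => ?_⟩
  refine (norm_iteratedFDeriv_comp_clm_le hf (dilCLM d ħ) k x).trans ?_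
  rw [mul_comm]
  refine mul_le_mul ?_ (hB k hk _) (norm_nonneg _) (by positivity)
  exact (pow_le_pow_left₀ (norm_nonneg _) (le_max_right _ _) k).trans
    (pow_le_pow_right₀ (le_max_left _ _) hk)

theorem symKer_dilSym_bound (d N : ℕ) (ħ : ℝ) : ∃ C, 0 ≤ C ∧ ∀ (f : Phase d → ℂ) (B : ℝ),
    ContDiff ℝ ∞ f → (∀ k ≤ N, ∀ x, ‖iteratedFDeriv ℝ k f x‖ ≤ B) →
    ∀ w z, ‖symKer (dilSym ħ f) w z‖ ≤ C * B * jd N (w - z) := by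
  obtain ⟨C, h0, hC⟩ := symKer_bound d N
  obtain ⟨C', h0', hC'⟩ := exists_dilSym_bound d N ħ
  refine ⟨C * C', mul_nonneg h0 h0', fun f B hf hB w z => ?_⟩
  rw [mul_assoc C]
  exact hC _ _ (hf.comp (dilCLM d ħ).contDiff) (hC' f B hf hB) w z

/-- A form of the Calderón–Vaillancourt theorem: `bigN d` derivatives of the symbol give integrable
decay off the diagonal, and Schur's test applies. -/
theorem norm_weylS_toLp_le (d : ℕ) (ħ : ℝ) : ∃ C, 0 ≤ C ∧ ∀ (f : Phase d → ℂ) (B : ℝ),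
    IsSymbol f → (∀ k ≤ bigN d, ∀ x, ‖iteratedFDeriv ℝ k f x‖ ≤ B) → ∀ ψ : 𝓢(Config d, ℂ),
    ‖(weylS ħ f ψ).toLp 2‖ ≤ C * B * ‖ψ.toLp 2‖ := by
  obtain ⟨C, h0, hC⟩ := symKer_dilSym_bound d (bigN d) ħ
  refine ⟨C * (jdMass d * kap d), mul_nonneg h0 (mul_nonneg (jdMass_nonneg d) (kap_pos d).le),
    fun f B hf hB ψ => ?_⟩
  have hB0 : 0 ≤ B := (norm_nonneg _).trans (hB 0 (Nat.zero_le _) 0)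
  rw [weylS_eq_opS hf]
  refine (norm_toLp_opS_le (offDiag_symKer (hf.dilSym ħ)) (mul_nonneg h0 hB0)
    (hC f B hf.1 hB) ψ).trans (le_of_eq ?_)
  ring

theorem exists_symbol_bound {f : Phase d → ℂ} (hf : IsSymbol f) (N : ℕ) :
    ∃ B, ∀ k ≤ N, ∀ x, ‖iteratedFDeriv ℝ k f x‖ ≤ B := by
  obtain ⟨C, -, hC⟩ := (isSymbol_iff_bddD.1 hf).exists_nonneg_bound N le_top
  exact ⟨C, fun k hk x => hC k hk x trivial⟩

theorem exists_weylL2 {f : Phase d → ℂ} (hf : IsSymbol f) (ħ : ℝ) :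
    ∃ T : L2 d →L[ℂ] L2 d, ∀ ψ : 𝓢(Config d, ℂ), T (ψ.toLp 2) = (weylS ħ f ψ).toLp 2 := by
  obtain ⟨C, -, hC⟩ := norm_weylS_toLp_le d ħ
  obtain ⟨B, hB⟩ := exists_symbol_bound hf (bigN d)
  have hd : DenseRange (SchwartzMap.toLpCLM ℂ ℂ 2 (volume : Measure (Config d))).toLinearMap :=
    SchwartzMap.denseRange_toLpCLM (by norm_num)
  exact ⟨(((SchwartzMap.toLpCLM ℂ ℂ 2 (volume : Measure (Config d))).comp
    (weylS ħ f)).toLinearMap).extendOfNorm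
    (SchwartzMap.toLpCLM ℂ ℂ 2 (volume : Measure (Config d))).toLinearMap,
    fun ψ => LinearMap.extendOfNorm_eq hd ⟨C * B, hC f B hf hB⟩ ψ⟩

theorem weylL2_toLp {f : Phase d → ℂ} (hf : IsSymbol f) (ħ : ℝ) (ψ : 𝓢(Config d, ℂ)) :
    weylL2 ħ f (ψ.toLp 2) = (weylS ħ f ψ).toLp 2 := by
  rw [weylL2, dif_pos (exists_weylL2 hf ħ)]
  exact (exists_weylL2 hf ħ).choose_spec ψ

theorem clm_ext_toLp {S T : L2 d →L[ℂ] L2 d}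
    (h : ∀ ψ : 𝓢(Config d, ℂ), S (ψ.toLp 2) = T (ψ.toLp 2)) : S = T := by
  have hd : DenseRange (SchwartzMap.toLpCLM ℝ ℂ 2 (volume : Measure (Config d))) :=
    SchwartzMap.denseRange_toLpCLM (by norm_num)
  exact DFunLike.coe_injective (hd.equalizer S.continuous T.continuous (funext h))

theorem norm_weylL2_le (d : ℕ) (ħ : ℝ) : ∃ C, 0 ≤ C ∧ ∀ (f : Phase d → ℂ) (B : ℝ),
    IsSymbol f → (∀ k ≤ bigN d, ∀ x, ‖iteratedFDeriv ℝ k f x‖ ≤ B) → ‖weylL2 ħ f‖ ≤ C * B := by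
  obtain ⟨C, h0, hC⟩ := norm_weylS_toLp_le d ħ
  refine ⟨C, h0, fun f B hf hB => ?_⟩
  have hB0 : 0 ≤ B := (norm_nonneg _).trans (hB 0 (Nat.zero_le _) 0)
  have hd : DenseRange (SchwartzMap.toLpCLM ℝ ℂ 2 (volume : Measure (Config d))) :=
    SchwartzMap.denseRange_toLpCLM (by norm_num)
  refine ContinuousLinearMap.opNorm_le_bound _ (mul_nonneg h0 hB0) fun u => ?_
  refine hd.induction_on u (isClosed_le (by fun_prop) (by fun_prop)) fun ψ => ?_
  rw [SchwartzMap.toLpCLM_apply, weylL2_toLp hf]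
  exact hC f B hf hB ψ

theorem weylL2_add_smul {f g : Phase d → ℂ} (hf : IsSymbol f) (hg : IsSymbol g) (c : ℂ) (ħ : ℝ) :
    weylL2 ħ (f + c • g) = weylL2 ħ f + c • weylL2 ħ g :=
  clm_ext_toLp fun ψ => by
    rw [weylL2_toLp (hf.add (hg.smul c)), weylS_add_smul hf hg, add_apply, smul_apply, add_apply, smul_apply, weylL2_toLp hf, weylL2_toLp hg]
    exact ((SchwartzMap.toLpCLM ℂ ℂ 2 (volume : Measure (Config d))).map_add _ _).trans
      (congrArg _ ((SchwartzMap.toLpCLM ℂ ℂ 2 (volume : Measure (Config d))).map_smul _ _))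

theorem weylL2_moyal {ħ : ℝ} (hħ : ħ ≠ 0) {f g : Phase d → ℂ} (hf : IsSymbol f)
    (hg : IsSymbol g) : weylL2 ħ (moyal ħ f g) = weylL2 ħ f * weylL2 ħ g :=
  clm_ext_toLp fun ψ => by
    obtain ⟨h1, h2⟩ := moyal_spec hħ hf hg
    rw [weylL2_toLp h1, ← h2]
    change _ = weylL2 ħ f (weylL2 ħ g (ψ.toLp 2))
    rw [weylL2_toLp hg, weylL2_toLp hf]
    rfl

end WeylCalculus

/-! ### Differentiable families of symbols under an abstract quantization -/

section Quantization

variable {d : ℕ}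

theorem foldr_iterate_single {X : Type*} (D : Fin d → X → X) (i : Fin d) (h : X) (l : List (Fin d))
    (hl : l.Nodup) : l.foldr (fun j h => (D j)^[(Pi.single i 1 : Fin d → ℕ) j] h) h =
      if i ∈ l then D i h else h := by
  induction l with
  | nil => simp
  | cons j l ih =>
    obtain ⟨h1, h2⟩ := List.nodup_cons.1 hl
    rw [List.foldr_cons, ih h2]
    by_cases hij : j = i
    · subst hij
      simp [h1]
    · simp [hij, Ne.symm hij]

theorem foldr_iterate_zero {X : Type*} (D : Fin d → X → X) (h : X) (l : List (Fin d)) :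
    l.foldr (fun j h => (D j)^[(0 : Fin d → ℕ) j] h) h = h := by
  induction l with
  | nil => simp
  | cons j l ih => rw [List.foldr_cons, ih]; simp

theorem dqp_single_zero (i : Fin d) (f : Phase d → ℂ) : dqp (Pi.single i 1) 0 f = dq i f := by
  rw [dqp, foldr_iterate_zero, foldr_iterate_single _ _ _ _ (List.nodup_finRange d)]
  simp

theorem dqp_zero_single (i : Fin d) (f : Phase d → ℂ) : dqp 0 (Pi.single i 1) f = dp i f := by
  rw [dqp, foldr_iterate_zero, foldr_iterate_single _ _ _ _ (List.nodup_finRange d)]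
  simp

theorem sum_piAntidiag_one {M : Type*} [AddCommMonoid M] (F : (Fin d → ℕ) → M) :
    ∑ α ∈ piAntidiag (univ : Finset (Fin d)) 1, F α = ∑ i, F (Pi.single i 1) := by
  refine (sum_bij (fun i _ => Pi.single i 1) (fun i _ => ?_) (fun i _ j _ h => ?_)
    (fun α hα => ?_) fun _ _ => rfl).symm
  · simp
  · by_contra hij
    have := congrFun h i
    simp [hij] at this
  · have h1 : ∑ i, α i = 1 := (mem_piAntidiag.1 hα).1
    obtain ⟨i, -, hi⟩ : ∃ i ∈ (univ : Finset (Fin d)), α i ≠ 0 := exists_ne_zero_of_sum_ne_zero (by omega)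
    refine ⟨i, mem_univ i, ?_⟩
    have h2 : α i + ∑ j ∈ univ.erase i, α j = 1 := by
      rw [add_sum_erase _ _ (mem_univ i), h1]
    have h3 : ∑ j ∈ univ.erase i, α j = 0 := by omega
    ext j
    by_cases hj : j = i
    · subst hj; simp; omega
    · simpa [hj] using (sum_eq_zero_iff.1 h3 j (by simp [hj])).symm

theorem sumM_zero (g : Phase d → ℝ) (f : Phase d → ℂ) (x : Phase d) :
    sumM g 0 f x = poisson (toC g) f x := by
  have hs : ∀ i : Fin d, ∑ j, (Pi.single i 1 : Fin d → ℕ) j = 1 := fun i => by simp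
  have hm : ∀ i : Fin d, multiFactorial (Pi.single i 1 : Fin d → ℕ) = 1 := fun i =>
    prod_eq_one fun j _ => by
      by_cases h : j = i
      · subst h; simp
      · simp [h]
  have h0 : multiFactorial (0 : Fin d → ℕ) = 1 := by simp [multiFactorial]
  have ha : antidiagonal (1 + 2 * 0) = {(0, 1), (1, 0)} := rfl
  rw [sumM, sumMulti, ha, sum_pair (by simp)]
  simp [piAntidiag_zero, sum_piAntidiag_one, dqp_single_zero, dqp_zero_single, hs, hm, h0, poisson,
    sum_sub_distrib, ← sub_eq_neg_add]

theorem poisson_eq_moyalTerm_one (g : Phase d → ℝ) (f : Phase d → ℂ) (x : Phase d) :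
    poisson (toC g) f x = 2 * I * moyalTerm 1 (toC g) f x := by
  have := moyalTerm_odd g 0 f x
  simp only [mul_zero, add_zero, pow_zero, inv_one, one_mul] at this
  rw [this, sumM_zero]

/-- The bracket is the Moyal term `k = 1`, so the right-hand side is a sum over all odd `k`, the
shape in which it cancels against a commutator. -/
theorem egorovL_hasDerivAt' {g : Phase d → ℝ} (hg : BddD Set.univ ⊤ g) {f : Phase d → ℂ}
    (hf : BddD Set.univ ⊤ f) (j : ℕ) (s : ℝ) (x : Phase d) :
    HasDerivAt (fun s' => egorovL g j s' f x)
      (2 * I * ∑ k ∈ Icc 1 (j + 1) with Odd k,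
          moyalTerm k (toC g) (egorovL g (j + 1 - k) s f) x) s := by
  convert egorovL_hasDerivAt hg hf j s x using 1
  have h : (Icc 1 (j + 1)).filter Odd = insert 1 ((Icc 3 (j + 1)).filter Odd) := by
    ext k
    simp only [mem_filter, mem_Icc, mem_insert]
    constructor
    · rintro ⟨⟨h1, h2⟩, h3⟩
      by_cases hk : k = 1
      · exact Or.inl hk
      · obtain ⟨m, rfl⟩ := h3
        exact Or.inr ⟨⟨by omega, h2⟩, m, rfl⟩
    · rintro (rfl | ⟨⟨h1, h2⟩, h3⟩)
      · exact ⟨⟨le_rfl, by omega⟩, odd_one⟩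
      · exact ⟨⟨by omega, h2⟩, h3⟩
  rw [h, sum_insert (by simp), mul_add, poisson_eq_moyalTerm_one]
  simp

theorem SlabB.exists_slice_bound {u : ℝ × Phase d → ℂ} (hu : SlabB u) (T : ℝ) (N : ℕ) :
    ∃ C, 0 ≤ C ∧ ∀ k ≤ N, ∀ t, |t| < T → ∀ x,
      ‖iteratedFDeriv ℝ k (fun x => u (t, x)) x‖ ≤ C := by
  obtain ⟨C, h0, hC⟩ := (hu T).exists_nonneg_bound N le_top
  set L := ContinuousLinearMap.inr ℝ ℝ (Phase d)
  refine ⟨C * max 1 ‖L‖ ^ N, by positivity, fun k hk t ht x => ?_⟩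
  have hs : ContDiff ℝ ∞ fun p => u (p + (t, 0)) := hu.contDiff.comp (contDiff_id.add contDiff_const)
  have h1 := norm_iteratedFDeriv_comp_clm_le hs L k x
  have h2 : (fun x => u (L x + (t, 0))) = fun x => u (t, x) := by
    ext x
    simp [L]
  rw [h2, iteratedFDeriv_comp_add_right] at h1
  refine h1.trans (mul_le_mul (hC k hk _ (by simpa [slab, L] using ht)) ?_ (by positivity) h0)
  exact (pow_le_pow_left₀ (norm_nonneg _) (le_max_right _ _) k).trans
    (pow_le_pow_right₀ (le_max_left _ _) hk)

theorem SlabB.hasDerivAt {u : ℝ × Phase d → ℂ} (hu : SlabB u) (s : ℝ) (x : Phase d) :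
    HasDerivAt (fun s => u (s, x)) (fderiv ℝ u (s, x) (1, 0)) s := by
  have hl : HasDerivAt (fun s : ℝ => (s, x)) ((1 : ℝ), (0 : Phase d)) s :=
    (hasDerivAt_id s).prodMk (hasDerivAt_const s x)
  exact (hu.contDiff.differentiable (by simp) (s, x)).hasFDerivAt.comp_hasDerivAt s hl

/-- The Taylor remainder of order two in the time variable, as a weighted integral. -/
theorem SlabB.taylor_two_eq {u : ℝ × Phase d → ℂ} (hu : SlabB u) (s h : ℝ) (x : Phase d) :
    u (s + h, x) - u (s, x) - h * fderiv ℝ u (s, x) (1, 0) =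
      ∫ θ : ℝ, (Set.Ioc (0 : ℝ) 1).indicator (fun θ => (((1 - θ) * h ^ 2 : ℝ) : ℂ)) θ *
        fderiv ℝ (fun p => fderiv ℝ u p (1, 0)) (s + θ * h, x) (1, 0) := by
  set v : ℝ × Phase d → ℂ := fun p => fderiv ℝ u p (1, 0) with hv
  have hv' : SlabB v := hu.fderiv_apply (1, 0)
  have hw : SlabB fun p => fderiv ℝ v p (1, 0) := hv'.fderiv_apply (1, 0)
  have hl : ∀ θ : ℝ, HasDerivAt (fun θ : ℝ => s + θ * h) h θ := fun θ => by
    simpa using ((hasDerivAt_id θ).mul_const h).const_add s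
  have hφ : ∀ θ : ℝ, HasDerivAt
      (fun θ : ℝ => u (s + θ * h, x) + (1 - θ : ℝ) • h • v (s + θ * h, x))
      ((((1 - θ) * h ^ 2 : ℝ) : ℂ) * fderiv ℝ v (s + θ * h, x) (1, 0)) θ := by
    intro θ
    have d1 := HasDerivAt.scomp θ (hu.hasDerivAt (s + θ * h) x) (hl θ)
    have d2 := HasDerivAt.scomp θ (hv'.hasDerivAt (s + θ * h) x) (hl θ)
    have d3 := ((hasDerivAt_id θ).const_sub 1).smul (d2.const_smul h)
    refine (d1.add d3).congr_deriv ?_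
    simp only [Complex.real_smul, id, hv, Pi.smul_apply, Function.comp]
    push_cast
    ring
  have hc : Continuous fun θ : ℝ =>
      (((1 - θ) * h ^ 2 : ℝ) : ℂ) * fderiv ℝ v (s + θ * h, x) (1, 0) := by
    have := hw.contDiff.continuous
    have h2 : Continuous fun θ : ℝ => fderiv ℝ v (s + θ * h, x) (1, 0) :=
      this.comp (by fun_prop : Continuous fun θ : ℝ => (s + θ * h, x))
    fun_prop
  have := intervalIntegral.integral_eq_sub_of_hasDerivAt (a := 0) (b := 1) (fun θ _ => hφ θ)
    (hc.intervalIntegrable _ _)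
  rw [intervalIntegral.integral_of_le zero_le_one] at this
  have he : (fun θ : ℝ => (Set.Ioc (0 : ℝ) 1).indicator (fun θ => (((1 - θ) * h ^ 2 : ℝ) : ℂ)) θ *
      fderiv ℝ v (s + θ * h, x) (1, 0)) = (Set.Ioc (0 : ℝ) 1).indicator fun θ =>
      (((1 - θ) * h ^ 2 : ℝ) : ℂ) * fderiv ℝ v (s + θ * h, x) (1, 0) := by
    ext θ
    rw [Set.indicator_mul_left]
  rw [he, integral_indicator measurableSet_Ioc, this]
  simp [hv]
  ring

/-- Derivatives in `x` pass under the integral form of the remainder. The time difference quotient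
thus converges in every symbol norm, which is what an operator bound in terms of symbol derivatives
can use. -/
theorem SlabB.taylor_two_bound {u : ℝ × Phase d → ℂ} (hu : SlabB u) (T : ℝ) (N : ℕ) :
    ∃ C, 0 ≤ C ∧ ∀ s h, |s| < T → |h| ≤ 1 → ∀ k ≤ N, ∀ x,
      ‖iteratedFDeriv ℝ k (fun x => u (s + h, x) - u (s, x) - h * fderiv ℝ u (s, x) (1, 0)) x‖ ≤
        C * h ^ 2 := by
  have hw : SlabB fun p => fderiv ℝ (fun p => fderiv ℝ u p (1, 0)) p (1, 0) :=
    (hu.fderiv_apply (1, 0)).fderiv_apply (1, 0)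
  set w : ℝ × Phase d → ℂ := fun p => fderiv ℝ (fun p => fderiv ℝ u p (1, 0)) p (1, 0) with hwd
  refine (hw.exists_slice_bound (T + 1) N).imp fun C hC => ⟨hC.1, fun s h hs hh k hk x => ?_⟩
  obtain ⟨h0, hC⟩ := hC
  set ρ : ℝ → ℂ := (Set.Ioc (0 : ℝ) 1).indicator fun θ => (((1 - θ) * h ^ 2 : ℝ) : ℂ) with hρ
  have hρm : Measurable ρ := by
    refine Measurable.indicator ?_ measurableSet_Ioc
    exact (by fun_prop : Continuous fun θ : ℝ => (((1 - θ) * h ^ 2 : ℝ) : ℂ)).measurable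
  have hρb : ∀ θ, ‖ρ θ‖ ≤ (Set.Ioc (0 : ℝ) 1).indicator (fun _ => h ^ 2) θ := by
    intro θ
    rw [hρ, norm_indicator_eq_indicator_norm]
    refine Set.indicator_le_indicator' fun hθ => ?_
    have h1 := hθ.1
    have h2 := hθ.2
    rw [Complex.norm_real, Real.norm_of_nonneg (mul_nonneg (by linarith) (sq_nonneg h))]
    exact mul_le_of_le_one_left (sq_nonneg h) (by linarith)
  have hi : Integrable ((Set.Ioc (0 : ℝ) 1).indicator (fun _ => h ^ 2)) := by
    rw [integrable_indicator_iff measurableSet_Ioc]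
    exact integrableOn_const (by simp)
  have key : ∀ (k : ℕ) (C : ℝ), (∀ t, |t| < T + 1 → ∀ x,
      ‖iteratedFDeriv ℝ k (fun x => w (t, x)) x‖ ≤ C) → ∀ x θ, ‖ρ θ‖ * ‖iteratedFDeriv ℝ k (fun x => w (s + θ * h, x)) x‖ ≤
      (Set.Ioc (0 : ℝ) 1).indicator (fun _ => h ^ 2) θ * C := by
    intro k C hC x θ
    by_cases hθ : θ ∈ Set.Ioc (0 : ℝ) 1
    · refine mul_le_mul (hρb θ) (hC _ ?_ x) (norm_nonneg _)
        (Set.indicator_nonneg (fun _ _ => sq_nonneg h) θ)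
      calc |s + θ * h| ≤ |s| + |θ * h| := abs_add_le _ _
        _ < T + 1 := by
          rw [abs_mul, abs_of_pos hθ.1]
          have := mul_le_one₀ hθ.2 (abs_nonneg h) hh
          linarith
    · have : ρ θ = 0 := Set.indicator_of_notMem hθ _
      rw [this, Set.indicator_of_notMem hθ]
      simp
  have hu' : ContDiff ℝ ∞ fun p : ℝ × Phase d => w (s + p.1 * h, p.2) :=
    hw.contDiff.comp ((contDiff_const.add (contDiff_fst.mul contDiff_const)).prodMk contDiff_snd)
  have hmain := contDiff_integral_weight (μ := volume) (ρ := ρ) hu' hρm.aestronglyMeasurable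
    fun k x₀ => by
      obtain ⟨C', -, hC'⟩ := hw.exists_slice_bound (T + 1) k
      exact ⟨_, hi.mul_const C', Filter.Eventually.of_forall fun x θ =>
        key k C' (hC' k le_rfl) x θ⟩
  simp only [hu.taylor_two_eq]
  refine (hmain.2 k x).trans ((integral_mono_of_nonneg (Filter.Eventually.of_forall fun θ => by
    positivity) (hi.mul_const C) (Filter.Eventually.of_forall fun θ =>
      key k C (hC k hk) x θ)).trans (le_of_eq ?_))
  rw [integral_mul_const, integral_indicator measurableSet_Ioc]
  simp [mul_comm]

/-- A quantization: a linear map to bounded operators on a class of symbols, which is continuous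
and turns the Moyal product into composition. -/
structure IsQuantization {W : Type*} [NormedAddCommGroup W] [NormedSpace ℂ W] (ħ : ℝ)
    (B : (Phase d → ℂ) → Prop) (Op : (Phase d → ℂ) → W →L[ℂ] W) : Prop where
  zero_mem : B 0
  add_smul_mem : ∀ f g (c : ℂ), B f → B g → B (f + c • g)
  add_smul : ∀ f g (c : ℂ), B f → B g → Op (f + c • g) = Op f + c • Op g
  moyal_mem : ∀ f g, B f → B g → B (moyal ħ f g)
  moyal : ∀ f g, B f → B g → Op (moyal ħ f g) = Op f * Op g
  bound : ∃ (N : ℕ) (C : ℝ), 0 ≤ C ∧ ∀ f b, B f →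
    (∀ k ≤ N, ∀ x, ‖iteratedFDeriv ℝ k f x‖ ≤ b) → ‖Op f‖ ≤ C * b

namespace IsQuantization

variable {W : Type*} [NormedAddCommGroup W] [NormedSpace ℂ W] {ħ : ℝ}
  {B : (Phase d → ℂ) → Prop} {Op : (Phase d → ℂ) → W →L[ℂ] W} (Q : IsQuantization ħ B Op)

include Q

theorem smul_mem {f : Phase d → ℂ} (hf : B f) (c : ℂ) : B (c • f) := by
  simpa using Q.add_smul_mem 0 f c Q.zero_mem hf

theorem map_zero : Op 0 = 0 := by
  have := Q.add_smul 0 0 1 Q.zero_mem Q.zero_mem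
  simpa using this

theorem map_smul {f : Phase d → ℂ} (hf : B f) (c : ℂ) : Op (c • f) = c • Op f := by
  simpa [Q.map_zero] using Q.add_smul 0 f c Q.zero_mem hf

theorem sum_mem {ι : Type*} (t : Finset ι) (F : ι → Phase d → ℂ) (c : ι → ℂ)
    (h : ∀ i ∈ t, B (F i)) : B (∑ i ∈ t, c i • F i) := by
  classical
  induction t using Finset.induction with
  | empty => simpa using Q.zero_mem
  | insert a t ha ih =>
    rw [sum_insert ha, add_comm]
    exact Q.add_smul_mem _ _ _ (ih fun i hi => h i (mem_insert_of_mem hi)) (h a (mem_insert_self a t))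

theorem map_sum {ι : Type*} (t : Finset ι) (F : ι → Phase d → ℂ) (c : ι → ℂ)
    (h : ∀ i ∈ t, B (F i)) : Op (∑ i ∈ t, c i • F i) = ∑ i ∈ t, c i • Op (F i) := by
  classical
  induction t using Finset.induction with
  | empty => simpa using Q.map_zero
  | insert a t ha ih =>
    have h1 : ∀ i ∈ t, B (F i) := fun i hi => h i (mem_insert_of_mem hi)
    rw [sum_insert ha, sum_insert ha, add_comm, Q.add_smul _ _ _ (Q.sum_mem t F c h1)
      (h a (mem_insert_self a t)), ih h1, add_comm]

theorem moyalRem_eq {J : ℕ} {f g : Phase d → ℂ} (hf : B f) (hg : B g)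
    (hM : ∀ j, B (moyalTerm j f g)) : Op (moyalRem ħ J f g) = ((ħ : ℂ) ^ J)⁻¹ •
      (Op f * Op g - ∑ j ∈ range J, ((ħ : ℂ) ^ j) • Op (moyalTerm j f g)) := by
  have h1 : moyalRem ħ J f g = ((ħ : ℂ) ^ J)⁻¹ • (_root_.moyal ħ f g +
      (-1 : ℂ) • ∑ j ∈ range J, ((ħ : ℂ) ^ j) • moyalTerm j f g) := by
    ext x
    simp only [moyalRem, Pi.smul_apply, Pi.add_apply, smul_eq_mul, Finset.sum_apply]
    ring
  have hs := Q.sum_mem (range J) (fun j => moyalTerm j f g) (fun j => (ħ : ℂ) ^ j) fun j _ => hM j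
  have hm := Q.moyal_mem f g hf hg
  rw [h1, Q.map_smul (Q.add_smul_mem _ _ _ hm hs), Q.add_smul _ _ _ hm hs, Q.moyal f g hf hg,
    Q.map_sum _ _ _ fun j _ => hM j, neg_one_smul, sub_eq_add_neg]

theorem taylor_two {u : ℝ × Phase d → ℂ} (hu : SlabB u) (hB : ∀ s, B fun x => u (s, x))
    (hB' : ∀ s, B fun x => fderiv ℝ u (s, x) (1, 0)) (T : ℝ) : ∃ C, ∀ s h, |s| < T → |h| ≤ 1 →
    ‖Op (fun x => u (s + h, x)) - Op (fun x => u (s, x)) -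
      h • Op (fun x => fderiv ℝ u (s, x) (1, 0))‖ ≤ C * h ^ 2 := by
  obtain ⟨N, C, h0, hC⟩ := Q.bound
  obtain ⟨C', h0', hC'⟩ := hu.taylor_two_bound T N
  refine ⟨C * C', fun s h hs hh => ?_⟩
  set u₁ : Phase d → ℂ := fun x => u (s + h, x)
  set u₀ : Phase d → ℂ := fun x => u (s, x)
  set v : Phase d → ℂ := fun x => fderiv ℝ u (s, x) (1, 0)
  have e : (fun x => u (s + h, x) - u (s, x) - h * fderiv ℝ u (s, x) (1, 0)) =
      (u₁ + (-1 : ℂ) • u₀) + (-h : ℂ) • v := by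
    ext x
    simp only [u₁, u₀, v, Pi.add_apply, Pi.smul_apply, smul_eq_mul]
    ring
  have h1 : B u₁ := hB _
  have h2 : B u₀ := hB _
  have h3 : B v := hB' _
  have h4 := Q.add_smul_mem _ _ (-1) h1 h2
  have h5 := Q.add_smul_mem _ _ (-h : ℂ) h4 h3
  have e2 : Op u₁ - Op u₀ - h • Op v = Op ((u₁ + (-1 : ℂ) • u₀) + (-h : ℂ) • v) := by
    rw [Q.add_smul _ _ _ h4 h3, Q.add_smul _ _ _ h1 h2, neg_one_smul, neg_smul, sub_eq_add_neg,
      sub_eq_add_neg]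
    rfl
  rw [e2, mul_assoc]
  refine hC _ _ h5 ?_
  rw [← e]
  exact fun k hk x => hC' s h hs hh k hk x

theorem hasDerivAt {u : ℝ × Phase d → ℂ} (hu : SlabB u) (hB : ∀ s, B fun x => u (s, x))
    (hB' : ∀ s, B fun x => fderiv ℝ u (s, x) (1, 0)) (s : ℝ) :
    HasDerivAt (fun s => Op fun x => u (s, x)) (Op fun x => fderiv ℝ u (s, x) (1, 0)) s := by
  obtain ⟨C, hC⟩ := Q.taylor_two hu hB hB' (|s| + 1)
  rw [hasDerivAt_iff_isLittleO_nhds_zero]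
  have h1 : (fun h : ℝ => (Op fun x => u (s + h, x)) - (Op fun x => u (s, x)) -
      h • Op fun x => fderiv ℝ u (s, x) (1, 0)) =O[nhds 0] fun h : ℝ => h ^ 2 := by
    refine Asymptotics.IsBigO.of_bound C ?_
    filter_upwards [Metric.closedBall_mem_nhds (0 : ℝ) one_pos] with h hh
    rw [Real.norm_of_nonneg (sq_nonneg h)]
    exact hC s h (by linarith) (by simpa using hh)
  exact h1.trans_isLittleO (Asymptotics.isLittleO_pow_id one_lt_two)

/-- Adding the Taylor expansions of the family at `s` and at `r` cancels its values and leaves `(r -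
s)(V r - V s) = O((r - s)²)`. No separate time estimate on the differentiated symbol is needed. -/
theorem continuous_deriv {u : ℝ × Phase d → ℂ} (hu : SlabB u) (hB : ∀ s, B fun x => u (s, x))
    (hB' : ∀ s, B fun x => fderiv ℝ u (s, x) (1, 0)) :
    Continuous fun s => Op fun x => fderiv ℝ u (s, x) (1, 0) := by
  refine continuous_iff_continuousAt.2 fun s => ?_
  obtain ⟨C, hC⟩ := Q.taylor_two hu hB hB' (|s| + 1)
  set V : ℝ → W →L[ℂ] W := fun s => Op fun x => fderiv ℝ u (s, x) (1, 0) with hV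
  have key : ∀ r, |r - s| < 1 → ‖V r - V s‖ ≤ 2 * C * |r - s| := by
    intro r hr
    rcases eq_or_ne r s with rfl | hrs
    · simp
    have hpos : 0 < |r - s| := abs_pos.2 (sub_ne_zero.2 hrs)
    have hr' : |r| < |s| + 1 := by
      have := abs_add_le s (r - s)
      rw [add_sub_cancel] at this
      linarith
    have h1 := hC s (r - s) (by linarith) hr.le
    have h2 := hC r (s - r) hr' (by rw [abs_sub_comm]; exact hr.le)
    rw [add_sub_cancel] at h1 h2
    have h3 := (norm_add_le _ _).trans (add_le_add h1 h2)
    have e : (Op fun x => u (r, x)) - (Op fun x => u (s, x)) - (r - s) • V s +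
        ((Op fun x => u (s, x)) - (Op fun x => u (r, x)) - (s - r) • V r) =
        (r - s) • (V r - V s) := by module
    rw [e, norm_smul, Real.norm_eq_abs, ← sq_abs (r - s), ← sq_abs (s - r), abs_sub_comm s r] at h3
    refine le_of_mul_le_mul_left (h3.trans (le_of_eq ?_)) hpos
    ring
  rw [ContinuousAt, tendsto_iff_norm_sub_tendsto_zero]
  have hl : Filter.Tendsto (fun r => 2 * C * |r - s|) (nhds s) (nhds 0) := by
    have : Continuous fun r => 2 * C * |r - s| := by fun_prop
    simpa using this.tendsto s
  refine squeeze_zero' (Filter.Eventually.of_forall fun _ => norm_nonneg _) ?_ hl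
  filter_upwards [Metric.ball_mem_nhds s one_pos] with r hr
  exact key r hr

end IsQuantization

end Quantization

/-! ### Cancellation of Moyal terms and Duhamel's formula -/

section Duhamel

variable {d : ℕ}

/-- Regrouping by `j = l + k - 1`: the Moyal term of order `k` on the `l`-th coefficient carries `ħ
^ (k + l)`, that is `ħ ^ (j + 1)`. Oddness of `k` excludes `k = 0`. -/
theorem sum_filter_odd_reindex {M : Type*} [AddCommMonoid M] (J : ℕ) (F : ℕ → ℕ → M) :
    ∑ l ∈ range J, ∑ k ∈ range (J - l + 1) with Odd k, F k l =
      ∑ j ∈ range J, ∑ k ∈ Icc 1 (j + 1) with Odd k, F k (j + 1 - k) := by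
  rw [sum_sigma', sum_sigma']
  refine sum_nbij' (fun x => ⟨x.1 + x.2 - 1, x.2⟩) (fun x => ⟨x.1 + 1 - x.2, x.2⟩) ?_ ?_ ?_ ?_ ?_
  · rintro ⟨l, k⟩ h
    simp only [mem_sigma, mem_range, mem_filter, mem_Icc] at h ⊢
    have := h.2.2.pos
    exact ⟨by omega, ⟨by omega, by omega⟩, h.2.2⟩
  · rintro ⟨j, k⟩ h
    simp only [mem_sigma, mem_range, mem_filter, mem_Icc] at h ⊢
    exact ⟨by omega, by omega, h.2.2⟩
  · rintro ⟨l, k⟩ h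
    simp only [mem_sigma, mem_range, mem_filter] at h
    have := h.2.2.pos
    simp only [Sigma.mk.injEq, heq_eq_eq, and_true]
    omega
  · rintro ⟨j, k⟩ h
    simp only [mem_sigma, mem_range, mem_filter, mem_Icc] at h
    simp only [Sigma.mk.injEq, heq_eq_eq, and_true]
    omega
  · rintro ⟨l, k⟩ h
    simp only [mem_sigma, mem_range, mem_filter] at h
    have := h.2.2.pos
    congr 1
    simp only
    omega

variable {W : Type*} [NormedAddCommGroup W] [NormedSpace ℂ W] {ħ : ℝ}
  {B : (Phase d → ℂ) → Prop} {Op : (Phase d → ℂ) → W →L[ℂ] W}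

theorem moyalTerm_comm_smul (j : ℕ) (f g : Phase d → ℂ) :
    moyalTerm j g f = ((-1 : ℂ) ^ j) • moyalTerm j f g := by
  ext x
  rw [moyalTerm_comm]
  rfl

/-- The remainders of the two Moyal products with `g` combine to a commutator, from which the odd
Moyal terms are subtracted. -/
theorem IsQuantization.moyalRem_sub (Q : IsQuantization ħ B Op) (hħ : ħ ≠ 0) {f g : Phase d → ℂ}
    (hf : B f) (hg : B g) (hM : ∀ j, B (moyalTerm j g f)) (K : ℕ) :
    ((ħ : ℂ) ^ K) • (Op (moyalRem ħ K g f) - Op (moyalRem ħ K f g)) =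
      (Op g * Op f - Op f * Op g) -
        ∑ k ∈ range K with Odd k, ((ħ : ℂ) ^ k) • (2 : ℂ) • Op (moyalTerm k g f) := by
  have hM' : ∀ j, B (moyalTerm j f g) := fun j => by
    rw [moyalTerm_comm_smul]; exact Q.smul_mem (hM j) _
  have h0 : (ħ : ℂ) ^ K ≠ 0 := pow_ne_zero _ (by exact_mod_cast hħ)
  -- For even orders the two Moyal terms coincide and cancel; for odd orders they are opposite and
  -- double.
  have hs : ∑ j ∈ range K, ((ħ : ℂ) ^ j) • Op (moyalTerm j g f) -
      ∑ j ∈ range K, ((ħ : ℂ) ^ j) • Op (moyalTerm j f g) =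
      ∑ k ∈ range K with Odd k, ((ħ : ℂ) ^ k) • (2 : ℂ) • Op (moyalTerm k g f) := by
    rw [← sum_sub_distrib, sum_filter]
    refine sum_congr rfl fun k _ => ?_
    rw [moyalTerm_comm_smul k g f, Q.map_smul (hM k)]
    split_ifs with hk
    · rw [hk.neg_one_pow]
      module
    · rw [(Nat.not_odd_iff_even.1 hk).neg_one_pow]
      module
  rw [Q.moyalRem_eq hg hf hM, Q.moyalRem_eq hf hg hM', smul_sub, smul_smul, smul_smul,
    mul_inv_cancel₀ h0, one_smul, one_smul, ← hs]
  abel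

variable {g : Phase d → ℝ} {f : Phase d → ℂ}

/-- The commutator identity satisfied by the truncated Egorov expansion. -/
theorem IsQuantization.commutator_expansion (Q : IsQuantization ħ B Op) (hħ : ħ ≠ 0)
    (hG : B (toC g)) (hF : ∀ j s, B (egorovL g j s f))
    (hM : ∀ k j s, B (moyalTerm k (toC g) (egorovL g j s f))) (J : ℕ) (s : ℝ) :
    ((ħ : ℂ) ^ (J + 1)) • (∑ l ∈ range J,
      (Op (moyalRem ħ (J - l + 1) (toC g) (egorovL g l s f)) -
        Op (moyalRem ħ (J - l + 1) (egorovL g l s f) (toC g)))) =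
      (Op (toC g) * (∑ l ∈ range J, ((ħ : ℂ) ^ l) • Op (egorovL g l s f)) -
        (∑ l ∈ range J, ((ħ : ℂ) ^ l) • Op (egorovL g l s f)) * Op (toC g)) -
      ∑ j ∈ range J, ((ħ : ℂ) ^ (j + 1)) • (2 : ℂ) • ∑ k ∈ Icc 1 (j + 1) with Odd k,
        Op (moyalTerm k (toC g) (egorovL g (j + 1 - k) s f)) := by
  have h1 : ∀ l ∈ range J, ((ħ : ℂ) ^ (J + 1)) •
      (Op (moyalRem ħ (J - l + 1) (toC g) (egorovL g l s f)) -
        Op (moyalRem ħ (J - l + 1) (egorovL g l s f) (toC g))) =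
      ((ħ : ℂ) ^ l) • (Op (toC g) * Op (egorovL g l s f) - Op (egorovL g l s f) * Op (toC g)) -
      ∑ k ∈ range (J - l + 1) with Odd k,
        ((ħ : ℂ) ^ (k + l)) • (2 : ℂ) • Op (moyalTerm k (toC g) (egorovL g l s f)) := by
    intro l hl
    have hl' := mem_range.1 hl
    rw [show J + 1 = l + (J - l + 1) by omega, pow_add, mul_smul,
      Q.moyalRem_sub hħ (hF l s) hG (fun k => hM k l s), smul_sub, smul_sum]
    congr 1
    refine sum_congr rfl fun k _ => ?_
    rw [smul_smul, ← pow_add, add_comm l k]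
  rw [smul_sum, sum_congr rfl h1, sum_sub_distrib, sum_filter_odd_reindex J fun k l =>
    ((ħ : ℂ) ^ (k + l)) • (2 : ℂ) • Op (moyalTerm k (toC g) (egorovL g l s f))]
  congr 1
  · simp only [mul_sum, sum_mul, mul_smul_comm, smul_mul_assoc, ← sum_sub_distrib, smul_sub]
  · refine sum_congr rfl fun j _ => ?_
    rw [smul_sum, smul_sum]
    refine sum_congr rfl fun k hk => ?_
    rw [mem_filter, mem_Icc] at hk
    rw [show k + (j + 1 - k) = j + 1 by omega]

theorem IsQuantization.hasDerivAt_egorovL (Q : IsQuantization ħ B Op) (hg : BddD Set.univ ⊤ g)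
    (hf : BddD Set.univ ⊤ f) (hF : ∀ j s, B (egorovL g j s f))
    (hM : ∀ k j s, B (moyalTerm k (toC g) (egorovL g j s f))) (j : ℕ) :
    (∀ s, HasDerivAt (fun s => Op (egorovL g j s f)) ((2 * I) • ∑ k ∈ Icc 1 (j + 1) with Odd k,
      Op (moyalTerm k (toC g) (egorovL g (j + 1 - k) s f))) s) ∧
    Continuous fun s => (2 * I) • ∑ k ∈ Icc 1 (j + 1) with Odd k,
      Op (moyalTerm k (toC g) (egorovL g (j + 1 - k) s f)) := by
  have hu := egorovL_slabB hg hf j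
  have e1 : ∀ s, (fun x => fderiv ℝ (fun p : ℝ × Phase d => egorovL g j p.1 f p.2) (s, x) (1, 0)) =
      ∑ k ∈ Icc 1 (j + 1) with Odd k,
        (2 * I) • moyalTerm k (toC g) (egorovL g (j + 1 - k) s f) := by
    intro s
    ext x
    rw [(hu.hasDerivAt s x).unique (egorovL_hasDerivAt' hg hf j s x), mul_sum, Finset.sum_apply]
    rfl
  have hB' : ∀ s, B fun x =>
      fderiv ℝ (fun p : ℝ × Phase d => egorovL g j p.1 f p.2) (s, x) (1, 0) := fun s => by
    rw [e1]
    exact Q.sum_mem _ _ _ fun k _ => hM k _ s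
  have e2 : ∀ s, (Op fun x =>
      fderiv ℝ (fun p : ℝ × Phase d => egorovL g j p.1 f p.2) (s, x) (1, 0)) =
      (2 * I) • ∑ k ∈ Icc 1 (j + 1) with Odd k,
        Op (moyalTerm k (toC g) (egorovL g (j + 1 - k) s f)) := fun s => by
    rw [e1, Q.map_sum _ _ _ fun k _ => hM k _ s, smul_sum]
  simp only [← e2]
  exact ⟨fun s => Q.hasDerivAt hu (hF j) hB' s, Q.continuous_deriv hu (hF j) hB'⟩

variable [CompleteSpace W]

theorem hasDerivAt_exp_I_smul (G : W →L[ℂ] W) (ħ t : ℝ) :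
    HasDerivAt (fun t : ℝ => NormedSpace.exp ((I * (t : ℂ) / (ħ : ℂ)) • G))
      ((I / ħ) • (G * NormedSpace.exp ((I * (t : ℂ) / (ħ : ℂ)) • G))) t := by
  have h := HasDerivAt.scomp t (hasDerivAt_exp_smul_const' (𝕂 := ℂ) ((I / (ħ : ℂ)) • G) (t : ℂ))
    Complex.ofRealCLM.hasDerivAt
  have e : ∀ t : ℝ, ((t : ℂ) • (I / (ħ : ℂ)) • G) = (I * (t : ℂ) / (ħ : ℂ)) • G := fun t => by
    rw [smul_smul]
    congr 1
    ring
  simpa only [Function.comp_def, Complex.ofRealCLM_apply, Complex.ofReal_one, one_smul, e,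
    smul_mul_assoc] using h

omit [CompleteSpace W] in
theorem commute_exp_I_smul (G : W →L[ℂ] W) (c : ℂ) : Commute (NormedSpace.exp (c • G)) G :=
  ((Commute.refl G).smul_left c).exp_left

/-- Duhamel's formula for the conjugation of the quantized observable by the quantum evolution. -/
theorem IsQuantization.egorov (Q : IsQuantization ħ B Op) (hħ : ħ ≠ 0)
    (hg : BddD Set.univ ⊤ g) (hf : BddD Set.univ ⊤ f) (hG : B (toC g))
    (hF : ∀ j s, B (egorovL g j s f))
    (hM : ∀ k j s, B (moyalTerm k (toC g) (egorovL g j s f)))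
    {E : ℝ → W →L[ℂ] W} (hE : ∀ t, E t = NormedSpace.exp ((I * (t : ℂ) / (ħ : ℂ)) • Op (toC g)))
    {J : ℕ} (hJ : 1 ≤ J) (t : ℝ) :
    Continuous (duhamelIntegrand Op E ħ g f J t) ∧
      E t ∘L Op f ∘L E (-t) = ∑ j ∈ range J, ((ħ : ℂ) ^ j) • Op (egorovL g j t f) +
        ((ħ : ℂ) ^ J) • (I • ∫ s in (0 : ℝ)..t, duhamelIntegrand Op E ħ g f J t s) := by
  have hħ' : (ħ : ℂ) ≠ 0 := by exact_mod_cast hħ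
  set G := Op (toC g) with hGd
  set X : ℝ → W →L[ℂ] W := fun s => ∑ l ∈ range J,
      (Op (moyalRem ħ (J - l + 1) (toC g) (egorovL g l s f)) -
        Op (moyalRem ħ (J - l + 1) (egorovL g l s f) (toC g))) with hX
  set V : ℕ → ℝ → W →L[ℂ] W := fun j s => (2 * I) • ∑ k ∈ Icc 1 (j + 1) with Odd k,
      Op (moyalTerm k (toC g) (egorovL g (j + 1 - k) s f)) with hV
  set F : ℝ → W →L[ℂ] W := fun s => ∑ l ∈ range J, ((ħ : ℂ) ^ l) • Op (egorovL g l s f) with hFd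
  set F' : ℝ → W →L[ℂ] W := fun s => ∑ l ∈ range J, ((ħ : ℂ) ^ l) • V l s with hF'
  have hdF : ∀ s, HasDerivAt F (F' s) s := fun s =>
    HasDerivAt.fun_sum fun l _ => ((Q.hasDerivAt_egorovL hg hf hF hM l).1 s).const_smul ((ħ : ℂ) ^ l)
  have hcF' : Continuous F' :=
    continuous_finsetSum _ fun l _ => by
      have h := (Q.hasDerivAt_egorovL hg hf hF hM l).2
      exact h.const_smul ((ħ : ℂ) ^ l)
  have hcF : Continuous F := continuous_iff_continuousAt.2 fun s => (hdF s).continuousAt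
  have hdE : ∀ s, HasDerivAt E ((I / ħ) • (G * E s)) s := fun s => by
    rw [hE s, funext hE]
    exact hasDerivAt_exp_I_smul G ħ s
  have hcE : Continuous E := continuous_iff_continuousAt.2 fun s => (hdE s).continuousAt
  have hcomm : ∀ s, G * E s = E s * G := fun s => by
    rw [hE]; exact (commute_exp_I_smul G _).eq.symm
  have hE0 : E 0 = 1 := by rw [hE]; simp [NormedSpace.exp_zero]
  -- By the transport equations the odd Moyal terms left over are `-iħ F'(s)`, as `i · 2i = -2`.
  -- This form also shows that `X` is continuous without examining the individual remainders.
  have hX1 : ∀ s, X s = ((ħ : ℂ) ^ (J + 1))⁻¹ • ((G * F s - F s * G) + (I * ħ) • F' s) := by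
    intro s
    have h := Q.commutator_expansion hħ hG hF hM J s
    have h2 : ∑ j ∈ range J, ((ħ : ℂ) ^ (j + 1)) • (2 : ℂ) • ∑ k ∈ Icc 1 (j + 1) with Odd k,
        Op (moyalTerm k (toC g) (egorovL g (j + 1 - k) s f)) = -((I * ħ) • F' s) := by
      simp only [hF', hV, smul_sum, ← sum_neg_distrib, smul_smul, ← neg_smul]
      refine sum_congr rfl fun j _ => sum_congr rfl fun k _ => ?_
      congr 1
      linear_combination (2 * (ħ : ℂ) ^ (j + 1)) * Complex.I_sq
    rw [h2, sub_neg_eq_add] at h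
    rw [← h, smul_smul, inv_mul_cancel₀ (pow_ne_zero _ hħ'), one_smul]
  have hcX : Continuous X := by
    rw [funext hX1]
    fun_prop
  have hD : duhamelIntegrand Op E ħ g f J t = fun s => E (t - s) * (X s * E (-(t - s))) := rfl
  have hcD : Continuous (duhamelIntegrand Op E ħ g f J t) := by
    rw [hD]
    exact (hcE.comp (by fun_prop : Continuous fun s : ℝ => t - s)).mul
      (hcX.mul (hcE.comp (by fun_prop : Continuous fun s : ℝ => -(t - s))))
  refine ⟨hcD, ?_⟩
  -- The propagators contribute `-(i/ħ)` times the commutator of `G` with `F(s)`, and `F`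
  -- contributes `F'(s)`; by `hX1` the sum is `-i ħ^J X(s)`.
  have hP : ∀ s, HasDerivAt (fun s => E (t - s) * (F s * E (-(t - s))))
      ((-(I * (ħ : ℂ) ^ J)) • duhamelIntegrand Op E ħ g f J t s) s := by
    intro s
    have d1 := HasDerivAt.scomp s (hdE (t - s)) ((hasDerivAt_id s).const_sub t)
    have d2 : HasDerivAt (fun s => E (-(t - s))) ((- -1 : ℝ) • (I / (ħ : ℂ)) • (G * E (-(t - s)))) s :=
      HasDerivAt.scomp (g₁ := E) (h := fun s => -(t - s)) s (hdE (-(t - s)))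
        ((hasDerivAt_id' s).const_sub t).fun_neg
    refine (d1.mul ((hdF s).mul d2)).congr_deriv ?_
    rw [hD]
    simp only [Function.comp, Pi.mul_apply, hX1, neg_neg, one_smul, neg_smul, hcomm (t - s), pow_succ]
    simp only [neg_mul, smul_mul_assoc, mul_smul_comm, mul_add, add_mul, mul_sub, sub_mul, smul_add,
      smul_sub, smul_smul, mul_assoc]
    have c1 : I * ((ħ : ℂ) ^ J * ((ħ : ℂ) ^ J * ħ)⁻¹) = I / ħ := by field_simp
    have c2 : I * ((ħ : ℂ) ^ J * (((ħ : ℂ) ^ J * ħ)⁻¹ * (I * ħ))) = -1 := by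
      field_simp
      exact Complex.I_sq
    rw [c1, c2]
    module
  have hint := intervalIntegral.integral_eq_sub_of_hasDerivAt (a := 0) (b := t)
    (fun s _ => hP s) ((hcD.const_smul (-(I * (ħ : ℂ) ^ J))).intervalIntegrable _ _)
  rw [intervalIntegral.integral_smul] at hint
  -- At time zero only the term `l = 0` survives; it is present because `1 ≤ J`.
  have hF0 : F 0 = Op f := by
    simp only [hFd, egorovL_zero_time hg]
    rw [sum_eq_single_of_mem 0 (mem_range.2 hJ)]
    · simp
    · intro l _ hl
      rw [if_neg hl, Q.map_zero, smul_zero]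
  simp only [sub_self, neg_zero, sub_zero, hE0, one_mul, mul_one, hF0] at hint
  have : E t ∘L Op f ∘L E (-t) = E t * (Op f * E (-t)) := rfl
  rw [this, smul_smul, mul_comm _ I]
  rw [neg_smul, neg_eq_iff_eq_neg, neg_sub] at hint
  rw [hint]
  abel

end Duhamel

/-! ### The expansion on `L²(ℝ^d)` -/

section EuclideanCase

variable {d : ℕ}

theorem isQuantization_weylL2 {ħ : ℝ} (hħ : ħ ≠ 0) :
    IsQuantization ħ (IsSymbol (d := d) (F := ℂ)) (weylL2 ħ) where
  zero_mem := isSymbol_iff_bddD.2 (BddD.const _ _ 0)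
  add_smul_mem _ _ c hf hg := hf.add (hg.smul c)
  add_smul _ _ c hf hg := weylL2_add_smul hf hg c ħ
  moyal_mem _ _ hf hg := (moyal_spec hħ hf hg).1
  moyal _ _ hf hg := weylL2_moyal hħ hf hg
  bound := by
    obtain ⟨C, h0, hC⟩ := norm_weylL2_le d ħ
    exact ⟨bigN d, C, h0, fun f b hf hb => hC f b hf hb⟩

theorem egorov_euclidean {ħ : ℝ} (hħ : ħ ≠ 0) {f : Phase d → ℂ} {g : Phase d → ℝ}
    (hf : IsSymbol f) (hg : IsSymbol g) {J : ℕ} (hJ : 1 ≤ J) (t : ℝ) :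
    Continuous (duhamelIntegrand (weylL2 ħ) (propL2 ħ g) ħ g f J t) ∧
      propL2 ħ g t ∘L weylL2 ħ f ∘L propL2 ħ g (-t) =
        ∑ j ∈ range J, ((ħ : ℂ) ^ j) • weylL2 ħ (egorovL g j t f) +
        ((ħ : ℂ) ^ J) • (I •
          ∫ s in (0 : ℝ)..t, duhamelIntegrand (weylL2 ħ) (propL2 ħ g) ħ g f J t s) := by
  rw [isSymbol_iff_bddD] at hf hg
  have hF : ∀ j s, IsSymbol (egorovL g j s f) := fun j s =>
    isSymbol_iff_bddD.2 ((egorovL_slabB hg hf j).slice s)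
  exact (isQuantization_weylL2 hħ).egorov hħ hg hf (isSymbol_iff_bddD.2 hg.toC) hF
    (fun k j s => isSymbol_iff_bddD.2 (hg.toC.moyalTerm (isSymbol_iff_bddD.1 (hF j s)) k))
    (fun _ => rfl) hJ t

end EuclideanCase

/-! ### Transposes of Weyl operators -/

section Transpose

variable {d : ℕ}

/-- Reversal of momenta. -/
def flipP (z : Phase d) : Phase d := (z.1, -z.2)

/-- The symbol of the transposed operator. -/
def flipSym (f : Phase d → ℂ) : Phase d → ℂ := fun x => f (x.1, -x.2)

theorem flipSym_dilSym (ħ : ℝ) (f : Phase d → ℂ) : dilSym ħ (flipSym f) = flipSym (dilSym ħ f) := by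
  ext x
  simp [flipSym, dilSym]

theorem flipSym_eq (f : Phase d → ℂ) : flipSym f = dilSym (-1) f := by
  ext x
  simp [flipSym, dilSym]

theorem IsSymbol.flipSym {f : Phase d → ℂ} (hf : IsSymbol f) : IsSymbol (flipSym f) := by
  rw [flipSym_eq]
  exact hf.dilSym _

theorem measurePreserving_flipP : MeasurePreserving (flipP : Phase d → Phase d) :=
  (MeasurePreserving.id volume).prod (Measure.measurePreserving_neg volume)

theorem measurableEmbedding_flipP : MeasurableEmbedding (flipP : Phase d → Phase d) := by
  have h : Measurable (flipP : Phase d → Phase d) := by unfold flipP; fun_prop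
  have hi : Function.Involutive (flipP : Phase d → Phase d) := fun z => by simp [flipP]
  exact (MeasurableEquiv.ofInvolutive flipP hi h).measurableEmbedding

theorem integral_comp_flipP (F : Phase d → ℂ) : ∫ z, F (flipP z) = ∫ z, F z :=
  measurePreserving_flipP.integral_comp measurableEmbedding_flipP F

theorem conj_coh (z : Phase d) (q : Config d) : starRingEnd ℂ (coh z q) = coh (flipP z) q := by
  rw [coh, coh, map_mul]
  congr 1
  · rw [gE_apply, Complex.conj_ofReal, gE_apply]
    rfl
  · simp only [chi, flipP, innerSL_apply_apply, inner_neg_left]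
    rw [← Complex.exp_conj, map_mul, Complex.conj_I, Complex.conj_ofReal]
    push_cast
    congr 1
    ring

theorem flipP_sub (w z : Phase d) : flipP w - flipP z = flipP (w - z) := by
  simp [flipP]
  abel

theorem jd_flipP (N : ℕ) (z : Phase d) : jd N (flipP z) = jd N z := by
  simp [jd, flipP, Prod.norm_def]

/-- The kernel of the transposed operator. -/
def transK (A : Phase d → Phase d → ℂ) (w z : Phase d) : ℂ := A (flipP z) (flipP w)

theorem measurable_flipP : Measurable (flipP : Phase d → Phase d) :=
  measurableEmbedding_flipP.measurable

theorem OffDiag.transK {A : Phase d → Phase d → ℂ} (hA : OffDiag A) : OffDiag (transK A) where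
  meas := hA.meas.comp ((measurable_flipP.comp measurable_snd).prodMk
    (measurable_flipP.comp measurable_fst))
  decay N := by
    obtain ⟨C, h0, hC⟩ := hA.decay N
    refine ⟨C, h0, fun w z => (hC _ _).trans (le_of_eq ?_)⟩
    rw [flipP_sub, jd_flipP, jd_sub_comm]

theorem integral_mul_opS {A : Phase d → Phase d → ℂ} (hA : OffDiag A) (φ ψ : 𝓢(Config d, ℂ)) :
    ∫ q, φ q * opS A hA ψ q = ∫ w, ∫ z, A w z * (anal φ (flipP w) * anal ψ z) := by
  refine (integral_mul_synth φ.isSchw (rapid_act hA (rapid_anal ψ))).trans ?_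
  congr 1
  ext w
  rw [act, ← integral_mul_const]
  have h : ∫ q, φ q * coh w q = anal φ (flipP w) := by
    rw [anal]
    congr 1
    ext q
    rw [conj_coh]
    simp [flipP, mul_comm]
  rw [h]
  congr 1
  ext z
  ring

/-- The pairing is bilinear and conjugating a packet reverses its momentum. Transposition therefore
exchanges the arguments of the kernel and reverses both momenta. -/
theorem integral_opS_mul {A : Phase d → Phase d → ℂ} (hA : OffDiag A) (φ ψ : 𝓢(Config d, ℂ)) :
    ∫ q, opS A hA φ q * ψ q = ∫ q, φ q * opS (transK A) hA.transK ψ q := by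
  have e1 : ∫ q, opS A hA φ q * ψ q = ∫ q, ψ q * opS A hA φ q := by simp only [mul_comm]
  rw [e1, integral_mul_opS, integral_mul_opS]
  have hi : Integrable (Function.uncurry fun w z =>
      A w z * (anal ψ (flipP w) * anal φ z)) (volume.prod volume) := by
    obtain ⟨C, hC0, hC⟩ := hA.decay (bigN d)
    obtain ⟨D, hD0, hD⟩ := (rapid_anal ψ).decay 0
    have hm : Measurable fun p : Phase d × Phase d => anal ψ (flipP p.1) * anal φ p.2 :=
      (((rapid_anal ψ).meas.comp measurable_flipP).comp measurable_fst).mul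
        ((rapid_anal φ).meas.comp measurable_snd)
    refine ((integrable_jd_sub_mul (rapid_anal φ).integrable.norm).const_mul (C * D)).mono'
      (hA.meas.mul hm).aestronglyMeasurable (Filter.Eventually.of_forall fun p => ?_)
    simp only [Function.uncurry, norm_mul]
    have h1 : ‖anal ψ (flipP p.1)‖ ≤ D := (hD _).trans (by rw [jd_zero_exp, mul_one])
    calc ‖A p.1 p.2‖ * (‖anal ψ (flipP p.1)‖ * ‖anal φ p.2‖)
        ≤ (C * jd (bigN d) (p.1 - p.2)) * (D * ‖anal φ p.2‖) :=
          mul_le_mul (hC _ _) (mul_le_mul_of_nonneg_right h1 (norm_nonneg _)) (by positivity)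
            (mul_nonneg hC0 (jd_nonneg _ _))
      _ = _ := by ring
  rw [integral_integral_swap hi, ← integral_comp_flipP]
  refine integral_congr_ae (Filter.Eventually.of_forall fun w => ?_)
  simp only
  rw [← integral_comp_flipP]
  have hf : ∀ z : Phase d, flipP (flipP z) = z := fun z => by simp [flipP]
  simp only [hf, transK]
  congr 1
  ext z
  ring

theorem wig_flipP (w z x : Phase d) : wig w z (flipP x) = wig (flipP z) (flipP w) x := by
  obtain ⟨Q, p⟩ := x
  simp only [flipP]
  rw [wig_apply, wig_apply]
  have h1 : gE d 1 (-p - (1 / 2 : ℝ) • (w.2 + z.2)) = gE d 1 (p - (1 / 2 : ℝ) • (-z.2 + -w.2)) := by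
    rw [gE_apply, gE_apply, ← norm_neg]
    congr 6
    module
  simp only [h1, add_comm z.1 w.1]
  congr 4
  have h2 : (1 / 2 : ℝ) • (-z.2 + -w.2) = -((1 / 2 : ℝ) • (w.2 + z.2)) := by module
  have h3 : -z.2 - -w.2 = w.2 - z.2 := by abel
  have h4 : z.1 - w.1 = -(w.1 - z.1) := by abel
  rw [h2, h3, h4, inner_neg_neg, inner_neg_left, inner_neg_right]

theorem symb_transK (A : Phase d → Phase d → ℂ) : symb (transK A) = flipSym (symb A) := by
  ext x
  have hm : MeasurePreserving (fun p : Phase d × Phase d => (flipP p.2, flipP p.1)) :=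
    (measurePreserving_flipP.prod measurePreserving_flipP).comp Measure.measurePreserving_swap
  have hf : ∀ z : Phase d, flipP (flipP z) = z := fun z => by simp [flipP]
  have hi : Function.Involutive (fun p : Phase d × Phase d => (flipP p.2, flipP p.1)) :=
    fun p => by simp [hf]
  have he : MeasurableEmbedding (fun p : Phase d × Phase d => (flipP p.2, flipP p.1)) :=
    (MeasurableEquiv.ofInvolutive _ hi hm.measurable).measurableEmbedding
  rw [symb, ← hm.integral_comp he, flipSym, symb]
  simp only [transK, hf]
  congr 1
  ext p
  rw [← wig_flipP]
  rfl

theorem weylS_flipSym {f : Phase d → ℂ} (hf : IsSymbol f) (ħ : ℝ) :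
    weylS ħ (flipSym f) = opS _ (offDiag_symKer (hf.dilSym ħ)).transK :=
  weylS_of_apply fun ψ q => by
    rw [weylFun_eq_dilSym, flipSym_dilSym, ← weylFun_symb, symb_transK]
    congr 1
    ext x
    simp only [flipSym, symb_symKer (hf.dilSym ħ)]

theorem integral_weylS_mul {f : Phase d → ℂ} (hf : IsSymbol f) (ħ : ℝ) (φ ψ : 𝓢(Config d, ℂ)) :
    ∫ q, weylS ħ f φ q * ψ q = ∫ q, φ q * weylS ħ (flipSym f) ψ q := by
  rw [weylS_flipSym hf, weylS_eq_opS hf, integral_opS_mul]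

/-- The conjugate of the difference is itself an admissible test function. -/
theorem schwartz_ext_of_integral {χ₁ χ₂ : 𝓢(Config d, ℂ)}
    (h : ∀ φ : 𝓢(Config d, ℂ), ∫ q, φ q * χ₁ q = ∫ q, φ q * χ₂ q) : χ₁ = χ₂ := by
  rw [← sub_eq_zero]
  set χ := χ₁ - χ₂ with hχ
  have h1 : ∫ q, starRingEnd ℂ (χ q) * χ q = 0 := by
    have h2 := h χ.isSchw.conj.toSchwartz
    have hi : ∀ η : 𝓢(Config d, ℂ), Integrable fun q => starRingEnd ℂ (χ q) * η q := by
      intro η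
      obtain ⟨C, hC⟩ := χ.isSchw.conj.bounded 0
      exact η.integrable.bdd_mul χ.isSchw.conj.1.continuous.aestronglyMeasurable
        (Filter.Eventually.of_forall fun q => by simpa using hC q)
    have h3 : (fun q => starRingEnd ℂ (χ q) * χ q) = fun q =>
        starRingEnd ℂ (χ q) * χ₁ q - starRingEnd ℂ (χ q) * χ₂ q := by
      ext q
      rw [← mul_sub]
      rfl
    rw [h3, integral_sub (hi _) (hi _), sub_eq_zero]
    exact h2
  rw [integral_conj_mul_self] at h1
  have h2 : ‖χ.toLp 2‖ ^ 2 = 0 := by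
    rw [norm_toLp_sq]
    exact_mod_cast h1
  have h3 : χ.toLp 2 = (0 : 𝓢(Config d, ℂ)).toLp 2 := by
    rw [pow_eq_zero_iff two_ne_zero, norm_eq_zero] at h2
    rw [h2]
    exact ((SchwartzMap.toLpCLM ℂ ℂ 2 (volume : Measure (Config d))).map_zero).symm
  exact SchwartzMap.injective_toLp 2 volume h3

/-- Transposition reverses products; each factor is moved across the pairing in turn. -/
theorem weylS_flipSym_moyal {ħ : ℝ} (hħ : ħ ≠ 0) {f g : Phase d → ℂ} (hf : IsSymbol f)
    (hg : IsSymbol g) : weylS ħ (flipSym (moyal ħ f g)) =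
      (weylS ħ (flipSym g)).comp (weylS ħ (flipSym f)) := by
  obtain ⟨h1, h2⟩ := moyal_spec hħ hf hg
  ext1 ψ
  refine schwartz_ext_of_integral fun φ => ?_
  rw [← integral_weylS_mul h1, ← h2, ContinuousLinearMap.comp_apply,
    ContinuousLinearMap.comp_apply, integral_weylS_mul hf, integral_weylS_mul hg]

end Transpose

/-! ### Lattice translations and invariance of the torus space -/

section Covariance

variable {d : ℕ}

/-- Shift `p` by `ħ⁻¹ b` and `q'` by `a`: the argument of the symbol moves by exactly `ξ`, under
which it is invariant, and the phases recombine. -/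
theorem weylFun_heisS {ħ : ℝ} (hħ : ħ ≠ 0) {F : Phase d → ℂ} {ξ : Phase d}
    (hF : ∀ x, F (x + ξ) = F x) (ψ : 𝓢(Config d, ℂ)) (q : Config d) :
    weylFun ħ F (heisS ħ ξ ψ) q = weylFun ħ F ψ (q - ξ.1) * heisPhase ħ ξ q := by
  obtain ⟨a, b⟩ := ξ
  simp only [weylFun]
  rw [mul_assoc]
  congr 1
  rw [← integral_mul_const, ← integral_add_right_eq_self _ (ħ⁻¹ • b)]
  congr 1
  ext p
  rw [← integral_mul_const, ← integral_add_right_eq_self _ a]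
  congr 1
  ext y
  have h1 : F ((1 / 2 : ℝ) • (q + (y + a)), ħ • (p + ħ⁻¹ • b)) =
      F ((1 / 2 : ℝ) • (q - a + y), ħ • p) := by
    rw [← hF ((1 / 2 : ℝ) • (q - a + y), ħ • p)]
    congr 1
    ext1
    · simp only [Prod.fst_add]; module
    · simp only [Prod.snd_add, smul_add, smul_smul, mul_inv_cancel₀ hħ, one_smul]
  rw [h1, heisS_apply]
  simp only [add_sub_cancel_right]
  have h2 : cexp (I * ((⟪q - (y + a), p + ħ⁻¹ • b⟫_ℝ : ℝ) : ℂ)) *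
      cexp (I * (((⟪b, y + a⟫_ℝ - ⟪a, b⟫_ℝ / 2) / ħ : ℝ) : ℂ)) =
      cexp (I * ((⟪q - a - y, p⟫_ℝ : ℝ) : ℂ)) * heisPhase ħ (a, b) q := by
    rw [heisPhase, ← Complex.exp_add, ← Complex.exp_add, ← mul_add, ← mul_add,
      ← Complex.ofReal_add, ← Complex.ofReal_add]
    congr 3
    simp only [inner_add_right, inner_add_left, inner_sub_left, real_inner_smul_right]
    rw [real_inner_comm b q, real_inner_comm b y, real_inner_comm b a]
    field_simp
    ring
  linear_combination (F ((1 / 2 : ℝ) • (q - a + y), ħ • p) * ψ y) * h2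

theorem weylS_heisS {ħ : ℝ} (hħ : ħ ≠ 0) {F : Phase d → ℂ} (hFs : IsSymbol F) {ξ : Phase d}
    (hF : ∀ x, F (x + ξ) = F x) (ψ : 𝓢(Config d, ℂ)) :
    weylS ħ F (heisS ħ ξ ψ) = heisS ħ ξ (weylS ħ F ψ) := by
  ext q
  rw [weylS_apply hFs, weylFun_heisS hħ hF, heisS_apply, weylS_apply hFs]
  rfl

theorem intVec_neg (n : Fin d → ℤ) : intVec (-n) = -intVec n := by
  ext i
  simp [intVec]

theorem weylS'_apply (ħ : ℝ) (f : Phase d → ℂ) (u : 𝓢'(Config d, ℂ)) (ψ : 𝓢(Config d, ℂ)) :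
    weylS' ħ f u ψ = u (weylS ħ (flipSym f) ψ) := rfl

theorem heisS'_apply (ħ : ℝ) (ξ : Phase d) (u : 𝓢'(Config d, ℂ)) (ψ : 𝓢(Config d, ℂ)) :
    heisS' ħ ξ u ψ = u (heisS ħ (-ξ.1, ξ.2) ψ) := rfl

theorem IsTorusSymbol.isSymbol {f : Phase d → ℂ} (hf : IsTorusSymbol f) : IsSymbol f :=
  isSymbol_iff_bddD.2 hf.bddD

/-- The reflected symbol is again periodic, so its quantization commutes with the transposed lattice
translations on `𝓢`; duality carries this to `𝓢'`. -/
theorem weylS'_mem_torusSpace {ħ : ℝ} (hħ : ħ ≠ 0) {κ : Phase d} {f : Phase d → ℂ}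
    (hf : IsTorusSymbol f) {u : 𝓢'(Config d, ℂ)} (hu : u ∈ torusSpace ħ κ) :
    weylS' ħ f u ∈ torusSpace ħ κ := by
  rw [mem_torusSpace] at hu ⊢
  intro a b
  ext ψ
  have hF : ∀ x, flipSym f (x + (-intVec a, intVec b)) = flipSym f x := fun x => by
    rw [flipSym, flipSym, ← hf.2 (x.1, -x.2) (-a) (-b), intVec_neg, intVec_neg]
    congr 1
    ext1
    · rfl
    · simp only [Prod.snd_add, neg_add]
  have h := DFunLike.congr_fun (hu a b) (weylS ħ (flipSym f) ψ)
  rw [heisS'_apply, weylS'_apply, weylS_heisS hħ hf.isSymbol.flipSym hF]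
  exact h

/-- The symbols whose Weyl quantization preserves the space of the torus. -/
def TorusPreserving (ħ : ℝ) (κ : Phase d) (f : Phase d → ℂ) : Prop :=
  IsSymbol f ∧ ∀ u ∈ torusSpace ħ κ, weylS' ħ f u ∈ torusSpace ħ κ

variable {ħ : ℝ} {κ : Phase d}

theorem IsTorusSymbol.torusPreserving (hħ : ħ ≠ 0) {f : Phase d → ℂ} (hf : IsTorusSymbol f) :
    TorusPreserving ħ κ f :=
  ⟨hf.isSymbol, fun _ hu => weylS'_mem_torusSpace hħ hf hu⟩

theorem TorusPreserving.weylTorus_apply {f : Phase d → ℂ} (hf : TorusPreserving ħ κ f)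
    (u : torusSpace ħ κ) : (weylTorus ħ κ f u : 𝓢'(Config d, ℂ)) = weylS' ħ f u := by
  have h : ∀ u : torusSpace ħ κ, weylS' ħ f u ∈ torusSpace ħ κ := fun u => hf.2 u u.2
  rw [weylTorus, dif_pos h]
  rfl

theorem weylS'_add_smul {f g : Phase d → ℂ} (hf : IsSymbol f) (hg : IsSymbol g) (c : ℂ)
    (u : 𝓢'(Config d, ℂ)) : weylS' ħ (f + c • g) u = weylS' ħ f u + c • weylS' ħ g u := by
  ext ψ
  have h : flipSym (f + c • g) = flipSym f + c • flipSym g := rfl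
  rw [weylS'_apply, h, weylS_add_smul hf.flipSym hg.flipSym]
  exact (u.map_add _ _).trans (congrArg _ (u.map_smul _ _))

theorem weylS'_moyal (hħ : ħ ≠ 0) {f g : Phase d → ℂ} (hf : IsSymbol f) (hg : IsSymbol g)
    (u : 𝓢'(Config d, ℂ)) : weylS' ħ (moyal ħ f g) u = weylS' ħ f (weylS' ħ g u) := by
  ext ψ
  rw [weylS'_apply, weylS_flipSym_moyal hħ hf hg]
  rfl

theorem TorusPreserving.add_smul {f g : Phase d → ℂ} (hf : TorusPreserving ħ κ f)
    (hg : TorusPreserving ħ κ g) (c : ℂ) : TorusPreserving ħ κ (f + c • g) :=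
  ⟨hf.1.add (hg.1.smul c), fun u hu => by
    rw [weylS'_add_smul hf.1 hg.1]
    exact Submodule.add_mem _ (hf.2 u hu) (Submodule.smul_mem _ c (hg.2 u hu))⟩

/-- Invariance passes to the Moyal product because it is quantized by the operator product. Working
with this class in place of periodic symbols avoids having to prove that the product is periodic. -/
theorem TorusPreserving.moyal (hħ : ħ ≠ 0) {f g : Phase d → ℂ} (hf : TorusPreserving ħ κ f)
    (hg : TorusPreserving ħ κ g) : TorusPreserving ħ κ (moyal ħ f g) :=
  ⟨(moyal_spec hħ hf.1 hg.1).1, fun u hu => by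
    rw [weylS'_moyal hħ hf.1 hg.1]
    exact hf.2 _ (hg.2 u hu)⟩

theorem weylTorus_add_smul {f g : Phase d → ℂ} (hf : TorusPreserving ħ κ f)
    (hg : TorusPreserving ħ κ g) (c : ℂ) :
    weylTorus ħ κ (f + c • g) = weylTorus ħ κ f + c • weylTorus ħ κ g := by
  ext1 u
  apply Subtype.ext
  rw [(hf.add_smul hg c).weylTorus_apply, weylS'_add_smul hf.1 hg.1, ← hf.weylTorus_apply,
    ← hg.weylTorus_apply]
  rfl

theorem weylTorus_moyal (hħ : ħ ≠ 0) {f g : Phase d → ℂ} (hf : TorusPreserving ħ κ f)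
    (hg : TorusPreserving ħ κ g) :
    weylTorus ħ κ (moyal ħ f g) = weylTorus ħ κ f ∘L weylTorus ħ κ g := by
  ext1 u
  apply Subtype.ext
  rw [(hf.moyal hħ hg).weylTorus_apply, weylS'_moyal hħ hf.1 hg.1, ContinuousLinearMap.comp_apply,
    hf.weylTorus_apply, hg.weylTorus_apply]

theorem temperedDistribution_bound (u : 𝓢'(Config d, ℂ)) :
    ∃ (C : ℝ) (n N : ℕ), 0 ≤ C ∧ ∀ ψ : 𝓢(Config d, ℂ), ‖u ψ‖ ≤ C * schwSup n N ψ := by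
  let l : 𝓢(Config d, ℂ) →ₗ[ℂ] ℂ :=
    { toFun := fun ψ => u ψ, map_add' := u.map_add, map_smul' := u.map_smul }
  have hl : ∀ ψ, l ψ = u ψ := fun ψ => rfl
  have hc : Continuous l := u.continuous
  clear_value l
  obtain ⟨s, C, -, hC⟩ := Seminorm.bound_of_continuous (schwartz_withSeminorms ℂ (Config d) ℂ)
    ((normSeminorm ℂ ℂ).comp l) (continuous_norm.comp hc)
  refine ⟨C, s.sup Prod.snd, s.sup Prod.fst, C.2, fun ψ => ?_⟩
  have h1 : ‖l ψ‖ ≤ C * (s.sup (schwartzSeminormFamily ℂ (Config d) ℂ)) ψ := hC ψ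
  rw [← hl]
  refine h1.trans (mul_le_mul_of_nonneg_left ?_ C.2)
  have h2 : s ⊆ Finset.Iic (s.sup Prod.fst, s.sup Prod.snd) := fun m hm =>
    mem_Iic.2 ⟨le_sup (f := Prod.fst) hm, le_sup (f := Prod.snd) hm⟩
  have h3 : s.sup (schwartzSeminormFamily ℂ (Config d) ℂ) ≤
    (Finset.Iic (s.sup Prod.fst, s.sup Prod.snd)).sup (schwartzSeminormFamily ℂ (Config d) ℂ) :=
    Finset.sup_mono h2
  exact h3 ψ

theorem continuousSMul_temperedDistribution : ContinuousSMul ℂ 𝓢'(Config d, ℂ) :=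
  UniformConvergenceCLM.continuousSMul _ _ _ fun _ hS =>
    Set.Finite.isVonNBounded hS

theorem continuousSMul_torusSpace : ContinuousSMul ℂ (torusSpace ħ κ) :=
  have := continuousSMul_temperedDistribution (d := d)
  inferInstance

end Covariance

/-! ### Tempered distributions as functionals of the coherent state transform -/

section CoherentExpansion

variable {d : ℕ}

/-- A coherent state as a Schwartz function. -/
def cohS (z : Phase d) : 𝓢(Config d, ℂ) := (isSchw_coh z).toSchwartz

theorem cohS_apply (z : Phase d) (q : Config d) : cohS z q = coh z q := rfl

theorem anal_cohS (y z : Phase d) : anal (cohS z) y = gram y z := rfl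

theorem act_gram_anal (ψ : 𝓢(Config d, ℂ)) (w : Phase d) :
    act gram (anal ψ) w = (kap d : ℂ) * anal ψ w := by
  have h : synth (anal ψ) = ((kap d : ℂ) • ψ : 𝓢(Config d, ℂ)) := by
    ext q
    rw [synth_anal]
    rfl
  rw [← anal_synth (rapid_anal ψ), h, anal_smul]
  rfl

theorem Rapid.mul_pow {F : Phase d → ℂ} (hF : Rapid F) (M : ℕ) :
    Rapid fun z => (((1 + ‖z‖) ^ M : ℝ) : ℂ) * F z where
  meas := (by fun_prop : Continuous fun z : Phase d =>
    (((1 + ‖z‖) ^ M : ℝ) : ℂ)).measurable.mul hF.meas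
  decay N := by
    obtain ⟨C, h0, hC⟩ := hF.decay (N + M)
    refine ⟨C, h0, fun z => ?_⟩
    rw [norm_mul, Complex.norm_real, Real.norm_of_nonneg (by positivity)]
    calc _ ≤ (1 + ‖z‖) ^ M * (C * jd (N + M) z) := by
          gcongr
          exact hC z
      _ = C * jd N z := by rw [← one_add_pow_mul_jd M N z]; ring

theorem Rapid.memLp_two {F : Phase d → ℂ} (hF : Rapid F) : MemLp F 2 :=
  (memLp_two_iff_integrable_sq_norm hF.meas.aestronglyMeasurable).2 hF.integrable_sq

/-- The coherent state transform with a weight, as a map to `L²`. -/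
def wAnal (d M : ℕ) : 𝓢(Config d, ℂ) →ₗ[ℂ] Lp ℂ 2 (volume : Measure (Phase d)) where
  toFun ψ := ((rapid_anal ψ).mul_pow M).memLp_two.toLp _
  map_add' ψ χ := by
    rw [← MemLp.toLp_add]
    congr 1
    ext z
    rw [anal_add]
    simp only [Pi.add_apply]
    ring
  map_smul' c ψ := by
    rw [RingHom.id_apply, ← MemLp.toLp_const_smul]
    congr 1
    ext z
    rw [anal_smul]
    simp only [Pi.smul_apply, smul_eq_mul]
    ring

theorem coeFn_wAnal (M : ℕ) (ψ : 𝓢(Config d, ℂ)) :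
    wAnal d M ψ =ᵐ[volume] fun z => (((1 + ‖z‖) ^ M : ℝ) : ℂ) * anal ψ z :=
  MemLp.coeFn_toLp ((rapid_anal ψ).mul_pow M).memLp_two

theorem memLp_jd : MemLp (fun z : Phase d => ((jd (bigN d) z : ℝ) : ℂ)) 2 := by
  refine (memLp_two_iff_integrable_sq_norm (Complex.continuous_ofReal.comp
    (continuous_jd _)).aestronglyMeasurable).2 ?_
  refine integrable_jd_phase.mono' (by
    have := continuous_jd (V := Phase d) (bigN d)
    fun_prop) (Filter.Eventually.of_forall fun z => ?_)
  have h0 := jd_nonneg (bigN d) z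
  rw [Function.comp_apply, Complex.norm_real, Real.norm_of_nonneg h0,
    Real.norm_of_nonneg (sq_nonneg _), sq]
  exact mul_le_of_le_one_left h0 (jd_le_one _ _)

theorem memLp_jd_sub (w : Phase d) :
    ∃ h : MemLp (fun z : Phase d => ((jd (bigN d) (w - z) : ℝ) : ℂ)) 2,
      ‖h.toLp _‖ = ‖memLp_jd.toLp (fun z : Phase d => ((jd (bigN d) z : ℝ) : ℂ))‖ := by
  have hmp : MeasurePreserving (fun z : Phase d => w - z) :=
    (Measure.measurePreserving_sub_left volume w.1).prod (Measure.measurePreserving_sub_left volume w.2)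
  refine ⟨memLp_jd.comp_measurePreserving hmp, ?_⟩
  rw [Lp.norm_toLp, Lp.norm_toLp]
  congr 1
  exact eLpNorm_comp_measurePreserving (p := 2)
    (g := fun z : Phase d => ((jd (bigN d) z : ℝ) : ℂ)) memLp_jd.1 hmp

theorem norm_toLp_eq_rpow {f : Phase d → ℂ} (hf : MemLp f 2) :
    ‖hf.toLp f‖ = (∫ z, ‖f z‖ ^ (2 : ℝ)) ^ ((1 : ℝ) / 2) := by
  rw [Lp.norm_toLp, hf.eLpNorm_eq_integral_rpow_norm (by norm_num) (by norm_num),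
    ENNReal.toReal_ofReal (by positivity)]
  norm_num

theorem integral_mul_norm_le_toLp {f g : Phase d → ℂ} (hf : MemLp f 2) (hg : MemLp g 2) :
    ∫ z, ‖f z‖ * ‖g z‖ ≤ ‖hf.toLp f‖ * ‖hg.toLp g‖ := by
  rw [norm_toLp_eq_rpow, norm_toLp_eq_rpow]
  exact integral_mul_norm_le_Lp_mul_Lq Real.HolderConjugate.two_two (by simpa using hf)
    (by simpa using hg)

/-- The transform reproduces itself under the Gram kernel up to the factor `kap d`. Peetre's
inequality shares the weight between `w` and `z`, and Cauchy–Schwarz turns the weighted `L²` norm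
into a pointwise bound. -/
theorem anal_le_norm_wAnal (d M : ℕ) : ∃ C, 0 ≤ C ∧ ∀ (ψ : 𝓢(Config d, ℂ)) (w : Phase d),
    ‖anal ψ w‖ ≤ C * ‖wAnal d M ψ‖ * jd M w := by
  obtain ⟨C, h0, hC⟩ := (offDiag_gram (d := d)).decay (bigN d + M)
  have hk := kap_pos d
  refine ⟨(kap d)⁻¹ * (C * ‖memLp_jd.toLp (fun z : Phase d => ((jd (bigN d) z : ℝ) : ℂ))‖),
    by positivity, fun ψ w => ?_⟩
  obtain ⟨hmem, hnorm⟩ := memLp_jd_sub w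
  have hpt : ∀ z, ‖gram w z * anal ψ z‖ ≤ C * jd M w *
      (jd (bigN d) (w - z) * ‖(((1 + ‖z‖) ^ M : ℝ) : ℂ) * anal ψ z‖) := by
    intro z
    have h1 : jd M (w - z) ≤ jd M w * (1 + ‖z‖) ^ M := by
      have h2 : jd M (w - z) * jd M z ≤ jd M w := by
        have := jd_mul_le M (w - z) z
        rwa [sub_add_cancel] at this
      calc jd M (w - z) = jd M (w - z) * jd M z * (1 + ‖z‖) ^ M := by
            rw [mul_assoc, mul_comm (jd M z), pow_mul_jd, mul_one]
        _ ≤ _ := by gcongr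
    rw [norm_mul, norm_mul, Complex.norm_real, Real.norm_of_nonneg (by positivity)]
    have h3 := jd_nonneg (bigN d) (w - z)
    calc ‖gram w z‖ * ‖anal ψ z‖ ≤ C * jd (bigN d + M) (w - z) * ‖anal ψ z‖ := by
          gcongr
          exact hC w z
      _ = C * jd (bigN d) (w - z) * jd M (w - z) * ‖anal ψ z‖ := by rw [jd_add_exp]; ring
      _ ≤ C * jd (bigN d) (w - z) * (jd M w * (1 + ‖z‖) ^ M) * ‖anal ψ z‖ := by gcongr
      _ = _ := by ring
  have hr := ((rapid_anal ψ).mul_pow M)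
  have hcs : ∫ z, jd (bigN d) (w - z) * ‖(((1 + ‖z‖) ^ M : ℝ) : ℂ) * anal ψ z‖ ≤
      ‖hmem.toLp _‖ * ‖wAnal d M ψ‖ := by
    refine le_trans (le_of_eq ?_) (integral_mul_norm_le_toLp hmem hr.memLp_two)
    congr 1
    ext z
    rw [Complex.norm_real, Real.norm_of_nonneg (jd_nonneg _ _)]
  have hi : Integrable fun z => jd (bigN d) (w - z) * ‖(((1 + ‖z‖) ^ M : ℝ) : ℂ) * anal ψ z‖ := by
    refine hr.integrable.norm.bdd_mul (c := 1) ?_ (Filter.Eventually.of_forall fun z => ?_)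
    · exact ((continuous_jd _).comp (by fun_prop : Continuous fun z : Phase d =>
        w - z)).aestronglyMeasurable
    · rw [Real.norm_of_nonneg (jd_nonneg _ _)]
      exact jd_le_one _ _
  have h1 : kap d * ‖anal ψ w‖ ≤ C * jd M w * (‖hmem.toLp _‖ * ‖wAnal d M ψ‖) := by
    have h2 : ‖act gram (anal ψ) w‖ = kap d * ‖anal ψ w‖ := by
      rw [act_gram_anal, norm_mul, Complex.norm_real, Real.norm_of_nonneg hk.le]
    rw [← h2]
    refine (norm_integral_le_of_norm_le (hi.const_mul _) (Filter.Eventually.of_forall hpt)).trans ?_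
    rw [integral_const_mul]
    exact mul_le_mul_of_nonneg_left hcs (mul_nonneg h0 (jd_nonneg _ _))
  rw [← hnorm]
  calc ‖anal ψ w‖ = (kap d)⁻¹ * (kap d * ‖anal ψ w‖) := by field_simp
    _ ≤ (kap d)⁻¹ * (C * jd M w * (‖hmem.toLp _‖ * ‖wAnal d M ψ‖)) := by gcongr
    _ = _ := by ring

/-- Seminorms of `ψ` are read off from its resynthesis, whose derivatives are controlled by
pointwise decay of the transform, hence by weighted `L²` norms. -/
theorem schwSup_le_norm_wAnal (d n N : ℕ) : ∃ (C : ℝ) (M : ℕ), 0 ≤ C ∧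
    ∀ ψ : 𝓢(Config d, ℂ), schwSup n N ψ ≤ C * ‖wAnal d M ψ‖ := by
  choose C M h0 hC using fun k : ℕ => synth_bound d k N
  set M' := (range (n + 1)).sup M with hM'
  obtain ⟨D, hD0, hD⟩ := anal_le_norm_wAnal d M'
  have hk := kap_pos d
  refine ⟨(kap d)⁻¹ * ((∑ k ∈ range (n + 1), C k) * D), M',
    mul_nonneg (inv_nonneg.2 hk.le) (mul_nonneg (sum_nonneg fun k _ => h0 k) hD0), fun ψ => ?_⟩
  have hb : 0 ≤ D * ‖wAnal d M' ψ‖ := by positivity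
  refine Seminorm.finset_sup_apply_le (mul_nonneg (mul_nonneg (inv_nonneg.2 hk.le)
    (mul_nonneg (sum_nonneg fun k _ => h0 k) hD0)) (norm_nonneg _)) fun m hm => ?_
  obtain ⟨hm1, hm2⟩ := Prod.mk_le_mk.1 (mem_Iic.1 hm)
  refine SchwartzMap.seminorm_le_bound ℂ _ _ _ (mul_nonneg (mul_nonneg (inv_nonneg.2 hk.le)
    (mul_nonneg (sum_nonneg fun k _ => h0 k) hD0)) (norm_nonneg _)) fun x => ?_
  have hmr : m.2 ∈ range (n + 1) := mem_range.2 (by omega)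
  have h1 := hC m.2 (anal ψ) _ hb (rapid_anal ψ) (fun z => (hD ψ z).trans
    (mul_le_mul_of_nonneg_left (jd_anti (le_sup (f := M) hmr) z) hb)) x
  have h2 : synth (anal ψ) = (kap d : ℂ) • (ψ : Config d → ℂ) := by
    ext q
    rw [synth_anal]
    rfl
  rw [h2, iteratedFDeriv_const_smul_apply (ψ.smooth _).contDiffAt, norm_smul, Complex.norm_real,
    Real.norm_of_nonneg hk.le, le_jd_iff] at h1
  have h3 : ‖x‖ ^ m.1 ≤ (1 + ‖x‖) ^ N :=
    (pow_le_pow_left₀ (norm_nonneg x) (by linarith [norm_nonneg x]) _).trans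
      (pow_le_pow_right₀ (by linarith [norm_nonneg x]) hm1)
  calc ‖x‖ ^ m.1 * ‖iteratedFDeriv ℝ m.2 ψ x‖
      ≤ (1 + ‖x‖) ^ N * ‖iteratedFDeriv ℝ m.2 ψ x‖ := by gcongr
    _ = (kap d)⁻¹ * ((1 + ‖x‖) ^ N * (kap d * ‖iteratedFDeriv ℝ m.2 ψ x‖)) := by field_simp
    _ ≤ (kap d)⁻¹ * (C m.2 * (D * ‖wAnal d M' ψ‖)) := by gcongr
    _ ≤ (kap d)⁻¹ * ((∑ k ∈ range (n + 1), C k) * (D * ‖wAnal d M' ψ‖)) := by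
        gcongr
        exact single_le_sum (fun k _ => h0 k) hmr
    _ = _ := by ring

/-- Continuity of `u` bounds it by a weighted `L²` norm of the transform, so it factors through a
bounded functional on the range of `wAnal`. Hahn–Banach extends this functional to `L²`, and Riesz
represents it. -/
theorem exists_riesz (u : 𝓢'(Config d, ℂ)) : ∃ (M : ℕ) (k : Lp ℂ 2 (volume : Measure (Phase d))),
    ∀ ψ : 𝓢(Config d, ℂ), u ψ =
      ∫ z, starRingEnd ℂ (k z) * ((((1 + ‖z‖) ^ M : ℝ) : ℂ) * anal ψ z) := by
  obtain ⟨C, n, N, h0, hC⟩ := temperedDistribution_bound u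
  obtain ⟨D, M, hD0, hD⟩ := schwSup_le_norm_wAnal d n N
  let l : 𝓢(Config d, ℂ) →ₗ[ℂ] ℂ :=
    { toFun := fun ψ => u ψ, map_add' := u.map_add, map_smul' := u.map_smul }
  have hl : ∀ ψ, l ψ = u ψ := fun ψ => rfl
  clear_value l
  have hb : ∃ C, ∀ ψ, ‖l ψ‖ ≤ C * ‖wAnal d M ψ‖ := ⟨C * D, fun ψ => by
    rw [hl, mul_assoc]
    exact (hC ψ).trans (mul_le_mul_of_nonneg_left (hD ψ) h0)⟩
  obtain ⟨g, hg, -⟩ := exists_extension_norm_eq (LinearMap.range (wAnal d M))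
    (l.compLeftInverse (wAnal d M))
  refine ⟨M, (InnerProductSpace.toDual ℂ _).symm g, fun ψ => ?_⟩
  have h1 := hg ⟨wAnal d M ψ, ψ, rfl⟩
  rw [LinearMap.compLeftInverse_apply_of_bdd _ _ hb ψ _ rfl, hl] at h1
  rw [← h1, ← InnerProductSpace.toDual_symm_apply, L2.inner_def]
  refine integral_congr_ae ?_
  filter_upwards [coeFn_wAnal M ψ] with z hz
  rw [hz, RCLike.inner_apply, mul_comm]

end CoherentExpansion

/-! ### Finitely many coherent states determine an element of the torus space -/

section FiniteDetermination

variable {d : ℕ}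

/-- The resolution of the identity by coherent states, for tempered distributions. -/
theorem reproducing_formula (u : 𝓢'(Config d, ℂ)) (ψ : 𝓢(Config d, ℂ)) :
    (kap d : ℂ) * u ψ = ∫ z, anal ψ z * u (cohS z) := by
  obtain ⟨M, k, hk⟩ := exists_riesz u
  have hr := (rapid_anal ψ).mul_pow M
  have hkm : Measurable (k : Phase d → ℂ) := (Lp.stronglyMeasurable k).measurable
  have hk2 : Integrable fun z => ‖k z‖ ^ 2 :=
    (memLp_two_iff_integrable_sq_norm hkm.aestronglyMeasurable).1 (Lp.memLp k)
  -- Peetre's inequality trades the weight in `y` for a weight in `z` on the rapidly decreasing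
  -- transform; then `ab ≤ a² + b²` separates the two square integrable factors.
  have hi : Integrable (Function.uncurry fun y z : Phase d =>
      starRingEnd ℂ (k y) * ((((1 + ‖y‖) ^ M : ℝ) : ℂ) * (gram y z * anal ψ z)))
      (volume.prod volume) := by
    obtain ⟨C, h0, hC⟩ := (offDiag_gram (d := d)).decay (bigN d + M)
    have h1 := ((integrable_jd_sub_mul' hk2).add (integrable_jd_sub_mul hr.integrable_sq)).const_mul C
    refine h1.mono' ?_ (Filter.Eventually.of_forall fun p => ?_)
    · have m1 : Measurable fun p : Phase d × Phase d => starRingEnd ℂ (k p.1) :=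
        Complex.continuous_conj.measurable.comp (hkm.comp measurable_fst)
      have m2 : Measurable fun p : Phase d × Phase d => (((1 + ‖p.1‖) ^ M : ℝ) : ℂ) :=
        (by fun_prop : Continuous fun p : Phase d × Phase d =>
          (((1 + ‖p.1‖) ^ M : ℝ) : ℂ)).measurable
      exact (m1.mul (m2.mul (offDiag_gram.measurable_mul (rapid_anal ψ).meas))).aestronglyMeasurable
    · obtain ⟨y, z⟩ := p
      have h2 : jd M (y - z) ≤ jd M y * (1 + ‖z‖) ^ M := by
        have h2 : jd M (y - z) * jd M z ≤ jd M y := by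
          have := jd_mul_le M (y - z) z
          rwa [sub_add_cancel] at this
        calc jd M (y - z) = jd M (y - z) * jd M z * (1 + ‖z‖) ^ M := by
              rw [mul_assoc, mul_comm (jd M z), pow_mul_jd, mul_one]
          _ ≤ _ := by gcongr
      have h3 := jd_nonneg (bigN d) (y - z)
      simp only [Function.uncurry, Pi.add_apply, norm_mul, RCLike.norm_conj, Complex.norm_real,
        norm_pow]
      rw [Real.norm_of_nonneg (by positivity : (0 : ℝ) ≤ 1 + ‖y‖),
        Real.norm_of_nonneg (by positivity : (0 : ℝ) ≤ 1 + ‖z‖)]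
      set a := ‖k y‖
      set b := (1 + ‖z‖) ^ M * ‖anal ψ z‖ with hb
      have hab : a * b ≤ a ^ 2 + b ^ 2 := by nlinarith [sq_nonneg (a - b), sq_nonneg a, sq_nonneg b]
      calc a * ((1 + ‖y‖) ^ M * (‖gram y z‖ * ‖anal ψ z‖))
          ≤ a * ((1 + ‖y‖) ^ M * ((C * jd (bigN d + M) (y - z)) * ‖anal ψ z‖)) := by
            gcongr
            exact hC y z
        _ = a * ((1 + ‖y‖) ^ M * ((C * (jd (bigN d) (y - z) * jd M (y - z))) * ‖anal ψ z‖)) := by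
            rw [jd_add_exp]
        _ ≤ a * ((1 + ‖y‖) ^ M * ((C * (jd (bigN d) (y - z) * (jd M y * (1 + ‖z‖) ^ M))) *
              ‖anal ψ z‖)) := by gcongr
        _ = C * jd (bigN d) (y - z) * ((1 + ‖y‖) ^ M * jd M y) * (a * b) := by rw [hb]; ring
        _ = C * jd (bigN d) (y - z) * (a * b) := by rw [pow_mul_jd, mul_one]
        _ ≤ C * jd (bigN d) (y - z) * (a ^ 2 + b ^ 2) := by gcongr
        _ = _ := by ring
  have h1 : ∀ z, anal ψ z * u (cohS z) = ∫ y,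
      starRingEnd ℂ (k y) * ((((1 + ‖y‖) ^ M : ℝ) : ℂ) * (gram y z * anal ψ z)) := by
    intro z
    rw [hk, ← integral_const_mul]
    congr 1
    ext y
    rw [anal_cohS]
    ring
  simp only [h1]
  rw [← integral_integral_swap hi]
  simp only [integral_const_mul]
  rw [hk, ← integral_const_mul]
  congr 1
  ext y
  have := act_gram_anal ψ y
  rw [act] at this
  rw [this]
  ring

theorem heisS_cohS {ħ : ℝ} (hħ : ħ ≠ 0) (ξ z : Phase d) : ∃ θ : ℂ, ‖θ‖ = 1 ∧
    heisS ħ ξ (cohS z) = θ • cohS (z + (ξ.1, ħ⁻¹ • ξ.2)) := by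
  refine ⟨cexp (((-⟪z.2, ξ.1⟫_ℝ - ⟪ξ.1, ξ.2⟫_ℝ / 2 / ħ : ℝ) : ℂ) * I),
    Complex.norm_exp_ofReal_mul_I _, ?_⟩
  ext q
  rw [heisS_apply, smul_apply, cohS_apply, cohS_apply, coh, coh, smul_eq_mul]
  have h1 : q - ξ.1 - z.1 = q - (z + (ξ.1, ħ⁻¹ • ξ.2)).1 := by
    simp only [Prod.fst_add]
    abel
  have h2 : chi (innerSL ℝ z.2) (q - ξ.1) *
      cexp (I * (((⟪ξ.2, q⟫_ℝ - ⟪ξ.1, ξ.2⟫_ℝ / 2) / ħ : ℝ) : ℂ)) =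
      cexp (((-⟪z.2, ξ.1⟫_ℝ - ⟪ξ.1, ξ.2⟫_ℝ / 2 / ħ : ℝ) : ℂ) * I) *
        chi (innerSL ℝ (z + (ξ.1, ħ⁻¹ • ξ.2)).2) q := by
    rw [chi, chi, innerSL_apply_apply, innerSL_apply_apply, mul_comm _ I, ← Complex.exp_add,
      ← Complex.exp_add, ← mul_add, ← mul_add, ← Complex.ofReal_add, ← Complex.ofReal_add]
    congr 3
    simp only [Prod.snd_add, inner_add_left, inner_sub_right, real_inner_smul_left]
    field_simp
    ring
  rw [h1]
  linear_combination gE d (1 / 2) (q - (z + (ξ.1, ħ⁻¹ • ξ.2)).1) * h2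

theorem temperedDistribution_map_smul (u : 𝓢'(Config d, ℂ)) (c : ℂ) (ψ : 𝓢(Config d, ℂ)) :
    u (c • ψ) = c * u ψ := u.map_smul c ψ

/-- A lattice translation maps a packet to a packet up to a phase, and it multiplies `u` by a phase.
-/
theorem norm_torus_apply_cohS {ħ : ℝ} (hħ : ħ ≠ 0) {κ : Phase d} {u : 𝓢'(Config d, ℂ)}
    (hu : u ∈ torusSpace ħ κ) (z : Phase d) (a b : Fin d → ℤ) :
    ‖u (cohS (z + (intVec a, ħ⁻¹ • intVec b)))‖ = ‖u (cohS z)‖ := by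
  have h := DFunLike.congr_fun ((mem_torusSpace ħ κ u).1 hu (-a) b) (cohS z)
  rw [heisS'_apply] at h
  simp only [intVec_neg, neg_neg] at h
  obtain ⟨θ, hθ, he⟩ := heisS_cohS hħ (intVec a, intVec b) z
  rw [he] at h
  have h2 := congrArg norm h
  rw [temperedDistribution_map_smul, norm_mul, hθ, one_mul] at h2
  rw [h2]
  refine (norm_mul _ _).trans ?_
  rw [mul_comm I, Complex.norm_exp_ofReal_mul_I, one_mul]
  rfl

/-- A compact set whose translates under the lattice of the torus cover phase space. -/
def torusCell (d : ℕ) (ħ : ℝ) : Set (Phase d) :=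
  dilCLM d ħ⁻¹ '' ({x | ∀ i, x i ∈ Set.Icc (0 : ℝ) 1} ×ˢ {x | ∀ i, x i ∈ Set.Icc (0 : ℝ) 1})

theorem isCompact_torusCell (d : ℕ) (ħ : ℝ) : IsCompact (torusCell d ħ) :=
  ((isCompact_unitCube d).prod (isCompact_unitCube d)).image (dilCLM d ħ⁻¹).continuous

theorem exists_add_mem_torusCell {ħ : ℝ} (hħ : ħ ≠ 0) (z : Phase d) :
    ∃ a b : Fin d → ℤ, z + (intVec a, ħ⁻¹ • intVec b) ∈ torusCell d ħ := by
  obtain ⟨a, ha⟩ := exists_intVec_add_mem z.1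
  obtain ⟨b, hb⟩ := exists_intVec_add_mem (ħ • z.2)
  refine ⟨a, b, (z.1 + intVec a, ħ • z.2 + intVec b), ⟨ha, hb⟩, ?_⟩
  ext1
  · rfl
  · simp [dilCLM, smul_smul, hħ]

theorem schwSup_cohS_le (d n N : ℕ) : ∃ C, 0 ≤ C ∧ ∀ z : Phase d,
    schwSup n N (cohS z) ≤ C * (1 + ‖z‖) ^ (n + N) := by
  obtain ⟨C, h0, hC⟩ := coh_deriv_bound (d := d) n N
  refine ⟨C, h0, fun z => ?_⟩
  refine Seminorm.finset_sup_apply_le (by positivity) fun m hm => ?_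
  obtain ⟨hm1, hm2⟩ := Prod.mk_le_mk.1 (mem_Iic.1 hm)
  refine SchwartzMap.seminorm_le_bound ℂ _ _ _ (by positivity) fun x => ?_
  have h3 : ‖x‖ ^ m.1 ≤ (1 + ‖x‖) ^ N :=
    (pow_le_pow_left₀ (norm_nonneg x) (by linarith [norm_nonneg x]) _).trans
      (pow_le_pow_right₀ (by linarith [norm_nonneg x]) hm1)
  have h4 : (1 + ‖x‖) ^ N * jd N (x - z.1) ≤ (1 + ‖z‖) ^ N := by
    rw [mul_comm, jd, inv_mul_le_iff₀ (by positivity), ← mul_pow]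
    refine pow_le_pow_left₀ (by positivity) ?_ N
    have h5 : ‖x‖ ≤ ‖x - z.1‖ + ‖z‖ := by
      have := norm_add_le (x - z.1) z.1
      rw [sub_add_cancel] at this
      linarith [norm_fst_le z]
    nlinarith [norm_nonneg (x - z.1), norm_nonneg z]
  have h5 : ‖iteratedFDeriv ℝ m.2 (cohS z) x‖ ≤ C * (1 + ‖z‖) ^ n * jd N (x - z.1) :=
    hC z x m.2 hm2
  have h6 := jd_nonneg N (x - z.1)
  calc ‖x‖ ^ m.1 * ‖iteratedFDeriv ℝ m.2 (cohS z) x‖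
      ≤ (1 + ‖x‖) ^ N * (C * (1 + ‖z‖) ^ n * jd N (x - z.1)) := by gcongr
    _ = C * (1 + ‖z‖) ^ n * ((1 + ‖x‖) ^ N * jd N (x - z.1)) := by ring
    _ ≤ C * (1 + ‖z‖) ^ n * (1 + ‖z‖) ^ N := by gcongr
    _ = _ := by rw [pow_add]; ring

/-- On the compact cell the bound comes from the continuity seminorms of `u`; periodicity extends it
to all packets. -/
theorem exists_bound_torus_apply_cohS {ħ : ℝ} (hħ : ħ ≠ 0) {κ : Phase d} {u : 𝓢'(Config d, ℂ)}
    (hu : u ∈ torusSpace ħ κ) : ∃ S, 0 ≤ S ∧ ∀ z, ‖u (cohS z)‖ ≤ S := by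
  obtain ⟨C, n, N, h0, hC⟩ := temperedDistribution_bound u
  obtain ⟨D, hD0, hD⟩ := schwSup_cohS_le d n N
  obtain ⟨R, hR⟩ := (isCompact_torusCell d ħ).isBounded.exists_norm_le
  refine ⟨C * (D * (1 + |R|) ^ (n + N)), by positivity, fun z => ?_⟩
  obtain ⟨a, b, hab⟩ := exists_add_mem_torusCell hħ z
  rw [← norm_torus_apply_cohS hħ hu z a b]
  refine (hC _).trans (mul_le_mul_of_nonneg_left ((hD _).trans ?_) h0)
  have := (hR _ hab).trans (le_abs_self R)
  gcongr

theorem continuous_gram (z : Phase d) : Continuous (gram z) := by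
  refine continuous_of_dominated (F := fun w q => starRingEnd ℂ (coh z q) * coh w q)
    (bound := fun q => ‖starRingEnd ℂ (coh z q)‖) (fun w => ?_)
    (fun w => Filter.Eventually.of_forall fun q => ?_)
    ((isSchw_coh z).conj.integrable volume).norm (Filter.Eventually.of_forall fun q => ?_)
  · have h : Continuous fun q => coh w q := by fun_prop
    exact ((isSchw_coh z).conj.1.continuous.mul h).aestronglyMeasurable
  · rw [norm_mul]
    exact mul_le_of_le_one_right (norm_nonneg _) (norm_coh_le_one w q)
  · have h : Continuous fun w => coh w q := by fun_prop
    exact continuous_const.mul h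

theorem exists_norm_gram_sub_le (d : ℕ) : ∃ C, ∀ w w' z : Phase d, ‖w' - w‖ ≤ 1 →
    ‖gram z w' - gram z w‖ ≤ C * jd (bigN d) (z - w) := by
  obtain ⟨C, h0, hC⟩ := (offDiag_gram (d := d)).decay (bigN d)
  refine ⟨C * (2 ^ bigN d + 1), fun w w' z h1 => ?_⟩
  have h2 : jd (bigN d) (z - w') ≤ 2 ^ bigN d * jd (bigN d) (z - w) := by
    have h3 := jd_mul_le (bigN d) (z - w') (w' - w)
    rw [sub_add_sub_cancel] at h3
    have h4 : (1 + ‖w' - w‖) ^ bigN d ≤ 2 ^ bigN d :=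
      pow_le_pow_left₀ (by positivity) (by linarith) _
    calc jd (bigN d) (z - w') =
          (1 + ‖w' - w‖) ^ bigN d * (jd (bigN d) (z - w') * jd (bigN d) (w' - w)) := by
          rw [mul_left_comm, pow_mul_jd, mul_one]
      _ ≤ (1 + ‖w' - w‖) ^ bigN d * jd (bigN d) (z - w) :=
          mul_le_mul_of_nonneg_left h3 (by positivity)
      _ ≤ _ := mul_le_mul_of_nonneg_right h4 (jd_nonneg _ _)
  calc ‖gram z w' - gram z w‖ ≤ ‖gram z w'‖ + ‖gram z w‖ := norm_sub_le _ _
    _ ≤ C * (2 ^ bigN d * jd (bigN d) (z - w)) + C * jd (bigN d) (z - w) :=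
        add_le_add ((hC _ _).trans (mul_le_mul_of_nonneg_left h2 h0)) (hC _ _)
    _ = _ := by ring

theorem OffDiag.measurable_left {A : Phase d → Phase d → ℂ} (hA : OffDiag A) (w : Phase d) :
    Measurable fun z => A z w := by
  have h : Measurable fun z : Phase d => (z, w) := measurable_id.prodMk measurable_const
  exact hA.meas.comp h

theorem measurable_gram_left (w : Phase d) : Measurable fun z => gram z w :=
  offDiag_gram.measurable_left w

theorem tendsto_norm_gram_sub (w z : Phase d) :
    Filter.Tendsto (fun w' => ‖gram z w' - gram z w‖) (nhds w) (nhds 0) := by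
  have h1 := ((continuous_gram z).tendsto w).sub_const (gram z w)
  rw [sub_self] at h1
  have h2 := h1.norm
  rwa [norm_zero] at h2

theorem tendsto_integral_gram_sub (w : Phase d) :
    Filter.Tendsto (fun w' => ∫ z, ‖gram z w' - gram z w‖) (nhds w) (nhds 0) := by
  obtain ⟨C, hC⟩ := exists_norm_gram_sub_le d
  have hi : Integrable fun z => C * jd (bigN d) (z - w) :=
    (integrable_jd_phase.comp_sub_right w).const_mul C
  have hm : ∀ w' : Phase d, AEStronglyMeasurable (fun z => ‖gram z w' - gram z w‖) volume :=
    fun w' => ((measurable_gram_left w').sub (measurable_gram_left w)).norm.aestronglyMeasurable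
  have hb : ∀ᶠ w' in nhds w, ∀ᵐ z : Phase d,
      ‖‖gram z w' - gram z w‖‖ ≤ C * jd (bigN d) (z - w) := by
    filter_upwards [Metric.closedBall_mem_nhds w one_pos] with w' hw'
    refine Filter.Eventually.of_forall fun z => ?_
    rw [norm_norm]
    exact hC w w' z (by rwa [← dist_eq_norm])
  have h := tendsto_integral_filter_of_dominated_convergence
    (F := fun w' z => ‖gram z w' - gram z w‖) (f := fun _ => (0 : ℝ))
    (fun z => C * jd (bigN d) (z - w)) (Filter.Eventually.of_forall hm) hb hi
    (Filter.Eventually.of_forall (tendsto_norm_gram_sub w))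
  rwa [integral_zero] at h

/-- The reproducing formula for the difference of two packets. The modulus of continuity is
proportional to `S`, with a factor independent of `u`. -/
theorem norm_apply_cohS_sub_le {u : 𝓢'(Config d, ℂ)} {S : ℝ} (hS : ∀ z, ‖u (cohS z)‖ ≤ S)
    (w w' : Phase d) : kap d * ‖u (cohS w') - u (cohS w)‖ ≤
      S * ∫ z, ‖gram z w' - gram z w‖ := by
  have h := reproducing_formula u (cohS w' - cohS w)
  have h1 : anal (cohS w' - cohS w : 𝓢(Config d, ℂ)) = fun z => gram z w' - gram z w := by
    rw [sub_eq_add_neg, ← neg_one_smul ℂ (cohS w), anal_add, anal_smul]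
    ext z
    simp only [Pi.add_apply, Pi.smul_apply, smul_eq_mul, neg_one_mul]
    rfl
  have hr := (rapid_anal (cohS w' - cohS w)).integrable
  rw [h1] at h hr
  have h2 := congrArg norm h
  rw [norm_mul, Complex.norm_real, Real.norm_of_nonneg (kap_pos d).le] at h2
  have h3 : u (cohS w' - cohS w) = u (cohS w') - u (cohS w) := u.map_sub _ _
  rw [← h3, h2, ← integral_const_mul]
  refine norm_integral_le_of_norm_le (hr.norm.const_mul S) (Filter.Eventually.of_forall fun z => ?_)
  rw [norm_mul, mul_comm]
  exact mul_le_mul_of_nonneg_right (hS z) (norm_nonneg _)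

/-- Finitely many coherent states separate the points of the space of the torus. -/
theorem exists_separating_finset {ħ : ℝ} (hħ : ħ ≠ 0) (κ : Phase d) : ∃ t : Finset (Phase d),
    ∀ u ∈ torusSpace ħ κ, (∀ w ∈ t, u (cohS w) = 0) → u = 0 := by
  have hk := kap_pos d
  obtain ⟨t, -, ht⟩ := (isCompact_torusCell d ħ).elim_nhds_subcover
    (fun w => {w' | ∫ z, ‖gram z w' - gram z w‖ < kap d / 2})
    (fun w _ => (tendsto_integral_gram_sub w).eventually (gt_mem_nhds (half_pos hk)))
  refine ⟨t, fun u hu hut => ?_⟩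
  -- Up to the lattice, every packet lies so near one of the finitely many where `u` vanishes that
  -- the modulus of continuity is below `S / 2`. Any bound can thus be halved, and iteration forces
  -- zero.
  have hstep : ∀ S, 0 ≤ S → (∀ z, ‖u (cohS z)‖ ≤ S) → ∀ z, ‖u (cohS z)‖ ≤ S / 2 := by
    intro S hS0 hS z
    obtain ⟨a, b, hab⟩ := exists_add_mem_torusCell hħ z
    obtain ⟨w, hw, hwz⟩ := Set.mem_iUnion₂.1 (ht hab)
    rw [← norm_torus_apply_cohS hħ hu z a b]
    have h1 := norm_apply_cohS_sub_le hS w (z + (intVec a, ħ⁻¹ • intVec b))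
    rw [hut w hw, sub_zero] at h1
    have h2 := h1.trans (mul_le_mul_of_nonneg_left (le_of_lt hwz) hS0)
    refine le_of_mul_le_mul_left (h2.trans (le_of_eq ?_)) hk
    ring
  obtain ⟨S, hS0, hS⟩ := exists_bound_torus_apply_cohS hħ hu
  have hpow : ∀ n : ℕ, ∀ z, ‖u (cohS z)‖ ≤ S * (1 / 2) ^ n := by
    intro n
    induction n with
    | zero => simpa using hS
    | succ n ih =>
      intro z
      refine (hstep _ (by positivity) ih z).trans (le_of_eq ?_)
      rw [pow_succ]
      ring
  have hzero : ∀ z, u (cohS z) = 0 := by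
    intro z
    have hl : Filter.Tendsto (fun n : ℕ => S * (1 / 2 : ℝ) ^ n) Filter.atTop (nhds (S * 0)) :=
      (tendsto_pow_atTop_nhds_zero_of_lt_one (by norm_num) (by norm_num)).const_mul S
    rw [mul_zero] at hl
    exact norm_le_zero_iff.1 (ge_of_tendsto' hl fun n => hpow n z)
  ext ψ
  have h := reproducing_formula u ψ
  simp only [hzero, mul_zero, integral_zero] at h
  have hk' : (kap d : ℂ) ≠ 0 := by exact_mod_cast hk.ne'
  exact (mul_eq_zero.1 h).resolve_left hk'

end FiniteDetermination

/-! ### Control by finitely many derivatives of the symbol -/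

section SymbolBounded

variable {d : ℕ}

/-- `Φ f` is controlled by finitely many sup norms of derivatives of the symbol `f`. -/
def SymbolBounded (B : (Phase d → ℂ) → Prop) (Φ : (Phase d → ℂ) → ℝ) : Prop :=
  ∃ (N : ℕ) (C : ℝ), 0 ≤ C ∧ ∀ f b, B f →
    (∀ k ≤ N, ∀ x, ‖iteratedFDeriv ℝ k f x‖ ≤ b) → Φ f ≤ C * b

theorem nonneg_of_bound {f : Phase d → ℂ} {N : ℕ} {b : ℝ}
    (hb : ∀ k ≤ N, ∀ x, ‖iteratedFDeriv ℝ k f x‖ ≤ b) : 0 ≤ b :=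
  (norm_nonneg _).trans (hb 0 (Nat.zero_le _) 0)

theorem SymbolBounded.sum {B : (Phase d → ℂ) → Prop} {ι : Type*} (s : Finset ι)
    {Φ : ι → (Phase d → ℂ) → ℝ} (h : ∀ i, SymbolBounded B (Φ i)) :
    SymbolBounded B fun f => ∑ i ∈ s, Φ i f := by
  choose N C h0 hC using h
  refine ⟨s.sup N, ∑ i ∈ s, C i, Finset.sum_nonneg fun i _ => h0 i, fun f b hf hb => ?_⟩
  rw [Finset.sum_mul]
  exact Finset.sum_le_sum fun i hi => hC i f b hf fun k hk => hb k (hk.trans (Finset.le_sup hi))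

theorem SymbolBounded.of_le_mul {B : (Phase d → ℂ) → Prop} {Φ Ψ : (Phase d → ℂ) → ℝ}
    (h : SymbolBounded B Ψ) {K : ℝ} (hK : 0 ≤ K) (hle : ∀ f, B f → Φ f ≤ K * Ψ f) :
    SymbolBounded B Φ := by
  obtain ⟨N, C, h0, hC⟩ := h
  refine ⟨N, K * C, mul_nonneg hK h0, fun f b hf hb => (hle f hf).trans ?_⟩
  rw [mul_assoc]
  exact mul_le_mul_of_nonneg_left (hC f b hf hb) hK

theorem symbolBounded_seminorm_weylS (ħ : ℝ) (ψ : 𝓢(Config d, ℂ)) (k n : ℕ) :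
    SymbolBounded IsSymbol fun f => SchwartzMap.seminorm ℂ k n (weylS ħ f ψ) := by
  obtain ⟨C, M, n', M', h0, hC⟩ := opFun_bound d n k
  obtain ⟨C', h0', hC'⟩ := symKer_dilSym_bound d M ħ
  have hs := schwSup_nonneg n' M' ψ
  refine ⟨M, C * C' * schwSup n' M' ψ, by positivity, fun f b hf hb => ?_⟩
  have hb0 := nonneg_of_bound hb
  refine SchwartzMap.seminorm_le_bound ℂ _ _ _ (by positivity) fun q => ?_
  rw [weylS_eq_opS hf]
  have h1 : ‖iteratedFDeriv ℝ n (opS (symKer (dilSym ħ f)) (offDiag_symKer (hf.dilSym ħ)) ψ) q‖ ≤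
      C * (C' * b) * schwSup n' M' ψ * jd k q :=
    hC _ _ (offDiag_symKer (hf.dilSym ħ)) (by positivity) (hC' f b hf.1 hb) ψ q
  have h2 : ‖q‖ ^ k ≤ (1 + ‖q‖) ^ k :=
    pow_le_pow_left₀ (norm_nonneg _) (by linarith) k
  calc _ ≤ (1 + ‖q‖) ^ k * (C * (C' * b) * schwSup n' M' ψ * jd k q) :=
        mul_le_mul h2 h1 (norm_nonneg _) (by positivity)
    _ = C * C' * schwSup n' M' ψ * b * ((1 + ‖q‖) ^ k * jd k q) := by ring
    _ = _ := by rw [pow_mul_jd, mul_one]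

theorem SymbolBounded.comp_flipSym {Φ : (Phase d → ℂ) → ℝ} (h : SymbolBounded IsSymbol Φ) :
    SymbolBounded IsSymbol fun f => Φ (flipSym f) := by
  obtain ⟨N, C, h0, hC⟩ := h
  obtain ⟨C', h0', hC'⟩ := exists_dilSym_bound d N (-1)
  refine ⟨N, C * C', mul_nonneg h0 h0', fun f b hf hb => ?_⟩
  rw [mul_assoc]
  refine hC _ _ hf.flipSym ?_
  rw [flipSym_eq]
  exact hC' f b hf.1 hb

/-- The distribution sees only finitely many seminorms of its argument, and each of these is
controlled by derivatives of the symbol. -/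
theorem symbolBounded_weylS' (ħ : ℝ) (u : 𝓢'(Config d, ℂ)) (ψ : 𝓢(Config d, ℂ)) :
    SymbolBounded IsSymbol fun f => ‖weylS' ħ f u ψ‖ := by
  obtain ⟨C, n, N, h0, hC⟩ := temperedDistribution_bound u
  refine ((SymbolBounded.sum (Finset.Iic (N, n)) fun m : ℕ × ℕ =>
    symbolBounded_seminorm_weylS ħ ψ m.1 m.2).comp_flipSym).of_le_mul h0 fun f _ => ?_
  rw [weylS'_apply]
  refine (hC _).trans (mul_le_mul_of_nonneg_left ?_ h0)
  refine Seminorm.finset_sup_apply_le (Finset.sum_nonneg fun _ _ => apply_nonneg _ _) fun m hm => ?_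
  exact Finset.single_le_sum
    (f := fun m : ℕ × ℕ => SchwartzMap.seminorm ℂ m.1 m.2 (weylS ħ (flipSym f) ψ))
    (fun _ _ => apply_nonneg _ _) hm

end SymbolBounded

/-! ### Transport of exponentials and integrals to a normed space -/

section Conjugation

variable {V : Type*} [AddCommGroup V] [Module ℂ V] [TopologicalSpace V]
  {W : Type*} [NormedAddCommGroup W] [NormedSpace ℂ W]

/-- The torus space has only the topology induced from `𝓢'`. The exponential is formed in the normed
algebra of operators on `W`, and its series is evaluated at a vector and pulled back termwise. -/
theorem isOpExp_conj [CompleteSpace W] (e : V ≃L[ℂ] W) (A : V →L[ℂ] V) {A' : W →L[ℂ] W}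
    (hA : ∀ v, A' (e v) = e (A v)) :
    IsOpExp A ((e.symm : W →L[ℂ] V) ∘L NormedSpace.exp A' ∘L (e : V →L[ℂ] W)) := by
  intro u
  have h := NormedSpace.exp_series_hasSum_exp' (𝕂 := ℂ) A'
  have h1 := ((e.symm : W →L[ℂ] V) ∘L (ContinuousLinearMap.apply ℂ W (e u))).hasSum h
  have h2 : ∀ n : ℕ, ∀ v, (A' ^ n) (e v) = e ((A ^ n) v) := by
    intro n
    induction n with
    | zero => intro v; simp
    | succ n ih =>
      intro v
      rw [pow_succ, pow_succ]
      change (A' ^ n) (A' (e v)) = e ((A ^ n) (A v))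
      rw [hA, ih]
  convert h1 using 2 with n
  · simp [h2]
  · rfl

theorem isOpIntegral_conj [CompleteSpace W] (e : V ≃L[ℂ] W) {F : ℝ → W →L[ℂ] W}
    (hF : Continuous F) (a b : ℝ) :
    IsOpIntegral (fun s => (e.symm : W →L[ℂ] V) ∘L F s ∘L (e : V →L[ℂ] W)) a b
      ((e.symm : W →L[ℂ] V) ∘L (∫ s in a..b, F s) ∘L (e : V →L[ℂ] W)) := by
  intro u ℓ
  set L : (W →L[ℂ] W) →L[ℂ] ℂ :=
    (ℓ ∘L (e.symm : W →L[ℂ] V)) ∘L (ContinuousLinearMap.apply ℂ W (e u)) with hL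
  have h : ∀ A : W →L[ℂ] W,
      ℓ (((e.symm : W →L[ℂ] V) ∘L A ∘L (e : V →L[ℂ] W)) u) = L A := fun A => rfl
  simp only [h]
  exact ⟨(L.continuous.comp hF).intervalIntegrable _ _,
    (L.intervalIntegral_comp_comm (hF.intervalIntegrable a b)).symm⟩

theorem duhamelIntegrand_conj [IsTopologicalAddGroup V] {d : ℕ} (e : V ≃L[ℂ] W) {Op : (Phase d → ℂ) → V →L[ℂ] V}
    (E : ℝ → W →L[ℂ] W) (ħ : ℝ) (g : Phase d → ℝ) (f : Phase d → ℂ) (J : ℕ) (t s : ℝ) :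
    duhamelIntegrand Op
      (fun t => (e.symm : W →L[ℂ] V) ∘L E t ∘L (e : V →L[ℂ] W)) ħ g f J t s =
    (e.symm : W →L[ℂ] V) ∘L duhamelIntegrand
      (fun f => (e : V →L[ℂ] W) ∘L Op f ∘L (e.symm : W →L[ℂ] V)) E ħ g f J t s ∘L
      (e : V →L[ℂ] W) := by
  ext1 u
  simp [duhamelIntegrand, map_sum, _root_.sum_apply]

end Conjugation

/-! ### The expansion on the torus space -/

section TorusCase

variable {d : ℕ}

/-- The values of a distribution at finitely many coherent states. -/
def evalCohS (ħ : ℝ) (κ : Phase d) (t : Finset (Phase d)) : torusSpace ħ κ →ₗ[ℂ] (t → ℂ) where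
  toFun u r := (u : 𝓢'(Config d, ℂ)) (cohS (r : Phase d))
  map_add' _ _ := rfl
  map_smul' _ _ := rfl

theorem exists_evalCohS_injective {ħ : ℝ} (hħ : ħ ≠ 0) (κ : Phase d) :
    ∃ t, Function.Injective (evalCohS ħ κ t) := by
  obtain ⟨t, ht⟩ := exists_separating_finset hħ κ
  refine ⟨t, (injective_iff_map_eq_zero _).2 fun u hu => Subtype.ext (ht u u.2 fun w hw => ?_)⟩
  exact congrFun hu ⟨w, hw⟩

theorem finiteDimensional_torusSpace {ħ : ℝ} (hħ : ħ ≠ 0) (κ : Phase d) :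
    FiniteDimensional ℂ (torusSpace ħ κ) := by
  obtain ⟨t, ht⟩ := exists_evalCohS_injective hħ κ
  exact FiniteDimensional.of_injective _ ht

/-- A left inverse of the evaluation at separating packets recovers coordinates linearly from
finitely many values `u(φ_w)`, each of which is controlled by derivatives of the symbol. -/
theorem symbolBounded_weylTorus {ħ : ℝ} (hħ : ħ ≠ 0) {κ : Phase d} {n : ℕ}
    (e : torusSpace ħ κ ≃L[ℂ] (Fin n → ℂ)) (v : torusSpace ħ κ) :
    SymbolBounded (TorusPreserving ħ κ) fun f => ‖e (weylTorus ħ κ f v)‖ := by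
  obtain ⟨t, ht⟩ := exists_evalCohS_injective hħ κ
  obtain ⟨L, hL⟩ := LinearMap.exists_leftInverse_of_injective _ (LinearMap.ker_eq_bot.2 ht)
  set T : (t → ℂ) →L[ℂ] (Fin n → ℂ) := (e.toLinearMap ∘ₗ L).toContinuousLinearMap with hT
  have hTe : ∀ x, e x = T (evalCohS ħ κ t x) := fun x =>
    congrArg e (LinearMap.congr_fun hL x).symm
  have hsum : SymbolBounded IsSymbol fun f =>
      ∑ r : t, ‖weylS' ħ f (v : 𝓢'(Config d, ℂ)) (cohS (r : Phase d))‖ :=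
    SymbolBounded.sum _ fun r => symbolBounded_weylS' ħ _ _
  obtain ⟨N, C, h0, hC⟩ := hsum
  have hsum' : SymbolBounded (TorusPreserving ħ κ) fun f =>
      ∑ r : t, ‖weylS' ħ f (v : 𝓢'(Config d, ℂ)) (cohS (r : Phase d))‖ :=
    ⟨N, C, h0, fun f b hf => hC f b hf.1⟩
  refine hsum'.of_le_mul (norm_nonneg T) fun f hf => ?_
  rw [hTe]
  refine (T.le_opNorm _).trans (mul_le_mul_of_nonneg_left ?_ (norm_nonneg _))
  refine (pi_norm_le_iff_of_nonneg (Finset.sum_nonneg fun _ _ => norm_nonneg _)).2 fun r => ?_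
  have h1 : evalCohS ħ κ t (weylTorus ħ κ f v) r =
      weylS' ħ f (v : 𝓢'(Config d, ℂ)) (cohS (r : Phase d)) := by
    rw [← hf.weylTorus_apply]
    rfl
  rw [h1]
  exact Finset.single_le_sum
    (f := fun r : t => ‖weylS' ħ f (v : 𝓢'(Config d, ℂ)) (cohS (r : Phase d))‖)
    (fun _ _ => norm_nonneg _) (Finset.mem_univ r)

theorem norm_clm_le_sum_single {n : ℕ} {W : Type*} [NormedAddCommGroup W] [NormedSpace ℂ W]
    (A : (Fin n → ℂ) →L[ℂ] W) : ‖A‖ ≤ ∑ i, ‖A (Pi.single i 1)‖ := by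
  refine A.opNorm_le_bound (Finset.sum_nonneg fun _ _ => norm_nonneg _) fun w => ?_
  have h : w = ∑ i, w i • (Pi.single i 1 : Fin n → ℂ) := by
    ext j
    simp [Finset.sum_apply, Pi.single_apply]
  conv_lhs => rw [h, map_sum]
  refine (norm_sum_le _ _).trans ?_
  rw [Finset.sum_mul]
  refine Finset.sum_le_sum fun i _ => ?_
  rw [map_smul, norm_smul, mul_comm]
  exact mul_le_mul_of_nonneg_left (norm_le_pi_norm w i) (norm_nonneg _)

theorem isQuantization_weylTorus {ħ : ℝ} (hħ : ħ ≠ 0) {κ : Phase d} {n : ℕ}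
    (e : torusSpace ħ κ ≃L[ℂ] (Fin n → ℂ)) :
    IsQuantization ħ (TorusPreserving ħ κ) fun f =>
      (e : torusSpace ħ κ →L[ℂ] (Fin n → ℂ)) ∘L weylTorus ħ κ f ∘L
        (e.symm : (Fin n → ℂ) →L[ℂ] torusSpace ħ κ) where
  zero_mem := IsTorusSymbol.torusPreserving hħ ⟨contDiff_const, fun _ _ _ => rfl⟩
  add_smul_mem _ _ c hf hg := hf.add_smul hg c
  add_smul f g c hf hg := by
    ext1 w
    simp [weylTorus_add_smul hf hg]
  moyal_mem _ _ hf hg := hf.moyal hħ hg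
  moyal f g hf hg := by
    ext1 w
    simp [weylTorus_moyal hħ hf hg]
  bound := by
    refine SymbolBounded.of_le_mul (SymbolBounded.sum (Finset.univ : Finset (Fin n)) fun i =>
      symbolBounded_weylTorus hħ e (e.symm (Pi.single i 1))) zero_le_one fun f _ => ?_
    rw [one_mul]
    exact norm_clm_le_sum_single _

theorem egorov_torus {ħ : ℝ} (hħ : ħ ≠ 0) (κ : Phase d) {f : Phase d → ℂ} {g : Phase d → ℝ}
    (hf : IsTorusSymbol f) (hg : IsTorusSymbol g) :
    ∃ E : ℝ → (torusSpace ħ κ →L[ℂ] torusSpace ħ κ),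
      (∀ t : ℝ, IsOpExp ((I * (t : ℂ) / (ħ : ℂ)) • weylTorus ħ κ (toC g)) (E t)) ∧
      ∀ (J : ℕ), 1 ≤ J → ∀ t : ℝ, ∃ D : torusSpace ħ κ →L[ℂ] torusSpace ħ κ,
        IsOpIntegral (duhamelIntegrand (weylTorus ħ κ) E ħ g f J t) 0 t D ∧
        E t ∘L weylTorus ħ κ f ∘L E (-t) =
          ∑ j ∈ range J, ((ħ : ℂ) ^ j) • weylTorus ħ κ (egorovL g j t f) +
          ((ħ : ℂ) ^ J) • (I • D) := by
  have := continuousSMul_torusSpace (ħ := ħ) (κ := κ)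
  have := finiteDimensional_torusSpace hħ κ
  have e := (Module.finBasis ℂ (torusSpace ħ κ)).equivFunL
  have hgC : IsTorusSymbol (toC g) := ⟨hg.bddD.toC.1, fun x m n => congrArg Complex.ofReal (hg.2 x m n)⟩
  have hF : ∀ j s, IsTorusSymbol (egorovL g j s f) := egorovL_isTorusSymbol hg hf
  let n := Module.finrank ℂ (torusSpace ħ κ)
  set Op : (Phase d → ℂ) → (Fin n → ℂ) →L[ℂ] (Fin n → ℂ) := fun f =>
    (e : torusSpace ħ κ →L[ℂ] (Fin n → ℂ)) ∘L weylTorus ħ κ f ∘L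
      (e.symm : (Fin n → ℂ) →L[ℂ] torusSpace ħ κ) with hOp
  set E : ℝ → (Fin n → ℂ) →L[ℂ] (Fin n → ℂ) := fun t =>
    NormedSpace.exp ((I * (t : ℂ) / (ħ : ℂ)) • Op (toC g)) with hE
  have hQ := fun J hJ t => (isQuantization_weylTorus hħ e).egorov (J := J) hħ hg.bddD hf.bddD
    (hgC.torusPreserving hħ) (fun j s => (hF j s).torusPreserving hħ)
    (fun k j s => (moyalTerm_isTorusSymbol hgC (hF j s) k).torusPreserving hħ)
    (E := E) (fun _ => rfl) hJ t
  refine ⟨fun t => (e.symm : (Fin n → ℂ) →L[ℂ] torusSpace ħ κ) ∘L E t ∘L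
    (e : torusSpace ħ κ →L[ℂ] (Fin n → ℂ)),
    fun t => isOpExp_conj e _ fun v => by simp [hOp], fun J hJ t => ?_⟩
  obtain ⟨hc, hid⟩ := hQ J hJ t
  refine ⟨(e.symm : (Fin n → ℂ) →L[ℂ] torusSpace ħ κ) ∘L
      (∫ s in (0 : ℝ)..t, duhamelIntegrand Op E ħ g f J t s) ∘L
        (e : torusSpace ħ κ →L[ℂ] (Fin n → ℂ)), ?_, ?_⟩
  · have h := isOpIntegral_conj e hc 0 t
    simp only [← duhamelIntegrand_conj] at h
    exact h
  · ext1 u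
    have h := congrArg (fun A => e.symm (A (e u))) hid
    simpa [hOp, _root_.sum_apply, map_sum] using h

end TorusCase

end

theorem theorem2p2 (d : ℕ) (hd : 1 ≤ d) :
    -- the case of `ℝ^{2d}`, with Hilbert space `L²(ℝ^d)` and arbitrary `ħ > 0`
    (∀ (ħ : ℝ), 0 < ħ → ∀ (f : Phase d → ℂ) (g : Phase d → ℝ), IsSymbol f → IsSymbol g →
      SolvesTransport IsSymbol g f ∧
      ∀ (J : ℕ), 1 ≤ J → ∀ t : ℝ,
        IntervalIntegrable (duhamelIntegrand (weylL2 ħ) (propL2 ħ g) ħ g f J t)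
          MeasureTheory.volume 0 t ∧
        propL2 ħ g t ∘L weylL2 ħ f ∘L propL2 ħ g (-t) =
          ∑ j ∈ Finset.range J, ((ħ : ℂ) ^ j) • weylL2 ħ (egorovL g j t f) +
          ((ħ : ℂ) ^ J) • (Complex.I •
            ∫ s in (0 : ℝ)..t, duhamelIntegrand (weylL2 ħ) (propL2 ħ g) ħ g f J t s)) ∧
    -- the case of `𝕋^{2d}`, with the space `𝓗_ħ(κ)` and `2πħN = 1`
    (∀ (N : ℕ), 1 ≤ N → ∀ (ħ : ℝ), 2 * Real.pi * ħ * N = 1 →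
      ∀ (κ : Phase d),
      (∀ i, κ.1 i ∈ Set.Ico 0 (2 * Real.pi) ∧ κ.2 i ∈ Set.Ico 0 (2 * Real.pi)) →
      ∀ (f : Phase d → ℂ) (g : Phase d → ℝ), IsTorusSymbol f → IsTorusSymbol g →
      SolvesTransport IsTorusSymbol g f ∧
      ∃ E : ℝ → (torusSpace ħ κ →L[ℂ] torusSpace ħ κ),
        (∀ t : ℝ, IsOpExp ((Complex.I * (t : ℂ) / (ħ : ℂ)) • weylTorus ħ κ (toC g)) (E t)) ∧
        ∀ (J : ℕ), 1 ≤ J → ∀ t : ℝ, ∃ D : torusSpace ħ κ →L[ℂ] torusSpace ħ κ,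
          IsOpIntegral (duhamelIntegrand (weylTorus ħ κ) E ħ g f J t) 0 t D ∧
          E t ∘L weylTorus ħ κ f ∘L E (-t) =
            ∑ j ∈ Finset.range J, ((ħ : ℂ) ^ j) • weylTorus ħ κ (egorovL g j t f) +
            ((ħ : ℂ) ^ J) • (Complex.I • D)) := by
  refine ⟨fun ħ hħ f g hf hg => ⟨?_, fun J hJ t => ?_⟩,
    fun N _ ħ hN κ _ f g hf hg => ⟨?_, ?_⟩⟩
  · rw [isSymbol_iff_bddD] at hf hg
    exact solvesTransport_of_class IsSymbol hg hf fun j s =>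
      isSymbol_iff_bddD.2 ((egorovL_slabB hg hf j).slice s)
  · obtain ⟨hc, hid⟩ := egorov_euclidean hħ.ne' hf hg hJ t
    exact ⟨hc.intervalIntegrable _ _, hid⟩
  · exact solvesTransport_of_class IsTorusSymbol hg.bddD hf.bddD (egorovL_isTorusSymbol hg hf)
  -- A vanishing `ħ` would contradict `2πħN = 1`.
  · refine egorov_torus (fun h => ?_) κ hf hg
    simp [h] at hN
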